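/- Let $k$ be a field and let $A$ be a Hopf algebra over $k$ with invertible antipode $S$. A right crossed $A$-module is a vector space $V$ with a right action $\triangleleft$ and a right coaction $v\mapsto v_{(0)}\otimes v_{(1)}$ of $A$ such that $(v\triangleleft a)_{(0)}\otimes (v\triangleleft a)_{(1)}=v_{(0)}\triangleleft a_{(2)}\otimes S(a_{(1)})v_{(1)}a_{(3)}$. Such modules form a braided category with tensor product action and coaction and braiding $\Psi(v\otimes w)=w_{(0)}\otimes v\triangleleft w_{(1)}$. The augmentation ideal $A^+=\ker\epsilon$ is a right crossed module by right multiplication and $\mathrm{Ad}_R(a)=a_{(2)}\otimes S(a_{(1)})a_{(3)}$. Put $\pi_\epsilon(a)=a-\epsilon(a)1$. Let $\varpi:A^+\to\Lambda^1$ be a surjective morphism of right crossed modules. Write $\Psi$ for the braiding of $\Lambda^1$ with itself and $\Psi_i$ for $\Psi$ acting in the tensor factors $i,i+1$. Let $[n;-\Psi]=\sum_{j=0}^{n-1}(-1)^j\Psi_1\cdots\Psi_j$ and let $[n;-\Psi]!=(\mathrm{id}\otimes[n-1;-\Psi]!)\,[n;-\Psi]$, $[0;-\Psi]!=\mathrm{id}$,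 be the braided factorials. Set $$\Lambda_{max}=T\Lambda^1/\langle(\varpi\pi_\epsilon\otimes\varpi\pi_\epsilon)\Delta\ker\varpi\rangle,\qquad \Lambda_{min}=B_-(\Lambda^1)=T\Lambda^1/\textstyle\bigoplus_n\ker[n;-\Psi]! .$$ Here $\bigoplus_n\ker[n;-\Psi]!$ is a two-sided ideal of $T\Lambda^1$. Then the following hold. 1. $\Lambda_{max}$ and $\Lambda_{min}$ are super-braided Hopf algebras in the category of right crossed $A$-modules, graded with $\Lambda^1$ in degree $1$ and primitively generated by it. Each carries a linear map $\mathrm d$ which is a super-derivation of degree $1$ and a right comodule map, with $\mathrm d^2=0$, and which satisfies, for all $a\in A^+$ in the first equation, all $a\in A$ in the second, and all $\eta$ in the algebra (homogeneous in the second), $$\mathrm d\varpi(a)+(\varpi\pi_\epsilon a_{(1)})(\varpi\pi_\epsilon a_{(2)})=0,$$ $$(\mathrm d\eta)\triangleleft a-\mathrm d(\eta\triangleleft a)=(\varpi\pi_\epsilon a_{(1)})(\eta\triangleleft a_{(2)})-(-1)^{|\eta|}(\eta\triangleleft a_{(1)})(\varpi\pi_\epsilon a_{(2)}),$$ $$\underline\Delta\mathrm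 d\eta-(\mathrm d\otimes\mathrm{id}+(-1)^{|\ |}\otimes\mathrm d)\underline\Delta\eta=(-1)^{|\eta_{\underline{(1)}}|}\,\eta_{\underline{(1)}(0)}\otimes(\varpi\pi_\epsilon\eta_{\underline{(1)}(1)})\,\eta_{\underline{(2)}} .$$ 2. The identity of $\Lambda^1$ extends to a surjective algebra map $\Lambda_{max}\to\Lambda_{min}$ which commutes with the actions, coactions, braided coproducts, counits, braided antipodes and with $\mathrm d$. Thus $\Lambda_{min}$ is a quotient of $\Lambda_{max}$ and inherits $\mathrm d$. 3. Let $\Omega_{min}$ be the super-bosonisation of $\Lambda_{min}$. It is $A\otimes\Lambda_{min}$ with product $(a\otimes\eta)(b\otimes\zeta)=ab_{(1)}\otimes(\eta\triangleleft b_{(2)})\zeta$, coproduct $a\otimes\eta\mapsto (a_{(1)}\otimes\eta_{\underline{(1)}(0)})\otimes(a_{(2)}\eta_{\underline{(1)}(1)}\otimes\eta_{\underline{(2)}})$ and differential $\mathrm d(a\otimes\eta)=a_{(1)}\otimes(\varpi\pi_\epsilon a_{(2)})\eta+a\otimes\mathrm d\eta$. It has the left and right coactions of $A$ obtained from the coproduct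 by projecting the first, respectively the second, factor to $A$ (degree $0$). Let $\Gamma=\ker(A\otimes A\xrightarrow{\ \cdot\ }A)/N$, where $N=r^{-1}(A\otimes\ker\varpi)$ and $r(a\otimes b)=ab_{(1)}\otimes b_{(2)}$. With $\mathrm da=[1\otimes a-a\otimes1]$, and with the bimodule structure induced from the outer multiplications, $\Gamma$ is a first order bicovariant calculus, namely the one associated by Woronowicz to the $\mathrm{Ad}$-stable right ideal $\ker\varpi$. Let $\sigma$ be the bimodule endomorphism of $\Gamma\otimes_A\Gamma$ with $\sigma(\omega\otimes\eta)=\eta\otimes\omega$ for $\omega$ left-invariant and $\eta$ right-invariant. It is induced by $\gamma\otimes\gamma'\mapsto\gamma_{(-2)}\gamma'_{(0)}S(\gamma'_{(1)})\otimes S(\gamma_{(-1)})\gamma_{(0)}\gamma'_{(2)}$. Let $\Gamma^\wedge$ be the tensor algebra of the $A$-bimodule $\Gamma$ modulo the ideal whose degree $n$ part is the kernel of the antisymmetriser $\sum_{p\in S_n}\mathrm{sign}(p)\sigma_p$ on $\Gamma^{\otimes_A n}$, where $\sigma_p=\sigma_{i_1}\cdots\sigma_{i_l}$ for a reduced expression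 $p=s_{i_1}\cdots s_{i_l}$ in adjacent transpositions. Then $\mathrm d:A\to\Gamma$ extends uniquely to a degree $1$ super-derivation of square zero on $\Gamma^\wedge$. The coproduct of $A$ and the coactions on $\Gamma$ extend to left and right coactions of $A$ on $\Gamma^\wedge$ which are algebra maps. There is an isomorphism of graded algebras $\Omega_{min}\cong\Gamma^\wedge$ which is the identity on $A$ and commutes with the differentials and with the left and right coactions. -/

import Mathlib

open scoped TensorProduct

noncomputable section

namespace BraidedExterior

universe u v w x

/-! ### Linear maps on a Hopf algebra -/

section Hopf

variable (k : Type u) (A : Type v) [Field k] [Ring A] [HopfAlgebra k A]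

/-- The iterated coproduct `a ↦ a₁ ⊗ (a₂ ⊗ a₃)`. -/
def comul₃ : A →ₗ[k] A ⊗[k] (A ⊗[k] A) :=
  (Coalgebra.comul (R := k) (A := A)).lTensor A ∘ₗ Coalgebra.comul

/-- `a ⊗ (x ⊗ c) ↦ S(a) x c`. -/
def antipodeSandwich : A ⊗[k] (A ⊗[k] A) →ₗ[k] A :=
  LinearMap.mul' k A ∘ₗ TensorProduct.map (HopfAlgebra.antipode k) (LinearMap.mul' k A)

/-- The right adjoint coaction `Ad_R(a) = a₂ ⊗ S(a₁) a₃`. -/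
def adR : A →ₗ[k] A ⊗[k] A :=
  (LinearMap.mul' k A ∘ₗ (HopfAlgebra.antipode k).rTensor A).lTensor A ∘ₗ
    (TensorProduct.leftComm k A A A).toLinearMap ∘ₗ comul₃ k A

/-- The augmentation ideal `A⁺ = ker ε`. -/
abbrev Aug : Submodule k A := LinearMap.ker (Coalgebra.counit (R := k) (A := A))

/-- The counit projection `π_ε(a) = a - ε(a) 1`. -/
def piEps : A →ₗ[k] Aug k A :=
  LinearMap.codRestrict (Aug k A)
    (LinearMap.id - Algebra.linearMap k A ∘ₗ Coalgebra.counit) (fun a => by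
      simp [Algebra.linearMap_apply])

end Hopf

/-! ### Right crossed (Drinfeld-Radford-Yetter) modules -/

section Crossed

variable {k : Type u} {A : Type v} [Field k] [Ring A] [HopfAlgebra k A]

/-- A right action map `v ⊗ a ↦ v ◁ a` and a right coaction map `v ↦ v₀ ⊗ v₁`, before laws. -/
structure CrossedData (k : Type u) (A : Type v) (V : Type w) [Field k] [Ring A] [HopfAlgebra k A]
    [AddCommGroup V] [Module k V] where
  act : V ⊗[k] A →ₗ[k] V
  coact : V →ₗ[k] V ⊗[k] A

variable {V : Type w} [AddCommGroup V] [Module k V] {W : Type x} [AddCommGroup W] [Module k W]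

namespace CrossedData

/-- `(v ⊗ y) ⊗ (a ⊗ (b ⊗ c)) ↦ (v ◁ b) ⊗ S(a) y c`. -/
def twist (X : CrossedData k A V) : (V ⊗[k] A) ⊗[k] (A ⊗[k] (A ⊗[k] A)) →ₗ[k] V ⊗[k] A :=
  TensorProduct.map X.act
      (antipodeSandwich k A ∘ₗ (TensorProduct.leftComm k A A A).toLinearMap) ∘ₗ
    (TensorProduct.tensorTensorTensorComm k V A A (A ⊗[k] A)).toLinearMap ∘ₗ
    (TensorProduct.leftComm k A A A).toLinearMap.lTensor (V ⊗[k] A)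

/-- The laws of a right crossed module: a right module and a right comodule with
`(v ◁ a)₀ ⊗ (v ◁ a)₁ = v₀ ◁ a₂ ⊗ S(a₁) v₁ a₃`. -/
structure IsCrossedModule (X : CrossedData k A V) : Prop where
  act_one : ∀ v : V, X.act (v ⊗ₜ 1) = v
  act_mul : ∀ (v : V) (a b : A), X.act (v ⊗ₜ (a * b)) = X.act (X.act (v ⊗ₜ a) ⊗ₜ b)
  coassoc : ∀ v : V, TensorProduct.assoc k V A A (X.coact.rTensor A (X.coact v)) =
    (Coalgebra.comul (R := k) (A := A)).lTensor V (X.coact v)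
  counit : ∀ v : V, (Coalgebra.counit (R := k) (A := A)).lTensor V (X.coact v) = v ⊗ₜ 1
  compat : ∀ (v : V) (a : A), X.coact (X.act (v ⊗ₜ a)) = X.twist (X.coact v ⊗ₜ comul₃ k A a)

/-- Morphisms of crossed modules: linear maps commuting with the actions and coactions. -/
structure IsMorphism (X : CrossedData k A V) (Y : CrossedData k A W) (f : V →ₗ[k] W) : Prop where
  act : ∀ (v : V) (a : A), f (X.act (v ⊗ₜ a)) = Y.act (f v ⊗ₜ a)
  coact : ∀ v : V, Y.coact (f v) = f.rTensor A (X.coact v)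

/-- The unit object: `c ◁ a = ε(a) c`, `c ↦ c ⊗ 1`. -/
def unit (k : Type u) (A : Type v) [Field k] [Ring A] [HopfAlgebra k A] : CrossedData k A k where
  act := LinearMap.mul' k k ∘ₗ (Coalgebra.counit (R := k) (A := A)).lTensor k
  coact := (TensorProduct.mk k k A).flip 1

/-- The tensor product: `(v ⊗ w) ◁ a = v ◁ a₁ ⊗ w ◁ a₂` and
`v ⊗ w ↦ (v₀ ⊗ w₀) ⊗ v₁ w₁`. -/
def tensor (X : CrossedData k A V) (Y : CrossedData k A W) : CrossedData k A (V ⊗[k] W) where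
  act := TensorProduct.map X.act Y.act ∘ₗ
    (TensorProduct.tensorTensorTensorComm k V W A A).toLinearMap ∘ₗ
    (Coalgebra.comul (R := k) (A := A)).lTensor (V ⊗[k] W)
  coact := (LinearMap.mul' k A).lTensor (V ⊗[k] W) ∘ₗ
    (TensorProduct.tensorTensorTensorComm k V A W A).toLinearMap ∘ₗ
    TensorProduct.map X.coact Y.coact

/-- The braiding `Ψ(v ⊗ w) = w₀ ⊗ v ◁ w₁`. -/
def braiding (X : CrossedData k A V) (Y : CrossedData k A W) : V ⊗[k] W →ₗ[k] W ⊗[k] V :=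
  X.act.lTensor W ∘ₗ (TensorProduct.leftComm k V W A).toLinearMap ∘ₗ Y.coact.lTensor V

/-- The augmentation ideal with right multiplication and the right adjoint coaction
(`Ad_R` maps `A⁺` into `A⁺ ⊗ A`, where `π_ε ⊗ id` is the identity). -/
def aug (k : Type u) (A : Type v) [Field k] [Ring A] [HopfAlgebra k A] :
    CrossedData k A (Aug k A) where
  act := LinearMap.codRestrict (Aug k A)
    (LinearMap.mul' k A ∘ₗ (Aug k A).subtype.rTensor A) (fun z => by
      induction z with
      | zero => simp
      | tmul v a => simp [LinearMap.mem_ker.1 v.2]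
      | add y z hy hz => rw [map_add]; exact add_mem hy hz)
  coact := (piEps k A).rTensor A ∘ₗ adR k A ∘ₗ (Aug k A).subtype

end CrossedData

end Crossed

/-! ### Braided factorials and tensor powers -/

section Powers

variable {k : Type u} [Field k] {V : Type w} [AddCommGroup V] [Module k V]

/-- `v ⊗ (v₁ ⊗ ⋯ ⊗ vₙ) ↦ v ⊗ v₁ ⊗ ⋯ ⊗ vₙ` as an isomorphism `V ⊗ V^{⊗n} ≅ V^{⊗(n+1)}`. -/
def consEquiv (k : Type u) [Field k] (V : Type w) [AddCommGroup V] [Module k V] (n : ℕ) :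
    V ⊗[k] (⨂[k]^n V) ≃ₗ[k] ⨂[k]^(n + 1) V :=
  (TensorProduct.congr (PiTensorProduct.subsingletonEquiv (R := k) (s := fun _ => V)
      (0 : Fin 1)).symm (LinearEquiv.refl k _)) ≪≫ₗ
    TensorPower.mulEquiv ≪≫ₗ TensorPower.cast k V (Nat.add_comm 1 n)

theorem consEquiv_tmul_tprod (n : ℕ) (v : V) (f : Fin n → V) :
    consEquiv k V n (v ⊗ₜ PiTensorProduct.tprod k f) =
      PiTensorProduct.tprod k (Fin.cons v f : Fin (n + 1) → V) := by
  have h : (PiTensorProduct.subsingletonEquiv (R := k) (s := fun _ => V) (0 : Fin 1)).symm v =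
      PiTensorProduct.tprod k (fun _ : Fin 1 => v) := by
    rw [LinearEquiv.symm_apply_eq, PiTensorProduct.subsingletonEquiv_apply_tprod]
  simp only [consEquiv, LinearEquiv.trans_apply, TensorProduct.congr_tmul,
    LinearEquiv.refl_apply]
  rw [h, ← TensorPower.gMul_def, TensorPower.tprod_mul_tprod, TensorPower.cast_tprod]
  congr 1
  funext i
  refine Fin.cases ?_ (fun i => ?_) i
  · simp [Fin.append, Fin.addCases]
  · simp only [Fin.append, Fin.addCases, Function.comp_apply, Fin.cons_succ]
    simp
    rfl

/-- `id ⊗ f` on `V ⊗ V^{⊗n} = V^{⊗(n+1)}`. -/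
def idTensor (n : ℕ) (f : Module.End k (⨂[k]^n V)) : Module.End k (⨂[k]^(n + 1) V) :=
  (consEquiv k V n).toLinearMap ∘ₗ f.lTensor V ∘ₗ (consEquiv k V n).symm.toLinearMap

/-- `Ψ` acting in the first two tensor factors. -/
def braidFirst (Ψ : V ⊗[k] V →ₗ[k] V ⊗[k] V) (n : ℕ) : Module.End k (⨂[k]^(n + 2) V) :=
  let e : (V ⊗[k] V) ⊗[k] (⨂[k]^n V) ≃ₗ[k] ⨂[k]^(n + 2) V :=
    TensorProduct.assoc k V V (⨂[k]^n V) ≪≫ₗ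
      TensorProduct.congr (LinearEquiv.refl k V) (consEquiv k V n) ≪≫ₗ consEquiv k V (n + 1)
  e.toLinearMap ∘ₗ Ψ.rTensor (⨂[k]^n V) ∘ₗ e.symm.toLinearMap

/-- `Ψ` acting on `V^{⊗n}` in the adjacent tensor factors `i, i+1`, counted from `0`
(the identity if these positions do not exist). -/
def braidAt (Ψ : V ⊗[k] V →ₗ[k] V ⊗[k] V) : (n i : ℕ) → Module.End k (⨂[k]^n V)
  | 0, _ => 1
  | 1, _ => 1
  | n + 2, 0 => braidFirst Ψ n
  | n + 2, i + 1 => idTensor (n + 1) (braidAt Ψ (n + 1) i)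

/-- The braided integer `[n; Ψ] = id + Ψ₁ + Ψ₁Ψ₂ + ⋯ + Ψ₁Ψ₂⋯Ψₙ₋₁` on `V^{⊗n}`. -/
def braidedInt (Ψ : V ⊗[k] V →ₗ[k] V ⊗[k] V) (n : ℕ) : Module.End k (⨂[k]^n V) :=
  ∑ j ∈ Finset.range n, ((List.range j).map (braidAt Ψ n)).prod

/-- The braided factorial, `[n+1; Ψ]! = (id ⊗ [n; Ψ]!) [n+1; Ψ]`, `[0; Ψ]! = id`. -/
def braidedFactorial (Ψ : V ⊗[k] V →ₗ[k] V ⊗[k] V) : (n : ℕ) → Module.End k (⨂[k]^n V)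
  | 0 => 1
  | n + 1 => idTensor n (braidedFactorial Ψ n) * braidedInt Ψ (n + 1)

/-- The standard reduced expression of a permutation of `{0, …, n-1}` in the adjacent
transpositions `sᵢ = (i, i+1)`, as the list of the indices `i`: if `p` sends `j` to `0` then
`p = (1 × q) s₀ s₁ ⋯ s_{j-1}`, where `q` is the permutation of `n - 1` letters which remains. -/
def reducedWord : (n : ℕ) → Equiv.Perm (Fin n) → List ℕ
  | 0, _ => []
  | n + 1, p =>
    (reducedWord n (Equiv.removeNone
      ((finSuccEquiv' (p.symm 0)).symm.trans (p.trans (finSuccEquiv n))))).map (· + 1) ++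
      List.range (p.symm 0)

/-- The antisymmetriser `∑_p sign(p) σ_p` on `V^{⊗n}`, where `σ_p = σ_{i₁} ⋯ σ_{i_l}` for a reduced
expression `p = s_{i₁} ⋯ s_{i_l}`. -/
def antisymmetriser (σ : V ⊗[k] V →ₗ[k] V ⊗[k] V) (n : ℕ) : Module.End k (⨂[k]^n V) :=
  ∑ p : Equiv.Perm (Fin n),
    (Equiv.Perm.sign p : ℤ) • ((reducedWord n p).map (braidAt σ n)).prod

end Powers

/-! ### The two exterior algebras -/

section Algebras

variable {k : Type u} {A : Type v} [Field k] [Ring A] [HopfAlgebra k A]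
variable {V : Type w} [AddCommGroup V] [Module k V]

/-- `ϖ π_ε : A → V`. -/
def mcForm (ϖ : Aug k A →ₗ[k] V) : A →ₗ[k] V := ϖ ∘ₗ piEps k A

/-- The relations `(ϖ π_ε ⊗ ϖ π_ε) Δ a = 0`, for `a` in the kernel of `ϖ`, in the tensor algebra. -/
inductive MaxRel (ϖ : Aug k A →ₗ[k] V) : TensorAlgebra k V → TensorAlgebra k V → Prop
  | of (a : Aug k A) (ha : ϖ a = 0) :
      MaxRel ϖ
        (LinearMap.mul' k _ (TensorProduct.map (TensorAlgebra.ι k ∘ₗ mcForm ϖ)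
          (TensorAlgebra.ι k ∘ₗ mcForm ϖ) (Coalgebra.comul (R := k) (a : A)))) 0

/-- `Λ_max = T(V) / ⟨(ϖ π_ε ⊗ ϖ π_ε) Δ ker ϖ⟩`. -/
abbrev LambdaMax (ϖ : Aug k A →ₗ[k] V) : Type _ := RingQuot (MaxRel ϖ)

/-- The generators `V → Λ_max`. -/
def LambdaMax.ι (ϖ : Aug k A →ₗ[k] V) : V →ₗ[k] LambdaMax ϖ :=
  (RingQuot.mkAlgHom k (MaxRel ϖ)).toLinearMap ∘ₗ TensorAlgebra.ι k

/-- The relations `x = 0` for `x` in the kernel of a braided factorial `[n; -Ψ]!`. -/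
inductive ExtRel (Ψ : V ⊗[k] V →ₗ[k] V ⊗[k] V) : TensorAlgebra k V → TensorAlgebra k V → Prop
  | of (n : ℕ) (x : ⨂[k]^n V) (hx : braidedFactorial (-Ψ) n x = 0) :
      ExtRel Ψ (TensorPower.toTensorAlgebra x) 0

/-- The braided exterior algebra `B₋(V) = T(V) / ⨁ₙ ker [n; -Ψ]!`. -/
abbrev BMinus (Ψ : V ⊗[k] V →ₗ[k] V ⊗[k] V) : Type _ := RingQuot (ExtRel Ψ)

/-- The projection `T(V) → B₋(V)`. -/
def BMinus.mk (Ψ : V ⊗[k] V →ₗ[k] V ⊗[k] V) : TensorAlgebra k V →ₐ[k] BMinus Ψ :=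
  RingQuot.mkAlgHom k (ExtRel Ψ)

/-- The generators `V → B₋(V)`. -/
def BMinus.ι (Ψ : V ⊗[k] V →ₗ[k] V ⊗[k] V) : V →ₗ[k] BMinus Ψ :=
  (BMinus.mk Ψ).toLinearMap ∘ₗ TensorAlgebra.ι k

end Algebras

/-! ### Super-braided Hopf algebras with a differential -/

section SuperBraided

variable {k : Type u} {A : Type v} [Field k] [Ring A] [HopfAlgebra k A]
variable {V : Type w} [AddCommGroup V] [Module k V]
variable {L : Type x} [Ring L] [Algebra k L]

/-- The degree `n` part of an algebra with space of generators `j(V)` in degree one. -/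
def gradedPart (j : V →ₗ[k] L) (n : ℕ) : Submodule k L := LinearMap.range j ^ n

/-- The product `(x ⊗ y)(z ⊗ w) = x τ(y ⊗ z) w` on `L ⊗ L` defined by `τ : L ⊗ L → L ⊗ L`. -/
def braidedTensorMul (τ : L ⊗[k] L →ₗ[k] L ⊗[k] L) :
    (L ⊗[k] L) ⊗[k] (L ⊗[k] L) →ₗ[k] L ⊗[k] L :=
  TensorProduct.map (LinearMap.mul' k L) (LinearMap.mul' k L) ∘ₗ
    (TensorProduct.assoc k L L (L ⊗[k] L)).symm.toLinearMap ∘ₗ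
    ((TensorProduct.assoc k L L L).toLinearMap ∘ₗ τ.rTensor L ∘ₗ
      (TensorProduct.assoc k L L L).symm.toLinearMap).lTensor L ∘ₗ
    (TensorProduct.assoc k L L (L ⊗[k] L)).toLinearMap

/-- The structure maps on an algebra `L`, before laws: crossed module structure, parity
`x ↦ (-1)^{|x|} x`, sign map `x ⊗ y ↦ (-1)^{|x||y|} x ⊗ y`, braided coproduct, counit, braided
antipode and differential. -/
structure SuperBraidedData (k : Type u) (A : Type v) (L : Type x) [Field k] [Ring A]
    [HopfAlgebra k A] [Ring L] [Algebra k L] where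
  crossed : CrossedData k A L
  parity : L →ₗ[k] L
  sign : L ⊗[k] L →ₗ[k] L ⊗[k] L
  comul : L →ₗ[k] L ⊗[k] L
  counit : L →ₗ[k] k
  antipode : L →ₗ[k] L
  d : L →ₗ[k] L

namespace SuperBraidedData

/-- `D` makes `L`, with `j : V → L` as its space of generators, into a super-braided Hopf algebra
in the category of right crossed `A`-modules, graded with `V` in degree one, and primitively
generated by `V`. -/
structure IsSuperBraidedHopf (D : SuperBraidedData k A L) (X : CrossedData k A V)
    (j : V →ₗ[k] L) : Prop where
  -- the grading
  generators_injective : Function.Injective j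
  graded : DirectSum.IsInternal (gradedPart j)
  parity_apply : ∀ (n : ℕ), ∀ x ∈ gradedPart j n, D.parity x = (-1 : k) ^ n • x
  sign_apply : ∀ (m n : ℕ), ∀ x ∈ gradedPart j m, ∀ y ∈ gradedPart j n,
    D.sign (x ⊗ₜ y) = (-1 : k) ^ (m * n) • (x ⊗ₜ y)
  -- an object of the category, all structure maps being morphisms
  isCrossedModule : D.crossed.IsCrossedModule
  generators_morphism : X.IsMorphism D.crossed j
  mul_morphism : (D.crossed.tensor D.crossed).IsMorphism D.crossed (LinearMap.mul' k L)
  one_morphism : (CrossedData.unit k A).IsMorphism D.crossed (Algebra.linearMap k L)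
  comul_morphism : D.crossed.IsMorphism (D.crossed.tensor D.crossed) D.comul
  counit_morphism : D.crossed.IsMorphism (CrossedData.unit k A) D.counit
  antipode_morphism : D.crossed.IsMorphism D.crossed D.antipode
  -- coalgebra
  coassoc : ∀ x, TensorProduct.assoc k L L L (D.comul.rTensor L (D.comul x)) =
    D.comul.lTensor L (D.comul x)
  counit_left : ∀ x, D.counit.rTensor L (D.comul x) = 1 ⊗ₜ x
  counit_right : ∀ x, D.counit.lTensor L (D.comul x) = x ⊗ₜ 1
  -- the coproduct and the counit are algebra maps, `L ⊗ L` having the super-braided product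
  comul_one : D.comul 1 = 1 ⊗ₜ 1
  comul_mul : ∀ x y, D.comul (x * y) =
    braidedTensorMul (D.crossed.braiding D.crossed ∘ₗ D.sign) (D.comul x ⊗ₜ D.comul y)
  counit_one : D.counit 1 = 1
  counit_mul : ∀ x y, D.counit (x * y) = D.counit x * D.counit y
  -- antipode
  antipode_left : ∀ x, LinearMap.mul' k L (D.antipode.rTensor L (D.comul x)) =
    algebraMap k L (D.counit x)
  antipode_right : ∀ x, LinearMap.mul' k L (D.antipode.lTensor L (D.comul x)) =
    algebraMap k L (D.counit x)
  -- the generators are primitive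
  comul_generators : ∀ v, D.comul (j v) = j v ⊗ₜ 1 + 1 ⊗ₜ j v

/-- `η ⊗ ζ ↦ (-1)^{|η|} η₀ ⊗ (φ(η₁) ζ)`. -/
def curvatureTerm (D : SuperBraidedData k A L) (φ : A →ₗ[k] L) : L ⊗[k] L →ₗ[k] L ⊗[k] L :=
  (LinearMap.mul' k L).lTensor L ∘ₗ (TensorProduct.assoc k L L L).toLinearMap ∘ₗ
    (φ.lTensor L ∘ₗ D.crossed.coact ∘ₗ D.parity).rTensor L

/-- `d` is a degree one super-derivation of square zero and a right comodule map, which obeys the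
Maurer-Cartan equation and the compatibility conditions with the action and with the braided
coproduct. -/
structure IsDifferential (D : SuperBraidedData k A L) (ϖ : Aug k A →ₗ[k] V)
    (j : V →ₗ[k] L) : Prop where
  degree : ∀ (n : ℕ), ∀ x ∈ gradedPart j n, D.d x ∈ gradedPart j (n + 1)
  leibniz : ∀ (n : ℕ), ∀ x ∈ gradedPart j n, ∀ y,
    D.d (x * y) = D.d x * y + (-1 : k) ^ n • (x * D.d y)
  d_d : ∀ x, D.d (D.d x) = 0
  coact_d : ∀ x, D.crossed.coact (D.d x) = D.d.rTensor A (D.crossed.coact x)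
  /-- `d ϖ(a) + (ϖ π_ε a₁)(ϖ π_ε a₂) = 0`. -/
  maurerCartan : ∀ a : Aug k A, D.d (j (ϖ a)) +
    LinearMap.mul' k L (TensorProduct.map (j ∘ₗ mcForm ϖ) (j ∘ₗ mcForm ϖ)
      (Coalgebra.comul (R := k) (a : A))) = 0
  /-- `(dη) ◁ a - d(η ◁ a) = (ϖ π_ε a₁)(η ◁ a₂) - (-1)^{|η|} (η ◁ a₁)(ϖ π_ε a₂)`. -/
  d_act : ∀ (n : ℕ), ∀ η ∈ gradedPart j n, ∀ a : A,
    D.crossed.act (D.d η ⊗ₜ a) - D.d (D.crossed.act (η ⊗ₜ a)) =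
      LinearMap.mul' k L (TensorProduct.map (j ∘ₗ mcForm ϖ)
        (TensorProduct.curry D.crossed.act η) (Coalgebra.comul (R := k) a)) -
      (-1 : k) ^ n • LinearMap.mul' k L (TensorProduct.map
        (TensorProduct.curry D.crossed.act η) (j ∘ₗ mcForm ϖ) (Coalgebra.comul (R := k) a))
  /-- `Δ dη - (d ⊗ id + (-1)^{| |} ⊗ d) Δ η = (-1)^{|η⁽¹⁾|} η⁽¹⁾₀ ⊗ (ϖ π_ε η⁽¹⁾₁) η⁽²⁾`. -/
  comul_d : ∀ η, D.comul (D.d η) -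
      (D.d.rTensor L (D.comul η) + TensorProduct.map D.parity D.d (D.comul η)) =
    D.curvatureTerm (j ∘ₗ mcForm ϖ) (D.comul η)

/-- An algebra map which commutes with all the structure maps. -/
structure IsHom {L' : Type*} [Ring L'] [Algebra k L'] (D : SuperBraidedData k A L)
    (D' : SuperBraidedData k A L') (q : L →ₐ[k] L') : Prop where
  crossed : D.crossed.IsMorphism D'.crossed q.toLinearMap
  comul : ∀ x, D'.comul (q x) = TensorProduct.map q.toLinearMap q.toLinearMap (D.comul x)
  counit : ∀ x, D'.counit (q x) = D.counit x
  antipode : ∀ x, D'.antipode (q x) = q (D.antipode x)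
  d : ∀ x, D'.d (q x) = q (D.d x)

/-! The super-bosonisation, on the vector space `A ⊗ L`. -/

/-- The product `(a ⊗ η)(b ⊗ ζ) = a b₁ ⊗ (η ◁ b₂) ζ`. -/
def bosonMul (D : SuperBraidedData k A L) : (A ⊗[k] L) ⊗[k] (A ⊗[k] L) →ₗ[k] A ⊗[k] L :=
  TensorProduct.map (LinearMap.mul' k A)
      (LinearMap.mul' k L ∘ₗ D.crossed.act.rTensor L ∘ₗ
        (TensorProduct.assoc k L A L).symm.toLinearMap) ∘ₗ
    (TensorProduct.tensorTensorTensorComm k A L A (A ⊗[k] L)).toLinearMap ∘ₗ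
    ((TensorProduct.assoc k A A L).toLinearMap ∘ₗ
      (Coalgebra.comul (R := k) (A := A)).rTensor L).lTensor (A ⊗[k] L)

/-- The coproduct `a ⊗ η ↦ (a₁ ⊗ η⁽¹⁾₀) ⊗ (a₂ η⁽¹⁾₁ ⊗ η⁽²⁾)`. -/
def bosonComul (D : SuperBraidedData k A L) : A ⊗[k] L →ₗ[k] (A ⊗[k] L) ⊗[k] (A ⊗[k] L) :=
  ((LinearMap.mul' k A).rTensor L ∘ₗ
      (TensorProduct.assoc k A A L).symm.toLinearMap).lTensor (A ⊗[k] L) ∘ₗ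
    (TensorProduct.tensorTensorTensorComm k A A L (A ⊗[k] L)).toLinearMap ∘ₗ
    TensorProduct.map (Coalgebra.comul (R := k) (A := A))
      ((TensorProduct.assoc k L A L).toLinearMap ∘ₗ D.crossed.coact.rTensor L ∘ₗ D.comul)

/-- The projection `a ⊗ η ↦ ε(η) a` onto degree zero. -/
def bosonProj (D : SuperBraidedData k A L) : A ⊗[k] L →ₗ[k] A :=
  (TensorProduct.rid k A).toLinearMap ∘ₗ D.counit.lTensor A

/-- The left coaction of `A` on the bosonisation, `(projection ⊗ id) Δ`. -/
def bosonCoactLeft (D : SuperBraidedData k A L) : A ⊗[k] L →ₗ[k] A ⊗[k] (A ⊗[k] L) :=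
  D.bosonProj.rTensor (A ⊗[k] L) ∘ₗ D.bosonComul

/-- The right coaction of `A` on the bosonisation, `(id ⊗ projection) Δ`. -/
def bosonCoactRight (D : SuperBraidedData k A L) : A ⊗[k] L →ₗ[k] (A ⊗[k] L) ⊗[k] A :=
  D.bosonProj.lTensor (A ⊗[k] L) ∘ₗ D.bosonComul

/-- The differential `d(a η) = a₁ (ϖ π_ε a₂) η + a dη`; in particular `d a = a₁ ϖ π_ε a₂`. -/
def bosonD (D : SuperBraidedData k A L) (ϖ : Aug k A →ₗ[k] V) (j : V →ₗ[k] L) :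
    A ⊗[k] L →ₗ[k] A ⊗[k] L :=
  (LinearMap.mul' k L ∘ₗ (j ∘ₗ mcForm ϖ).rTensor L).lTensor A ∘ₗ
      (TensorProduct.assoc k A A L).toLinearMap ∘ₗ
      (Coalgebra.comul (R := k) (A := A)).rTensor L +
    D.d.lTensor A

end SuperBraidedData

end SuperBraided

/-! ### Woronowicz's bicovariant calculus and exterior algebra -/

section Woronowicz

variable {k : Type u} {A : Type v} [Field k] [Ring A] [HopfAlgebra k A]

/-- The structure maps of a first order bicovariant calculus on `A`, before laws: bimodule
structure, left and right coactions, and `d : A → Γ`. -/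
structure CalculusData (k : Type u) (A : Type v) (Γ : Type w) [Field k] [Ring A]
    [HopfAlgebra k A] [AddCommGroup Γ] [Module k Γ] where
  lact : A ⊗[k] Γ →ₗ[k] Γ
  ract : Γ ⊗[k] A →ₗ[k] Γ
  coL : Γ →ₗ[k] A ⊗[k] Γ
  coR : Γ →ₗ[k] Γ ⊗[k] A
  d : A →ₗ[k] Γ

namespace CalculusData

variable {Γ : Type w} [AddCommGroup Γ] [Module k Γ]

/-- First order differential calculi which are bicovariant. -/
structure IsBicovariant (C : CalculusData k A Γ) : Prop where
  -- bimodule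
  one_lact : ∀ γ, C.lact (1 ⊗ₜ γ) = γ
  mul_lact : ∀ a b γ, C.lact ((a * b) ⊗ₜ γ) = C.lact (a ⊗ₜ C.lact (b ⊗ₜ γ))
  ract_one : ∀ γ, C.ract (γ ⊗ₜ 1) = γ
  ract_mul : ∀ γ a b, C.ract (γ ⊗ₜ (a * b)) = C.ract (C.ract (γ ⊗ₜ a) ⊗ₜ b)
  lact_ract : ∀ a γ b, C.ract (C.lact (a ⊗ₜ γ) ⊗ₜ b) = C.lact (a ⊗ₜ C.ract (γ ⊗ₜ b))
  -- differential
  leibniz : ∀ a b, C.d (a * b) = C.ract (C.d a ⊗ₜ b) + C.lact (a ⊗ₜ C.d b)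
  span : LinearMap.range (C.lact ∘ₗ C.d.lTensor A) = ⊤
  -- bicomodule
  coL_coassoc : ∀ γ, TensorProduct.assoc k A A Γ
    ((Coalgebra.comul (R := k) (A := A)).rTensor Γ (C.coL γ)) = C.coL.lTensor A (C.coL γ)
  coL_counit : ∀ γ, (Coalgebra.counit (R := k) (A := A)).rTensor Γ (C.coL γ) = 1 ⊗ₜ γ
  coR_coassoc : ∀ γ, TensorProduct.assoc k Γ A A (C.coR.rTensor A (C.coR γ)) =
    (Coalgebra.comul (R := k) (A := A)).lTensor Γ (C.coR γ)
  coR_counit : ∀ γ, (Coalgebra.counit (R := k) (A := A)).lTensor Γ (C.coR γ) = γ ⊗ₜ 1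
  coL_coR : ∀ γ, TensorProduct.assoc k A Γ A (C.coL.rTensor A (C.coR γ)) =
    C.coR.lTensor A (C.coL γ)
  -- the coactions are bimodule maps, and `d` is a bicomodule map
  coL_lact : ∀ a γ, C.coL (C.lact (a ⊗ₜ γ)) =
    TensorProduct.map (LinearMap.mul' k A) C.lact
      (TensorProduct.tensorTensorTensorComm k A A A Γ (Coalgebra.comul (R := k) a ⊗ₜ C.coL γ))
  coL_ract : ∀ γ a, C.coL (C.ract (γ ⊗ₜ a)) =
    TensorProduct.map (LinearMap.mul' k A) C.ract
      (TensorProduct.tensorTensorTensorComm k A Γ A A (C.coL γ ⊗ₜ Coalgebra.comul (R := k) a))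
  coR_lact : ∀ a γ, C.coR (C.lact (a ⊗ₜ γ)) =
    TensorProduct.map C.lact (LinearMap.mul' k A)
      (TensorProduct.tensorTensorTensorComm k A A Γ A (Coalgebra.comul (R := k) a ⊗ₜ C.coR γ))
  coR_ract : ∀ γ a, C.coR (C.ract (γ ⊗ₜ a)) =
    TensorProduct.map C.ract (LinearMap.mul' k A)
      (TensorProduct.tensorTensorTensorComm k Γ A A A (C.coR γ ⊗ₜ Coalgebra.comul (R := k) a))
  coL_d : ∀ a, C.coL (C.d a) = C.d.lTensor A (Coalgebra.comul (R := k) a)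
  coR_d : ∀ a, C.coR (C.d a) = C.d.rTensor A (Coalgebra.comul (R := k) a)

/-- The projection `γ ↦ S(γ₋₁) γ₀` onto left-invariant forms. -/
def projL (C : CalculusData k A Γ) : Γ →ₗ[k] Γ :=
  C.lact ∘ₗ (HopfAlgebra.antipode k (A := A)).rTensor Γ ∘ₗ C.coL

/-- The projection `γ ↦ γ₀ S(γ₁)` onto right-invariant forms. -/
def projR (C : CalculusData k A Γ) : Γ →ₗ[k] Γ :=
  C.ract ∘ₗ (HopfAlgebra.antipode k (A := A)).lTensor Γ ∘ₗ C.coR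

/-- Woronowicz's braiding of `Γ ⊗_A Γ`, the `A`-bimodule map with `σ(ω ⊗ η) = η ⊗ ω` for
left-invariant `ω` and right-invariant `η`. As `γ = γ₋₁ projL(γ₀)` and `γ' = projR(γ'₀) γ'₁`, it is
induced by `γ ⊗ γ' ↦ γ₋₁ projR(γ'₀) ⊗ projL(γ₀) γ'₁` on `Γ ⊗ Γ`. -/
def braiding (C : CalculusData k A Γ) : Γ ⊗[k] Γ →ₗ[k] Γ ⊗[k] Γ :=
  TensorProduct.map (C.lact ∘ₗ C.projR.lTensor A) (C.ract ∘ₗ C.projL.rTensor A) ∘ₗ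
    (TensorProduct.tensorTensorTensorComm k A Γ Γ A).toLinearMap ∘ₗ
    TensorProduct.map C.coL C.coR

theorem braiding_invariant (C : CalculusData k A Γ) (hC : C.IsBicovariant) (ω η : Γ)
    (hω : C.coL ω = 1 ⊗ₜ ω) (hη : C.coR η = η ⊗ₜ 1) : C.braiding (ω ⊗ₜ η) = η ⊗ₜ ω := by
  simp [braiding, projL, projR, hω, hη, hC.one_lact, hC.ract_one]

/-- The kernel of `Γ^{⊗n} → Γ ⊗_A ⋯ ⊗_A Γ`, spanned by the differences of the tensors
`⋯ ⊗ γ a ⊗ γ' ⊗ ⋯` and `⋯ ⊗ γ ⊗ a γ' ⊗ ⋯`. -/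
def balanced (C : CalculusData k A Γ) (n : ℕ) : Submodule k (⨂[k]^n Γ) :=
  Submodule.span k {z | ∃ (f : Fin n → Γ) (i i' : Fin n) (a : A), (i' : ℕ) = i + 1 ∧
    z = PiTensorProduct.tprod k (Function.update f i (C.ract (f i ⊗ₜ a))) -
      PiTensorProduct.tprod k (Function.update f i' (C.lact (a ⊗ₜ f i')))}

/-- The relations of the exterior algebra on the generators `a ∈ A` and `γ ∈ Γ`: those of the
tensor algebra of the `A`-bimodule `Γ`, and `x = 0` for `x ∈ Γ ⊗_A ⋯ ⊗_A Γ` in the kernel of the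
antisymmetriser. -/
inductive ExtRel (C : CalculusData k A Γ) :
    TensorAlgebra k (A × Γ) → TensorAlgebra k (A × Γ) → Prop
  | one : ExtRel C (TensorAlgebra.ι k (1, 0)) 1
  | mul (a b : A) : ExtRel C (TensorAlgebra.ι k (a, 0) * TensorAlgebra.ι k (b, 0))
      (TensorAlgebra.ι k (a * b, 0))
  | lact (a : A) (γ : Γ) : ExtRel C (TensorAlgebra.ι k (a, 0) * TensorAlgebra.ι k (0, γ))
      (TensorAlgebra.ι k (0, C.lact (a ⊗ₜ γ)))
  | ract (γ : Γ) (a : A) : ExtRel C (TensorAlgebra.ι k (0, γ) * TensorAlgebra.ι k (a, 0))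
      (TensorAlgebra.ι k (0, C.ract (γ ⊗ₜ a)))
  | antisymm (n : ℕ) (x : ⨂[k]^n Γ) (hx : antisymmetriser C.braiding n x ∈ C.balanced n) :
      ExtRel C (TensorPower.toTensorAlgebra
        (PiTensorProduct.map (fun _ : Fin n => LinearMap.inr k A Γ) x)) 0

/-- Woronowicz's exterior algebra over `A`: the tensor algebra of the bimodule `Γ` modulo the
kernels of the antisymmetrisers. -/
abbrev Ext (C : CalculusData k A Γ) : Type _ := RingQuot C.ExtRel

/-- `A → Γ^∧`. -/
def Ext.ofA (C : CalculusData k A Γ) : A →ₗ[k] C.Ext :=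
  (RingQuot.mkAlgHom k C.ExtRel).toLinearMap ∘ₗ TensorAlgebra.ι k ∘ₗ LinearMap.inl k A Γ

/-- `Γ → Γ^∧`. -/
def Ext.ofΓ (C : CalculusData k A Γ) : Γ →ₗ[k] C.Ext :=
  (RingQuot.mkAlgHom k C.ExtRel).toLinearMap ∘ₗ TensorAlgebra.ι k ∘ₗ LinearMap.inr k A Γ

/-- `Γ^{⊗n} → Γ^∧`. -/
def Ext.ofTensors (C : CalculusData k A Γ) (n : ℕ) : (⨂[k]^n Γ) →ₗ[k] C.Ext :=
  (RingQuot.mkAlgHom k C.ExtRel).toLinearMap ∘ₗ TensorPower.toTensorAlgebra ∘ₗ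
    PiTensorProduct.map (fun _ : Fin n => LinearMap.inr k A Γ)

/-- The degree `n` part of the exterior algebra. -/
def Ext.deg (C : CalculusData k A Γ) (n : ℕ) : Submodule k C.Ext :=
  LinearMap.range (Ext.ofA C) * LinearMap.range (Ext.ofΓ C) ^ n

/-- The exterior derivatives: degree one super-derivations of square zero extending
`d : A → Γ`. -/
structure IsExteriorDerivative (C : CalculusData k A Γ) (δ : C.Ext →ₗ[k] C.Ext) : Prop where
  degree : ∀ (n : ℕ), ∀ x ∈ Ext.deg C n, δ x ∈ Ext.deg C (n + 1)
  ofA : ∀ a, δ (Ext.ofA C a) = Ext.ofΓ C (C.d a)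
  leibniz : ∀ (n : ℕ), ∀ x ∈ Ext.deg C n, ∀ y, δ (x * y) = δ x * y + (-1 : k) ^ n • (x * δ y)
  sq : ∀ x, δ (δ x) = 0

/-- The left coaction of `A` on the exterior algebra: the algebra map extending the coproduct of
`A` and the left coaction on `Γ`. -/
structure IsLeftCoaction (C : CalculusData k A Γ) (Φ : C.Ext →ₐ[k] A ⊗[k] C.Ext) : Prop where
  ofA : ∀ a, Φ (Ext.ofA C a) = (Ext.ofA C).lTensor A (Coalgebra.comul (R := k) a)
  ofΓ : ∀ γ, Φ (Ext.ofΓ C γ) = (Ext.ofΓ C).lTensor A (C.coL γ)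

/-- The right coaction of `A` on the exterior algebra: the algebra map extending the coproduct of
`A` and the right coaction on `Γ`. -/
structure IsRightCoaction (C : CalculusData k A Γ) (Φ : C.Ext →ₐ[k] C.Ext ⊗[k] A) : Prop where
  ofA : ∀ a, Φ (Ext.ofA C a) = (Ext.ofA C).rTensor A (Coalgebra.comul (R := k) a)
  ofΓ : ∀ γ, Φ (Ext.ofΓ C γ) = (Ext.ofΓ C).rTensor A (C.coR γ)

end CalculusData

/-- The universal first order forms `ker (A ⊗ A → A)`. -/
abbrev UniversalForms (k : Type u) (A : Type v) [Field k] [Ring A] [HopfAlgebra k A] :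
    Submodule k (A ⊗[k] A) :=
  LinearMap.ker (LinearMap.mul' k A)

variable {V : Type w} [AddCommGroup V] [Module k V]

/-- The right ideal `ker ϖ`, as a subspace of `A`. -/
def kerIdeal (ϖ : Aug k A →ₗ[k] V) : Submodule k A :=
  (LinearMap.ker ϖ).map (Aug k A).subtype

/-- `N = r⁻¹(A ⊗ ker ϖ)`, for `r(a ⊗ b) = a b₁ ⊗ b₂`. -/
def worSub (ϖ : Aug k A →ₗ[k] V) : Submodule k (A ⊗[k] A) :=
  (LinearMap.range ((kerIdeal ϖ).subtype.lTensor A)).comap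
    ((LinearMap.mul' k A).rTensor A ∘ₗ (TensorProduct.assoc k A A A).symm.toLinearMap ∘ₗ
      (Coalgebra.comul (R := k) (A := A)).lTensor A)

/-- Woronowicz's space of first order forms for the right ideal `ker ϖ`: the quotient of the
universal first order forms by `N`. -/
abbrev WorForms (ϖ : Aug k A →ₗ[k] V) : Type _ :=
  UniversalForms k A ⧸ (worSub ϖ).comap (UniversalForms k A).subtype

/-- The class of a universal form. -/
def WorForms.mk (ϖ : Aug k A →ₗ[k] V) : UniversalForms k A →ₗ[k] WorForms ϖ :=
  Submodule.mkQ _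

theorem lmul_mem (a : A) (z : UniversalForms k A) :
    (a ⊗ₜ[k] (1 : A)) * (z : A ⊗[k] A) ∈ UniversalForms k A := by
  have h : ∀ z : A ⊗[k] A, LinearMap.mul' k A ((a ⊗ₜ[k] (1 : A)) * z) =
      a * LinearMap.mul' k A z := by
    intro z
    induction z with
    | zero => simp
    | tmul x y => simp [mul_assoc]
    | add y z hy hz => rw [mul_add, map_add, map_add, hy, hz, mul_add]
  rw [LinearMap.mem_ker, h, LinearMap.mem_ker.1 z.2, mul_zero]

theorem rmul_mem (z : UniversalForms k A) (a : A) :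
    (z : A ⊗[k] A) * ((1 : A) ⊗ₜ[k] a) ∈ UniversalForms k A := by
  have h : ∀ z : A ⊗[k] A, LinearMap.mul' k A (z * ((1 : A) ⊗ₜ[k] a)) =
      LinearMap.mul' k A z * a := by
    intro z
    induction z with
    | zero => simp
    | tmul x y => simp [mul_assoc]
    | add y z hy hz => rw [add_mul, map_add, map_add, hy, hz, add_mul]
  rw [LinearMap.mem_ker, h, LinearMap.mem_ker.1 z.2, zero_mul]

/-- The universal differential `a ↦ 1 ⊗ a - a ⊗ 1`. -/
def universalD (a : A) : UniversalForms k A :=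
  ⟨(1 : A) ⊗ₜ[k] a - a ⊗ₜ[k] (1 : A), by simp⟩

/-- The calculus of Woronowicz associated to the ideal `ker ϖ`: the bimodule structure and the
differential are those induced from the universal calculus, and it is bicovariant (the coactions
are determined by this). -/
structure IsWoronowiczCalculus (ϖ : Aug k A →ₗ[k] V) (C : CalculusData k A (WorForms ϖ)) :
    Prop where
  lact : ∀ (a : A) (z : UniversalForms k A), C.lact (a ⊗ₜ WorForms.mk ϖ z) =
    WorForms.mk ϖ ⟨(a ⊗ₜ[k] (1 : A)) * (z : A ⊗[k] A), lmul_mem a z⟩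
  ract : ∀ (z : UniversalForms k A) (a : A), C.ract (WorForms.mk ϖ z ⊗ₜ a) =
    WorForms.mk ϖ ⟨(z : A ⊗[k] A) * ((1 : A) ⊗ₜ[k] a), rmul_mem z a⟩
  d : ∀ a : A, C.d a = WorForms.mk ϖ (universalD a)
  isBicovariant : C.IsBicovariant

end Woronowicz

end BraidedExterior

end

open scoped TensorProduct

noncomputable section

namespace BraidedExterior

universe u v w x

/-! ### Shortcuts for type class search -/

section Shortcuts

variable {k : Type*} [CommSemiring k] {M N : Type*} [AddCommMonoid M] [Module k M]
variable [AddCommMonoid N] [Module k N]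
variable {R S : Type*} [Semiring R] [Algebra k R] [Semiring S] [Algebra k S]

instance : ZeroHomClass (M →ₗ[k] N) M N := inferInstance
instance : AddHomClass (M →ₗ[k] N) M N := inferInstance
instance : ZeroHomClass (M ≃ₗ[k] N) M N := inferInstance
instance : AddHomClass (M ≃ₗ[k] N) M N := inferInstance
instance : ZeroHomClass (R →ₐ[k] S) R S := inferInstance
instance : AddHomClass (R →ₐ[k] S) R S := inferInstance
instance : MulHomClass (R →ₐ[k] S) R S := inferInstance

end Shortcuts

/-! ### Convolution algebras -/

section Convolution

open WithConv

variable (k : Type u) (A : Type v) [Field k] [Ring A] [HopfAlgebra k A]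
variable {R : Type*} [Ring R] [Algebra k R] {R' : Type*} [Ring R'] [Algebra k R']

/-- The convolution algebra of linear maps `A → R`. -/
abbrev Conv (R : Type*) [Ring R] [Algebra k R] : Type _ := WithConv (A →ₗ[k] R)

namespace Conv

variable {k A}

theorem ext' {f g : Conv k A R} (h : ∀ a, f a = g a) : f = g :=
  WithConv.ext (LinearMap.ext h)

/-- Postcomposition with an algebra map. -/
def post (h : R →ₐ[k] R') : Conv k A R →ₐ[k] Conv k A R' where
  toFun f := toConv (h.toLinearMap ∘ₗ f.ofConv)
  map_one' := ext' fun a => by simp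
  map_mul' f g := ext' fun a => by
    have := LinearMap.algHom_comp_convMul_distrib h f g
    exact LinearMap.congr_fun this a
  map_zero' := ext' fun a => by simp
  map_add' f g := ext' fun a => by simp
  commutes' c := ext' fun a => by simp

@[simp] theorem post_apply (h : R →ₐ[k] R') (f : Conv k A R) (a : A) : post h f a = h (f a) := rfl

/-- The constant `a ↦ ε(a) r`. -/
def constₗ (r : R) : Conv k A R :=
  toConv ((LinearMap.toSpanSingleton k R r) ∘ₗ Coalgebra.counit)

@[simp] theorem constₗ_apply (r : R) (a : A) :
    (constₗ r : Conv k A R) a = Coalgebra.counit (R := k) a • r := rfl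

theorem constₗ_mul_apply (r : R) (f : Conv k A R) (a : A) :
    ((constₗ r : Conv k A R) * f) a = r * f a := by
  have h : LinearMap.mul' k R ∘ₗ TensorProduct.map (constₗ r : Conv k A R).ofConv f.ofConv =
      LinearMap.mulLeft k r ∘ₗ f.ofConv ∘ₗ (TensorProduct.lid k A).toLinearMap ∘ₗ
        (Coalgebra.counit (R := k) (A := A)).rTensor A := by
    ext a b
    simp
  simpa using LinearMap.congr_fun h (Coalgebra.comul a)

/-- Constants `r ↦ (a ↦ ε(a) r)`. -/
def const : R →ₐ[k] Conv k A R where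
  toFun r := constₗ r
  map_one' := ext' fun a => by
    rw [constₗ_apply, LinearMap.convOne_apply, Algebra.algebraMap_eq_smul_one]
  map_mul' r s := ext' fun a => by
    rw [constₗ_mul_apply, constₗ_apply, constₗ_apply, mul_smul_comm]
  map_zero' := ext' fun a => by simp
  map_add' f g := ext' fun a => by simp
  commutes' c := ext' fun a => by
    rw [constₗ_apply, LinearMap.convAlgebraMap_apply, Algebra.algebraMap_eq_smul_one,
      Algebra.algebraMap_eq_smul_one, smul_comm]

@[simp] theorem const_apply (r : R) (a : A) :
    (const r : Conv k A R) a = Coalgebra.counit (R := k) a • r := rfl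

theorem const_mul_apply (r : R) (f : Conv k A R) (a : A) :
    ((const r : Conv k A R) * f) a = r * f a :=
  constₗ_mul_apply r f a

theorem mul_const_apply (r : R) (f : Conv k A R) (a : A) :
    (f * (const r : Conv k A R)) a = f a * r := by
  have h : LinearMap.mul' k R ∘ₗ TensorProduct.map f.ofConv (const r : Conv k A R).ofConv =
      LinearMap.mulRight k r ∘ₗ f.ofConv ∘ₗ (TensorProduct.rid k A).toLinearMap ∘ₗ
        (Coalgebra.counit (R := k) (A := A)).lTensor A := by
    ext a b
    simp
  simpa using LinearMap.congr_fun h (Coalgebra.comul a)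

/-- Evaluation at `1`. -/
def evalOne : Conv k A R →ₐ[k] R where
  toFun f := f 1
  map_one' := by simp
  map_mul' f g := by simp [Algebra.TensorProduct.one_def]
  map_zero' := by simp
  map_add' f g := by simp
  commutes' c := by simp [Algebra.algebraMap_eq_smul_one]

@[simp] theorem evalOne_apply (f : Conv k A R) : evalOne f = f 1 := rfl

/-- The convolution `a ↦ 1 ⊗ a`. -/
def incl (R : Type*) [Ring R] [Algebra k R] : Conv k A (R ⊗[k] A) :=
  toConv (TensorProduct.mk k R A 1)

/-- The convolution `a ↦ 1 ⊗ S(a)`. -/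
def inclInv (R : Type*) [Ring R] [Algebra k R] : Conv k A (R ⊗[k] A) :=
  toConv (TensorProduct.mk k R A 1 ∘ₗ HopfAlgebra.antipode k)

@[simp] theorem incl_apply (a : A) : (incl R : Conv k A (R ⊗[k] A)) a = 1 ⊗ₜ a := rfl

@[simp] theorem inclInv_apply (a : A) :
    (inclInv R : Conv k A (R ⊗[k] A)) a = 1 ⊗ₜ HopfAlgebra.antipode k a := rfl

theorem incl_mul_inclInv : (incl R * inclInv R : Conv k A (R ⊗[k] A)) = 1 := by
  refine ext' fun a => ?_
  have h : LinearMap.mul' k (R ⊗[k] A) ∘ₗ TensorProduct.map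
      (incl R : Conv k A (R ⊗[k] A)).ofConv (inclInv R : Conv k A (R ⊗[k] A)).ofConv =
      TensorProduct.mk k R A 1 ∘ₗ LinearMap.mul' k A ∘ₗ
        (HopfAlgebra.antipode k (A := A)).lTensor A := by
    ext a b
    simp
  have h' := LinearMap.congr_fun h (Coalgebra.comul a)
  simpa [Algebra.TensorProduct.algebraMap_apply, Algebra.algebraMap_eq_smul_one,
    Algebra.TensorProduct.one_def] using h'

theorem inclInv_mul_incl : (inclInv R * incl R : Conv k A (R ⊗[k] A)) = 1 := by
  refine ext' fun a => ?_
  have h : LinearMap.mul' k (R ⊗[k] A) ∘ₗ TensorProduct.map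
      (inclInv R : Conv k A (R ⊗[k] A)).ofConv (incl R : Conv k A (R ⊗[k] A)).ofConv =
      TensorProduct.mk k R A 1 ∘ₗ LinearMap.mul' k A ∘ₗ
        (HopfAlgebra.antipode k (A := A)).rTensor A := by
    ext a b
    simp
  have h' := LinearMap.congr_fun h (Coalgebra.comul a)
  simpa [Algebra.TensorProduct.algebraMap_apply, Algebra.algebraMap_eq_smul_one,
    Algebra.TensorProduct.one_def] using h'

variable {M : Type*} [AddCommGroup M] [Module k M]

/-- The operator `m ⊗ w ↦ m₀ ⊗ f(m₁) w` on `M ⊗ R`, for a coaction `c` on `M`. -/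
def coOpₗ (c : M →ₗ[k] M ⊗[k] A) : Conv k A R →ₗ[k] Module.End k (M ⊗[k] R) where
  toFun f := (LinearMap.mul' k R ∘ₗ f.ofConv.rTensor R).lTensor M ∘ₗ
    (TensorProduct.assoc k M A R).toLinearMap ∘ₗ c.rTensor R
  map_add' f g := by
    ext m w
    simp only [TensorProduct.AlgebraTensorModule.curry_apply, TensorProduct.curry_apply,
      LinearMap.coe_restrictScalars, LinearMap.comp_apply, LinearMap.add_apply,
      LinearMap.rTensor_tmul, LinearEquiv.coe_coe]
    generalize c m = t
    induction t with
    | zero => simp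
    | tmul m a => simp [TensorProduct.tmul_add]
    | add s t hs ht => simp only [TensorProduct.add_tmul, map_add, hs, ht]; abel
  map_smul' r f := by
    ext m w
    simp only [TensorProduct.AlgebraTensorModule.curry_apply, TensorProduct.curry_apply,
      LinearMap.coe_restrictScalars, LinearMap.comp_apply, LinearMap.smul_apply,
      LinearMap.rTensor_tmul, LinearEquiv.coe_coe, RingHom.id_apply]
    generalize c m = t
    induction t with
    | zero => simp
    | tmul m a => simp
    | add s t hs ht => simp only [TensorProduct.add_tmul, map_add, hs, ht, smul_add]

/-- `m ⊗ a ↦ m ⊗ f(a) w`. -/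
def fill (f : Conv k A R) (w : R) : M ⊗[k] A →ₗ[k] M ⊗[k] R :=
  (LinearMap.mulRight k w ∘ₗ f.ofConv).lTensor M

@[simp] theorem fill_tmul (f : Conv k A R) (w : R) (m : M) (a : A) :
    fill f w (m ⊗ₜ[k] a) = m ⊗ₜ (f a * w) := rfl

theorem coOpₗ_tmul (c : M →ₗ[k] M ⊗[k] A) (f : Conv k A R) (m : M) (w : R) :
    coOpₗ c f (m ⊗ₜ w) = fill f w (c m) := by
  simp only [coOpₗ, LinearMap.coe_mk, AddHom.coe_mk, LinearMap.comp_apply,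
      LinearMap.rTensor_tmul, LinearEquiv.coe_coe]
  generalize c m = t
  induction t with
  | zero => simp
  | tmul m a => simp
  | add s t hs ht => simp only [TensorProduct.add_tmul, map_add, hs, ht]

theorem coOpₗ_mul (c : M →ₗ[k] M ⊗[k] A)
    (hc : ∀ m, TensorProduct.assoc k M A A (c.rTensor A (c m)) =
      (Coalgebra.comul (R := k) (A := A)).lTensor M (c m)) (f g : Conv k A R) :
    coOpₗ c (f * g) = coOpₗ c f * coOpₗ c g := by
  ext m w
  simp only [TensorProduct.AlgebraTensorModule.curry_apply, TensorProduct.curry_apply,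
      LinearMap.coe_restrictScalars, Module.End.mul_apply, coOpₗ_tmul]
  let φ : M ⊗[k] (A ⊗[k] A) →ₗ[k] M ⊗[k] R :=
    (LinearMap.mulRight k w ∘ₗ LinearMap.mul' k R ∘ₗ
      TensorProduct.map f.ofConv g.ofConv).lTensor M
  have h1 : ∀ t, fill (f * g) w t =
      φ ((Coalgebra.comul (R := k) (A := A)).lTensor M t) := by
    intro t
    induction t with
    | zero => simp
    | tmul m a => simp [φ]
    | add s t hs ht => simp only [map_add, hs, ht]
  have h2 : ∀ t, coOpₗ c f (fill g w t) = φ (TensorProduct.assoc k M A A (c.rTensor A t)) := by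
    intro t
    induction t with
    | zero => simp
    | tmul m a =>
      simp only [fill_tmul, coOpₗ_tmul, LinearMap.rTensor_tmul]
      generalize c m = s
      induction s with
      | zero => simp
      | tmul m b => simp [φ, mul_assoc]
      | add s t hs ht => simp only [map_add, hs, ht, TensorProduct.add_tmul]
    | add s t hs ht => simp only [map_add, hs, ht]
  rw [h1, h2, hc]

theorem coOpₗ_one (c : M →ₗ[k] M ⊗[k] A)
    (hc : ∀ m, (Coalgebra.counit (R := k) (A := A)).lTensor M (c m) = m ⊗ₜ 1) :
    coOpₗ c (1 : Conv k A R) = 1 := by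
  ext m w
  simp only [TensorProduct.AlgebraTensorModule.curry_apply, TensorProduct.curry_apply,
      LinearMap.coe_restrictScalars, Module.End.one_apply, coOpₗ_tmul]
  have h1 : ∀ t, fill (1 : Conv k A R) w t = (LinearMap.toSpanSingleton k R w).lTensor M
      ((Coalgebra.counit (R := k) (A := A)).lTensor M t) := by
    intro t
    induction t with
    | zero => simp
    | tmul m a => simp [Algebra.smul_def]
    | add s t hs ht => simp only [map_add, hs, ht]
  rw [h1, hc]
  simp

end Conv

end Convolution

/-! ### Algebras generated by a crossed module -/

section Generated

open WithConv

variable {k : Type u} {A : Type v} [Field k] [Ring A] [HopfAlgebra k A]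
variable {V : Type w} [AddCommGroup V] [Module k V]
variable {L : Type x} [Ring L] [Algebra k L]

/-- An algebra `L` generated by `j(V)`, together with a coaction `α`, an action `β`, a parity
automorphism, a counit, a grading and the projection onto degree one. -/
structure Generated (X : CrossedData k A V) (L : Type x) [Ring L] [Algebra k L]
    (j : V →ₗ[k] L) where
  α : L →ₐ[k] L ⊗[k] A
  β : L →ₐ[k] Conv k A L
  P : L →ₐ[k] L
  ε : L →ₐ[k] k
  γ : L →ₐ[k] Polynomial L
  pr : L →ₗ[k] V
  adjoin_eq_top : Algebra.adjoin k (Set.range j) = ⊤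
  α_gen : ∀ v, α (j v) = j.rTensor A (X.coact v)
  β_gen : ∀ v a, β (j v) a = j (X.act (v ⊗ₜ a))
  P_gen : ∀ v, P (j v) = - j v
  ε_gen : ∀ v, ε (j v) = 0
  γ_gen : ∀ v, γ (j v) = Polynomial.monomial 1 (j v)
  pr_one : pr 1 = 0
  pr_gen : ∀ v x, pr (j v * x) = ε x • v

namespace Generated

theorem actLeft_commute (β : L →ₐ[k] Conv k A L) (x : L) (c : A) :
    Commute (((Conv.post Algebra.TensorProduct.includeLeft).comp β) x : Conv k A (L ⊗[k] A))
      ((Conv.const.comp Algebra.TensorProduct.includeRight) c) := by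
  refine Conv.ext' fun a => ?_
  simp only [AlgHom.comp_apply]
  rw [Conv.mul_const_apply, Conv.const_mul_apply]
  simp

/-- `z ⊗ c ↦ (a ↦ (z ◁ a) ⊗ c)`, for an action `β`. -/
def actLeft (β : L →ₐ[k] Conv k A L) : L ⊗[k] A →ₐ[k] Conv k A (L ⊗[k] A) :=
  Algebra.TensorProduct.lift ((Conv.post Algebra.TensorProduct.includeLeft).comp β)
    (Conv.const.comp Algebra.TensorProduct.includeRight) (actLeft_commute β)

theorem actLeft_tmul (β : L →ₐ[k] Conv k A L) (z : L) (c a : A) :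
    actLeft β (z ⊗ₜ c) a = β z a ⊗ₜ c := by
  rw [actLeft, Algebra.TensorProduct.lift_tmul]
  simp only [AlgHom.comp_apply]
  rw [Conv.mul_const_apply]
  simp

theorem _root_.BraidedExterior.adjoin_induction_left {j : V →ₗ[k] L}
    (h : Algebra.adjoin k (Set.range j) = ⊤) {p : L → Prop} (one : p 1)
    (add : ∀ x y, p x → p y → p (x + y)) (smul : ∀ (c : k) x, p x → p (c • x))
    (gen_mul : ∀ v x, p x → p (j v * x)) (x : L) : p x := by
  have hx : x ∈ Algebra.adjoin k (Set.range j) := h ▸ Algebra.mem_top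
  have key : ∀ y, p y → p (x * y) := by
    induction hx using Algebra.adjoin_induction with
    | mem x hx =>
      obtain ⟨v, rfl⟩ := hx
      exact fun y hy => gen_mul v y hy
    | algebraMap r =>
      intro y hy
      rw [← Algebra.smul_def]
      exact smul _ _ hy
    | add a b _ _ ha hb =>
      intro y hy
      rw [add_mul]
      exact add _ _ (ha y hy) (hb y hy)
    | mul a b _ _ ha hb =>
      intro y hy
      rw [mul_assoc]
      exact ha _ (hb y hy)
  simpa using key 1 one

theorem _root_.BraidedExterior.linearMap_ext_left {j : V →ₗ[k] L}
    (h : Algebra.adjoin k (Set.range j) = ⊤) {M : Type*} [AddCommGroup M] [Module k M]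
    {f g : L →ₗ[k] M} (one : f 1 = g 1)
    (gen_mul : ∀ v x, f x = g x → f (j v * x) = g (j v * x)) : f = g := by
  ext x
  induction x using adjoin_induction_left h with
  | one => exact one
  | add x y hx hy => rw [map_add, map_add, hx, hy]
  | smul c x hx => rw [map_smul, map_smul, hx]
  | gen_mul v x hx => exact gen_mul v x hx

variable {X : CrossedData k A V} {j : V →ₗ[k] L} (G : Generated X L j)

theorem algHom_ext (G : Generated X L j) {R : Type*} [Ring R] [Algebra k R] {f g : L →ₐ[k] R}
    (h : ∀ v, f (j v) = g (j v)) : f = g :=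
  AlgHom.ext_of_adjoin_eq_top (s := Set.range j) G.adjoin_eq_top (by rintro _ ⟨v, rfl⟩; exact h v)

/-- The crossed module structure of `L`, before laws. -/
def crossed : CrossedData k A L where
  act := TensorProduct.lift ((WithConv.linearEquiv k _).toLinearMap ∘ₗ G.β.toLinearMap)
  coact := G.α.toLinearMap

@[simp] theorem crossed_act (x : L) (a : A) : G.crossed.act (x ⊗ₜ a) = G.β x a := rfl

@[simp] theorem crossed_coact (x : L) : G.crossed.coact x = G.α x := rfl

theorem P_P (x : L) : G.P (G.P x) = x := by
  have h : G.P.comp G.P = AlgHom.id k L := G.algHom_ext fun v => by simp [G.P_gen]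
  exact AlgHom.congr_fun h x

theorem α_P (x : L) : G.α (G.P x) = G.P.toLinearMap.rTensor A (G.α x) := by
  have h : G.α.comp G.P = (Algebra.TensorProduct.map G.P (AlgHom.id k A)).comp G.α :=
    G.algHom_ext fun v => by
      simp only [AlgHom.comp_apply, G.P_gen, map_neg, G.α_gen]
      generalize X.coact v = t
      induction t with
      | zero => simp
      | tmul m a => simp [G.P_gen, TensorProduct.neg_tmul]
      | add s t hs ht => simp only [map_add, neg_add, hs, ht]
  exact AlgHom.congr_fun h x

theorem β_P (x : L) (a : A) : G.β (G.P x) a = G.P (G.β x a) := by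
  have h : G.β.comp G.P = (Conv.post G.P).comp G.β :=
    G.algHom_ext fun v => Conv.ext' fun a => by simp [G.P_gen, G.β_gen]
  exact congr($h x a)

theorem ε_P (x : L) : G.ε (G.P x) = G.ε x := by
  have h : G.ε.comp G.P = G.ε := G.algHom_ext fun v => by simp [G.P_gen, G.ε_gen]
  exact AlgHom.congr_fun h x

theorem ε_α (x : L) : G.ε.toLinearMap.rTensor A (G.α x) = G.ε x ⊗ₜ 1 := by
  have h : (Algebra.TensorProduct.map G.ε (AlgHom.id k A)).comp G.α =
      (Algebra.ofId k (k ⊗[k] A)).comp G.ε := G.algHom_ext fun v => by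
    simp only [AlgHom.comp_apply, G.α_gen, G.ε_gen, map_zero]
    generalize X.coact v = t
    induction t with
    | zero => simp
    | tmul m a => simp [G.ε_gen]
    | add s t hs ht => simp only [map_add, hs, ht, add_zero]
  exact AlgHom.congr_fun h x

theorem ε_β (x : L) (a : A) : G.ε (G.β x a) = G.ε x * Coalgebra.counit (R := k) a := by
  have h : (Conv.post G.ε).comp G.β = Conv.const.comp G.ε :=
    G.algHom_ext fun v => Conv.ext' fun a => by simp [G.ε_gen, G.β_gen]
  have h' : (Conv.post G.ε (G.β x)) a = (Conv.const (G.ε x) : Conv k A k) a := congr($h x a)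
  simpa [mul_comm] using h'

theorem β_mul_apply (x y : L) (a : A) : G.β (x * y) a = LinearMap.mul' k L
    (TensorProduct.map (G.β x).ofConv (G.β y).ofConv (Coalgebra.comul (R := k) a)) := by
  rw [map_mul]; rfl

theorem pr_P (x : L) : G.pr (G.P x) = - G.pr x := by
  have h : G.pr ∘ₗ G.P.toLinearMap = - G.pr := linearMap_ext_left G.adjoin_eq_top
    (by simp [G.pr_one]) fun v x _ => by simp [G.P_gen, G.pr_gen, G.ε_P]
  exact LinearMap.congr_fun h x

theorem pr_α (x : L) : G.pr.rTensor A (G.α x) = X.coact (G.pr x) := by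
  have h : G.pr.rTensor A ∘ₗ G.α.toLinearMap = X.coact ∘ₗ G.pr :=
    linearMap_ext_left G.adjoin_eq_top
      (by simp [G.pr_one, Algebra.TensorProduct.one_def]) fun v x _ => by
      simp only [LinearMap.comp_apply, AlgHom.toLinearMap_apply, map_mul, G.α_gen, G.pr_gen,
        map_smul]
      have h1 : ∀ s : V ⊗[k] A, ∀ t : L ⊗[k] A, G.pr.rTensor A (j.rTensor A s * t) =
          LinearMap.lTensor V (LinearMap.mul' k A) (TensorProduct.assoc k V A A
            (s ⊗ₜ TensorProduct.lid k A (G.ε.toLinearMap.rTensor A t))) := by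
        intro s t
        induction s with
        | zero => simp
        | tmul v a =>
          induction t with
          | zero => simp
          | tmul y b => simp [G.pr_gen, TensorProduct.smul_tmul]
          | add s t hs ht => simp only [map_add, mul_add, hs, ht, TensorProduct.tmul_add]
        | add s t hs ht => simp only [map_add, add_mul, hs, ht, TensorProduct.add_tmul]
      rw [h1, G.ε_α]
      generalize X.coact v = s
      induction s with
      | zero => simp
      | tmul v a => simp
      | add s t hs ht => simp only [map_add, hs, ht, TensorProduct.add_tmul, smul_add]
  exact LinearMap.congr_fun h x

theorem pr_β (x : L) (a : A) : G.pr (G.β x a) = X.act (G.pr x ⊗ₜ a) := by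
  induction x using adjoin_induction_left G.adjoin_eq_top with
  | one => simp [G.pr_one, Algebra.algebraMap_eq_smul_one]
  | add x y hx hy => simp [hx, hy, TensorProduct.add_tmul]
  | smul c x hx => simp [hx, ← TensorProduct.smul_tmul']
  | gen_mul v x _ =>
    have h1 : G.pr ∘ₗ LinearMap.mul' k L ∘ₗ
        TensorProduct.map (G.β (j v)).ofConv (G.β x).ofConv =
        G.ε x • (TensorProduct.curry X.act v ∘ₗ (TensorProduct.rid k A).toLinearMap ∘ₗ
          (Coalgebra.counit (R := k) (A := A)).lTensor A) := by
      ext a b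
      simp [G.β_gen, G.pr_gen, G.ε_β, mul_smul]
    rw [β_mul_apply, G.pr_gen]
    have := LinearMap.congr_fun h1 (Coalgebra.comul a)
    simp only [LinearMap.comp_apply] at this
    rw [this]
    simp [← TensorProduct.smul_tmul']

theorem α_coassoc (hX : X.IsCrossedModule) (x : L) :
    TensorProduct.assoc k L A A (G.α.toLinearMap.rTensor A (G.α x)) =
    (Coalgebra.comul (R := k) (A := A)).lTensor L (G.α x) := by
  have h : ((Algebra.TensorProduct.assoc k k k L A A).toAlgHom.comp
      (Algebra.TensorProduct.map G.α (AlgHom.id k A))).comp G.α =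
      (Algebra.TensorProduct.map (AlgHom.id k L) (Bialgebra.comulAlgHom k A)).comp G.α :=
    G.algHom_ext fun v => by
      have h2 := congr((j.rTensor (A ⊗[k] A)) $(hX.coassoc v))
      simp only [AlgHom.comp_apply, G.α_gen]
      have e1 : ∀ t : V ⊗[k] A, (Algebra.TensorProduct.assoc k k k L A A).toAlgHom
          (Algebra.TensorProduct.map G.α (AlgHom.id k A) (j.rTensor A t)) =
          (j.rTensor (A ⊗[k] A)) (TensorProduct.assoc k V A A (X.coact.rTensor A t)) := by
        intro t
        induction t with
        | zero => simp
        | tmul m a =>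
          simp only [LinearMap.rTensor_tmul, Algebra.TensorProduct.map_tmul, G.α_gen]
          generalize X.coact m = s
          induction s with
          | zero => simp
          | tmul m a => simp
          | add s t hs ht => simp only [map_add, hs, ht, TensorProduct.add_tmul]
        | add s t hs ht => simp only [map_add, hs, ht]
      have e2 : ∀ t : V ⊗[k] A, Algebra.TensorProduct.map (AlgHom.id k L)
          (Bialgebra.comulAlgHom k A) (j.rTensor A t) =
          (j.rTensor (A ⊗[k] A)) ((Coalgebra.comul (R := k) (A := A)).lTensor V t) := by
        intro t
        induction t with
        | zero => simp
        | tmul m a => simp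
        | add s t hs ht => simp only [map_add, hs, ht]
      rw [e1, e2, h2]
  exact AlgHom.congr_fun h x

theorem α_counit (hX : X.IsCrossedModule) (x : L) :
    (Coalgebra.counit (R := k) (A := A)).lTensor L (G.α x) = x ⊗ₜ 1 := by
  have h : (Algebra.TensorProduct.map (AlgHom.id k L) (Bialgebra.counitAlgHom k A)).comp G.α =
      Algebra.TensorProduct.includeLeft := G.algHom_ext fun v => by
    have h2 := congr((j.rTensor k) $(hX.counit v))
    simp only [AlgHom.comp_apply, G.α_gen]
    have e2 : ∀ t : V ⊗[k] A, Algebra.TensorProduct.map (AlgHom.id k L)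
        (Bialgebra.counitAlgHom k A) (j.rTensor A t) =
        (j.rTensor k) ((Coalgebra.counit (R := k) (A := A)).lTensor V t) := by
      intro t
      induction t with
      | zero => simp
      | tmul m a => simp
      | add s t hs ht => simp only [map_add, hs, ht]
    rw [e2, h2]
    simp
  exact AlgHom.congr_fun h x

theorem β_apply_one (hX : X.IsCrossedModule) (x : L) : G.β x 1 = x := by
  have h : Conv.evalOne.comp G.β = AlgHom.id k L := G.algHom_ext fun v => by
    simp [G.β_gen, hX.act_one]
  exact AlgHom.congr_fun h x

theorem β_apply_mul (hX : X.IsCrossedModule) (x : L) (a b : A) :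
    G.β x (a * b) = G.β (G.β x a) b := by
  induction x using adjoin_induction_left G.adjoin_eq_top generalizing a b with
  | one => simp [Algebra.algebraMap_eq_smul_one, mul_smul]
  | add x y hx hy => simp [hx, hy]
  | smul c x hx => simp [hx]
  | gen_mul v x ih =>
    rw [β_mul_apply, β_mul_apply, Bialgebra.comul_mul]
    generalize (Coalgebra.comul (R := k) a) = s
    induction s with
    | zero => simp
    | tmul a a' =>
      simp only [TensorProduct.map_tmul, LinearMap.mul'_apply]
      rw [β_mul_apply]
      generalize (Coalgebra.comul (R := k) b) = t
      induction t with
      | zero => simp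
      | tmul b b' => simp [G.β_gen, hX.act_mul, ih]
      | add s t hs ht => simp only [map_add, mul_add, hs, ht]
    | add s t hs ht => simp only [map_add, add_mul, hs, ht, ofConv_add, LinearMap.add_apply]

theorem twist_eq (t : L ⊗[k] A) (a : A) : G.crossed.twist (t ⊗ₜ comul₃ k A a) =
    (Conv.inclInv L * (actLeft G.β t * Conv.incl L) : Conv k A (L ⊗[k] A)) a := by
  induction t with
  | zero => simp
  | tmul y c =>
    simp only [comul₃, LinearMap.comp_apply, LinearMap.convMul_apply]
    generalize (Coalgebra.comul (R := k) a) = s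
    induction s with
    | zero => simp
    | tmul a b =>
      simp only [LinearMap.lTensor_tmul, TensorProduct.map_tmul, LinearMap.mul'_apply,
        LinearMap.convMul_apply]
      generalize (Coalgebra.comul (R := k) b) = s
      induction s with
      | zero => simp
      | tmul a b =>
        simp [CrossedData.twist, antipodeSandwich, actLeft_tmul]
      | add s t hs ht => simp only [map_add, mul_add, hs, ht, TensorProduct.tmul_add]
    | add s t hs ht => simp only [map_add, hs, ht, TensorProduct.tmul_add]
  | add s t hs ht => simp only [map_add, hs, ht, TensorProduct.add_tmul, mul_add, add_mul,
      ofConv_add, LinearMap.add_apply]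

theorem twist_gen (t : V ⊗[k] A) (s : A ⊗[k] (A ⊗[k] A)) :
    j.rTensor A (X.twist (t ⊗ₜ s)) = G.crossed.twist (j.rTensor A t ⊗ₜ s) := by
  induction t with
  | zero => simp
  | tmul y c =>
    induction s with
    | zero => simp
    | tmul a s =>
      induction s with
      | zero => simp
      | tmul b d => simp [CrossedData.twist, antipodeSandwich, G.β_gen]
      | add s t hs ht => simp only [map_add, hs, ht, TensorProduct.tmul_add]
    | add s t hs ht => simp only [map_add, hs, ht, TensorProduct.tmul_add]
  | add s t hs ht => simp only [map_add, hs, ht, TensorProduct.add_tmul]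

theorem post_α_β (hX : X.IsCrossedModule) (x : L) : Conv.post G.α (G.β x) =
    Conv.inclInv L * (actLeft G.β (G.α x) * Conv.incl L) := by
  have key : ∀ f g : Conv k A (L ⊗[k] A),
      (Conv.inclInv L * (f * Conv.incl L)) * (Conv.inclInv L * (g * Conv.incl L)) =
      Conv.inclInv L * ((f * g) * Conv.incl L) := fun f g => by
    calc _ = Conv.inclInv L * f * (Conv.incl L * Conv.inclInv L) * (g * Conv.incl L) := by
          simp only [mul_assoc]
      _ = _ := by rw [Conv.incl_mul_inclInv, mul_one]; simp only [mul_assoc]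
  induction x using adjoin_induction_left G.adjoin_eq_top with
  | one => rw [map_one, map_one, map_one, map_one, one_mul, Conv.inclInv_mul_incl]
  | add x y hx hy => simp only [map_add, hx, hy, add_mul, mul_add]
  | smul c x hx => simp only [map_smul, hx, smul_mul_assoc, mul_smul_comm]
  | gen_mul v x ih =>
    have h : Conv.post G.α (G.β (j v)) =
        Conv.inclInv L * (actLeft G.β (G.α (j v)) * Conv.incl L) := Conv.ext' fun a => by
      rw [← twist_eq, G.α_gen, ← twist_gen, ← hX.compat, Conv.post_apply, G.β_gen, G.α_gen]
    rw [map_mul, map_mul, map_mul, map_mul, ih, h, key]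

theorem incl_mul_post_α_β (hX : X.IsCrossedModule) (x : L) : Conv.incl L * Conv.post G.α (G.β x) =
    actLeft G.β (G.α x) * Conv.incl L := by
  rw [G.post_α_β hX, ← mul_assoc, Conv.incl_mul_inclInv, one_mul]

theorem isCrossedModule (hX : X.IsCrossedModule) : G.crossed.IsCrossedModule where
  act_one x := by rw [crossed_act, G.β_apply_one hX]
  act_mul x a b := by simp [G.β_apply_mul hX]
  coassoc x := G.α_coassoc hX x
  counit x := G.α_counit hX x
  compat x a := by
    rw [crossed_coact, crossed_coact, crossed_act, twist_eq, ← G.post_α_β hX, Conv.post_apply]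

theorem generators_morphism : X.IsMorphism G.crossed j where
  act v a := by rw [crossed_act, G.β_gen]
  coact v := by rw [crossed_coact, G.α_gen]

theorem mul_morphism : (G.crossed.tensor G.crossed).IsMorphism G.crossed (LinearMap.mul' k L) where
  act z a := by
    induction z with
    | zero => simp
    | tmul x y =>
      rw [LinearMap.mul'_apply, crossed_act, β_mul_apply]
      simp only [CrossedData.tensor, LinearMap.comp_apply, LinearMap.lTensor_tmul]
      generalize (Coalgebra.comul (R := k) a) = s
      induction s with
      | zero => simp
      | tmul a b => simp
      | add s t hs ht => simp only [map_add, hs, ht, TensorProduct.tmul_add]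
    | add s t hs ht => simp only [map_add, hs, ht, TensorProduct.add_tmul]
  coact z := by
    induction z with
    | zero => simp
    | tmul x y =>
      rw [LinearMap.mul'_apply, crossed_coact, map_mul]
      simp only [CrossedData.tensor, LinearMap.comp_apply, TensorProduct.map_tmul, crossed_coact]
      generalize G.α x = s
      generalize G.α y = t
      induction s with
      | zero => simp
      | tmul x a =>
        induction t with
        | zero => simp
        | tmul y b => simp
        | add s t hs ht => simp only [map_add, hs, ht, TensorProduct.tmul_add, mul_add]
      | add s t hs ht => simp only [map_add, hs, ht, TensorProduct.add_tmul, add_mul]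
    | add s t hs ht => simp only [map_add, hs, ht]

theorem one_morphism : (CrossedData.unit k A).IsMorphism G.crossed (Algebra.linearMap k L) where
  act c a := by
    simp [CrossedData.unit, Algebra.algebraMap_eq_smul_one, mul_smul]
  coact c := by
    simp [CrossedData.unit, Algebra.algebraMap_eq_smul_one, Algebra.TensorProduct.one_def,
      ← TensorProduct.smul_tmul']

theorem counit_morphism : G.crossed.IsMorphism (CrossedData.unit k A) G.ε.toLinearMap where
  act x a := by simp [CrossedData.unit, G.ε_β]
  coact x := by
    rw [crossed_coact, ε_α]
    simp [CrossedData.unit]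

end Generated

end Generated

section Coproduct

open WithConv

variable {k : Type u} {A : Type v} [Field k] [Ring A] [HopfAlgebra k A]
variable {V : Type w} [AddCommGroup V] [Module k V]
variable {L : Type x} [Ring L] [Algebra k L]

namespace Conv

variable {M : Type*} [AddCommGroup M] [Module k M] {N : Type*} [AddCommGroup N] [Module k N]
variable {R : Type*} [Ring R] [Algebra k R]

/-- `m ⊗ n ↦ m₀ ⊗ g(m₁)(n)`. -/
def coAct (c : M →ₗ[k] M ⊗[k] A) (g : A →ₗ[k] N →ₗ[k] N) : M ⊗[k] N →ₗ[k] M ⊗[k] N :=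
  (TensorProduct.lift g).lTensor M ∘ₗ (TensorProduct.assoc k M A N).toLinearMap ∘ₗ c.rTensor N

/-- `m ⊗ a ↦ m ⊗ g(a)(n)`. -/
def fillAct (g : A →ₗ[k] N →ₗ[k] N) (n : N) : M ⊗[k] A →ₗ[k] M ⊗[k] N :=
  (g.flip n).lTensor M

@[simp] theorem fillAct_tmul (g : A →ₗ[k] N →ₗ[k] N) (n : N) (m : M) (a : A) :
    fillAct g n (m ⊗ₜ[k] a) = m ⊗ₜ g a n := rfl

theorem coAct_tmul (c : M →ₗ[k] M ⊗[k] A) (g : A →ₗ[k] N →ₗ[k] N) (m : M) (n : N) :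
    coAct c g (m ⊗ₜ n) = fillAct g n (c m) := by
  simp only [coAct, LinearMap.comp_apply, LinearMap.rTensor_tmul, LinearEquiv.coe_coe]
  generalize c m = t
  induction t with
  | zero => simp
  | tmul m a => simp
  | add s t hs ht => simp only [TensorProduct.add_tmul, map_add, hs, ht]

/-- `f(c ·)`. -/
def shift (f : Conv k A R) (c : A) : Conv k A R := toConv (f.ofConv ∘ₗ LinearMap.mulLeft k c)

@[simp] theorem shift_apply (f : Conv k A R) (c a : A) : shift f c a = f (c * a) := rfl

theorem shift_add (f : Conv k A R) (c d : A) : shift f (c + d) = shift f c + shift f d :=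
  ext' fun a => by simp [add_mul]

/-- Right multiplication of the second tensor factor commutes with `coOpₗ`. -/
theorem coOpₗ_mulRight (c : M →ₗ[k] M ⊗[k] A) (f : Conv k A R) (y : R) (z : M ⊗[k] R) :
    coOpₗ c f ((LinearMap.mulRight k y).lTensor M z) =
      (LinearMap.mulRight k y).lTensor M (coOpₗ c f z) := by
  induction z with
  | zero => simp
  | tmul m w =>
    simp only [LinearMap.lTensor_tmul, coOpₗ_tmul]
    generalize c m = t
    induction t with
    | zero => simp
    | tmul m a => simp [mul_assoc]
    | add s t hs ht => simp only [map_add, hs, ht]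
  | add s t hs ht => simp only [map_add, hs, ht]

end Conv

namespace Generated

variable {X : CrossedData k A V} {j : V →ₗ[k] L} (G : Generated X L j)

/-- Left multiplication of the first tensor factor. -/
def lmulFst (M : Type*) [AddCommGroup M] [Module k M] (z : L) : Module.End k (L ⊗[k] M) :=
  (LinearMap.mulLeft k z).rTensor M

@[simp] theorem lmulFst_tmul {M : Type*} [AddCommGroup M] [Module k M] (z y : L) (m : M) :
    lmulFst M z (y ⊗ₜ[k] m) = (z * y) ⊗ₜ m := rfl

theorem lmulFst_mul {M : Type*} [AddCommGroup M] [Module k M] (z y : L) :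
    (lmulFst M (z * y) : Module.End k (L ⊗[k] M)) = lmulFst M z * lmulFst M y := by
  ext a b; simp [mul_assoc]

theorem lmulFst_add {M : Type*} [AddCommGroup M] [Module k M] (z y : L) :
    (lmulFst M (z + y) : Module.End k (L ⊗[k] M)) = lmulFst M z + lmulFst M y := by
  ext a b; simp [add_mul, TensorProduct.add_tmul]

/-- The parity of the first tensor factor. -/
def parityFst (M : Type*) [AddCommGroup M] [Module k M] : Module.End k (L ⊗[k] M) :=
  G.P.toLinearMap.rTensor M

@[simp] theorem parityFst_tmul {M : Type*} [AddCommGroup M] [Module k M] (y : L) (m : M) :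
    G.parityFst M (y ⊗ₜ[k] m) = G.P y ⊗ₜ m := rfl

/-- The operators `z ⊗ r ↦ z₀ ⊗ f(z₁) r`. -/
def op {R : Type*} [Ring R] [Algebra k R] (f : Conv k A R) : Module.End k (L ⊗[k] R) :=
  Conv.coOpₗ G.α.toLinearMap f

section Op

variable {R : Type*} [Ring R] [Algebra k R]

theorem op_tmul (f : Conv k A R) (z : L) (r : R) :
    G.op f (z ⊗ₜ r) = Conv.fill f r (G.α z) := Conv.coOpₗ_tmul _ _ _ _

theorem op_add (f g : Conv k A R) : G.op (f + g) = G.op f + G.op g := map_add _ _ _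

theorem op_sub (f g : Conv k A R) : G.op (f - g) = G.op f - G.op g := map_sub _ _ _

theorem op_neg (f : Conv k A R) : G.op (-f) = - G.op f := map_neg _ _

theorem op_zero : G.op (0 : Conv k A R) = 0 := map_zero _

theorem op_smul (c : k) (f : Conv k A R) : G.op (c • f) = c • G.op f := map_smul _ _ _

theorem op_mul (hX : X.IsCrossedModule) (f g : Conv k A R) : G.op (f * g) = G.op f * G.op g :=
  Conv.coOpₗ_mul _ (G.α_coassoc hX) f g

theorem op_one (hX : X.IsCrossedModule) : G.op (1 : Conv k A R) = 1 :=
  Conv.coOpₗ_one _ (G.α_counit hX)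

theorem parityFst_mul_parityFst {M : Type*} [AddCommGroup M] [Module k M] :
    G.parityFst M * G.parityFst M = 1 := by
  ext a b; simp [G.P_P]

theorem parityFst_mul_lmulFst {M : Type*} [AddCommGroup M] [Module k M] (z : L) :
    G.parityFst M * lmulFst M z = lmulFst M (G.P z) * G.parityFst M := by
  ext a b; simp

theorem parityFst_mul_op (f : Conv k A R) : G.parityFst R * G.op f = G.op f * G.parityFst R := by
  ext z r
  simp only [TensorProduct.AlgebraTensorModule.curry_apply, TensorProduct.curry_apply,
    LinearMap.coe_restrictScalars, Module.End.mul_apply, op_tmul, parityFst_tmul, α_P]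
  generalize G.α z = t
  induction t with
  | zero => simp
  | tmul m a => simp
  | add s t hs ht => simp only [map_add, hs, ht]

/-- `Σ ℓ(z₀) f(z₁ ·)` for a tensor `z₀ ⊗ z₁`. -/
def pushed (f : Conv k A R) : L ⊗[k] A →ₗ[k] Module.End k (L ⊗[k] R) :=
  TensorProduct.lift (LinearMap.mk₂ k (fun z c => lmulFst R z * G.op (Conv.shift f c))
    (fun z y c => by rw [lmulFst_add, add_mul])
    (fun r z c => by
      rw [← smul_mul_assoc]; congr 1; ext a b; simp [TensorProduct.smul_tmul'])
    (fun z c d => by rw [Conv.shift_add, op_add, mul_add])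
    (fun r z c => by
      rw [← mul_smul_comm, ← op_smul]; congr 2; exact Conv.ext' fun a => by simp))

@[simp] theorem pushed_tmul (f : Conv k A R) (z : L) (c : A) :
    G.pushed f (z ⊗ₜ c) = lmulFst R z * G.op (Conv.shift f c) := rfl

theorem op_mul_lmulFst (f : Conv k A R) (z : L) :
    G.op f * lmulFst R z = G.pushed f (G.α z) := by
  ext y r
  simp only [TensorProduct.AlgebraTensorModule.curry_apply, TensorProduct.curry_apply,
    LinearMap.coe_restrictScalars, Module.End.mul_apply, op_tmul, lmulFst_tmul, map_mul]
  generalize G.α z = s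
  induction s with
  | zero => simp
  | tmul z a =>
    simp only [pushed_tmul, Module.End.mul_apply, op_tmul]
    generalize G.α y = t
    induction t with
    | zero => simp
    | tmul y b => simp
    | add s t hs ht => simp only [map_add, hs, ht, mul_add]
  | add s t hs ht => simp only [map_add, hs, ht, add_mul, LinearMap.add_apply]

theorem shift_β (hX : X.IsCrossedModule) (x : L) (c : A) :
    Conv.shift (G.β x) c = G.β (G.β x c) :=
  Conv.ext' fun a => G.β_apply_mul hX x c a

end Op

/-- The operator of multiplication by `v ⊗ 1 + 1 ⊗ v` in the super-braided tensor square. -/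
def primOp (v : V) : Module.End k (L ⊗[k] L) :=
  lmulFst L (j v) + G.op (G.β (j v)) * G.parityFst L

theorem primOp_tmul (v : V) (z w : L) : G.primOp v (z ⊗ₜ w) =
    (j v * z) ⊗ₜ w + Conv.fill (G.β (j v)) w (G.α (G.P z)) := by
  simp [primOp, op_tmul]

/-- `Δ` is the coproduct of `L` for which the generators are primitive. -/
structure IsCoproduct (Δ : L →ₗ[k] L ⊗[k] L) : Prop where
  one : Δ 1 = 1 ⊗ₜ 1
  gen_mul : ∀ v x, Δ (j v * x) = G.primOp v (Δ x)

variable {G} {Δ : L →ₗ[k] L ⊗[k] L}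

namespace IsCoproduct

theorem counit_left (hX : X.IsCrossedModule) (h : G.IsCoproduct Δ) (x : L) :
    G.ε.toLinearMap.rTensor L (Δ x) = 1 ⊗ₜ x := by
  have key : G.ε.toLinearMap.rTensor L ∘ₗ Δ = TensorProduct.mk k k L 1 := by
    refine linearMap_ext_left G.adjoin_eq_top (by simp [h.one]) fun v x ih => ?_
    simp only [LinearMap.comp_apply] at ih ⊢
    have e : ∀ Z, G.ε.toLinearMap.rTensor L (G.primOp v Z) =
        (LinearMap.mulLeft k (j v)).lTensor k (G.ε.toLinearMap.rTensor L Z) := by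
      intro Z
      induction Z with
      | zero => simp
      | tmul z w =>
        have e2 : ∀ t : L ⊗[k] A, G.ε.toLinearMap.rTensor L (Conv.fill (G.β (j v)) w t) =
            Conv.fill (G.β (j v)) w (G.ε.toLinearMap.rTensor A t) := by
          intro t
          induction t with
          | zero => simp
          | tmul z c => simp
          | add s t hs ht => simp only [map_add, hs, ht]
        rw [primOp_tmul, map_add, e2, G.ε_α]
        simp [G.ε_gen, G.ε_P, G.β_apply_one hX]
      | add s t hs ht => simp only [map_add, hs, ht]
    rw [h.gen_mul, e, ih]
    simp
  exact LinearMap.congr_fun key x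

theorem counit_right (h : G.IsCoproduct Δ) (x : L) :
    G.ε.toLinearMap.lTensor L (Δ x) = x ⊗ₜ 1 := by
  have key : G.ε.toLinearMap.lTensor L ∘ₗ Δ = (TensorProduct.mk k L k).flip 1 := by
    refine linearMap_ext_left G.adjoin_eq_top (by simp [h.one]) fun v x ih => ?_
    simp only [LinearMap.comp_apply] at ih ⊢
    have e : ∀ Z, G.ε.toLinearMap.lTensor L (G.primOp v Z) =
        lmulFst k (j v) (G.ε.toLinearMap.lTensor L Z) := by
      intro Z
      induction Z with
      | zero => simp
      | tmul z w =>
        have e2 : ∀ t : L ⊗[k] A, G.ε.toLinearMap.lTensor L (Conv.fill (G.β (j v)) w t) = 0 := by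
          intro t
          induction t with
          | zero => simp
          | tmul z c => simp [G.ε_β, G.ε_gen]
          | add s t hs ht => simp only [map_add, hs, ht, add_zero]
        rw [primOp_tmul, map_add, e2]
        simp
      | add s t hs ht => simp only [map_add, hs, ht]
    rw [h.gen_mul, e, ih]
    simp
  exact LinearMap.congr_fun key x

theorem parity (h : G.IsCoproduct Δ) (x : L) :
    Δ (G.P x) = TensorProduct.map G.P.toLinearMap G.P.toLinearMap (Δ x) := by
  have key : Δ ∘ₗ G.P.toLinearMap = TensorProduct.map G.P.toLinearMap G.P.toLinearMap ∘ₗ Δ := by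
    refine linearMap_ext_left G.adjoin_eq_top (by simp [h.one]) fun v x ih => ?_
    simp only [LinearMap.comp_apply, AlgHom.toLinearMap_apply] at ih ⊢
    have e : ∀ Z, G.primOp v (TensorProduct.map G.P.toLinearMap G.P.toLinearMap Z) =
        - TensorProduct.map G.P.toLinearMap G.P.toLinearMap (G.primOp v Z) := by
      intro Z
      induction Z with
      | zero => simp
      | tmul z w =>
        simp only [TensorProduct.map_tmul, primOp_tmul, AlgHom.toLinearMap_apply, map_add, α_P]
        rw [neg_add]
        congr 1
        · simp [G.P_gen, TensorProduct.neg_tmul]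
        generalize G.α z = t
        induction t with
        | zero => simp
        | tmul z c => simp [← G.β_P, G.P_gen, TensorProduct.tmul_neg]
        | add s t hs ht => simp only [map_add, hs, ht, neg_add]
      | add s t hs ht => simp only [map_add, hs, ht, neg_add]
    rw [h.gen_mul, map_mul, G.P_gen, neg_mul, map_neg, h.gen_mul, ih, e, neg_neg]
  exact LinearMap.congr_fun key x

end IsCoproduct

variable (G)

/-- The coaction `z ⊗ w ↦ z₀ ⊗ (w₀ ⊗ z₁ w₁)` on the tensor square. -/
def coactSq : L ⊗[k] L →ₗ[k] L ⊗[k] (L ⊗[k] A) :=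
  G.op (Conv.incl L) ∘ₗ G.α.toLinearMap.lTensor L

theorem coactSq_eq (Z : L ⊗[k] L) :
    TensorProduct.assoc k L L A ((G.crossed.tensor G.crossed).coact Z) = G.coactSq Z := by
  induction Z with
  | zero => simp
  | tmul z w =>
    simp only [CrossedData.tensor, LinearMap.comp_apply, TensorProduct.map_tmul, crossed_coact,
      coactSq, LinearMap.lTensor_tmul, AlgHom.toLinearMap_apply, op_tmul, LinearEquiv.coe_coe]
    generalize G.α z = s
    generalize G.α w = t
    induction s with
    | zero => simp
    | tmul z a =>
      induction t with
      | zero => simp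
      | tmul w b => simp
      | add s t hs ht => simp only [map_add, TensorProduct.tmul_add, hs, ht,
          Conv.fill_tmul, mul_add]
    | add s t hs ht => simp only [map_add, TensorProduct.add_tmul, hs, ht]
  | add s t hs ht => simp only [map_add, hs, ht]

theorem coactSq_op (hX : X.IsCrossedModule) (f : Conv k A L) (Z : L ⊗[k] L) :
    G.coactSq (G.op f Z) = G.op (Conv.incl L * Conv.post G.α f) (G.α.toLinearMap.lTensor L Z) := by
  rw [G.op_mul hX, coactSq, LinearMap.comp_apply, Module.End.mul_apply]
  congr 1
  induction Z with
  | zero => simp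
  | tmul z w =>
    simp only [LinearMap.lTensor_tmul, op_tmul, AlgHom.toLinearMap_apply]
    generalize G.α z = s
    induction s with
    | zero => simp
    | tmul z a => simp
    | add s t hs ht => simp only [map_add, hs, ht]
  | add s t hs ht => simp only [map_add, hs, ht]

/-- `z ⊗ (w ⊗ b) ↦ Σ v₀ z ⊗ (w ⊗ v₁ b)`. -/
def lmulFstCoact : L ⊗[k] A →ₗ[k] Module.End k (L ⊗[k] (L ⊗[k] A)) :=
  TensorProduct.lift (LinearMap.mk₂ k (fun z c => lmulFst (L ⊗[k] A) z *
      (LinearMap.mulLeft k ((1 : L) ⊗ₜ[k] c)).lTensor L)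
    (fun z y c => by rw [lmulFst_add, add_mul])
    (fun r z c => by
      rw [← smul_mul_assoc]; congr 1; ext a b; simp [TensorProduct.smul_tmul'])
    (fun z c d => by
      ext; simp [TensorProduct.tmul_add, add_mul])
    (fun r z c => by
      ext; simp))

@[simp] theorem lmulFstCoact_tmul (z : L) (c : A) :
    lmulFstCoact (z ⊗ₜ[k] c) = lmulFst (L ⊗[k] A) z *
      (LinearMap.mulLeft k ((1 : L) ⊗ₜ[k] c)).lTensor L := rfl

theorem pushed_incl (t : L ⊗[k] A) :
    G.pushed (Conv.incl L) t = lmulFstCoact t * G.op (Conv.incl L) := by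
  induction t with
  | zero => simp
  | tmul z c =>
    rw [pushed_tmul, lmulFstCoact_tmul, mul_assoc]
    congr 1
    ext y w b
    simp only [TensorProduct.AlgebraTensorModule.curry_apply, TensorProduct.curry_apply,
      LinearMap.coe_restrictScalars, Module.End.mul_apply, op_tmul]
    generalize G.α y = t
    induction t with
    | zero => simp
    | tmul z c => simp [mul_assoc]
    | add s t hs ht => simp only [map_add, hs, ht]
  | add s t hs ht => simp only [map_add, hs, ht, add_mul]

namespace IsCoproduct

variable {G}

theorem coact (hX : X.IsCrossedModule) (h : G.IsCoproduct Δ) (x : L) :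
    G.coactSq (Δ x) = TensorProduct.assoc k L L A (Δ.rTensor A (G.α x)) := by
  have key : G.coactSq ∘ₗ Δ =
      (TensorProduct.assoc k L L A).toLinearMap ∘ₗ Δ.rTensor A ∘ₗ G.α.toLinearMap := by
    refine linearMap_ext_left G.adjoin_eq_top ?_ fun v x ih => ?_
    · simp [h.one, coactSq, op_tmul, Algebra.TensorProduct.one_def]
    simp only [LinearMap.comp_apply, AlgHom.toLinearMap_apply, LinearEquiv.coe_coe] at ih ⊢
    have e1 : ∀ Z, G.coactSq (G.primOp v Z) = (lmulFstCoact (G.α (j v)) +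
        G.op (actLeft G.β (G.α (j v))) * G.parityFst (L ⊗[k] A)) (G.coactSq Z) := by
      intro Z
      have c1 : ∀ Z, G.α.toLinearMap.lTensor L (lmulFst L (j v) Z) =
          lmulFst _ (j v) (G.α.toLinearMap.lTensor L Z) := fun Z => by
        induction Z with
        | zero => simp
        | tmul z w => simp
        | add s t hs ht => simp only [map_add, hs, ht]
      have c2 : ∀ Z, G.α.toLinearMap.lTensor L (G.parityFst L Z) =
          G.parityFst _ (G.α.toLinearMap.lTensor L Z) := fun Z => by
        induction Z with
        | zero => simp
        | tmul z w => simp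
        | add s t hs ht => simp only [map_add, hs, ht]
      rw [primOp, LinearMap.add_apply, LinearMap.add_apply, map_add]
      congr 1
      · rw [coactSq, LinearMap.comp_apply, c1, ← Module.End.mul_apply, op_mul_lmulFst,
          pushed_incl]
        rfl
      · rw [Module.End.mul_apply, coactSq_op G hX, G.incl_mul_post_α_β hX, G.op_mul hX, c2]
        simp only [coactSq, Module.End.mul_apply, LinearMap.comp_apply]
        rw [← Module.End.mul_apply (G.op (Conv.incl L)), ← parityFst_mul_op]
        rfl
    have e2 : ∀ (s : V ⊗[k] A) (t : L ⊗[k] A),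
        TensorProduct.assoc k L L A (Δ.rTensor A (j.rTensor A s * t)) =
        (lmulFstCoact (j.rTensor A s) + G.op (actLeft G.β (j.rTensor A s)) *
          G.parityFst (L ⊗[k] A)) (TensorProduct.assoc k L L A (Δ.rTensor A t)) := by
      intro s t
      induction s with
      | zero => simp [op_zero]
      | tmul u c =>
        induction t with
        | zero => simp
        | tmul y b =>
          simp only [LinearMap.rTensor_tmul, Algebra.TensorProduct.tmul_mul_tmul, h.gen_mul]
          generalize Δ y = Z
          induction Z with
          | zero => simp
          | tmul z w =>
            rw [primOp_tmul]
            simp only [TensorProduct.assoc_tmul, LinearMap.add_apply, lmulFstCoact_tmul,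
              Module.End.mul_apply, parityFst_tmul, op_tmul, TensorProduct.add_tmul, map_add,
              LinearMap.lTensor_tmul, lmulFst_tmul, LinearMap.mulLeft_apply,
              Algebra.TensorProduct.tmul_mul_tmul, one_mul]
            congr 1
            generalize G.α (G.P z) = t
            induction t with
            | zero => simp
            | tmul z a => simp [actLeft_tmul]
            | add s t hs ht => simp only [map_add, hs, ht, TensorProduct.add_tmul]
          | add s t hs ht => simp only [map_add, hs, ht, TensorProduct.add_tmul]
        | add s t hs ht => simp only [map_add, hs, ht, mul_add]
      | add s t hs ht =>
        simp only [map_add, hs, ht, add_mul, op_add, LinearMap.add_apply]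
        abel
    rw [h.gen_mul, e1, ih, map_mul, G.α_gen, e2]
  exact LinearMap.congr_fun key x

end IsCoproduct

/-- The diagonal action on the tensor square: `z ⊗ w ↦ (a ↦ z ◁ a₁ ⊗ w ◁ a₂)`. -/
def actSq : L ⊗[k] L →ₗ[k] Conv k A (L ⊗[k] L) :=
  TensorProduct.lift (((LinearMap.mul k (Conv k A (L ⊗[k] L))).compl₁₂
    ((Conv.post Algebra.TensorProduct.includeLeft).comp G.β).toLinearMap)
    ((Conv.post Algebra.TensorProduct.includeRight).comp G.β).toLinearMap)

theorem actSq_tmul (z w : L) : G.actSq (z ⊗ₜ w) =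
    Conv.post Algebra.TensorProduct.includeLeft (G.β z) *
      Conv.post Algebra.TensorProduct.includeRight (G.β w) := rfl

theorem actSq_eq (Z : L ⊗[k] L) (a : A) :
    (G.crossed.tensor G.crossed).act (Z ⊗ₜ a) = G.actSq Z a := by
  induction Z with
  | zero => simp
  | tmul z w =>
    simp only [CrossedData.tensor, LinearMap.comp_apply, actSq_tmul, LinearMap.lTensor_tmul,
      LinearMap.convMul_apply]
    generalize (Coalgebra.comul (R := k) a) = s
    induction s with
    | zero => simp
    | tmul a b => simp
    | add s t hs ht => simp only [map_add, hs, ht, TensorProduct.tmul_add]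
  | add s t hs ht => simp only [map_add, hs, ht, TensorProduct.add_tmul, ofConv_add,
      LinearMap.add_apply]

/-- `a ⊗ Z ↦ primOp(v ◁ a) Z`. -/
def primOpAct (v : V) : A ⊗[k] (L ⊗[k] L) →ₗ[k] L ⊗[k] L :=
  TensorProduct.lift (LinearMap.mk₂ k (fun a Z => G.primOp (X.act (v ⊗ₜ a)) Z)
    (fun a b Z => by
      simp [primOp, TensorProduct.tmul_add, lmulFst_add, op_add, add_mul]; abel)
    (fun c a Z => by
      simp only [primOp, TensorProduct.tmul_smul, map_smul, op_smul, LinearMap.add_apply,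
        smul_mul_assoc, LinearMap.smul_apply, smul_add]
      congr 1
      induction Z with
      | zero => simp
      | tmul z w => simp [TensorProduct.smul_tmul']
      | add s t hs ht => simp only [map_add, hs, ht, smul_add])
    (fun a Z W => map_add _ _ _) (fun c a Z => map_smul _ _ _))

@[simp] theorem primOpAct_tmul (v : V) (a : A) (Z : L ⊗[k] L) :
    G.primOpAct v (a ⊗ₜ Z) = G.primOp (X.act (v ⊗ₜ a)) Z := rfl

theorem actSq_primOp (hX : X.IsCrossedModule) (v : V) (Z : L ⊗[k] L) (a : A) :
    G.actSq (G.primOp v Z) a =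
      G.primOpAct v ((G.actSq Z).ofConv.lTensor A (Coalgebra.comul (R := k) a)) := by
  induction Z with
  | zero => simp
  | add s t hs ht => simp only [map_add, hs, ht, ofConv_add, LinearMap.add_apply,
      LinearMap.lTensor_add]
  | tmul z w =>
    let i₁ : L →ₐ[k] L ⊗[k] L := Algebra.TensorProduct.includeLeft
    let i₂ : L →ₐ[k] L ⊗[k] L := Algebra.TensorProduct.includeRight
    -- the map `x ⊗ c ↦ P x ⊗ (v ◁ c)`
    let ψ : L ⊗[k] A →ₗ[k] L ⊗[k] L := TensorProduct.map G.P.toLinearMap (G.β (j v)).ofConv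
    let N : Conv k A (L ⊗[k] L) :=
      toConv (ψ ∘ₗ (Conv.incl L * Conv.post G.α (G.β z) : Conv k A (L ⊗[k] A)).ofConv)
    have e1 : ∀ b, ∀ Y : L ⊗[k] L, lmulFst L (G.β (j v) b) Y = i₁ (G.β (j v) b) * Y := by
      intro b Y
      induction Y with
      | zero => simp
      | tmul z w => simp [i₁]
      | add s t hs ht => simp only [map_add, hs, ht, mul_add]
    have e2 : ∀ b c, (G.op (G.β (j (X.act (v ⊗ₜ b)))) * G.parityFst L) (i₁ (G.β z c)) =
        ψ ((Conv.incl L : Conv k A _) b * Conv.post G.α (G.β z) c) := by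
      intro b c
      simp only [Module.End.mul_apply, i₁, Algebra.TensorProduct.includeLeft_apply,
        parityFst_tmul, op_tmul, α_P, Conv.incl_apply, Conv.post_apply]
      generalize G.α (G.β z c) = t
      induction t with
      | zero => simp
      | tmul z a => simp [ψ, ← G.β_gen, G.β_apply_mul hX]
      | add s t hs ht => simp only [map_add, hs, ht, mul_add]
    have e3 : N = toConv (ψ ∘ₗ (actLeft G.β (G.α z) * Conv.incl L : Conv k A _).ofConv) := by
      simp only [N, G.incl_mul_post_α_β hX]
    have e4 : G.actSq (Conv.fill (G.β (j v)) w (G.α (G.P z))) = N * Conv.post i₂ (G.β w) := by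
      rw [e3, α_P]
      generalize G.α z = t
      induction t with
      | zero =>
        simp
      | tmul y c =>
        simp only [LinearMap.rTensor_tmul, AlgHom.toLinearMap_apply, Conv.fill_tmul, actSq_tmul,
          map_mul]
        rw [← mul_assoc]
        congr 1
        refine Conv.ext' fun b => ?_
        simp only [LinearMap.convMul_apply, LinearMap.comp_apply]
        generalize (Coalgebra.comul (R := k) b) = s
        induction s with
        | zero => simp
        | tmul b b' => simp [ψ, actLeft_tmul, G.β_P, G.β_apply_mul hX]
        | add s t hs ht => simp only [map_add, hs, ht]
      | add s t hs ht =>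
        simp only [map_add, hs, ht, add_mul, ofConv_add, LinearMap.comp_add, toConv_add]
    have e5 : ∀ f : Conv k A L, ∀ Y, ∀ y, G.op f (G.parityFst L (Y * i₂ y)) =
        G.op f (G.parityFst L Y) * i₂ y := by
      intro f Y y
      induction Y with
      | zero => simp
      | tmul z w =>
        simp only [i₂, Algebra.TensorProduct.includeRight_apply,
          Algebra.TensorProduct.tmul_mul_tmul, mul_one, parityFst_tmul, op_tmul]
        generalize G.α (G.P z) = t
        induction t with
        | zero => simp
        | tmul z a => simp [mul_assoc]
        | add s t hs ht => simp only [map_add, hs, ht, add_mul]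
      | add s t hs ht => simp only [map_add, hs, ht, add_mul]
    rw [primOp_tmul, map_add, e4, actSq_tmul, map_mul, map_mul]
    have e6 : G.primOpAct v ((G.actSq (z ⊗ₜ w)).ofConv.lTensor A (Coalgebra.comul (R := k) a)) =
        (Conv.post i₁ (G.β (j v)) * (G.actSq (z ⊗ₜ w))) a + (N * Conv.post i₂ (G.β w)) a := by
      -- `N * post i₂ (β w)` as an iterated coproduct
      have hN' : (N * Conv.post i₂ (G.β w)) a = TensorProduct.lift
          ((LinearMap.mk₂ k (fun b Y => (G.op (G.β (j (X.act (v ⊗ₜ b)))) * G.parityFst L) Y)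
            (fun b c Y => by simp [TensorProduct.tmul_add, op_add, add_mul])
            (fun r b Y => by simp [op_smul])
            (fun b Y Z => map_add _ _ _) (fun r b Z => map_smul _ _ _)))
          ((G.actSq (z ⊗ₜ w)).ofConv.lTensor A (Coalgebra.comul (R := k) a)) := by
        let Q : A ⊗[k] (A ⊗[k] A) →ₗ[k] L ⊗[k] L :=
          LinearMap.mul' k (L ⊗[k] L) ∘ₗ TensorProduct.map
            (ψ ∘ₗ LinearMap.mul' k (L ⊗[k] A) ∘ₗ
              TensorProduct.map (Conv.incl L : Conv k A _).ofConv
                (Conv.post G.α (G.β z) : Conv k A _).ofConv)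
            (Conv.post i₂ (G.β w) : Conv k A _).ofConv ∘ₗ
            (TensorProduct.assoc k A A A).symm.toLinearMap
        have q1 : (N * Conv.post i₂ (G.β w)) a = Q (TensorProduct.assoc k A A A
            ((Coalgebra.comul (R := k) (A := A)).rTensor A (Coalgebra.comul a))) := by
          simp only [LinearMap.convMul_apply, Q, LinearMap.comp_apply, LinearEquiv.coe_coe,
            LinearEquiv.symm_apply_apply]
          generalize (Coalgebra.comul (R := k) a) = s
          induction s with
          | zero => simp
          | tmul b c => simp [N]
          | add s t hs ht => simp only [map_add, hs, ht]
        rw [q1, Coalgebra.coassoc_apply]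
        generalize (Coalgebra.comul (R := k) a) = s
        induction s with
        | zero => simp
        | tmul b c =>
          simp only [LinearMap.lTensor_tmul, TensorProduct.lift.tmul, LinearMap.mk₂_apply,
            actSq_tmul, LinearMap.convMul_apply]
          generalize (Coalgebra.comul (R := k) c) = s
          induction s with
          | zero => simp
          | tmul c d =>
            simp only [TensorProduct.map_tmul, LinearMap.mul'_apply]
            have := e5 (G.β (j (X.act (v ⊗ₜ b)))) (i₁ (G.β z c)) (G.β w d)
            have h2 := e2 b c
            simp only [Module.End.mul_apply] at h2 ⊢
            change _ = (G.op (G.β (j (X.act (v ⊗ₜ b))))) ((G.parityFst L)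
              (i₁ (G.β z c) * i₂ (G.β w d)))
            rw [this, h2]
            simp [Q]
          | add s t hs ht => simp only [map_add, hs, ht, TensorProduct.tmul_add]
        | add s t hs ht => simp only [map_add, hs, ht]
      rw [hN', LinearMap.convMul_apply]
      generalize (Coalgebra.comul (R := k) a) = s
      induction s with
      | zero => simp
      | tmul b c =>
        simp only [LinearMap.lTensor_tmul, primOpAct_tmul, TensorProduct.lift.tmul,
          LinearMap.mk₂_apply, TensorProduct.map_tmul, LinearMap.mul'_apply]
        rw [primOp, LinearMap.add_apply]
        congr 1
        rw [← G.β_gen, e1]; rfl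
      | add s t hs ht => simp only [map_add, hs, ht]; abel
    rw [e6, actSq_tmul, ofConv_add, LinearMap.add_apply, mul_assoc]

theorem IsCoproduct.act {G : Generated X L j} (hX : X.IsCrossedModule) (h : G.IsCoproduct Δ)
    (x : L) (a : A) : Δ (G.β x a) = G.actSq (Δ x) a := by
  induction x using adjoin_induction_left G.adjoin_eq_top generalizing a with
  | one => simp [h.one, actSq_tmul, Algebra.algebraMap_eq_smul_one,
      Algebra.TensorProduct.one_def]
  | add x y hx hy => simp [hx, hy]
  | smul c x hx => simp [hx]
  | gen_mul v x ih =>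
    rw [h.gen_mul, actSq_primOp G hX, β_mul_apply]
    generalize (Coalgebra.comul (R := k) a) = s
    induction s with
    | zero => simp
    | tmul b c => simp [G.β_gen, h.gen_mul, ih]
    | add s t hs ht => simp only [map_add, hs, ht]

theorem IsCoproduct.morphism {G : Generated X L j} (hX : X.IsCrossedModule)
    (h : G.IsCoproduct Δ) : G.crossed.IsMorphism (G.crossed.tensor G.crossed) Δ where
  act x a := by rw [crossed_act, actSq_eq, h.act hX]
  coact x := by
    apply (TensorProduct.assoc k L L A).injective
    rw [coactSq_eq, h.coact hX]
    rfl

end Generated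

end Coproduct

section Bialgebra

open WithConv

variable {k : Type u} {A : Type v} [Field k] [Ring A] [HopfAlgebra k A]
variable {V : Type w} [AddCommGroup V] [Module k V]
variable {L : Type x} [Ring L] [Algebra k L]

namespace Generated

variable {X : CrossedData k A V} {j : V →ₗ[k] L} (G : Generated X L j)
variable {Δ : L →ₗ[k] L ⊗[k] L}

/-! ### Coassociativity -/

/-- `c ↦ primOp(v ◁ c)`. -/
def primOpOrbit (v : V) : A →ₗ[k] Module.End k (L ⊗[k] L) where
  toFun c := G.primOp (X.act (v ⊗ₜ c))
  map_add' a b := by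
    simp [primOp, TensorProduct.tmul_add, lmulFst_add, op_add, add_mul]; abel
  map_smul' c a := by
    simp only [primOp, TensorProduct.tmul_smul, map_smul, op_smul, smul_mul_assoc, smul_add,
      RingHom.id_apply]
    congr 1
    ext z w
    simp [TensorProduct.smul_tmul']

@[simp] theorem primOpOrbit_apply (v : V) (c : A) :
    G.primOpOrbit v c = G.primOp (X.act (v ⊗ₜ c)) := rfl

/-- The operator of multiplication by `v ⊗ 1 ⊗ 1 + 1 ⊗ v ⊗ 1 + 1 ⊗ 1 ⊗ v`. -/
def primOpCube (v : V) : Module.End k (L ⊗[k] (L ⊗[k] L)) :=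
  lmulFst (L ⊗[k] L) (j v) +
    Conv.coAct G.α.toLinearMap (G.primOpOrbit v) * G.parityFst (L ⊗[k] L)

theorem primOpCube_tmul (v : V) (z : L) (Z : L ⊗[k] L) : G.primOpCube v (z ⊗ₜ Z) =
    (j v * z) ⊗ₜ Z + Conv.fillAct (G.primOpOrbit v) Z (G.α (G.P z)) := by
  simp [primOpCube, Conv.coAct_tmul]

theorem IsCoproduct.coassoc {G : Generated X L j} (hX : X.IsCrossedModule)
    (h : G.IsCoproduct Δ) (x : L) :
    TensorProduct.assoc k L L L (Δ.rTensor L (Δ x)) = Δ.lTensor L (Δ x) := by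
  have key : (TensorProduct.assoc k L L L).toLinearMap ∘ₗ Δ.rTensor L ∘ₗ Δ =
      Δ.lTensor L ∘ₗ Δ := by
    refine linearMap_ext_left G.adjoin_eq_top (by simp [h.one]) fun v x ih => ?_
    simp only [LinearMap.comp_apply, LinearEquiv.coe_coe] at ih ⊢
    have e1 : ∀ Z, Δ.lTensor L (G.primOp v Z) = G.primOpCube v (Δ.lTensor L Z) := by
      intro Z
      induction Z with
      | zero => simp
      | tmul z w =>
        rw [primOp_tmul, LinearMap.lTensor_tmul, primOpCube_tmul, map_add, LinearMap.lTensor_tmul]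
        congr 1
        generalize G.α (G.P z) = t
        induction t with
        | zero => simp
        | tmul z a => simp [G.β_gen, h.gen_mul]
        | add s t hs ht => simp only [map_add, hs, ht]
      | add s t hs ht => simp only [map_add, hs, ht]
    have e2 : ∀ Z, TensorProduct.assoc k L L L (Δ.rTensor L (G.primOp v Z)) =
        G.primOpCube v (TensorProduct.assoc k L L L (Δ.rTensor L Z)) := by
      intro Z
      induction Z with
      | zero => simp
      | tmul z w =>
        rw [primOp_tmul, map_add, LinearMap.rTensor_tmul, h.gen_mul]
        -- `Δ(z₀) ⊗ (v ◁ z₁) w` in terms of the coaction on the tensor square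
        have f1 : ∀ t : L ⊗[k] A, TensorProduct.assoc k L L L
            (Δ.rTensor L (Conv.fill (G.β (j v)) w t)) = (Conv.fill (G.β (j v)) w).lTensor L
              (TensorProduct.assoc k L L A (Δ.rTensor A t)) := by
          intro t
          induction t with
          | zero => simp
          | tmul z a =>
            simp only [Conv.fill_tmul, LinearMap.rTensor_tmul]
            generalize Δ z = Z
            induction Z with
            | zero => simp
            | tmul z w => simp
            | add s t hs ht => simp only [map_add, hs, ht, TensorProduct.add_tmul]
          | add s t hs ht => simp only [map_add, hs, ht]
        rw [map_add, f1, ← h.coact hX, h.parity, LinearMap.rTensor_tmul]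
        generalize Δ z = Z
        induction Z with
        | zero => simp
        | tmul y y' =>
          rw [primOp_tmul, TensorProduct.assoc_tmul, primOpCube_tmul, TensorProduct.add_tmul,
            map_add, TensorProduct.assoc_tmul, add_assoc]
          congr 1
          simp only [TensorProduct.map_tmul, AlgHom.toLinearMap_apply, coactSq,
            LinearMap.comp_apply, LinearMap.lTensor_tmul, op_tmul]
          generalize G.α (G.P y) = t
          induction t with
          | zero => simp
          | tmul z a =>
            simp only [Conv.fill_tmul, Conv.fillAct_tmul, primOpOrbit_apply, primOp_tmul,
              TensorProduct.assoc_tmul, TensorProduct.tmul_add, LinearMap.lTensor_tmul]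
            congr 1
            · rw [G.β_gen]
            generalize G.α (G.P y') = t
            congr 1
            induction t with
            | zero => simp
            | tmul y c => simp [G.β_apply_mul hX, ← G.β_gen]
            | add s t hs ht => simp only [map_add, hs, ht, mul_add]
          | add s t hs ht =>
            simp only [map_add, TensorProduct.add_tmul, ← hs, ← ht]
            abel
        | add s t hs ht =>
          simp only [map_add, TensorProduct.add_tmul, ← hs, ← ht]
          abel
      | add s t hs ht => simp only [map_add, hs, ht]
    rw [h.gen_mul, e2, ih, e1]
  exact LinearMap.congr_fun key x

/-! ### The grading -/

theorem γ_of_mem (n : ℕ) (x : L) (hx : x ∈ gradedPart j n) :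
    G.γ x = Polynomial.monomial n x := by
  rw [gradedPart] at hx
  induction n generalizing x with
  | zero =>
    rw [pow_zero] at hx
    obtain ⟨c, rfl⟩ := Submodule.mem_one.1 hx
    rw [AlgHom.commutes]; rfl
  | succ n ih =>
    rw [pow_succ] at hx
    refine Submodule.mul_induction_on hx ?_ ?_
    · rintro y hy _ ⟨v, rfl⟩
      rw [map_mul, ih y hy, G.γ_gen, Polynomial.monomial_mul_monomial]
    · intro x y hx hy
      rw [map_add, map_add, hx, hy]

theorem P_of_mem (n : ℕ) (x : L) (hx : x ∈ gradedPart j n) : G.P x = (-1 : k) ^ n • x := by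
  rw [gradedPart] at hx
  induction n generalizing x with
  | zero =>
    rw [pow_zero] at hx
    obtain ⟨c, rfl⟩ := Submodule.mem_one.1 hx
    simp
  | succ n ih =>
    rw [pow_succ] at hx
    refine Submodule.mul_induction_on hx ?_ ?_
    · rintro y hy _ ⟨v, rfl⟩
      rw [map_mul, ih y hy, G.P_gen, pow_succ]
      simp
    · intro x y hx hy
      rw [map_add, smul_add, hx, hy]

theorem _root_.BraidedExterior.gen_mul_mem_gradedPart (j : V →ₗ[k] L) (n : ℕ) (v : V) (x : L)
    (hx : x ∈ gradedPart j n) : j v * x ∈ gradedPart j (n + 1) := by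
  rw [gradedPart, pow_succ']
  exact Submodule.mul_mem_mul ⟨v, rfl⟩ hx

theorem _root_.BraidedExterior.one_mem_gradedPart (j : V →ₗ[k] L) : (1 : L) ∈ gradedPart j 0 := by
  rw [gradedPart, pow_zero]
  exact Submodule.one_le.1 le_rfl

theorem iSup_gradedPart (G : Generated X L j) : ⨆ n, gradedPart j n = ⊤ := by
  rw [eq_top_iff]
  rintro x -
  induction x using adjoin_induction_left G.adjoin_eq_top with
  | one => exact Submodule.mem_iSup_of_mem 0 (one_mem_gradedPart j)
  | add x y hx hy => exact add_mem hx hy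
  | smul c x hx => exact Submodule.smul_mem _ _ hx
  | gen_mul v x hx =>
    induction hx using Submodule.iSup_induction' with
    | mem n x hx => exact Submodule.mem_iSup_of_mem (n + 1) (gen_mul_mem_gradedPart j n v x hx)
    | zero => simp
    | add x y _ _ hx hy => rw [mul_add]; exact add_mem hx hy

theorem isInternal (G : Generated X L j) : DirectSum.IsInternal (gradedPart j) := by
  refine DirectSum.isInternal_submodule_of_iSupIndep_of_iSup_eq_top ?_ G.iSup_gradedPart
  rw [iSupIndep_def]
  intro n
  rw [Submodule.disjoint_def]
  intro x hx hx'
  have h1 : ∀ y ∈ ⨆ m, ⨆ (_ : m ≠ n), gradedPart j m, (G.γ y).coeff n = 0 := by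
    intro y hy
    refine Submodule.iSup_induction _ (motive := fun y => (G.γ y).coeff n = 0) hy ?_ (by simp) ?_
    · intro m y hy
      refine Submodule.iSup_induction _ (motive := fun y => (G.γ y).coeff n = 0) hy ?_
        (by simp) ?_
      · intro hm y hy
        rw [G.γ_of_mem m y hy, Polynomial.coeff_monomial, if_neg hm]
      · intro y z hy hz
        rw [map_add, Polynomial.coeff_add, hy, hz, add_zero]
    · intro y z hy hz
      rw [map_add, Polynomial.coeff_add, hy, hz, add_zero]
  have h2 := h1 x hx'
  rwa [G.γ_of_mem n x hx, Polynomial.coeff_monomial, if_pos rfl] at h2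

theorem generators_injective (G : Generated X L j) : Function.Injective j := by
  rw [injective_iff_map_eq_zero]
  intro v hv
  have := G.pr_gen v 1
  simpa [hv] using this.symm

/-- The linear map `L[t] → L ⊗ L`, `w tⁿ ↦ w ⊗ Pⁿ z`. -/
def signPoly (z : L) : Polynomial L →ₗ[k] L ⊗[k] L :=
  Polynomial.lsum fun n => (TensorProduct.mk k L L).flip ((G.P.toLinearMap ^ n) z)

theorem signPoly_monomial (z : L) (n : ℕ) (w : L) :
    G.signPoly z (Polynomial.monomial n w) = w ⊗ₜ (G.P.toLinearMap ^ n) z := by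
  simp [signPoly, Polynomial.lsum_apply]

/-- The sign map `x ⊗ y ↦ (-1)^{|x||y|} x ⊗ y`. -/
def sign : L ⊗[k] L →ₗ[k] L ⊗[k] L :=
  TensorProduct.lift (LinearMap.mk₂ k (fun w z => G.signPoly z (G.γ w))
    (fun w w' z => by simp) (fun c w z => by simp)
    (fun w z z' => by
      generalize G.γ w = q
      induction q using Polynomial.induction_on' with
      | add p q hp hq => simp only [map_add, hp, hq]; abel
      | monomial n a => simp [signPoly_monomial, TensorProduct.tmul_add])
    (fun c w z => by
      generalize G.γ w = q
      induction q using Polynomial.induction_on' with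
      | add p q hp hq => simp only [map_add, hp, hq, smul_add]
      | monomial n a => simp [signPoly_monomial]))

theorem sign_tmul (w z : L) : G.sign (w ⊗ₜ z) = G.signPoly z (G.γ w) := rfl

theorem sign_one_tmul (z : L) : G.sign (1 ⊗ₜ z) = 1 ⊗ₜ z := by
  rw [sign_tmul, map_one, ← Polynomial.monomial_zero_one, signPoly_monomial]
  simp

theorem sign_gen_mul (v : V) (w z : L) : G.sign ((j v * w) ⊗ₜ z) =
    TensorProduct.map (LinearMap.mulLeft k (j v)) G.P.toLinearMap (G.sign (w ⊗ₜ z)) := by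
  rw [sign_tmul, sign_tmul, map_mul, G.γ_gen]
  generalize G.γ w = q
  induction q using Polynomial.induction_on' with
  | add p q hp hq => simp only [map_add, mul_add, hp, hq]
  | monomial n a =>
    rw [Polynomial.monomial_mul_monomial, signPoly_monomial, signPoly_monomial, add_comm 1 n,
      pow_succ']
    simp

theorem sign_apply (m n : ℕ) (x : L) (hx : x ∈ gradedPart j m) (y : L) (hy : y ∈ gradedPart j n) :
    G.sign (x ⊗ₜ y) = (-1 : k) ^ (m * n) • (x ⊗ₜ y) := by
  rw [sign_tmul, G.γ_of_mem m x hx, signPoly_monomial]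
  have : ∀ m : ℕ, (G.P.toLinearMap ^ m) y = (-1 : k) ^ (m * n) • y := by
    intro m
    induction m with
    | zero => simp
    | succ m ih =>
      rw [pow_succ', Module.End.mul_apply, ih, map_smul, AlgHom.toLinearMap_apply,
        G.P_of_mem n y hy, smul_smul, ← pow_add, Nat.succ_mul]
  rw [this, TensorProduct.tmul_smul]

/-! ### Multiplicativity of the coproduct -/

/-- The operators `x ⊗ w ↦ Σ y ◁-multiplication` used to describe the braided product:
`y ⊗ z ↦ (w ↦ z₀ ⊗ (y ◁ z₁) w)`. -/
def braidMulRight (w : L) : L ⊗[k] L →ₗ[k] L ⊗[k] L :=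
  (LinearMap.mulRight k w).lTensor L ∘ₗ G.crossed.braiding G.crossed

theorem braidMulRight_tmul (w y z : L) :
    G.braidMulRight w (y ⊗ₜ z) = G.op (G.β y) (z ⊗ₜ w) := by
  simp only [braidMulRight, CrossedData.braiding, LinearMap.comp_apply, LinearMap.lTensor_tmul,
    crossed_coact, op_tmul, LinearEquiv.coe_coe]
  generalize G.α z = t
  induction t with
  | zero => simp
  | tmul z c => simp
  | add s t hs ht => simp only [map_add, hs, ht, TensorProduct.tmul_add]

/-- Multiplication by `1 ⊗ w` in the super-braided tensor square. -/
def sndOp (w : L) : Module.End k (L ⊗[k] L) :=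
  TensorProduct.lift (LinearMap.mk₂ k (fun z y => G.braidMulRight y (G.sign (w ⊗ₜ z)))
    (fun z z' y => by simp [TensorProduct.tmul_add]) (fun c z y => by simp)
    (fun z y y' => by
      generalize G.sign (w ⊗ₜ z) = t
      induction t with
      | zero => simp
      | tmul a b => simp [braidMulRight_tmul, TensorProduct.tmul_add]
      | add s t hs ht => simp only [map_add, hs, ht]; abel)
    (fun c z y => by
      generalize G.sign (w ⊗ₜ z) = t
      induction t with
      | zero => simp
      | tmul a b => simp [braidMulRight_tmul]
      | add s t hs ht => simp only [map_add, hs, ht, smul_add]))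

theorem sndOp_tmul (w z y : L) :
    G.sndOp w (z ⊗ₜ y) = G.braidMulRight y (G.sign (w ⊗ₜ z)) := rfl

theorem sndOp_one (hX : X.IsCrossedModule) : G.sndOp 1 = 1 := by
  ext z y
  simp [sndOp_tmul, sign_one_tmul, braidMulRight_tmul, G.op_one hX]

theorem sndOp_gen_mul (hX : X.IsCrossedModule) (v : V) (w : L) :
    G.sndOp (j v * w) = G.op (G.β (j v)) * G.parityFst L * G.sndOp w := by
  ext z y
  simp only [TensorProduct.AlgebraTensorModule.curry_apply, TensorProduct.curry_apply,
    LinearMap.coe_restrictScalars, Module.End.mul_apply, sndOp_tmul, sign_gen_mul]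
  generalize G.sign (w ⊗ₜ z) = t
  induction t with
  | zero => simp
  | tmul a b =>
    simp only [TensorProduct.map_tmul, braidMulRight_tmul, LinearMap.mulLeft_apply, map_mul,
      AlgHom.toLinearMap_apply, G.op_mul hX, Module.End.mul_apply]
    rw [← parityFst_tmul, ← Module.End.mul_apply (G.op (G.β a)), ← parityFst_mul_op]
    rfl
  | add s t hs ht => simp only [map_add, hs, ht]

/-- Left multiplication in the super-braided tensor square. -/
def lmulSq (Z : L ⊗[k] L) : Module.End k (L ⊗[k] L) :=
  TensorProduct.curry (braidedTensorMul (G.crossed.braiding G.crossed ∘ₗ G.sign)) Z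

theorem lmulSq_add (Z W : L ⊗[k] L) : G.lmulSq (Z + W) = G.lmulSq Z + G.lmulSq W := map_add _ _ _

theorem lmulSq_zero : G.lmulSq (0 : L ⊗[k] L) = 0 := map_zero _

theorem lmulSq_tmul (z w : L) : G.lmulSq (z ⊗ₜ w) = lmulFst L z * G.sndOp w := by
  ext z' w'
  simp only [TensorProduct.AlgebraTensorModule.curry_apply, TensorProduct.curry_apply,
    LinearMap.coe_restrictScalars, Module.End.mul_apply, sndOp_tmul, lmulSq, braidedTensorMul,
    LinearMap.comp_apply, LinearEquiv.coe_coe, TensorProduct.assoc_tmul,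
    TensorProduct.assoc_symm_tmul, LinearMap.lTensor_tmul, LinearMap.rTensor_tmul, braidMulRight]
  generalize G.crossed.braiding G.crossed (G.sign (w ⊗ₜ z')) = t
  induction t with
  | zero => simp
  | tmul a b => simp
  | add s t hs ht => simp only [map_add, hs, ht, TensorProduct.add_tmul, TensorProduct.tmul_add]

theorem lmulSq_primOp (hX : X.IsCrossedModule) (v : V) (Z : L ⊗[k] L) :
    G.lmulSq (G.primOp v Z) = G.primOp v * G.lmulSq Z := by
  induction Z with
  | zero => simp [lmulSq_zero]
  | tmul z w =>
    rw [primOp_tmul, lmulSq_add, lmulSq_tmul, lmulSq_tmul, primOp, add_mul]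
    congr 1
    · rw [lmulFst_mul, mul_assoc]
    rw [mul_assoc, ← mul_assoc (G.parityFst L), parityFst_mul_lmulFst, ← mul_assoc, ← mul_assoc,
      op_mul_lmulFst]
    generalize G.α (G.P z) = t
    induction t with
    | zero => simp [lmulSq_zero]
    | tmul z c =>
      rw [Conv.fill_tmul, lmulSq_tmul, pushed_tmul, G.shift_β hX, G.β_gen, G.sndOp_gen_mul hX,
        ← G.β_gen]
      simp only [mul_assoc]
    | add s t hs ht => simp only [map_add, hs, ht, add_mul, lmulSq_add]
  | add s t hs ht => simp only [map_add, hs, ht, mul_add, lmulSq_add]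

theorem IsCoproduct.comul_mul {G : Generated X L j} (hX : X.IsCrossedModule)
    (h : G.IsCoproduct Δ) (x y : L) : Δ (x * y) =
    braidedTensorMul (G.crossed.braiding G.crossed ∘ₗ G.sign) (Δ x ⊗ₜ Δ y) := by
  change Δ (x * y) = G.lmulSq (Δ x) (Δ y)
  induction x using adjoin_induction_left G.adjoin_eq_top generalizing y with
  | one => rw [h.one, lmulSq_tmul, G.sndOp_one hX, one_mul, mul_one]; simp [lmulFst]
  | add x x' hx hx' => rw [add_mul, map_add, hx, hx', map_add, lmulSq_add, LinearMap.add_apply]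
  | smul c x hx =>
    rw [smul_mul_assoc, map_smul, hx, map_smul, lmulSq, lmulSq, map_smul, LinearMap.smul_apply]
  | gen_mul v x hx =>
    rw [mul_assoc, h.gen_mul, hx, h.gen_mul, G.lmulSq_primOp hX, Module.End.mul_apply]

end Generated

end Bialgebra

section Antipode

open WithConv

variable {k : Type u} {A : Type v} [Field k] [Ring A] [HopfAlgebra k A]
variable {V : Type w} [AddCommGroup V] [Module k V]
variable {L : Type x} [Ring L] [Algebra k L]

theorem exists_linear_limit {M N : Type*} [AddCommGroup M] [Module k M] [AddCommGroup N]
    [Module k N] (f : ℕ → M →ₗ[k] N) (h : ∀ x, ∃ n₀, ∀ n ≥ n₀, f n x = f n₀ x) :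
    ∃ S : M →ₗ[k] N, ∀ x, ∃ n₀, ∀ n ≥ n₀, S x = f n x := by
  choose n₀ hn₀ using h
  have key : ∀ x n, n₀ x ≤ n → f (n₀ x) x = f n x := fun x n hn => (hn₀ x n hn).symm
  refine ⟨{ toFun := fun x => f (n₀ x) x, map_add' := fun x y => ?_, map_smul' := fun c x => ?_ },
    fun x => ⟨n₀ x, key x⟩⟩
  · let n := max (n₀ (x + y)) (max (n₀ x) (n₀ y))
    rw [key x n (by simp [n]), key y n (by simp [n]), key (x + y) n (by simp [n]), map_add]
  · let n := max (n₀ (c • x)) (n₀ x)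
    rw [key x n (by simp [n]), key (c • x) n (by simp [n]), map_smul, RingHom.id_apply]

/-- A left and a right convolution inverse coincide. -/
theorem convolution_inverse_unique {Δ : L →ₗ[k] L ⊗[k] L} {ε : L →ₗ[k] k}
    (hΔ : ∀ x, TensorProduct.assoc k L L L (Δ.rTensor L (Δ x)) = Δ.lTensor L (Δ x))
    (hl : ∀ x, ε.rTensor L (Δ x) = 1 ⊗ₜ x) (hr : ∀ x, ε.lTensor L (Δ x) = x ⊗ₜ 1)
    {R : Type*} [Ring R] [Algebra k R] {f g h : L →ₗ[k] R}
    (hg : ∀ x, LinearMap.mul' k R (TensorProduct.map g f (Δ x)) = algebraMap k R (ε x))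
    (hh : ∀ x, LinearMap.mul' k R (TensorProduct.map f h (Δ x)) = algebraMap k R (ε x)) :
    g = h := by
  let _ : Coalgebra k L :=
    { comul := Δ
      counit := ε
      coassoc := LinearMap.ext fun x => hΔ x
      rTensor_counit_comp_comul := LinearMap.ext fun x => hl x
      lTensor_counit_comp_comul := LinearMap.ext fun x => hr x }
  have h1 : toConv g * toConv f = 1 := WithConv.ext (LinearMap.ext hg)
  have h2 : toConv f * toConv h = 1 := WithConv.ext (LinearMap.ext hh)
  exact toConv_injective (left_inv_eq_right_inv h1 h2)

/-- The degree `n` part of the tensor square. -/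
def gradedPartSq (j : V →ₗ[k] L) (n : ℕ) : Submodule k (L ⊗[k] L) :=
  Submodule.span k {z | ∃ a b, a + b = n ∧ ∃ x ∈ gradedPart j a, ∃ y ∈ gradedPart j b, x ⊗ₜ y = z}

namespace Generated

variable {X : CrossedData k A V} {j : V →ₗ[k] L} (G : Generated X L j)
variable {Δ : L →ₗ[k] L ⊗[k] L}

theorem α_mem (n : ℕ) (x : L) (hx : x ∈ gradedPart j n) :
    G.α x ∈ LinearMap.range ((gradedPart j n).subtype.rTensor A) := by
  rw [gradedPart] at hx
  induction n generalizing x with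
  | zero =>
    rw [pow_zero] at hx
    obtain ⟨c, rfl⟩ := Submodule.mem_one.1 hx
    rw [AlgHom.commutes, Algebra.TensorProduct.algebraMap_apply]
    exact ⟨⟨algebraMap k L c, by rw [gradedPart, pow_zero]; exact Submodule.mem_one.2 ⟨c, rfl⟩⟩
      ⊗ₜ 1, rfl⟩
  | succ n ih =>
    rw [pow_succ'] at hx
    refine Submodule.mul_induction_on hx ?_ ?_
    · rintro _ ⟨v, rfl⟩ y hy
      rw [map_mul, G.α_gen]
      obtain ⟨t, ht⟩ := ih y hy
      rw [← ht]
      clear ht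
      generalize X.coact v = s
      induction s with
      | zero => simp
      | tmul v a =>
        induction t with
        | zero => simp
        | tmul z b =>
          exact ⟨⟨j v * z, gen_mul_mem_gradedPart j n v z z.2⟩ ⊗ₜ (a * b), by simp⟩
        | add s t hs ht =>
          rw [map_add, mul_add]
          exact add_mem hs ht
      | add s t hs ht => rw [map_add, add_mul]; exact add_mem hs ht
    · intro x y hx hy
      rw [map_add]
      exact add_mem hx hy

theorem β_mem (n : ℕ) (x : L) (hx : x ∈ gradedPart j n) (a : A) : G.β x a ∈ gradedPart j n := by
  rw [gradedPart] at hx ⊢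
  induction n generalizing x a with
  | zero =>
    rw [pow_zero] at hx ⊢
    obtain ⟨c, rfl⟩ := Submodule.mem_one.1 hx
    rw [AlgHom.commutes, LinearMap.convAlgebraMap_apply, Algebra.smul_def, ← map_mul]
    exact Submodule.mem_one.2 ⟨_, rfl⟩
  | succ n ih =>
    rw [pow_succ'] at hx
    refine Submodule.mul_induction_on hx ?_ ?_
    · rintro _ ⟨v, rfl⟩ y hy
      rw [β_mul_apply]
      generalize (Coalgebra.comul (R := k) a) = s
      induction s with
      | zero => simp
      | tmul a b =>
        rw [TensorProduct.map_tmul, LinearMap.mul'_apply, G.β_gen]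
        exact gen_mul_mem_gradedPart j n _ _ (ih y hy b)
      | add s t hs ht => rw [map_add, map_add]; exact add_mem hs ht
    · intro x y hx hy
      rw [map_add]
      exact add_mem hx hy

theorem IsCoproduct.mem_gradedPartSq {G : Generated X L j} (h : G.IsCoproduct Δ) (n : ℕ) (x : L)
    (hx : x ∈ gradedPart j n) : Δ x ∈ gradedPartSq j n := by
  rw [gradedPart] at hx
  induction n generalizing x with
  | zero =>
    rw [pow_zero] at hx
    obtain ⟨c, rfl⟩ := Submodule.mem_one.1 hx
    rw [Algebra.algebraMap_eq_smul_one, map_smul, h.one]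
    exact Submodule.smul_mem _ _ (Submodule.subset_span
      ⟨0, 0, rfl, 1, one_mem_gradedPart j, 1, one_mem_gradedPart j, rfl⟩)
  | succ n ih =>
    rw [pow_succ'] at hx
    refine Submodule.mul_induction_on hx ?_ ?_
    · rintro _ ⟨v, rfl⟩ y hy
      rw [h.gen_mul]
      have hz := ih y hy
      generalize Δ y = Z at hz
      refine Submodule.span_induction (p := fun Z _ => G.primOp v Z ∈ gradedPartSq j (n + 1))
        ?_ (by simp) (fun Z W _ _ hZ hW => by rw [map_add]; exact add_mem hZ hW)
        (fun c Z _ hZ => by rw [map_smul]; exact Submodule.smul_mem _ _ hZ) hz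
      rintro _ ⟨a, b, hab, x, hx, y, hy, rfl⟩
      rw [primOp_tmul]
      refine add_mem (Submodule.subset_span ⟨a + 1, b, by omega, _,
        gen_mul_mem_gradedPart j a v x hx, y, hy, rfl⟩) ?_
      have hPx : G.P x ∈ gradedPart j a := by
        rw [G.P_of_mem a x hx]; exact Submodule.smul_mem _ _ hx
      obtain ⟨t, ht⟩ := G.α_mem a _ hPx
      rw [← ht]
      clear ht
      induction t with
      | zero => simp
      | tmul z c =>
        rw [LinearMap.rTensor_tmul, Conv.fill_tmul, G.β_gen]
        exact Submodule.subset_span ⟨a, b + 1, by omega, _, z.2, _,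
          gen_mul_mem_gradedPart j b _ y hy, rfl⟩
      | add s t hs ht => rw [map_add, map_add]; exact add_mem hs ht
    · intro x y hx hy
      rw [map_add]
      exact add_mem hx hy

theorem IsCoproduct.exists_antipode {G : Generated X L j} (hX : X.IsCrossedModule)
    (h : G.IsCoproduct Δ) : ∃ S : L →ₗ[k] L,
      (∀ x, LinearMap.mul' k L (S.rTensor L (Δ x)) = algebraMap k L (G.ε x)) ∧
      ∀ x, LinearMap.mul' k L (S.lTensor L (Δ x)) = algebraMap k L (G.ε x) := by
  let _ : Coalgebra k L :=
    { comul := Δ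
      counit := G.ε.toLinearMap
      coassoc := LinearMap.ext fun x => h.coassoc hX x
      rTensor_counit_comp_comul := LinearMap.ext fun x => h.counit_left hX x
      lTensor_counit_comp_comul := LinearMap.ext fun x => h.counit_right x }
  let N : WithConv (L →ₗ[k] L) := 1 - toConv LinearMap.id
  have hN0 : ∀ x ∈ gradedPart j 0, N x = 0 := by
    intro x hx
    rw [gradedPart, pow_zero] at hx
    obtain ⟨c, rfl⟩ := Submodule.mem_one.1 hx
    change algebraMap k L (G.ε (algebraMap k L c)) - algebraMap k L c = 0
    simp
  have hNn : ∀ n m, m < n → ∀ x ∈ gradedPart j m, (N ^ n) x = 0 := by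
    intro n
    induction n with
    | zero => intro m hm; omega
    | succ n ih =>
      intro m hm x hx
      rw [pow_succ']
      change LinearMap.mul' k L (TensorProduct.map N.ofConv (N ^ n).ofConv (Δ x)) = 0
      have hz := h.mem_gradedPartSq m x hx
      refine Submodule.span_induction (p := fun Z _ => LinearMap.mul' k L
        (TensorProduct.map N.ofConv (N ^ n).ofConv Z) = 0)
        ?_ (by simp) (fun Z W _ _ hZ hW => by rw [map_add, map_add, hZ, hW, add_zero])
        (fun c Z _ hZ => by rw [map_smul, map_smul, hZ, smul_zero]) hz
      rintro _ ⟨a, b, hab, x, hx, y, hy, rfl⟩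
      rw [TensorProduct.map_tmul, LinearMap.mul'_apply]
      rcases Nat.eq_zero_or_pos a with rfl | ha
      · rw [hN0 x hx, zero_mul]
      · rw [ih b (by omega) y hy, mul_zero]
  have hNx : ∀ x, ∃ n₀, ∀ n ≥ n₀, (N ^ n) x = 0 := by
    intro x
    have hx : x ∈ ⨆ n, gradedPart j n := G.iSup_gradedPart ▸ Submodule.mem_top
    induction hx using Submodule.iSup_induction' with
    | mem m x hx => exact ⟨m + 1, fun n hn => hNn n m (by omega) x hx⟩
    | zero => exact ⟨0, fun n _ => by simp⟩
    | add x y _ _ hx hy =>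
      obtain ⟨n, hn⟩ := hx
      obtain ⟨m, hm⟩ := hy
      refine ⟨max n m, fun l hl => ?_⟩
      rw [map_add, hn l (le_trans (le_max_left _ _) hl), hm l (le_trans (le_max_right _ _) hl),
        add_zero]
  let T : ℕ → WithConv (L →ₗ[k] L) := fun n => ∑ i ∈ Finset.range n, N ^ i
  obtain ⟨S, hS⟩ := exists_linear_limit (fun n => (T n).ofConv) (fun x => by
    obtain ⟨n₀, hn₀⟩ := hNx x
    refine ⟨n₀, fun n hn => ?_⟩
    obtain ⟨m, rfl⟩ := Nat.exists_eq_add_of_le hn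
    simp only [T]
    rw [Finset.sum_range_add, ofConv_add, LinearMap.add_apply, ofConv_sum, ofConv_sum,
      LinearMap.sum_apply, LinearMap.sum_apply]
    rw [Finset.sum_eq_zero (s := Finset.range m), add_zero]
    exact fun i _ => hn₀ _ (by omega))
  have hid : toConv LinearMap.id = 1 - N := by simp [N]
  have e1 : ∀ n, T n * toConv LinearMap.id = 1 - N ^ n := fun n => by
    rw [hid]; exact geom_sum_mul_neg N n
  have e2 : ∀ n, toConv LinearMap.id * T n = 1 - N ^ n := fun n => by
    rw [hid]; exact mul_neg_geom_sum N n
  have l1 : ∀ Z : L ⊗[k] L, ∃ n₀, ∀ n ≥ n₀, S.rTensor L Z = (T n).ofConv.rTensor L Z := by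
    intro Z
    induction Z with
    | zero => exact ⟨0, fun n _ => by simp⟩
    | tmul x y =>
      obtain ⟨n₀, hn₀⟩ := hS x
      exact ⟨n₀, fun n hn => by simp [hn₀ n hn]⟩
    | add x y hx hy =>
      obtain ⟨n, hn⟩ := hx
      obtain ⟨m, hm⟩ := hy
      refine ⟨max n m, fun l hl => ?_⟩
      rw [map_add, map_add, hn l (le_trans (le_max_left _ _) hl),
        hm l (le_trans (le_max_right _ _) hl)]
  have l2 : ∀ Z : L ⊗[k] L, ∃ n₀, ∀ n ≥ n₀, S.lTensor L Z = (T n).ofConv.lTensor L Z := by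
    intro Z
    induction Z with
    | zero => exact ⟨0, fun n _ => by simp⟩
    | tmul x y =>
      obtain ⟨n₀, hn₀⟩ := hS y
      exact ⟨n₀, fun n hn => by simp [hn₀ n hn]⟩
    | add x y hx hy =>
      obtain ⟨n, hn⟩ := hx
      obtain ⟨m, hm⟩ := hy
      refine ⟨max n m, fun l hl => ?_⟩
      rw [map_add, map_add, hn l (le_trans (le_max_left _ _) hl),
        hm l (le_trans (le_max_right _ _) hl)]
  refine ⟨S, fun x => ?_, fun x => ?_⟩
  · obtain ⟨n, hn⟩ := l1 (Δ x)
    obtain ⟨m, hm⟩ := hNx x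
    rw [hn (max n m) (le_max_left _ _)]
    have := congr($(e1 (max n m)) x)
    refine Eq.trans this ?_
    change (1 : WithConv (L →ₗ[k] L)) x - (N ^ (max n m)) x = _
    rw [hm _ (le_max_right _ _), sub_zero]
    rfl
  · obtain ⟨n, hn⟩ := l2 (Δ x)
    obtain ⟨m, hm⟩ := hNx x
    rw [hn (max n m) (le_max_left _ _)]
    have := congr($(e2 (max n m)) x)
    refine Eq.trans this ?_
    change (1 : WithConv (L →ₗ[k] L)) x - (N ^ (max n m)) x = _
    rw [hm _ (le_max_right _ _), sub_zero]
    rfl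

variable {S : L →ₗ[k] L}

theorem IsCoproduct.antipode_morphism {G : Generated X L j} (hX : X.IsCrossedModule)
    (h : G.IsCoproduct Δ)
    (hl : ∀ x, LinearMap.mul' k L (S.rTensor L (Δ x)) = algebraMap k L (G.ε x))
    (hr : ∀ x, LinearMap.mul' k L (S.lTensor L (Δ x)) = algebraMap k L (G.ε x)) :
    G.crossed.IsMorphism G.crossed S where
  act x a := by
    have key : G.β.toLinearMap ∘ₗ S =
        (WithConv.linearEquiv k (A →ₗ[k] L)).symm.toLinearMap ∘ₗ LinearMap.compRight k S ∘ₗ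
          (WithConv.linearEquiv k (A →ₗ[k] L)).toLinearMap ∘ₗ G.β.toLinearMap := by
      refine convolution_inverse_unique (ε := G.ε.toLinearMap) (h.coassoc hX) (h.counit_left hX)
        h.counit_right (f := G.β.toLinearMap) (fun x => ?_) (fun x => ?_)
      · have := congr(G.β $(hl x))
        rw [AlgHom.commutes] at this
        refine Eq.trans ?_ this
        generalize Δ x = Z
        induction Z with
        | zero => simp
        | tmul y z => simp
        | add s t hs ht => simp only [map_add, hs, ht]
      · refine Conv.ext' fun a => ?_
        have h2 := hr (G.β x a)
        rw [h.act hX, ε_β] at h2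
        rw [LinearMap.convAlgebraMap_apply, Algebra.smul_def, ← map_mul]
        refine Eq.trans ?_ h2
        generalize Δ x = Z
        induction Z with
        | zero => simp
        | tmul y z =>
          rw [actSq_tmul]
          simp only [TensorProduct.map_tmul, LinearMap.mul'_apply, LinearMap.convMul_apply]
          generalize (Coalgebra.comul (R := k) a) = s
          induction s with
          | zero => simp
          | tmul a b => simp
          | add s t hs ht => simp only [map_add, hs, ht]
        | add s t hs ht => simp only [map_add, hs, ht, ofConv_add, LinearMap.add_apply]
    exact congr($key x a).symm
  coact x := by
    have key : G.α.toLinearMap ∘ₗ S = S.rTensor A ∘ₗ G.α.toLinearMap := by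
      refine convolution_inverse_unique (ε := G.ε.toLinearMap) (h.coassoc hX) (h.counit_left hX)
        h.counit_right (f := G.α.toLinearMap) (fun x => ?_) (fun x => ?_)
      · have := congr(G.α $(hl x))
        rw [AlgHom.commutes] at this
        refine Eq.trans ?_ this
        generalize Δ x = Z
        induction Z with
        | zero => simp
        | tmul y z => simp
        | add s t hs ht => simp only [map_add, hs, ht]
      · have e1 : LinearMap.mul' k (L ⊗[k] A) (TensorProduct.map G.α.toLinearMap
            (S.rTensor A ∘ₗ G.α.toLinearMap) (Δ x)) =
            (LinearMap.mul' k L ∘ₗ S.lTensor L).rTensor A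
              ((G.crossed.tensor G.crossed).coact (Δ x)) := by
          generalize Δ x = Z
          induction Z with
          | zero => simp
          | tmul y z =>
            simp only [CrossedData.tensor, LinearMap.comp_apply, TensorProduct.map_tmul,
              crossed_coact, AlgHom.toLinearMap_apply, LinearMap.mul'_apply]
            generalize G.α y = s
            generalize G.α z = t
            induction s with
            | zero => simp
            | tmul y a =>
              induction t with
              | zero => simp
              | tmul z b => simp
              | add s t hs ht => simp only [map_add, hs, ht, TensorProduct.tmul_add, mul_add]
            | add s t hs ht => simp only [map_add, hs, ht, TensorProduct.add_tmul, add_mul]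
          | add s t hs ht => simp only [map_add, hs, ht]
        have e2 : ∀ t : L ⊗[k] A, (LinearMap.mul' k L ∘ₗ S.lTensor L).rTensor A (Δ.rTensor A t) =
            (Algebra.linearMap k L).rTensor A (G.ε.toLinearMap.rTensor A t) := by
          intro t
          induction t with
          | zero => simp
          | tmul y a => simp [hr]
          | add s t hs ht => simp only [map_add, hs, ht]
        rw [e1, (h.morphism hX).coact, crossed_coact, e2, ε_α]
        simp [Algebra.TensorProduct.algebraMap_apply]
    exact congr($key x)

/-- The structure maps of `L`. -/
def data (Δ : L →ₗ[k] L ⊗[k] L) (S d : L →ₗ[k] L) : SuperBraidedData k A L where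
  crossed := G.crossed
  parity := G.P.toLinearMap
  sign := G.sign
  comul := Δ
  counit := G.ε.toLinearMap
  antipode := S
  d := d

theorem IsCoproduct.isSuperBraidedHopf {G : Generated X L j} (hX : X.IsCrossedModule)
    (h : G.IsCoproduct Δ)
    (hl : ∀ x, LinearMap.mul' k L (S.rTensor L (Δ x)) = algebraMap k L (G.ε x))
    (hr : ∀ x, LinearMap.mul' k L (S.lTensor L (Δ x)) = algebraMap k L (G.ε x))
    (d : L →ₗ[k] L) : (G.data Δ S d).IsSuperBraidedHopf X j where
  generators_injective := G.generators_injective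
  graded := G.isInternal
  parity_apply n x hx := G.P_of_mem n x hx
  sign_apply m n x hx y hy := G.sign_apply m n x hx y hy
  isCrossedModule := G.isCrossedModule hX
  generators_morphism := G.generators_morphism
  mul_morphism := G.mul_morphism
  one_morphism := G.one_morphism
  comul_morphism := h.morphism hX
  counit_morphism := G.counit_morphism
  antipode_morphism := h.antipode_morphism hX hl hr
  coassoc := h.coassoc hX
  counit_left := h.counit_left hX
  counit_right := h.counit_right
  comul_one := h.one
  comul_mul := h.comul_mul hX
  counit_one := map_one G.ε
  counit_mul := map_mul G.ε
  antipode_left := hl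
  antipode_right := hr
  comul_generators v := by
    change Δ (j v) = _
    have := h.gen_mul v 1
    rw [mul_one] at this
    rw [this, h.one, primOp_tmul, map_one, map_one, Algebra.TensorProduct.one_def, mul_one,
      Conv.fill_tmul, G.β_apply_one hX, mul_one]

end Generated

end Antipode

section Differential

open WithConv

variable {k : Type u} {A : Type v} [Field k] [Ring A] [HopfAlgebra k A]
variable {V : Type w} [AddCommGroup V] [Module k V]

/-! ### The Maurer-Cartan form -/

theorem piEps_apply (a : A) : (piEps k A a : A) = a - algebraMap k A (Coalgebra.counit a) := rfl

theorem piEps_coe (a : Aug k A) : piEps k A (a : A) = a := by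
  apply Subtype.ext
  rw [piEps_apply, LinearMap.mem_ker.1 a.2, map_zero, sub_zero]

theorem piEps_one : piEps k A 1 = 0 := by
  apply Subtype.ext
  simp [piEps_apply]

theorem mcForm_one (ϖ : Aug k A →ₗ[k] V) : mcForm ϖ 1 = 0 := by
  rw [mcForm, LinearMap.comp_apply, piEps_one, map_zero]

theorem mcForm_coe (ϖ : Aug k A →ₗ[k] V) (a : Aug k A) : mcForm ϖ a = ϖ a := by
  rw [mcForm, LinearMap.comp_apply, piEps_coe]

theorem mcForm_surjective {ϖ : Aug k A →ₗ[k] V} (h : Function.Surjective ϖ) :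
    Function.Surjective (mcForm ϖ) := fun v => by
  obtain ⟨a, rfl⟩ := h v
  exact ⟨a, mcForm_coe ϖ a⟩

/-- `(f ⊗ id) Ad_R(a)` in the convolution algebra. -/
theorem rTensor_adR {R : Type*} [Ring R] [Algebra k R] (f : Conv k A R) (a : A) :
    f.ofConv.rTensor A (adR k A a) = (Conv.inclInv R *
      (Conv.post Algebra.TensorProduct.includeLeft f * Conv.incl R) : Conv k A (R ⊗[k] A)) a := by
  simp only [adR, comul₃, LinearMap.comp_apply, LinearMap.convMul_apply]
  generalize (Coalgebra.comul (R := k) a) = s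
  induction s with
  | zero => simp
  | tmul a b =>
    simp only [LinearMap.lTensor_tmul, TensorProduct.map_tmul, LinearMap.convMul_apply]
    generalize (Coalgebra.comul (R := k) b) = s
    induction s with
    | zero => simp
    | tmul b c => simp
    | add s t hs ht => simp only [map_add, hs, ht, TensorProduct.tmul_add]
  | add s t hs ht => simp only [map_add, hs, ht]

theorem adR_one : adR k A (1 : A) = 1 ⊗ₜ 1 := by
  simp [adR, comul₃, Algebra.TensorProduct.one_def]

variable {X : CrossedData k A V} {ϖ : Aug k A →ₗ[k] V}

theorem mcForm_mul (hϖ : (CrossedData.aug k A).IsMorphism X ϖ) (a b : A) :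
    mcForm ϖ (a * b) = X.act (mcForm ϖ a ⊗ₜ b) + Coalgebra.counit (R := k) a • mcForm ϖ b := by
  rw [mcForm, LinearMap.comp_apply, LinearMap.comp_apply, LinearMap.comp_apply, ← hϖ.act,
    ← map_smul, ← map_add]
  congr 1
  apply Subtype.ext
  simp [CrossedData.aug, piEps_apply, sub_mul, Algebra.algebraMap_eq_smul_one, smul_sub, mul_smul]

theorem coact_mcForm (hϖ : (CrossedData.aug k A).IsMorphism X ϖ) (a : A) :
    X.coact (mcForm ϖ a) = (mcForm ϖ).rTensor A (adR k A a) := by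
  have h1 : adR k A (piEps k A a : A) = adR k A a -
      Coalgebra.counit (R := k) a • (1 : A) ⊗ₜ[k] (1 : A) := by
    rw [piEps_apply, map_sub, Algebra.algebraMap_eq_smul_one, map_smul, adR_one]
  have h2 : (mcForm ϖ) = ϖ ∘ₗ piEps k A := rfl
  rw [h2, LinearMap.comp_apply, hϖ.coact, LinearMap.rTensor_comp, LinearMap.comp_apply]
  congr 1
  simp [CrossedData.aug, h1, piEps_one]

theorem rTensor_adR_eq_zero (hϖ : (CrossedData.aug k A).IsMorphism X ϖ)
    (hsurj : Function.Surjective ϖ) {R : Type*} [AddCommGroup R] [Module k R] {f : A →ₗ[k] R}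
    (h1 : f 1 = 0) (hf : ∀ a : Aug k A, ϖ a = 0 → f a = 0) (a : Aug k A) (ha : ϖ a = 0) :
    f.rTensor A (adR k A (a : A)) = 0 := by
  obtain ⟨s, hs⟩ := ϖ.exists_rightInverse_of_surjective (LinearMap.range_eq_top.2 hsurj)
  have hf' : f = (f ∘ₗ (Aug k A).subtype ∘ₗ s) ∘ₗ mcForm ϖ := by
    ext b
    have h2 : f (piEps k A b : A) = f b := by
      rw [piEps_apply, map_sub, Algebra.algebraMap_eq_smul_one, map_smul, h1, smul_zero, sub_zero]
    have h3 := hf (piEps k A b - s (ϖ (piEps k A b))) (by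
      rw [map_sub, ← LinearMap.comp_apply ϖ s, hs, LinearMap.id_apply, sub_self])
    rw [Submodule.coe_sub, map_sub, sub_eq_zero, h2] at h3
    exact h3
  rw [hf', LinearMap.rTensor_comp, LinearMap.comp_apply, ← coact_mcForm hϖ, mcForm_coe, ha,
    map_zero, map_zero]

variable {L : Type x} [Ring L] [Algebra k L]

/-- The form `ϖ π_ε` with values in `L`, in the convolution algebra. -/
def mcConv (ϖ : Aug k A →ₗ[k] V) (j : V →ₗ[k] L) : Conv k A L := toConv (j ∘ₗ mcForm ϖ)

@[simp] theorem mcConv_apply (ϖ : Aug k A →ₗ[k] V) (j : V →ₗ[k] L) (a : A) :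
    mcConv ϖ j a = j (mcForm ϖ a) := rfl

namespace Conv

variable {R : Type*} [Ring R] [Algebra k R]

/-- `c ↦ f(c ·)` as a linear map. -/
def shiftₗ (f : Conv k A R) : A →ₗ[k] Conv k A R where
  toFun := shift f
  map_add' := shift_add f
  map_smul' c a := ext' fun b => by simp

@[simp] theorem shiftₗ_apply (f : Conv k A R) (a : A) : shiftₗ f a = shift f a := rfl

theorem shift_mul (f g : Conv k A R) (c : A) : shift (f * g) c = LinearMap.mul' k _
    (TensorProduct.map (shiftₗ f) (shiftₗ g) (Coalgebra.comul (R := k) c)) := by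
  refine ext' fun a => ?_
  rw [shift_apply, LinearMap.convMul_apply, Bialgebra.comul_mul]
  generalize (Coalgebra.comul (R := k) c) = s
  induction s with
  | zero => simp
  | tmul c c' =>
    simp only [TensorProduct.map_tmul, LinearMap.mul'_apply, LinearMap.convMul_apply, shiftₗ_apply]
    generalize (Coalgebra.comul (R := k) a) = t
    induction t with
    | zero => simp
    | tmul b b' => simp
    | add s t hs ht => simp only [map_add, mul_add, hs, ht]
  | add s t hs ht => simp only [map_add, add_mul, hs, ht, ofConv_add, LinearMap.add_apply]

end Conv

namespace Generated

variable {j : V →ₗ[k] L} (G : Generated X L j)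

theorem post_α_mcConv (hϖ : (CrossedData.aug k A).IsMorphism X ϖ) :
    Conv.post G.α (mcConv ϖ j) = Conv.inclInv L *
      (Conv.post Algebra.TensorProduct.includeLeft (mcConv ϖ j) * Conv.incl L) :=
  Conv.ext' fun a => by
    rw [← rTensor_adR, Conv.post_apply, mcConv_apply, G.α_gen, coact_mcForm hϖ]
    change _ = (j ∘ₗ mcForm ϖ).rTensor A _
    rw [LinearMap.rTensor_comp]; rfl

theorem incl_mul_post_α_mcConv (hϖ : (CrossedData.aug k A).IsMorphism X ϖ) :
    Conv.incl L * Conv.post G.α (mcConv ϖ j) =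
      Conv.post Algebra.TensorProduct.includeLeft (mcConv ϖ j) * Conv.incl L := by
  rw [G.post_α_mcConv hϖ, ← mul_assoc, Conv.incl_mul_inclInv, one_mul]

theorem α_mcConv_sq (hϖ : (CrossedData.aug k A).IsMorphism X ϖ) (a : A) :
    G.α ((mcConv ϖ j * mcConv ϖ j) a) =
      (mcConv ϖ j * mcConv ϖ j).ofConv.rTensor A (adR k A a) := by
  rw [rTensor_adR, ← Conv.post_apply, map_mul, map_mul, G.post_α_mcConv hϖ]
  have h : ∀ f : Conv k A (L ⊗[k] A),
      Conv.inclInv L * (f * Conv.incl L) * (Conv.inclInv L * (f * Conv.incl L)) =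
      Conv.inclInv L * (f * f * Conv.incl L) := fun f => by
    calc _ = Conv.inclInv L * f * (Conv.incl L * Conv.inclInv L) * (f * Conv.incl L) := by
          simp only [mul_assoc]
      _ = _ := by rw [Conv.incl_mul_inclInv, mul_one]; simp only [mul_assoc]
  rw [h]

theorem β_mcConv (hϖ : (CrossedData.aug k A).IsMorphism X ϖ) (b : A) :
    G.β (mcConv ϖ j b) = Conv.shift (mcConv ϖ j) b -
      Coalgebra.counit (R := k) b • mcConv ϖ j :=
  Conv.ext' fun a => by
    simp [G.β_gen, mcForm_mul hϖ]

/-- The action on `(ϖ π_ε b₁)(ϖ π_ε b₂)`. -/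
theorem β_mcConv_sq (hϖ : (CrossedData.aug k A).IsMorphism X ϖ) (b : A) :
    G.β ((mcConv ϖ j * mcConv ϖ j) b) = Conv.shift (mcConv ϖ j * mcConv ϖ j) b -
      mcConv ϖ j * Conv.shift (mcConv ϖ j) b - Conv.shift (mcConv ϖ j) b * mcConv ϖ j +
      Coalgebra.counit (R := k) b • (mcConv ϖ j * mcConv ϖ j) := by
  set E := mcConv ϖ j
  have h1 : ∀ s : A ⊗[k] A, G.β (LinearMap.mul' k L (TensorProduct.map E.ofConv E.ofConv s)) =
      LinearMap.mul' k _ (TensorProduct.map (Conv.shiftₗ E) (Conv.shiftₗ E) s) -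
      E * Conv.shiftₗ E (TensorProduct.lid k A
        ((Coalgebra.counit (R := k) (A := A)).rTensor A s)) -
      Conv.shiftₗ E (TensorProduct.rid k A
        ((Coalgebra.counit (R := k) (A := A)).lTensor A s)) * E +
      LinearMap.mul' k k (TensorProduct.map Coalgebra.counit Coalgebra.counit s) • (E * E) := by
    intro s
    induction s with
    | zero => simp only [map_zero, mul_zero, zero_mul, zero_smul, sub_zero, add_zero]
    | tmul a b =>
      have ha := G.β_mcConv (j := j) hϖ a
      have hb := G.β_mcConv (j := j) hϖ b
      simp only [TensorProduct.map_tmul, LinearMap.mul'_apply, map_mul, E] at ha hb ⊢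
      rw [ha, hb]
      simp only [LinearMap.rTensor_tmul, LinearMap.lTensor_tmul, TensorProduct.lid_tmul,
        TensorProduct.rid_tmul, map_smul, Conv.shiftₗ_apply, sub_mul, mul_sub, smul_mul_assoc,
        mul_smul_comm, smul_sub, mul_smul]
      rw [smul_comm (Coalgebra.counit (R := k) b)]
      abel
    | add s t hs ht =>
      simp only [map_add, hs, ht, mul_add, add_mul, add_smul]
      abel
  have h2 := h1 (Coalgebra.comul b)
  rw [Coalgebra.rTensor_counit_comul, Coalgebra.lTensor_counit_comul, ← Conv.shift_mul] at h2
  refine Eq.trans h2 ?_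
  have h3 : LinearMap.mul' k k (TensorProduct.map Coalgebra.counit Coalgebra.counit
      (Coalgebra.comul (R := k) b)) = Coalgebra.counit (R := k) b := by
    have h4 : (TensorProduct.map Coalgebra.counit Coalgebra.counit : A ⊗[k] A →ₗ[k] k ⊗[k] k) =
        (Coalgebra.counit (R := k) (A := A)).lTensor k ∘ₗ
          (Coalgebra.counit (R := k) (A := A)).rTensor A := by
      ext; simp
    rw [h4, LinearMap.comp_apply, Coalgebra.rTensor_counit_comul]
    simp
  rw [h3]
  simp

/-- `d` is the super-derivation of `L` which satisfies the Maurer-Cartan equation. -/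
structure IsExterior (ϖ : Aug k A →ₗ[k] V) (d : L →ₗ[k] L) : Prop where
  one : d 1 = 0
  gen_mul : ∀ v x, d (j v * x) = d (j v) * x - j v * d x
  mc : ∀ a, d (j (mcForm ϖ a)) = - (mcConv ϖ j * mcConv ϖ j) a

variable {d : L →ₗ[k] L}

namespace IsExterior

variable {G}

theorem comp_mc (h : IsExterior (j := j) ϖ d) :
    d ∘ₗ (mcConv ϖ j).ofConv = - (mcConv ϖ j * mcConv ϖ j).ofConv :=
  LinearMap.ext fun a => h.mc a

theorem leibniz (G : Generated X L j) (h : IsExterior (j := j) ϖ d) (x y : L) :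
    d (x * y) = d x * y + G.P x * d y := by
  induction x using adjoin_induction_left G.adjoin_eq_top generalizing y with
  | one => simp [h.one]
  | add x x' hx hx' => rw [add_mul, map_add, hx, hx', map_add, map_add, add_mul, add_mul]; abel
  | smul c x hx =>
    rw [smul_mul_assoc, map_smul, hx, map_smul, map_smul, smul_mul_assoc, smul_mul_assoc, smul_add]
  | gen_mul v x hx =>
    rw [mul_assoc, h.gen_mul, hx, h.gen_mul, map_mul, G.P_gen]
    noncomm_ring

theorem d_P (G : Generated X L j) (hsurj : Function.Surjective ϖ) (h : IsExterior (j := j) ϖ d)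
    (x : L) : d (G.P x) = - G.P (d x) := by
  have key : d ∘ₗ G.P.toLinearMap = - G.P.toLinearMap ∘ₗ d := by
    refine linearMap_ext_left G.adjoin_eq_top (by simp [h.one]) fun v x ih => ?_
    simp only [LinearMap.comp_apply, AlgHom.toLinearMap_apply, LinearMap.neg_apply] at ih ⊢
    obtain ⟨a, rfl⟩ := mcForm_surjective hsurj v
    have h1 : G.P (d (j (mcForm ϖ a))) = d (j (mcForm ϖ a)) := by
      rw [h.mc, map_neg, LinearMap.convMul_apply]
      congr 1
      generalize (Coalgebra.comul (R := k) a) = s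
      induction s with
      | zero => simp
      | tmul a b => simp [G.P_gen]
      | add s t hs ht => simp only [map_add, hs, ht]
    rw [map_mul, G.P_gen, neg_mul, map_neg, h.gen_mul, h.gen_mul, ih, map_sub, map_mul, map_mul,
      G.P_gen, h1]
    noncomm_ring
  exact LinearMap.congr_fun key x

theorem d_d (G : Generated X L j) (hsurj : Function.Surjective ϖ) (h : IsExterior (j := j) ϖ d)
    (x : L) : d (d x) = 0 := by
  have key : d ∘ₗ d = 0 := by
    refine linearMap_ext_left G.adjoin_eq_top (by simp [h.one]) fun v x ih => ?_
    simp only [LinearMap.comp_apply, LinearMap.zero_apply] at ih ⊢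
    obtain ⟨a, rfl⟩ := mcForm_surjective hsurj v
    set E := mcConv ϖ j with hE
    have h1 : d (d (j (mcForm ϖ a))) = 0 := by
      rw [h.mc, map_neg, neg_eq_zero]
      have h2 : d ((E * E) a) = (-(E * E * E) + E * (E * E)) a := by
        rw [ofConv_add, LinearMap.add_apply, ofConv_neg, LinearMap.neg_apply,
          LinearMap.convMul_apply, LinearMap.convMul_apply (E * E), LinearMap.convMul_apply E]
        generalize (Coalgebra.comul (R := k) a) = s
        induction s with
        | zero => simp
        | tmul a b =>
          simp only [TensorProduct.map_tmul, LinearMap.mul'_apply]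
          rw [hE, mcConv_apply, h.gen_mul, mcConv_apply, h.mc, h.mc]
          simp
        | add s t hs ht =>
          simp only [map_add, hs, ht]
          abel
      rw [h2, mul_assoc, neg_add_cancel]; rfl
    have h3 : G.P (d (j (mcForm ϖ a))) = d (j (mcForm ϖ a)) := by
      have := h.d_P G hsurj (j (mcForm ϖ a))
      rw [G.P_gen, map_neg, neg_inj] at this
      exact this.symm
    rw [h.gen_mul, map_sub, h.leibniz G, h.gen_mul, h1, h3, ih]
    noncomm_ring
  exact LinearMap.congr_fun key x

theorem degree (hsurj : Function.Surjective ϖ) (h : IsExterior (j := j) ϖ d) (n : ℕ) (x : L)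
    (hx : x ∈ gradedPart j n) : d x ∈ gradedPart j (n + 1) := by
  rw [gradedPart] at hx
  induction n generalizing x with
  | zero =>
    rw [pow_zero] at hx
    obtain ⟨c, rfl⟩ := Submodule.mem_one.1 hx
    rw [Algebra.algebraMap_eq_smul_one, map_smul, h.one, smul_zero]
    exact Submodule.zero_mem _
  | succ n ih =>
    rw [pow_succ'] at hx
    refine Submodule.mul_induction_on hx ?_ ?_
    · rintro _ ⟨v, rfl⟩ y hy
      obtain ⟨a, rfl⟩ := mcForm_surjective hsurj v
      rw [h.gen_mul, h.mc]
      refine sub_mem ?_ (gen_mul_mem_gradedPart j (n + 1) _ _ (ih y hy))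
      rw [neg_mul, LinearMap.convMul_apply]
      refine neg_mem ?_
      generalize (Coalgebra.comul (R := k) a) = s
      induction s with
      | zero => simp
      | tmul a b =>
        simp only [TensorProduct.map_tmul, LinearMap.mul'_apply, mcConv_apply, mul_assoc]
        exact gen_mul_mem_gradedPart j _ _ _ (gen_mul_mem_gradedPart j _ _ _ hy)
      | add s t hs ht => simp only [map_add, add_mul]; exact add_mem hs ht
    · intro x y hx hy
      rw [map_add]
      exact add_mem hx hy

theorem coact_d (G : Generated X L j) (hϖ : (CrossedData.aug k A).IsMorphism X ϖ)
    (hsurj : Function.Surjective ϖ) (h : IsExterior (j := j) ϖ d) (x : L) :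
    G.α (d x) = d.rTensor A (G.α x) := by
  have key : G.α.toLinearMap ∘ₗ d = d.rTensor A ∘ₗ G.α.toLinearMap := by
    refine linearMap_ext_left G.adjoin_eq_top
      (by simp [h.one, Algebra.TensorProduct.one_def]) fun v x ih => ?_
    simp only [LinearMap.comp_apply, AlgHom.toLinearMap_apply] at ih ⊢
    have h1 : G.α (d (j v)) = d.rTensor A (j.rTensor A (X.coact v)) := by
      obtain ⟨a, rfl⟩ := mcForm_surjective hsurj v
      have h2 : (d ∘ₗ j) ∘ₗ mcForm ϖ = - (mcConv ϖ j * mcConv ϖ j).ofConv := h.comp_mc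
      rw [h.mc, map_neg, G.α_mcConv_sq hϖ, coact_mcForm hϖ, ← LinearMap.rTensor_comp_apply,
        ← LinearMap.rTensor_comp_apply, h2, LinearMap.rTensor_neg]
      rfl
    have h2 : ∀ (s : V ⊗[k] A) (t : L ⊗[k] A), d.rTensor A (j.rTensor A s * t) =
        d.rTensor A (j.rTensor A s) * t - j.rTensor A s * d.rTensor A t := by
      intro s t
      induction s with
      | zero => simp
      | tmul u c =>
        induction t with
        | zero => simp
        | tmul y b => simp [h.gen_mul, TensorProduct.sub_tmul]
        | add s t hs ht => simp only [map_add, hs, ht, mul_add]; abel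
      | add s t hs ht => simp only [map_add, hs, ht, add_mul]; abel
    rw [map_mul G.α, G.α_gen, h2, h.gen_mul, map_sub, map_mul, map_mul, h1, ih, G.α_gen]
  exact LinearMap.congr_fun key x

/-- Postcomposition with `d`. -/
def dConv (d : L →ₗ[k] L) (f : Conv k A L) : Conv k A L := toConv (d ∘ₗ f.ofConv)

@[simp] theorem dConv_apply (f : Conv k A L) (a : A) : dConv d f a = d (f a) := rfl

theorem dConv_mul (G : Generated X L j) (h : IsExterior (j := j) ϖ d) (f g : Conv k A L) :
    dConv d (f * g) = dConv d f * g + Conv.post G.P f * dConv d g :=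
  Conv.ext' fun a => by
    rw [ofConv_add, LinearMap.add_apply]
    simp only [dConv_apply, LinearMap.convMul_apply]
    generalize (Coalgebra.comul (R := k) a) = s
    induction s with
    | zero => simp
    | tmul a b => simp [h.leibniz G]
    | add s t hs ht => simp only [map_add, hs, ht]; abel

theorem dConv_mcConv (h : IsExterior (j := j) ϖ d) :
    dConv d (mcConv ϖ j) = - (mcConv ϖ j * mcConv ϖ j) :=
  Conv.ext' fun a => h.mc a

theorem dConv_β_gen (G : Generated X L j) (hϖ : (CrossedData.aug k A).IsMorphism X ϖ)
    (h : IsExterior (j := j) ϖ d) (b : A) :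
    dConv d (G.β (mcConv ϖ j b)) = - Conv.shift (mcConv ϖ j * mcConv ϖ j) b +
      Coalgebra.counit (R := k) b • (mcConv ϖ j * mcConv ϖ j) := by
  rw [G.β_mcConv hϖ]
  refine Conv.ext' fun a => ?_
  have h1 : ∀ c, d ((mcConv ϖ j) c) = - (mcConv ϖ j * mcConv ϖ j) c := h.mc
  simp only [dConv_apply, ofConv_sub, LinearMap.sub_apply, map_sub, ofConv_smul,
    LinearMap.smul_apply, map_smul, Conv.shift_apply, h1, ofConv_add, LinearMap.add_apply,
    ofConv_neg, LinearMap.neg_apply, smul_neg, sub_neg_eq_add]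

/-- The differential and the action, on all of `L`. -/
theorem d_act (G : Generated X L j) (hϖ : (CrossedData.aug k A).IsMorphism X ϖ)
    (hsurj : Function.Surjective ϖ) (h : IsExterior (j := j) ϖ d) (x : L) :
    G.β (d x) - dConv d (G.β x) = mcConv ϖ j * G.β x - G.β (G.P x) * mcConv ϖ j := by
  have gen : ∀ v, G.β (d (j v)) - dConv d (G.β (j v)) =
      mcConv ϖ j * G.β (j v) + G.β (j v) * mcConv ϖ j := by
    intro v
    obtain ⟨b, rfl⟩ := mcForm_surjective hsurj v
    have h1 := h.dConv_β_gen G hϖ b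
    have h2 := G.β_mcConv (j := j) hϖ b
    have h3 := G.β_mcConv_sq (j := j) hϖ b
    rw [mcConv_apply] at h1 h2
    rw [h1, h.mc, map_neg, h3, h2]
    generalize mcConv ϖ j = E
    generalize Conv.shift E b = s
    simp only [mul_sub, sub_mul, mul_smul_comm, smul_mul_assoc]
    abel
  have hP : ∀ x, Conv.post G.P (G.β x) = G.β (G.P x) := fun x => Conv.ext' fun a => by
    rw [Conv.post_apply, G.β_P]
  induction x using adjoin_induction_left G.adjoin_eq_top with
  | one =>
    rw [h.one, map_zero, map_one, map_one, map_one, mul_one, one_mul, sub_self]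
    exact Conv.ext' fun a => by simp [Algebra.algebraMap_eq_smul_one, h.one]
  | add x y hx hy =>
    have h1 : dConv d (G.β x + G.β y) = dConv d (G.β x) + dConv d (G.β y) :=
      Conv.ext' fun a => by simp
    rw [map_add, map_add, map_add, map_add, map_add, h1, mul_add, add_mul, add_sub_add_comm, hx,
      hy, ← add_sub_add_comm]
  | smul c x hx =>
    have h1 : dConv d (c • G.β x) = c • dConv d (G.β x) := Conv.ext' fun a => by simp
    rw [map_smul, map_smul, map_smul, map_smul, map_smul, h1, ← smul_sub, hx, mul_smul_comm,
      smul_mul_assoc, smul_sub]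
  | gen_mul v x hx =>
    have g := gen v
    rw [sub_eq_iff_eq_add] at hx g
    rw [h.gen_mul, map_sub, map_mul, map_mul, map_mul, h.dConv_mul G, hP, map_mul, map_mul,
      G.P_gen, map_neg, hx, g]
    noncomm_ring

end IsExterior

end Generated

end Differential

section DifferentialCoproduct

open WithConv

variable {k : Type u} {A : Type v} [Field k] [Ring A] [HopfAlgebra k A]
variable {V : Type w} [AddCommGroup V] [Module k V]
variable {X : CrossedData k A V} {ϖ : Aug k A →ₗ[k] V}
variable {L : Type x} [Ring L] [Algebra k L]

namespace Generated

variable {j : V →ₗ[k] L} (G : Generated X L j) {d : L →ₗ[k] L}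

theorem pushed_shift {R : Type*} [Ring R] [Algebra k R] (f : Conv k A R) (c : A)
    (t : L ⊗[k] A) : G.pushed (Conv.shift f c) t = G.pushed f ((1 ⊗ₜ c) * t) := by
  induction t with
  | zero => simp
  | tmul z a =>
    rw [Algebra.TensorProduct.tmul_mul_tmul, one_mul, pushed_tmul, pushed_tmul]
    congr 2
    exact Conv.ext' fun b => by simp [mul_assoc]
  | add s t hs ht => simp only [map_add, hs, ht, mul_add]

theorem _root_.BraidedExterior.end_neg_mul {M : Type*} [AddCommGroup M] [Module k M]
    (f g : Module.End k M) : (-(f : M →ₗ[k] M) : M →ₗ[k] M) * g = -(f * g : M →ₗ[k] M) := rfl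

theorem _root_.BraidedExterior.end_mul_neg {M : Type*} [AddCommGroup M] [Module k M]
    (f g : Module.End k M) : f * (-(g : M →ₗ[k] M) : M →ₗ[k] M) = -(f * g : M →ₗ[k] M) :=
  LinearMap.comp_neg g f

/-- `b ↦ ℓ(ϖ π_ε b)`. -/
def mcLeft (ϖ : Aug k A →ₗ[k] V) (j : V →ₗ[k] L) : Conv k A (Module.End k (L ⊗[k] L)) :=
  toConv (LinearMap.rTensorHom L ∘ₗ LinearMap.mul k L ∘ₗ (mcConv ϖ j).ofConv)

theorem mcLeft_apply (b : A) : mcLeft ϖ j b = lmulFst L (mcConv ϖ j b) := rfl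

/-- `b ↦ (z ⊗ w ↦ P z₀ ⊗ ϖ π_ε(b z₁) w)`. -/
def mcShift (ϖ : Aug k A →ₗ[k] V) : Conv k A (Module.End k (L ⊗[k] L)) :=
  toConv (LinearMap.mulRight k (G.parityFst L) ∘ₗ
    Conv.coOpₗ (R := L) G.α.toLinearMap ∘ₗ Conv.shiftₗ (mcConv ϖ j))

theorem mcShift_apply (b : A) :
    G.mcShift ϖ b = G.op (Conv.shift (mcConv ϖ j) b) * G.parityFst L := rfl

/-- The curvature operator `z ⊗ w ↦ P z₀ ⊗ ϖ π_ε(z₁) w`. -/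
def curvOp (ϖ : Aug k A →ₗ[k] V) : Module.End k (L ⊗[k] L) :=
  G.op (mcConv ϖ j) * G.parityFst L

/-- `b ↦ primOp(ϖ π_ε b)`. -/
def mcPrim (ϖ : Aug k A →ₗ[k] V) : Conv k A (Module.End k (L ⊗[k] L)) :=
  mcLeft ϖ j + G.mcShift ϖ - Conv.const (G.curvOp ϖ)

theorem mcPrim_apply (hϖ : (CrossedData.aug k A).IsMorphism X ϖ) (b : A) :
    G.mcPrim ϖ b = G.primOp (mcForm ϖ b) := by
  have h := G.β_mcConv (j := j) hϖ b
  rw [mcConv_apply] at h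
  rw [mcPrim, ofConv_sub, ofConv_add, LinearMap.sub_apply, LinearMap.add_apply, mcLeft_apply,
    mcShift_apply, Conv.const_apply, primOp, h, op_sub, op_smul, sub_mul, smul_mul_assoc, curvOp,
    mcConv_apply, add_sub_assoc]

theorem mcShift_mul_mcLeft (hϖ : (CrossedData.aug k A).IsMorphism X ϖ) :
    G.mcShift ϖ * mcLeft ϖ j = - (mcLeft ϖ j * G.mcShift ϖ) := by
  refine Conv.ext' fun a => ?_
  have h1 : (G.mcShift ϖ * mcLeft ϖ j) a = - G.pushed (mcConv ϖ j)
      ((Conv.incl L * Conv.post G.α (mcConv ϖ j) : Conv k A (L ⊗[k] A)) a) * G.parityFst L := by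
    simp only [LinearMap.convMul_apply]
    generalize (Coalgebra.comul (R := k) a) = s
    induction s with
    | zero => simp
    | tmul a b =>
      simp only [TensorProduct.map_tmul, LinearMap.mul'_apply, mcLeft_apply, mcShift_apply,
        Conv.incl_apply, Conv.post_apply]
      rw [← pushed_shift, ← op_mul_lmulFst, mul_assoc, parityFst_mul_lmulFst, mcConv_apply,
        G.P_gen]
      have : lmulFst (k := k) L (-(j (mcForm ϖ b))) =
          - lmulFst (k := k) L (j (mcForm ϖ b)) :=
        map_neg (LinearMap.rTensorHom L ∘ₗ LinearMap.mul k L :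
          L →ₗ[k] Module.End k (L ⊗[k] L)) _
      rw [this]
      ext y z
      simp
    | add s t hs ht => simp only [map_add, hs, ht, neg_add, add_mul]
  have h2 : (mcLeft ϖ j * G.mcShift ϖ) a = G.pushed (mcConv ϖ j)
      ((Conv.post Algebra.TensorProduct.includeLeft (mcConv ϖ j) * Conv.incl L : Conv k A _) a) *
        G.parityFst L := by
    simp only [LinearMap.convMul_apply]
    generalize (Coalgebra.comul (R := k) a) = s
    induction s with
    | zero => simp
    | tmul a b =>
      simp only [TensorProduct.map_tmul, LinearMap.mul'_apply, mcLeft_apply, mcShift_apply,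
        Conv.incl_apply, Conv.post_apply, Algebra.TensorProduct.includeLeft_apply,
        Algebra.TensorProduct.tmul_mul_tmul, mul_one, one_mul, pushed_tmul, mul_assoc]
    | add s t hs ht => simp only [map_add, hs, ht, add_mul]
  rw [h1, ofConv_neg, LinearMap.neg_apply, h2, G.incl_mul_post_α_mcConv hϖ]
  rfl

theorem mcLeft_mul_mcLeft (b : A) :
    (mcLeft ϖ j * mcLeft ϖ j) b = lmulFst L ((mcConv ϖ j * mcConv ϖ j) b) := by
  simp only [LinearMap.convMul_apply]
  have h : ∀ s : A ⊗[k] A, LinearMap.mul' k (Module.End k (L ⊗[k] L))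
      (TensorProduct.map (mcLeft ϖ j).ofConv (mcLeft ϖ j).ofConv s) =
      LinearMap.rTensorHom L (LinearMap.mul k L (LinearMap.mul' k L
        (TensorProduct.map (mcConv ϖ j).ofConv (mcConv ϖ j).ofConv s))) := by
    intro s
    induction s with
    | zero => simp
    | tmul a b =>
      simp only [TensorProduct.map_tmul, LinearMap.mul'_apply, mcLeft_apply, ← lmulFst_mul]
      rfl
    | add s t hs ht => simp only [map_add, hs, ht]
  exact h _

theorem mcShift_mul_mcShift (hX : X.IsCrossedModule) (b : A) :
    (G.mcShift ϖ * G.mcShift ϖ) b = G.op (Conv.shift (mcConv ϖ j * mcConv ϖ j) b) := by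
  rw [Conv.shift_mul, LinearMap.convMul_apply]
  generalize (Coalgebra.comul (R := k) b) = s
  induction s with
  | zero => simp [op_zero]
  | tmul a b =>
    simp only [TensorProduct.map_tmul, LinearMap.mul'_apply, mcShift_apply, Conv.shiftₗ_apply,
      G.op_mul hX]
    rw [mul_assoc, ← mul_assoc (G.parityFst L), parityFst_mul_op, mul_assoc,
      parityFst_mul_parityFst, mul_one]
  | add s t hs ht => simp only [map_add, hs, ht, op_add]

theorem mcPrim_mul_mcPrim (hX : X.IsCrossedModule)
    (hϖ : (CrossedData.aug k A).IsMorphism X ϖ) (b : A) :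
    (G.mcPrim ϖ * G.mcPrim ϖ) b = lmulFst L ((mcConv ϖ j * mcConv ϖ j) b) +
      G.op (Conv.shift (mcConv ϖ j * mcConv ϖ j) b -
        mcConv ϖ j * Conv.shift (mcConv ϖ j) b - Conv.shift (mcConv ϖ j) b * mcConv ϖ j +
      Coalgebra.counit (R := k) b • (mcConv ϖ j * mcConv ϖ j)) -
      (lmulFst L (mcConv ϖ j b) * G.curvOp ϖ + G.curvOp ϖ * lmulFst L (mcConv ϖ j b)) := by
  have h1 : G.mcPrim ϖ * G.mcPrim ϖ = mcLeft ϖ j * mcLeft ϖ j + G.mcShift ϖ * G.mcShift ϖ -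
      (mcLeft ϖ j * Conv.const (G.curvOp ϖ) + Conv.const (G.curvOp ϖ) * mcLeft ϖ j) -
      (G.mcShift ϖ * Conv.const (G.curvOp ϖ) + Conv.const (G.curvOp ϖ) * G.mcShift ϖ) +
      Conv.const (G.curvOp ϖ * G.curvOp ϖ) := by
    have h := G.mcShift_mul_mcLeft hϖ
    simp only [mcPrim, mul_add, add_mul, sub_mul, mul_sub, map_mul, h]
    abel
  have pp : ∀ f g : Conv k A L, G.op f * G.parityFst L * (G.op g * G.parityFst L) =
      G.op (f * g) := fun f g => by
    rw [G.op_mul hX, mul_assoc, ← mul_assoc (G.parityFst L), parityFst_mul_op, mul_assoc,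
      parityFst_mul_parityFst, mul_one]
  rw [h1]
  simp only [ofConv_add, ofConv_sub, LinearMap.add_apply, LinearMap.sub_apply,
    Conv.mul_const_apply, Conv.const_mul_apply, Conv.const_apply]
  rw [mcLeft_mul_mcLeft, G.mcShift_mul_mcShift hX]
  simp only [mcLeft_apply, mcShift_apply]
  have c : ∀ f : Conv k A L, G.curvOp ϖ * (G.op f * G.parityFst L) = G.op (mcConv ϖ j * f) :=
    fun f => pp _ _
  have c' : ∀ f : Conv k A L, G.op f * G.parityFst L * G.curvOp ϖ = G.op (f * mcConv ϖ j) :=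
    fun f => pp _ _
  have c'' : G.curvOp ϖ * G.curvOp ϖ = G.op (mcConv ϖ j * mcConv ϖ j) := pp _ _
  rw [c, c', c'']
  simp only [op_add, op_sub, op_smul]
  abel

/-- The differential of the tensor square, twisted by the curvature. -/
def curvedD (ϖ : Aug k A →ₗ[k] V) (d : L →ₗ[k] L) : Module.End k (L ⊗[k] L) :=
  d.rTensor L + G.parityFst L * d.lTensor L + G.curvOp ϖ

theorem curvedD_primOp (hX : X.IsCrossedModule)
    (hϖ : (CrossedData.aug k A).IsMorphism X ϖ) (hsurj : Function.Surjective ϖ)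
    (h : IsExterior (j := j) ϖ d) (b : A) :
    G.curvedD ϖ d * G.primOp (mcForm ϖ b) + G.primOp (mcForm ϖ b) * G.curvedD ϖ d =
      - (G.mcPrim ϖ * G.mcPrim ϖ) b := by
  rw [G.mcPrim_mul_mcPrim hX hϖ]
  set E := mcConv ϖ j with hE
  set B := G.β (j (mcForm ϖ b)) with hB
  set p := G.parityFst L with hp
  have hBE : B = Conv.shift E b - Coalgebra.counit (R := k) b • E := G.β_mcConv hϖ b
  have a1 : d.rTensor L * lmulFst L (E b) + lmulFst L (E b) * d.rTensor L =
      - lmulFst L ((E * E) b) := by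
    ext y z
    have : d (E b) = - (E * E) b := h.mc b
    simp only [TensorProduct.AlgebraTensorModule.curry_apply, TensorProduct.curry_apply,
      LinearMap.coe_restrictScalars, Module.End.mul_apply, LinearMap.add_apply, lmulFst_tmul,
      LinearMap.rTensor_tmul, LinearMap.neg_apply]
    rw [← TensorProduct.add_tmul, ← TensorProduct.neg_tmul, ← neg_mul, ← this, hE, mcConv_apply,
      h.gen_mul, sub_add_cancel]
  have a2 : p * d.lTensor L * lmulFst L (E b) + lmulFst L (E b) * (p * d.lTensor L) = 0 := by
    ext y z
    simp [hp, hE, G.P_gen, TensorProduct.neg_tmul]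
  have pd : p * d.lTensor L = d.lTensor L * p := by ext y z; simp [hp]
  have dp : d.rTensor L * p = - (p * d.rTensor L) := by
    ext y z; simp [hp, h.d_P G hsurj, TensorProduct.neg_tmul]
  have dop : ∀ f : Conv k A L, d.rTensor L * G.op f = G.op f * d.rTensor L := by
    intro f
    ext y z
    simp only [TensorProduct.AlgebraTensorModule.curry_apply, TensorProduct.curry_apply,
      LinearMap.coe_restrictScalars, Module.End.mul_apply, op_tmul, LinearMap.rTensor_tmul,
      h.coact_d G hϖ hsurj]
    generalize G.α y = t
    induction t with
    | zero => simp
    | tmul m a => simp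
    | add s t hs ht => simp only [map_add, hs, ht]
  have a3 : d.rTensor L * (G.op B * p) + G.op B * p * d.rTensor L = 0 := by
    rw [← mul_assoc, dop, mul_assoc, dp, end_mul_neg, mul_assoc, neg_add_cancel]
  have dop' : d.lTensor L * G.op B = G.op (IsExterior.dConv d B) - G.op B * d.lTensor L := by
    have hPB : ∀ a, G.P (B a) = - B a := fun a => by rw [hB, ← G.β_P, G.P_gen, map_neg]; rfl
    ext y z
    simp only [TensorProduct.AlgebraTensorModule.curry_apply, TensorProduct.curry_apply,
      LinearMap.coe_restrictScalars, Module.End.mul_apply, op_tmul, LinearMap.lTensor_tmul,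
      LinearMap.sub_apply]
    generalize G.α y = t
    induction t with
    | zero => simp
    | tmul m a =>
      simp [h.leibniz G, hPB, TensorProduct.tmul_add, TensorProduct.tmul_neg, sub_eq_add_neg]
    | add s t hs ht => simp only [map_add, hs, ht]; abel
  have a4 : p * d.lTensor L * (G.op B * p) + G.op B * p * (p * d.lTensor L) =
      G.op (IsExterior.dConv d B) := by
    have : p * d.lTensor L * (G.op B * p) = G.op (IsExterior.dConv d B) - G.op B * d.lTensor L := by
      rw [pd, ← mul_assoc, mul_assoc (d.lTensor L), hp, parityFst_mul_op, ← mul_assoc, dop',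
        mul_assoc, parityFst_mul_parityFst, mul_one]
    rw [this, mul_assoc, ← mul_assoc p, hp, parityFst_mul_parityFst, one_mul, sub_add_cancel]
  have a5 : G.curvOp ϖ * (G.op B * p) + G.op B * p * G.curvOp ϖ = G.op (E * B + B * E) := by
    have pp : ∀ f g : Conv k A L, G.op f * p * (G.op g * p) =
        G.op (f * g) := fun f g => by
      rw [G.op_mul hX, mul_assoc, ← mul_assoc p, hp, parityFst_mul_op, mul_assoc,
        parityFst_mul_parityFst, mul_one]
    rw [curvOp, op_add, ← pp, ← pp]
  have hdB : IsExterior.dConv d B = - Conv.shift (E * E) b +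
      Coalgebra.counit (R := k) b • (E * E) := h.dConv_β_gen G hϖ b
  have expand : G.curvedD ϖ d * G.primOp (mcForm ϖ b) + G.primOp (mcForm ϖ b) * G.curvedD ϖ d =
      (d.rTensor L * lmulFst L (E b) + lmulFst L (E b) * d.rTensor L) +
      (p * d.lTensor L * lmulFst L (E b) + lmulFst L (E b) * (p * d.lTensor L)) +
      (d.rTensor L * (G.op B * p) + G.op B * p * d.rTensor L) +
      (p * d.lTensor L * (G.op B * p) + G.op B * p * (p * d.lTensor L)) +
      (G.curvOp ϖ * (G.op B * p) + G.op B * p * G.curvOp ϖ) +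
      (lmulFst L (E b) * G.curvOp ϖ + G.curvOp ϖ * lmulFst L (E b)) := by
    have : G.primOp (mcForm ϖ b) = lmulFst L (E b) + G.op B * p := rfl
    rw [this, curvedD]
    simp only [add_mul, mul_add]
    abel
  rw [expand, a1, a2, a3, a4, a5, hdB, hBE]
  simp only [mul_sub, sub_mul, mul_smul_comm, smul_mul_assoc, op_add, op_sub, op_smul, op_neg]
  abel

variable {Δ : L →ₗ[k] L ⊗[k] L}

theorem IsCoproduct.comul_d {G : Generated X L j} (hX : X.IsCrossedModule)
    (hϖ : (CrossedData.aug k A).IsMorphism X ϖ) (hsurj : Function.Surjective ϖ)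
    (hΔ : G.IsCoproduct Δ) (h : IsExterior (j := j) ϖ d) (x : L) :
    Δ (d x) = G.curvedD ϖ d (Δ x) := by
  have key : Δ ∘ₗ d = G.curvedD ϖ d ∘ₗ Δ := by
    refine linearMap_ext_left G.adjoin_eq_top ?_ fun v x ih => ?_
    · simp [h.one, hΔ.one, curvedD, curvOp, op_tmul, Algebra.TensorProduct.one_def, mcForm_one]
    simp only [LinearMap.comp_apply] at ih ⊢
    obtain ⟨b, rfl⟩ := mcForm_surjective hsurj v
    have h1 : Δ ((mcConv ϖ j * mcConv ϖ j) b * x) = (G.mcPrim ϖ * G.mcPrim ϖ) b (Δ x) := by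
      simp only [LinearMap.convMul_apply]
      generalize (Coalgebra.comul (R := k) b) = s
      induction s with
      | zero => simp
      | tmul a b =>
        simp only [TensorProduct.map_tmul, LinearMap.mul'_apply, mcConv_apply, mul_assoc,
          hΔ.gen_mul, G.mcPrim_apply hϖ, Module.End.mul_apply]
      | add s t hs ht => simp only [map_add, hs, ht, add_mul, LinearMap.add_apply]
    have h2 := congr($(G.curvedD_primOp hX hϖ hsurj h b) (Δ x))
    rw [LinearMap.add_apply, Module.End.mul_apply, Module.End.mul_apply, LinearMap.neg_apply] at h2
    rw [h.gen_mul, map_sub, h.mc, neg_mul, map_neg, h1, hΔ.gen_mul, hΔ.gen_mul, ih, ← h2,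
      add_sub_cancel_right]
  exact LinearMap.congr_fun key x

theorem IsCoproduct.isDifferential {G : Generated X L j} (hX : X.IsCrossedModule)
    (hϖ : (CrossedData.aug k A).IsMorphism X ϖ) (hsurj : Function.Surjective ϖ)
    (hΔ : G.IsCoproduct Δ) (h : IsExterior (j := j) ϖ d) (S : L →ₗ[k] L) :
    (G.data Δ S d).IsDifferential ϖ j where
  degree := h.degree hsurj
  leibniz n x hx y := by
    change d (x * y) = d x * y + _ • (x * d y)
    rw [h.leibniz G, G.P_of_mem n x hx, smul_mul_assoc]
  d_d := h.d_d G hsurj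
  coact_d := h.coact_d G hϖ hsurj
  maurerCartan a := by
    change d (j (ϖ a)) + (mcConv ϖ j * mcConv ϖ j) (a : A) = 0
    rw [← mcForm_coe, h.mc, neg_add_cancel]
  d_act n x hx a := by
    have h1 := congr($(h.d_act G hϖ hsurj x) a)
    rw [G.P_of_mem n x hx, map_smul, smul_mul_assoc] at h1
    exact h1
  comul_d x := by
    have h1 := hΔ.comul_d hX hϖ hsurj h x
    change Δ (d x) - (d.rTensor L (Δ x) + TensorProduct.map G.P.toLinearMap d (Δ x)) =
      (G.data Δ S d).curvatureTerm (j ∘ₗ mcForm ϖ) (Δ x)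
    rw [h1]
    generalize Δ x = Z
    induction Z with
    | zero => simp
    | tmul z w =>
      simp only [curvedD, curvOp, LinearMap.add_apply, Module.End.mul_apply,
        LinearMap.rTensor_tmul, LinearMap.lTensor_tmul, parityFst_tmul, TensorProduct.map_tmul,
        AlgHom.toLinearMap_apply, add_sub_cancel_left, op_tmul,
        SuperBraidedData.curvatureTerm, LinearMap.comp_apply, data, crossed_coact]
      generalize G.α (G.P z) = t
      induction t with
      | zero => simp
      | tmul m a => simp
      | add s t hs ht => simp only [map_add, hs, ht, TensorProduct.add_tmul]
    | add s t hs ht =>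
      rw [map_add, map_add (SuperBraidedData.curvatureTerm _ _), ← hs, ← ht]
      simp only [map_add]
      abel

end Generated

end DifferentialCoproduct

/-! ### Separation by families of linear maps -/

section Separation

variable {k : Type u} [Field k] {M : Type*} [AddCommGroup M] [Module k M]
variable {W : Type*} [AddCommGroup W] [Module k W] {M' : Type*} [AddCommGroup M'] [Module k M']
variable {ι : Type*} {N : ι → Type*} [∀ i, AddCommGroup (N i)] [∀ i, Module k (N i)]

theorem equivFinsuppOfBasisRight_rTensor {κ : Type*} [DecidableEq κ] (b : Module.Basis κ k W)
    (g : M →ₗ[k] M') (Z : M ⊗[k] W) (i : κ) :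
    TensorProduct.equivFinsuppOfBasisRight b (g.rTensor W Z) i =
      g (TensorProduct.equivFinsuppOfBasisRight b Z i) := by
  induction Z with
  | zero => simp
  | tmul m w => simp
  | add s t hs ht => simp only [map_add, Finsupp.add_apply, hs, ht]

theorem comm_lTensor (g : M →ₗ[k] M') (Z : W ⊗[k] M) :
    TensorProduct.comm k W M' (g.lTensor W Z) = g.rTensor W (TensorProduct.comm k W M Z) := by
  induction Z with
  | zero => simp
  | tmul m w => simp
  | add s t hs ht => simp only [map_add, hs, ht]

theorem rTensor_eq_zero_of_family {f : ∀ i, M →ₗ[k] N i} {π : M →ₗ[k] M'}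
    (h : ∀ x, (∀ i, f i x = 0) → π x = 0) {Z : M ⊗[k] W}
    (hZ : ∀ i, (f i).rTensor W Z = 0) : π.rTensor W Z = 0 := by
  classical
  let b := Module.Basis.ofVectorSpace k W
  refine (TensorProduct.equivFinsuppOfBasisRight b).injective (Finsupp.ext fun i => ?_)
  rw [map_zero, Finsupp.zero_apply, equivFinsuppOfBasisRight_rTensor]
  refine h _ fun l => ?_
  rw [← equivFinsuppOfBasisRight_rTensor, hZ l, map_zero, Finsupp.zero_apply]

theorem lTensor_eq_zero_of_family {f : ∀ i, M →ₗ[k] N i} {π : M →ₗ[k] M'}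
    (h : ∀ x, (∀ i, f i x = 0) → π x = 0) {Z : W ⊗[k] M}
    (hZ : ∀ i, (f i).lTensor W Z = 0) : π.lTensor W Z = 0 := by
  refine (TensorProduct.comm k W M').map_eq_zero_iff.1 ?_
  rw [comm_lTensor]
  exact rTensor_eq_zero_of_family h fun i => by rw [← comm_lTensor, hZ i, map_zero]

end Separation

section Radical

open WithConv

variable {k : Type u} {A : Type v} [Field k] [Ring A] [HopfAlgebra k A]
variable {V : Type w} [AddCommGroup V] [Module k V]
variable {X : CrossedData k A V} {ϖ : Aug k A →ₗ[k] V}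
variable {L : Type x} [Ring L] [Algebra k L]

namespace CrossedData

theorem tensor_act_tmul {W : Type*} [AddCommGroup W] [Module k W] (X : CrossedData k A V)
    (Y : CrossedData k A W) (v : V) (y : W) (a : A) : (X.tensor Y).act ((v ⊗ₜ y) ⊗ₜ a) =
      TensorProduct.map (TensorProduct.curry X.act v) (TensorProduct.curry Y.act y)
        (Coalgebra.comul (R := k) a) := by
  simp only [tensor, LinearMap.comp_apply, LinearMap.lTensor_tmul, LinearEquiv.coe_coe]
  generalize (Coalgebra.comul (R := k) a) = s
  induction s with
  | zero => simp
  | tmul a b => simp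
  | add s t hs ht => simp only [map_add, TensorProduct.tmul_add, hs, ht]

theorem tensor_coact_tmul {W : Type*} [AddCommGroup W] [Module k W] (X : CrossedData k A V)
    (Y : CrossedData k A W) (v : V) (y : W) : (X.tensor Y).coact (v ⊗ₜ y) =
      (LinearMap.mul' k A).lTensor (V ⊗[k] W)
        (TensorProduct.tensorTensorTensorComm k V A W A (X.coact v ⊗ₜ Y.coact y)) := rfl

theorem IsMorphism.rTensor_tensor {V' W : Type*} [AddCommGroup V'] [Module k V']
    [AddCommGroup W] [Module k W] {X : CrossedData k A V} {X' : CrossedData k A V'}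
    (Y : CrossedData k A W) {f : V →ₗ[k] V'} (hf : X.IsMorphism X' f) :
    (X.tensor Y).IsMorphism (X'.tensor Y) (f.rTensor W) where
  act z a := by
    induction z with
    | zero => simp
    | tmul v y =>
      rw [LinearMap.rTensor_tmul, tensor_act_tmul, tensor_act_tmul]
      generalize (Coalgebra.comul (R := k) a) = s
      induction s with
      | zero => simp
      | tmul a b => simp [hf.act]
      | add s t hs ht => simp only [map_add, hs, ht]
    | add s t hs ht => simp only [map_add, TensorProduct.add_tmul, hs, ht]
  coact z := by
    induction z with
    | zero => simp
    | tmul v y =>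
      rw [LinearMap.rTensor_tmul, tensor_coact_tmul, tensor_coact_tmul, hf.coact]
      generalize X.coact v = s
      generalize Y.coact y = t
      induction s with
      | zero => simp
      | tmul v a =>
        induction t with
        | zero => simp
        | tmul y b => simp
        | add s t hs ht => simp only [map_add, TensorProduct.tmul_add, hs, ht]
      | add s t hs ht => simp only [map_add, TensorProduct.add_tmul, hs, ht]
    | add s t hs ht => simp only [map_add, hs, ht]

end CrossedData

namespace Generated

variable {j : V →ₗ[k] L} (G : Generated X L j) (Δ : L →ₗ[k] L ⊗[k] L)

/-- The left braided derivative `(pr ⊗ id) Δ : L → V ⊗ L`. -/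
def leftDer : L →ₗ[k] V ⊗[k] L := G.pr.rTensor L ∘ₗ Δ

variable {Δ} {G}

namespace IsCoproduct

theorem leftDer_one (hΔ : G.IsCoproduct Δ) : G.leftDer Δ 1 = 0 := by
  simp [leftDer, hΔ.one, G.pr_one]

theorem rTensor_pr_op (f : Conv k A L) (Z : L ⊗[k] L) :
    G.pr.rTensor L (G.op f Z) = Conv.coOpₗ X.coact f (G.pr.rTensor L Z) := by
  induction Z with
  | zero => simp
  | tmul z y =>
    rw [op_tmul, LinearMap.rTensor_tmul, Conv.coOpₗ_tmul, ← G.pr_α]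
    generalize G.α z = t
    induction t with
    | zero => simp
    | tmul z a => simp
    | add s t hs ht => simp only [map_add, hs, ht]
  | add s t hs ht => simp only [map_add, hs, ht]

theorem rTensor_pr_parityFst (Z : L ⊗[k] L) :
    G.pr.rTensor L (G.parityFst L Z) = - G.pr.rTensor L Z := by
  induction Z with
  | zero => simp
  | tmul z y => simp [G.pr_P, TensorProduct.neg_tmul]
  | add s t hs ht => simp only [map_add, hs, ht, neg_add]

theorem leftDer_gen_mul (hX : X.IsCrossedModule) (hΔ : G.IsCoproduct Δ) (v : V) (x : L) :
    G.leftDer Δ (j v * x) = v ⊗ₜ x - Conv.coOpₗ X.coact (G.β (j v)) (G.leftDer Δ x) := by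
  have h1 : ∀ Z : L ⊗[k] L, G.pr.rTensor L (lmulFst L (j v) Z) =
      v ⊗ₜ TensorProduct.lid k L (G.ε.toLinearMap.rTensor L Z) := by
    intro Z
    induction Z with
    | zero => simp
    | tmul z y => simp [G.pr_gen, TensorProduct.smul_tmul]
    | add s t hs ht => simp only [map_add, hs, ht, TensorProduct.tmul_add]
  simp only [leftDer, LinearMap.comp_apply]
  rw [hΔ.gen_mul, primOp, LinearMap.add_apply, map_add, h1, hΔ.counit_left hX,
    Module.End.mul_apply, rTensor_pr_op, rTensor_pr_parityFst, map_neg, sub_eq_add_neg]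
  simp

theorem leftDer_P (hΔ : G.IsCoproduct Δ) (x : L) :
    G.leftDer Δ (G.P x) = - G.P.toLinearMap.lTensor V (G.leftDer Δ x) := by
  simp only [leftDer, LinearMap.comp_apply, hΔ.parity]
  generalize Δ x = Z
  induction Z with
  | zero => simp
  | tmul z y => simp [G.pr_P, TensorProduct.neg_tmul]
  | add s t hs ht => simp only [map_add, hs, ht, neg_add]

theorem pr_morphism : G.crossed.IsMorphism X G.pr where
  act x a := G.pr_β x a
  coact x := (G.pr_α x).symm

theorem leftDer_morphism (hX : X.IsCrossedModule) (hΔ : G.IsCoproduct Δ) :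
    G.crossed.IsMorphism (X.tensor G.crossed) (G.leftDer Δ) where
  act x a := by
    rw [leftDer, LinearMap.comp_apply, (hΔ.morphism hX).act,
      (pr_morphism.rTensor_tensor G.crossed).act]
    rfl
  coact x := by
    rw [leftDer, LinearMap.comp_apply, (pr_morphism.rTensor_tensor G.crossed).coact,
      (hΔ.morphism hX).coact, LinearMap.rTensor_comp, LinearMap.comp_apply]

theorem leftDer_coassoc (hX : X.IsCrossedModule) (hΔ : G.IsCoproduct Δ) (x : L) :
    TensorProduct.assoc k V L L ((G.leftDer Δ).rTensor L (Δ x)) =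
      Δ.lTensor V (G.leftDer Δ x) := by
  have h := congr(G.pr.rTensor (L ⊗[k] L) $(hΔ.coassoc hX x))
  have h1 : ∀ Z : (L ⊗[k] L) ⊗[k] L, G.pr.rTensor (L ⊗[k] L) (TensorProduct.assoc k L L L Z) =
      TensorProduct.assoc k V L L ((G.pr.rTensor L).rTensor L Z) := by
    intro Z
    induction Z with
    | zero => simp
    | tmul z y =>
      induction z with
      | zero => simp
      | tmul z w => simp
      | add s t hs ht => simp only [map_add, hs, ht, TensorProduct.add_tmul]
    | add s t hs ht => simp only [map_add, hs, ht]
  rw [h1] at h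
  rw [leftDer, LinearMap.rTensor_comp, LinearMap.comp_apply, h, LinearMap.comp_apply,
    ← LinearMap.comp_apply, ← LinearMap.comp_apply (LinearMap.lTensor V Δ),
    LinearMap.rTensor_comp_lTensor, LinearMap.lTensor_comp_rTensor]

theorem leftDer_counit_right (hΔ : G.IsCoproduct Δ) (x : L) :
    G.ε.toLinearMap.lTensor V (G.leftDer Δ x) = G.pr x ⊗ₜ 1 := by
  rw [leftDer, LinearMap.comp_apply, ← LinearMap.comp_apply, LinearMap.lTensor_comp_rTensor,
    ← LinearMap.rTensor_comp_lTensor, LinearMap.comp_apply, hΔ.counit_right,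
    LinearMap.rTensor_tmul]

theorem leftDer_mul_gen (hX : X.IsCrossedModule) (hΔ : G.IsCoproduct Δ) (x : L) (v : V) :
    G.leftDer Δ (x * j v) = (LinearMap.mulRight k (j v)).lTensor V (G.leftDer Δ x) +
      Conv.coOpₗ X.coact (G.β (G.P x)) (v ⊗ₜ 1) := by
  induction x using adjoin_induction_left G.adjoin_eq_top with
  | one =>
    have h := hΔ.leftDer_gen_mul hX v 1
    rw [mul_one] at h
    rw [one_mul, h, hΔ.leftDer_one, map_one, map_one, Conv.coOpₗ_one _ hX.counit]
    simp
  | add x y hx hy => simp only [add_mul, map_add, hx, hy, LinearMap.add_apply]; abel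
  | smul c x hx => simp only [smul_mul_assoc, map_smul, hx, LinearMap.smul_apply, smul_add]
  | gen_mul w x hx =>
    rw [mul_assoc, hΔ.leftDer_gen_mul hX, hx, hΔ.leftDer_gen_mul hX, map_mul, G.P_gen, map_mul,
      Conv.coOpₗ_mul _ hX.coassoc, map_neg, map_neg, end_neg_mul, map_add,
      Conv.coOpₗ_mulRight, map_sub]
    simp only [LinearMap.neg_apply, Module.End.mul_apply, LinearMap.lTensor_tmul,
      LinearMap.mulRight_apply]
    abel

end IsCoproduct

/-! The components of `L → ⨁ₙ V^{⊗n}`. -/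

variable (Δ) (G)

/-- The component `L → V^{⊗n}` of the map to the tensor coalgebra. -/
def tensorPart : (n : ℕ) → L →ₗ[k] ⨂[k]^n V
  | 0 => (PiTensorProduct.isEmptyEquiv (Fin 0)).symm.toLinearMap ∘ₗ G.ε.toLinearMap
  | n + 1 => (consEquiv k V n).toLinearMap ∘ₗ (tensorPart n).lTensor V ∘ₗ G.leftDer Δ

/-- The common kernel of the components `L → V^{⊗n}`. -/
def radical : Submodule k L := ⨅ n, LinearMap.ker (G.tensorPart Δ n)

variable {Δ} {G}

theorem mem_radical {x : L} : x ∈ G.radical Δ ↔ ∀ n, G.tensorPart Δ n x = 0 := by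
  simp [radical, Submodule.mem_iInf]

theorem tensorPart_zero_eq_zero {x : L} : G.tensorPart Δ 0 x = 0 ↔ G.ε x = 0 := by
  rw [tensorPart, LinearMap.comp_apply]
  exact (PiTensorProduct.isEmptyEquiv (Fin 0)).symm.map_eq_zero_iff

theorem tensorPart_succ_eq_zero {n : ℕ} {x : L} :
    G.tensorPart Δ (n + 1) x = 0 ↔ (G.tensorPart Δ n).lTensor V (G.leftDer Δ x) = 0 := by
  simp [tensorPart]

theorem ε_of_mem_radical {x : L} (hx : x ∈ G.radical Δ) : G.ε x = 0 :=
  tensorPart_zero_eq_zero.1 (mem_radical.1 hx 0)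

theorem radical_cases {N : Type*} [AddCommGroup N] [Module k N] {φ : V ⊗[k] L →ₗ[k] N}
    (hφ : ∀ v, ∀ y ∈ G.radical Δ, φ (v ⊗ₜ y) = 0) {x : L} (hx : x ∈ G.radical Δ) :
    φ (G.leftDer Δ x) = 0 := by
  have h1 : (G.radical Δ).mkQ.lTensor V (G.leftDer Δ x) = 0 :=
    lTensor_eq_zero_of_family (f := fun n => G.tensorPart Δ n)
      (fun x hx => (Submodule.Quotient.mk_eq_zero _).2 (mem_radical.2 hx))
      fun n => tensorPart_succ_eq_zero.1 (mem_radical.1 hx (n + 1))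
  have h2 : G.leftDer Δ x ∈ LinearMap.range ((G.radical Δ).subtype.lTensor V) :=
    ((lTensor_exact V (LinearMap.exact_subtype_mkQ _) (Submodule.mkQ_surjective _)) _).1 h1
  obtain ⟨Z, hZ⟩ := h2
  rw [← hZ]
  clear hZ
  induction Z with
  | zero => simp
  | tmul v y => exact hφ v y y.2
  | add s t hs ht => rw [map_add, map_add, hs, ht, add_zero]

theorem mem_radical_of {g : L →ₗ[k] L} (h0 : ∀ x ∈ G.radical Δ, G.ε (g x) = 0)
    (h1 : ∀ n, (∀ x ∈ G.radical Δ, G.tensorPart Δ n (g x) = 0) → ∀ x ∈ G.radical Δ,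
      (G.tensorPart Δ n).lTensor V (G.leftDer Δ (g x)) = 0) {x : L} (hx : x ∈ G.radical Δ) :
    g x ∈ G.radical Δ := by
  refine mem_radical.2 fun n => ?_
  induction n generalizing x with
  | zero => exact tensorPart_zero_eq_zero.2 (h0 x hx)
  | succ n ih => exact tensorPart_succ_eq_zero.2 (h1 n (fun y hy => ih hy) x hx)

namespace IsCoproduct

theorem P_mem_radical (hΔ : G.IsCoproduct Δ) {x : L} (hx : x ∈ G.radical Δ) :
    G.P x ∈ G.radical Δ := by
  refine mem_radical_of (g := G.P.toLinearMap)
    (fun x hx => (G.ε_P x).trans (ε_of_mem_radical hx)) (fun n ih x hx => ?_) hx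
  rw [AlgHom.toLinearMap_apply, hΔ.leftDer_P, map_neg, neg_eq_zero, ← LinearMap.comp_apply]
  refine radical_cases (fun v y hy => ?_) hx
  have := ih y hy
  simp only [AlgHom.toLinearMap_apply] at this
  simp [this]

theorem β_mem_radical (hX : X.IsCrossedModule) (hΔ : G.IsCoproduct Δ) {x : L}
    (hx : x ∈ G.radical Δ) (a : A) : G.β x a ∈ G.radical Δ := by
  have key : ∀ n, ∀ x ∈ G.radical Δ, ∀ a, G.tensorPart Δ n (G.β x a) = 0 := by
    intro n
    induction n with
    | zero =>
      exact fun x hx a => tensorPart_zero_eq_zero.2 (by rw [G.ε_β, ε_of_mem_radical hx, zero_mul])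
    | succ n ih =>
      intro x hx a
      rw [tensorPart_succ_eq_zero, ← crossed_act, (hΔ.leftDer_morphism hX).act]
      refine radical_cases (φ := (G.tensorPart Δ n).lTensor V ∘ₗ (X.tensor G.crossed).act ∘ₗ
        (TensorProduct.mk k _ A).flip a) (fun v y hy => ?_) hx
      simp only [LinearMap.comp_apply, LinearMap.flip_apply, TensorProduct.mk_apply,
        CrossedData.tensor_act_tmul]
      generalize (Coalgebra.comul (R := k) a) = s
      induction s with
      | zero => simp
      | tmul a b => simp [ih y hy]
      | add s t hs ht => simp only [map_add, hs, ht, add_zero]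
  exact mem_radical.2 fun n => key n x hx a

theorem rTensor_α_of_mem_radical (hX : X.IsCrossedModule) (hΔ : G.IsCoproduct Δ) {x : L}
    (hx : x ∈ G.radical Δ) (n : ℕ) : (G.tensorPart Δ n).rTensor A (G.α x) = 0 := by
  induction n generalizing x with
  | zero =>
    rw [tensorPart, LinearMap.rTensor_comp, LinearMap.comp_apply, G.ε_α, ε_of_mem_radical hx]
    simp
  | succ n ih =>
    rw [tensorPart, LinearMap.rTensor_comp, LinearMap.rTensor_comp, LinearMap.comp_apply,
      LinearMap.comp_apply]
    have h := (hΔ.leftDer_morphism hX).coact x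
    rw [crossed_coact] at h
    rw [← h]
    refine (congrArg _ ?_).trans (map_zero ((consEquiv k V n).toLinearMap.rTensor A))
    rw [← LinearMap.comp_apply]
    refine radical_cases (fun v y hy => ?_) hx
    have nat : ∀ (s : V ⊗[k] A) (t : L ⊗[k] A), ((G.tensorPart Δ n).lTensor V).rTensor A
        ((LinearMap.mul' k A).lTensor (V ⊗[k] L)
          (TensorProduct.tensorTensorTensorComm k V A L A (s ⊗ₜ t))) =
        (LinearMap.mul' k A).lTensor _ (TensorProduct.tensorTensorTensorComm k V A _ A
          (s ⊗ₜ (G.tensorPart Δ n).rTensor A t)) := by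
      intro s t
      induction s with
      | zero => simp
      | tmul v a =>
        induction t with
        | zero => simp
        | tmul y b => simp
        | add s t hs ht => simp only [map_add, TensorProduct.tmul_add, hs, ht]
      | add s t hs ht => simp only [map_add, TensorProduct.add_tmul, hs, ht]
    rw [LinearMap.comp_apply, CrossedData.tensor_coact_tmul, nat, crossed_coact, ih hy]
    simp

theorem map_comul_of_mem_radical (hX : X.IsCrossedModule) (hΔ : G.IsCoproduct Δ) {x : L}
    (hx : x ∈ G.radical Δ) (m n : ℕ) :
    (G.tensorPart Δ m).rTensor _ ((G.tensorPart Δ n).lTensor L (Δ x)) = 0 := by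
  induction m generalizing x with
  | zero =>
    rw [tensorPart, LinearMap.rTensor_comp, LinearMap.comp_apply, ← LinearMap.comp_apply _
      ((G.tensorPart Δ n).lTensor L), LinearMap.rTensor_comp_lTensor,
      ← LinearMap.lTensor_comp_rTensor, LinearMap.comp_apply, hΔ.counit_left hX,
      LinearMap.lTensor_tmul, mem_radical.1 hx]
    simp
  | succ m ih =>
    rw [tensorPart, LinearMap.rTensor_comp, LinearMap.rTensor_comp, LinearMap.comp_apply,
      LinearMap.comp_apply, ← LinearMap.comp_apply _ ((G.tensorPart Δ n).lTensor L),
      LinearMap.rTensor_comp_lTensor, ← LinearMap.lTensor_comp_rTensor, LinearMap.comp_apply]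
    have h := hΔ.leftDer_coassoc hX x
    rw [LinearEquiv.eq_symm_apply _ |>.2 h]
    refine (congrArg _ ?_).trans (map_zero ((consEquiv k V m).toLinearMap.rTensor _))
    refine radical_cases (φ := ((G.tensorPart Δ m).lTensor V).rTensor _ ∘ₗ
      (G.tensorPart Δ n).lTensor (V ⊗[k] L) ∘ₗ (TensorProduct.assoc k V L L).symm.toLinearMap ∘ₗ
      Δ.lTensor V) (fun v y hy => ?_) hx
    have nat : ∀ Z : L ⊗[k] L, ((G.tensorPart Δ m).lTensor V).rTensor _
        ((G.tensorPart Δ n).lTensor (V ⊗[k] L) ((TensorProduct.assoc k V L L).symm (v ⊗ₜ Z))) =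
        (TensorProduct.assoc k V _ _).symm (v ⊗ₜ
          ((G.tensorPart Δ m).rTensor _ ((G.tensorPart Δ n).lTensor L Z))) := by
      intro Z
      induction Z with
      | zero => simp
      | tmul z w => simp
      | add s t hs ht => simp only [map_add, TensorProduct.tmul_add, hs, ht]
    simp only [LinearMap.comp_apply, LinearMap.lTensor_tmul, LinearEquiv.coe_coe]
    rw [nat, ih hy]
    simp

theorem gen_mul_mem_radical (hX : X.IsCrossedModule) (hΔ : G.IsCoproduct Δ) {x : L}
    (hx : x ∈ G.radical Δ) (v : V) : j v * x ∈ G.radical Δ := by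
  have key : ∀ n, ∀ x ∈ G.radical Δ, ∀ v, G.tensorPart Δ n (j v * x) = 0 := by
    intro n
    induction n with
    | zero =>
      exact fun x hx v => tensorPart_zero_eq_zero.2 (by rw [map_mul, G.ε_gen, zero_mul])
    | succ n ih =>
      intro x hx v
      rw [tensorPart_succ_eq_zero, hΔ.leftDer_gen_mul hX, map_sub, LinearMap.lTensor_tmul,
        mem_radical.1 hx, TensorProduct.tmul_zero, zero_sub, neg_eq_zero, ← LinearMap.comp_apply]
      refine radical_cases (fun w y hy => ?_) hx
      rw [LinearMap.comp_apply, Conv.coOpₗ_tmul]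
      generalize X.coact w = t
      induction t with
      | zero => simp
      | tmul w a => simp [G.β_gen, ih y hy]
      | add s t hs ht => simp only [map_add, hs, ht, add_zero]
  exact mem_radical.2 fun n => key n x hx v

theorem mul_mem_radical_left (hX : X.IsCrossedModule) (hΔ : G.IsCoproduct Δ) {x : L}
    (hx : x ∈ G.radical Δ) (y : L) : y * x ∈ G.radical Δ := by
  induction y using adjoin_induction_left G.adjoin_eq_top with
  | one => rwa [one_mul]
  | add y z hy hz => rw [add_mul]; exact add_mem hy hz
  | smul c y hy => rw [smul_mul_assoc]; exact Submodule.smul_mem _ _ hy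
  | gen_mul v y hy => rw [mul_assoc]; exact hΔ.gen_mul_mem_radical hX hy v

theorem mul_gen_mem_radical (hX : X.IsCrossedModule) (hΔ : G.IsCoproduct Δ) {x : L}
    (hx : x ∈ G.radical Δ) (v : V) : x * j v ∈ G.radical Δ := by
  refine mem_radical_of (g := LinearMap.mulRight k (j v)) (fun x hx => ?_)
    (fun n ih x hx => ?_) hx
  · rw [LinearMap.mulRight_apply, map_mul, ε_of_mem_radical hx, zero_mul]
  rw [LinearMap.mulRight_apply, hΔ.leftDer_mul_gen hX, map_add, ← LinearMap.comp_apply,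
    radical_cases (fun w y hy => ?_) hx, zero_add, Conv.coOpₗ_tmul]
  · generalize X.coact v = t
    induction t with
    | zero => simp
    | tmul w a =>
      simp [mem_radical.1 (hΔ.β_mem_radical hX (hΔ.P_mem_radical hx) a)]
    | add s t hs ht => simp only [map_add, hs, ht, add_zero]
  · have := ih y hy
    rw [LinearMap.mulRight_apply] at this
    simp [this]

theorem mul_mem_radical_right (hX : X.IsCrossedModule) (hΔ : G.IsCoproduct Δ) {x : L}
    (hx : x ∈ G.radical Δ) (y : L) : x * y ∈ G.radical Δ := by
  induction y using adjoin_induction_left G.adjoin_eq_top generalizing x with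
  | one => rwa [mul_one]
  | add y z hy hz => rw [mul_add]; exact add_mem (hy hx) (hz hx)
  | smul c y hy => rw [mul_smul_comm]; exact Submodule.smul_mem _ _ (hy hx)
  | gen_mul v y hy => rw [← mul_assoc]; exact hy (hΔ.mul_gen_mem_radical hX hx v)

theorem pr_of_mem_radical (hΔ : G.IsCoproduct Δ) {x : L} (hx : x ∈ G.radical Δ) :
    G.pr x = 0 := by
  have h := hΔ.leftDer_counit_right x
  rw [radical_cases (fun v y hy => ?_) hx] at h
  · simpa using (congr(TensorProduct.rid k V $h)).symm
  · simp [ε_of_mem_radical hy]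

end IsCoproduct

variable (G)

/-- The homogeneous components. -/
def component (n : ℕ) : L →ₗ[k] L :=
  (Polynomial.lcoeff L n).restrictScalars k ∘ₗ G.γ.toLinearMap

theorem component_apply (n : ℕ) (x : L) : G.component n x = (G.γ x).coeff n := rfl

theorem component_gen_mul_zero (v : V) (x : L) : G.component 0 (j v * x) = 0 := by
  rw [component_apply, map_mul, G.γ_gen, ← mul_one (j v), ← Polynomial.C_mul_X_eq_monomial]
  simp

theorem component_gen_mul_succ (v : V) (x : L) (n : ℕ) :
    G.component (n + 1) (j v * x) = j v * G.component n x := by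
  rw [component_apply, map_mul, G.γ_gen, ← Polynomial.C_mul_X_eq_monomial, mul_assoc,
    Polynomial.coeff_C_mul, Polynomial.coeff_X_mul, component_apply]

theorem component_one_succ (n : ℕ) : G.component (n + 1) 1 = 0 := by
  rw [component_apply, map_one, Polynomial.coeff_one]
  simp

theorem component_zero (x : L) : G.component 0 x = algebraMap k L (G.ε x) := by
  have h : G.component 0 = (Algebra.linearMap k L) ∘ₗ G.ε.toLinearMap := by
    refine linearMap_ext_left G.adjoin_eq_top (by simp [component_apply]) fun v x _ => ?_
    rw [component_gen_mul_zero]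
    simp [G.ε_gen]
  exact LinearMap.congr_fun h x

variable {G}

namespace IsCoproduct

theorem leftDer_component (hX : X.IsCrossedModule) (hΔ : G.IsCoproduct Δ) (n : ℕ) (x : L) :
    G.leftDer Δ (G.component (n + 1) x) = (G.component n).lTensor V (G.leftDer Δ x) := by
  induction x using adjoin_induction_left G.adjoin_eq_top generalizing n with
  | one => simp [component_one_succ, hΔ.leftDer_one]
  | add x y hx hy => simp only [map_add, hx, hy]
  | smul c x hx => simp only [map_smul, hx]
  | gen_mul v x hx =>
    rw [component_gen_mul_succ, hΔ.leftDer_gen_mul hX, hΔ.leftDer_gen_mul hX, map_sub,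
      LinearMap.lTensor_tmul]
    congr 1
    cases n with
    | zero =>
      rw [component_zero, Algebra.algebraMap_eq_smul_one, map_smul, hΔ.leftDer_one, smul_zero,
        map_zero]
      generalize G.leftDer Δ x = Z
      induction Z with
      | zero => simp
      | tmul w y =>
        rw [Conv.coOpₗ_tmul]
        generalize X.coact w = t
        induction t with
        | zero => simp
        | tmul w a => simp [G.β_gen, component_gen_mul_zero]
        | add s t hs ht => rw [map_add, map_add, ← hs, ← ht, add_zero]
      | add s t hs ht => rw [map_add, map_add, ← hs, ← ht, add_zero]
    | succ n =>
      rw [hx]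
      generalize G.leftDer Δ x = Z
      induction Z with
      | zero => simp
      | tmul w y =>
        rw [LinearMap.lTensor_tmul, Conv.coOpₗ_tmul, Conv.coOpₗ_tmul]
        generalize X.coact w = t
        induction t with
        | zero => simp
        | tmul w a => simp [G.β_gen, component_gen_mul_succ]
        | add s t hs ht => simp only [map_add, hs, ht]
      | add s t hs ht => simp only [map_add, hs, ht]

theorem component_mem_radical (hX : X.IsCrossedModule) (hΔ : G.IsCoproduct Δ) {x : L}
    (hx : x ∈ G.radical Δ) (n : ℕ) : G.component n x ∈ G.radical Δ := by
  have key : ∀ m, ∀ x ∈ G.radical Δ, ∀ n, G.tensorPart Δ m (G.component n x) = 0 := by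
    intro m
    induction m with
    | zero =>
      intro x hx n
      rw [tensorPart_zero_eq_zero]
      have h : ∀ x : L, G.ε (G.component n x) = if n = 0 then G.ε x else 0 := by
        intro x
        cases n with
        | zero => simp [component_zero]
        | succ n =>
          induction x using adjoin_induction_left G.adjoin_eq_top with
          | one => simp [component_one_succ]
          | add x y hx hy => rw [map_add, map_add, hx, hy]; simp
          | smul c x hx => rw [map_smul, map_smul, hx]; simp
          | gen_mul v x hx => simp [component_gen_mul_succ, G.ε_gen]
      rw [h, ε_of_mem_radical hx, ite_self]
    | succ m ih =>
      intro x hx n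
      cases n with
      | zero => rw [component_zero, ε_of_mem_radical hx, map_zero, map_zero]
      | succ n =>
        rw [tensorPart_succ_eq_zero, hΔ.leftDer_component hX, ← LinearMap.comp_apply]
        exact radical_cases (fun v y hy => by simp [ih y hy n]) hx
  exact mem_radical.2 fun m => key m x hx n

theorem ε_d (hsurj : Function.Surjective ϖ) {d : L →ₗ[k] L}
    (h : IsExterior (j := j) ϖ d) (x : L) : G.ε (d x) = 0 := by
  induction x using adjoin_induction_left G.adjoin_eq_top with
  | one => rw [h.one, map_zero]
  | add x y hx hy => rw [map_add, map_add, hx, hy, add_zero]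
  | smul c x hx => rw [map_smul, map_smul, hx, smul_zero]
  | gen_mul v x hx =>
    obtain ⟨b, rfl⟩ := mcForm_surjective hsurj v
    have h1 : G.ε ((mcConv ϖ j * mcConv ϖ j) b) = 0 := by
      rw [LinearMap.convMul_apply]
      generalize (Coalgebra.comul (R := k) b) = s
      induction s with
      | zero => simp
      | tmul a b => simp [G.ε_gen]
      | add s t hs ht => rw [map_add, map_add, map_add, hs, ht, add_zero]
    rw [h.gen_mul, h.mc, map_sub, map_mul, map_mul, G.ε_gen, zero_mul, sub_zero, map_neg, h1,
      neg_zero, zero_mul]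

theorem leftDer_d (hX : X.IsCrossedModule) (hϖ : (CrossedData.aug k A).IsMorphism X ϖ)
    (hsurj : Function.Surjective ϖ) (hΔ : G.IsCoproduct Δ) {d : L →ₗ[k] L}
    (h : IsExterior (j := j) ϖ d) (x : L) : G.leftDer Δ (d x) =
      - (d.lTensor V (G.leftDer Δ x) + Conv.coOpₗ X.coact (mcConv ϖ j) (G.leftDer Δ x)) := by
  have hε := ε_d (G := G) hsurj h
  have hpr : ∀ x, G.pr (d x) = 0 := by
    have : G.pr ∘ₗ d = 0 := by
      refine linearMap_ext_left G.adjoin_eq_top (by simp [h.one]) fun v x _ => ?_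
      obtain ⟨b, rfl⟩ := mcForm_surjective hsurj v
      rw [LinearMap.comp_apply, h.gen_mul, h.mc, map_sub, G.pr_gen, hε, zero_smul, sub_zero,
        LinearMap.convMul_apply]
      generalize (Coalgebra.comul (R := k) b) = s
      induction s with
      | zero => simp
      | tmul a b => simp [mul_assoc, G.pr_gen, G.ε_gen]
      | add s t hs ht =>
        simp only [map_add, neg_add, add_mul, LinearMap.zero_apply] at hs ht ⊢
        rw [hs, ht, add_zero]
    exact fun x => LinearMap.congr_fun this x
  have h1 : ∀ Z : L ⊗[k] L, G.pr.rTensor L (d.rTensor L Z) = 0 := by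
    intro Z
    induction Z with
    | zero => simp
    | tmul z y => simp [hpr]
    | add s t hs ht => simp only [map_add, hs, ht, add_zero]
  have h2 : ∀ Z : L ⊗[k] L, G.pr.rTensor L (d.lTensor L Z) = d.lTensor V (G.pr.rTensor L Z) := by
    intro Z
    rw [← LinearMap.comp_apply, LinearMap.rTensor_comp_lTensor, ← LinearMap.lTensor_comp_rTensor,
      LinearMap.comp_apply]
  rw [leftDer, LinearMap.comp_apply, hΔ.comul_d hX hϖ hsurj h, curvedD, LinearMap.add_apply,
    LinearMap.add_apply, map_add, map_add, h1, Module.End.mul_apply, rTensor_pr_parityFst, h2,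
    curvOp, Module.End.mul_apply, rTensor_pr_op, rTensor_pr_parityFst]
  simp only [LinearMap.comp_apply, map_neg, neg_add, zero_add]

theorem d_mem_radical (hX : X.IsCrossedModule) (hϖ : (CrossedData.aug k A).IsMorphism X ϖ)
    (hsurj : Function.Surjective ϖ) (hΔ : G.IsCoproduct Δ) {d : L →ₗ[k] L}
    (h : IsExterior (j := j) ϖ d) {x : L} (hx : x ∈ G.radical Δ) : d x ∈ G.radical Δ := by
  refine mem_radical_of (fun x hx => ?_) (fun n ih x hx => ?_) hx
  · exact ε_d hsurj h x
  · rw [hΔ.leftDer_d hX hϖ hsurj h, map_neg, neg_eq_zero, map_add, ← LinearMap.comp_apply,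
      radical_cases (fun v y hy => by simp [ih y hy]) hx, zero_add, ← LinearMap.comp_apply]
    refine radical_cases (fun v y hy => ?_) hx
    rw [LinearMap.comp_apply, Conv.coOpₗ_tmul]
    generalize X.coact v = t
    induction t with
    | zero => simp
    | tmul w a => simp [mem_radical.1 (hΔ.mul_mem_radical_left hX hy _)]
    | add s t hs ht => simp only [map_add, hs, ht, add_zero]

end IsCoproduct

end Generated

end Radical

/-! ### The quotient by the radical -/

section Descent

variable {k : Type u} [Field k] {L : Type*} [Ring L] [Algebra k L] {L' : Type*} [Ring L']
  [Algebra k L'] {M : Type*} [AddCommGroup M] [Module k M] {R : Type*} [Ring R] [Algebra k R]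

/-- The map induced on a quotient algebra by a linear map. -/
def descend (π : L →ₐ[k] L') (hπ : Function.Surjective π) (f : L →ₗ[k] M) : L' →ₗ[k] M :=
  f ∘ₗ (LinearMap.exists_rightInverse_of_surjective π.toLinearMap
    (LinearMap.range_eq_top.2 hπ)).choose

theorem descend_apply {π : L →ₐ[k] L'} (hπ : Function.Surjective π) {f : L →ₗ[k] M}
    (h : ∀ x, π x = 0 → f x = 0) (x : L) : descend π hπ f (π x) = f x := by
  have hs := (LinearMap.exists_rightInverse_of_surjective π.toLinearMap
    (LinearMap.range_eq_top.2 hπ)).choose_spec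
  have h1 := LinearMap.congr_fun hs (π x)
  rw [descend, LinearMap.comp_apply, ← sub_eq_zero, ← map_sub]
  refine h _ ?_
  rw [map_sub, sub_eq_zero]
  exact h1

/-- The algebra map induced on a quotient algebra by an algebra map. -/
def descendAlg (π : L →ₐ[k] L') (hπ : Function.Surjective π) (f : L →ₐ[k] R)
    (h : ∀ x, π x = 0 → f x = 0) : L' →ₐ[k] R :=
  AlgHom.ofLinearMap (descend π hπ f.toLinearMap)
    (by rw [← map_one π, descend_apply hπ h]; exact map_one f) fun x y => by
      obtain ⟨x, rfl⟩ := hπ x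
      obtain ⟨y, rfl⟩ := hπ y
      rw [← map_mul, descend_apply hπ h, descend_apply hπ h, descend_apply hπ h]
      exact map_mul f x y

@[simp] theorem descendAlg_apply {π : L →ₐ[k] L'} (hπ : Function.Surjective π) {f : L →ₐ[k] R}
    (h : ∀ x, π x = 0 → f x = 0) (x : L) : descendAlg π hπ f h (π x) = f x :=
  descend_apply hπ (f := f.toLinearMap) h x

end Descent

section Quotient

open WithConv

variable {k : Type u} {A : Type v} [Field k] [Ring A] [HopfAlgebra k A]
variable {V : Type w} [AddCommGroup V] [Module k V]
variable {X : CrossedData k A V} {ϖ : Aug k A →ₗ[k] V}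
variable {L : Type x} [Ring L] [Algebra k L] {L' : Type*} [Ring L'] [Algebra k L']

namespace Generated

variable {j : V →ₗ[k] L} {G : Generated X L j} {Δ : L →ₗ[k] L ⊗[k] L}
variable {j' : V →ₗ[k] L'} {G' : Generated X L' j'} {Δ' : L' →ₗ[k] L' ⊗[k] L'}

/-- An algebra map commuting with all structures but the differential. -/
structure IsMap (G : Generated X L j) (G' : Generated X L' j') (π : L →ₐ[k] L') : Prop where
  gen : ∀ v, π (j v) = j' v

namespace IsMap

variable {π : L →ₐ[k] L'}

theorem surjective (hπ : IsMap G G' π) : Function.Surjective π := by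
  have h : Algebra.adjoin k (Set.range j') ≤ π.range := by
    refine Algebra.adjoin_le ?_
    rintro _ ⟨v, rfl⟩
    exact ⟨j v, hπ.gen v⟩
  rw [G'.adjoin_eq_top] at h
  exact fun y => h Algebra.mem_top

theorem α_apply (hπ : IsMap G G' π) (x : L) :
    G'.α (π x) = π.toLinearMap.rTensor A (G.α x) := by
  have h : G'.α.comp π = (Algebra.TensorProduct.map π (AlgHom.id k A)).comp G.α :=
    G.algHom_ext fun v => by
      simp only [AlgHom.comp_apply, hπ.gen, G.α_gen, G'.α_gen]
      generalize X.coact v = t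
      induction t with
      | zero => simp
      | tmul m a => simp [hπ.gen]
      | add s t hs ht => simp only [map_add, hs, ht]
  exact AlgHom.congr_fun h x

theorem β_apply (hπ : IsMap G G' π) (x : L) (a : A) : G'.β (π x) a = π (G.β x a) := by
  have h : G'.β.comp π = (Conv.post π).comp G.β :=
    G.algHom_ext fun v => Conv.ext' fun a => by simp [hπ.gen, G.β_gen, G'.β_gen]
  exact congr($h x a)

theorem P_apply (hπ : IsMap G G' π) (x : L) : G'.P (π x) = π (G.P x) := by
  have h : G'.P.comp π = π.comp G.P := G.algHom_ext fun v => by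
    simp [hπ.gen, G.P_gen, G'.P_gen]
  exact AlgHom.congr_fun h x

theorem ε_apply (hπ : IsMap G G' π) (x : L) : G'.ε (π x) = G.ε x := by
  have h : G'.ε.comp π = G.ε := G.algHom_ext fun v => by simp [hπ.gen, G.ε_gen, G'.ε_gen]
  exact AlgHom.congr_fun h x

theorem pr_apply (hπ : IsMap G G' π) (x : L) : G'.pr (π x) = G.pr x := by
  have h : G'.pr ∘ₗ π.toLinearMap = G.pr :=
    linearMap_ext_left G.adjoin_eq_top (by simp [G.pr_one, G'.pr_one]) fun v x _ => by
      simp [hπ.gen, G.pr_gen, G'.pr_gen, hπ.ε_apply]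
  exact LinearMap.congr_fun h x

theorem primOp_map (hπ : IsMap G G' π) (v : V) (Z : L ⊗[k] L) :
    G'.primOp v (TensorProduct.map π.toLinearMap π.toLinearMap Z) =
      TensorProduct.map π.toLinearMap π.toLinearMap (G.primOp v Z) := by
  induction Z with
  | zero => simp
  | tmul z w =>
    rw [TensorProduct.map_tmul, primOp_tmul, primOp_tmul]
    simp only [AlgHom.toLinearMap_apply, hπ.P_apply, hπ.α_apply, map_add]
    congr 1
    · simp [hπ.gen]
    · generalize G.α (G.P z) = t
      induction t with
      | zero => simp
      | tmul m a => simp [← hπ.gen, hπ.β_apply]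
      | add s t hs ht => simp only [map_add, hs, ht]
  | add s t hs ht => simp only [map_add, hs, ht]

theorem comul_apply (hπ : IsMap G G' π) (hΔ : G.IsCoproduct Δ) (hΔ' : G'.IsCoproduct Δ') (x : L) :
    Δ' (π x) = TensorProduct.map π.toLinearMap π.toLinearMap (Δ x) := by
  induction x using adjoin_induction_left G.adjoin_eq_top with
  | one => simp [hΔ.one, hΔ'.one]
  | add x y hx hy => simp only [map_add, hx, hy]
  | smul c x hx => simp only [map_smul, hx]
  | gen_mul v x hx => rw [map_mul, hπ.gen, hΔ'.gen_mul, hx, hΔ.gen_mul, hπ.primOp_map]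

theorem leftDer_apply (hπ : IsMap G G' π) (hΔ : G.IsCoproduct Δ) (hΔ' : G'.IsCoproduct Δ')
    (x : L) : G'.leftDer Δ' (π x) = π.toLinearMap.lTensor V (G.leftDer Δ x) := by
  simp only [leftDer, LinearMap.comp_apply, hπ.comul_apply hΔ hΔ']
  generalize Δ x = Z
  induction Z with
  | zero => simp
  | tmul z w => simp [hπ.pr_apply]
  | add s t hs ht => simp only [map_add, hs, ht]

theorem tensorPart_apply (hπ : IsMap G G' π) (hΔ : G.IsCoproduct Δ) (hΔ' : G'.IsCoproduct Δ')
    (n : ℕ) (x : L) : G'.tensorPart Δ' n (π x) = G.tensorPart Δ n x := by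
  induction n generalizing x with
  | zero => simp [tensorPart, hπ.ε_apply]
  | succ n ih =>
    have h : G'.tensorPart Δ' n ∘ₗ π.toLinearMap = G.tensorPart Δ n := LinearMap.ext ih
    rw [tensorPart, tensorPart, LinearMap.comp_apply, LinearMap.comp_apply,
      hπ.leftDer_apply hΔ hΔ', LinearMap.comp_apply, LinearMap.comp_apply,
      ← LinearMap.lTensor_comp_apply, h]

theorem mem_radical (hπ : IsMap G G' π) (hΔ : G.IsCoproduct Δ) (hΔ' : G'.IsCoproduct Δ')
    (x : L) : π x ∈ G'.radical Δ' ↔ x ∈ G.radical Δ := by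
  simp only [Generated.mem_radical, hπ.tensorPart_apply hΔ hΔ']

theorem d_apply (hπ : IsMap G G' π) (hsurj : Function.Surjective ϖ) {d : L →ₗ[k] L}
    {d' : L' →ₗ[k] L'} (h : IsExterior (j := j) ϖ d) (h' : IsExterior (j := j') ϖ d') (x : L) :
    d' (π x) = π (d x) := by
  induction x using adjoin_induction_left G.adjoin_eq_top with
  | one => simp [h.one, h'.one]
  | add x y hx hy => simp only [map_add, hx, hy]
  | smul c x hx => simp only [map_smul, hx]
  | gen_mul v x hx =>
    obtain ⟨b, rfl⟩ := mcForm_surjective hsurj v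
    have h1 : (mcConv ϖ j' * mcConv ϖ j') b = π ((mcConv ϖ j * mcConv ϖ j) b) := by
      have : mcConv ϖ j' = Conv.post π (mcConv ϖ j) :=
        Conv.ext' fun a => by simp [hπ.gen]
      rw [this, ← map_mul]
      rfl
    rw [map_mul, hπ.gen, h'.gen_mul, h'.mc, hx, h.gen_mul, h.mc, h1, map_sub, map_mul, map_mul,
      map_neg, hπ.gen]

end IsMap

section Construction

variable (π : L →ₐ[k] L') (hπ : Function.Surjective π)

theorem toLinearMap_eq_zero {π : L →ₐ[k] L'} (hker : ∀ x, π x = 0 ↔ x ∈ G.radical Δ) (x : L)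
    (h : ∀ n, G.tensorPart Δ n x = 0) : π.toLinearMap x = 0 :=
  (hker x).2 (Generated.mem_radical.2 h)

/-- The structures induced on the quotient by the radical. -/
def ofRadical (hX : X.IsCrossedModule) (hΔ : G.IsCoproduct Δ)
    (hker : ∀ x, π x = 0 ↔ x ∈ G.radical Δ) : Generated X L' (π.toLinearMap ∘ₗ j) where
  α := descendAlg π hπ ((Algebra.TensorProduct.map π (AlgHom.id k A)).comp G.α) fun x hx =>
    rTensor_eq_zero_of_family (toLinearMap_eq_zero hker)
      (hΔ.rTensor_α_of_mem_radical hX ((hker x).1 hx))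
  β := descendAlg π hπ ((Conv.post π).comp G.β) fun x hx => Conv.ext' fun a =>
    (hker _).2 (hΔ.β_mem_radical hX ((hker x).1 hx) a)
  P := descendAlg π hπ (π.comp G.P) fun x hx => (hker _).2 (hΔ.P_mem_radical ((hker x).1 hx))
  ε := descendAlg π hπ G.ε fun x hx => ε_of_mem_radical ((hker x).1 hx)
  γ := descendAlg π hπ ((Polynomial.mapAlgHom π).comp G.γ) fun x hx => by
    refine Polynomial.ext fun n => ?_
    rw [AlgHom.comp_apply, Polynomial.coe_mapAlgHom, Polynomial.coeff_map, Polynomial.coeff_zero]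
    exact (hker _).2 (hΔ.component_mem_radical hX ((hker x).1 hx) n)
  pr := descend π hπ G.pr
  adjoin_eq_top := by
    have h : (Algebra.adjoin k (Set.range j)).map π = ⊤ := by
      rw [G.adjoin_eq_top, Algebra.map_top, AlgHom.range_eq_top]
      exact hπ
    rw [AlgHom.map_adjoin, ← Set.range_comp] at h
    exact h
  α_gen v := (descendAlg_apply hπ _ (j v)).trans (by
    rw [AlgHom.comp_apply, G.α_gen, LinearMap.rTensor_comp_apply]
    rfl)
  β_gen v a := (congrArg (fun f : Conv k A L' => f a)
    (descendAlg_apply hπ (f := (Conv.post π).comp G.β) _ (j v))).trans (by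
      simp [G.β_gen])
  P_gen v := (descendAlg_apply hπ _ (j v)).trans (by simp [G.P_gen])
  ε_gen v := (descendAlg_apply hπ _ (j v)).trans (G.ε_gen v)
  γ_gen v := (descendAlg_apply hπ _ (j v)).trans (by simp [G.γ_gen])
  pr_one := by
    rw [← map_one π, descend_apply hπ fun x hx => hΔ.pr_of_mem_radical ((hker x).1 hx), G.pr_one]
  pr_gen v x := by
    obtain ⟨x, rfl⟩ := hπ x
    refine Eq.trans (b := descend π hπ G.pr (π (j v * x))) (by rw [map_mul π]; rfl) ?_
    rw [descend_apply hπ fun x hx => hΔ.pr_of_mem_radical ((hker x).1 hx), G.pr_gen]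
    exact congr($(descendAlg_apply hπ _ x) • v).symm

variable (hX : X.IsCrossedModule) (hΔ : G.IsCoproduct Δ)
  (hker : ∀ x, π x = 0 ↔ x ∈ G.radical Δ)

theorem isMap_ofRadical : IsMap G (ofRadical π hπ hX hΔ hker) π := ⟨fun _ => rfl⟩

theorem exists_isCoproduct_ofRadical : ∃ Δ', (ofRadical π hπ hX hΔ hker).IsCoproduct Δ' := by
  have h0 : ∀ x, π x = 0 → (TensorProduct.map π.toLinearMap π.toLinearMap ∘ₗ Δ) x = 0 := by
    intro x hx
    rw [LinearMap.comp_apply, ← LinearMap.rTensor_comp_lTensor, LinearMap.comp_apply]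
    refine rTensor_eq_zero_of_family (toLinearMap_eq_zero hker) fun m => ?_
    rw [← LinearMap.comp_apply, LinearMap.rTensor_comp_lTensor, ← LinearMap.lTensor_comp_rTensor,
      LinearMap.comp_apply]
    refine lTensor_eq_zero_of_family (toLinearMap_eq_zero hker) fun n => ?_
    rw [← LinearMap.comp_apply, LinearMap.lTensor_comp_rTensor, ← LinearMap.rTensor_comp_lTensor]
    exact hΔ.map_comul_of_mem_radical hX ((hker x).1 hx) m n
  refine ⟨descend π hπ (TensorProduct.map π.toLinearMap π.toLinearMap ∘ₗ Δ), ?_, ?_⟩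
  · rw [← map_one π, descend_apply hπ h0, LinearMap.comp_apply, hΔ.one]
    simp
  · intro v x
    obtain ⟨x, rfl⟩ := hπ x
    have h1 := (isMap_ofRadical π hπ hX hΔ hker).primOp_map v (Δ x)
    rw [← hΔ.gen_mul] at h1
    rw [descend_apply hπ h0, LinearMap.comp_apply, LinearMap.comp_apply, h1,
      AlgHom.toLinearMap_apply, ← map_mul, descend_apply hπ h0, LinearMap.comp_apply]

theorem exists_isExterior_ofRadical (π : L →ₐ[k] L') (hπ : Function.Surjective π)
    (hX : X.IsCrossedModule) (hΔ : G.IsCoproduct Δ)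
    (hker : ∀ x, π x = 0 ↔ x ∈ G.radical Δ) (hϖ : (CrossedData.aug k A).IsMorphism X ϖ)
    (hsurj : Function.Surjective ϖ) {d : L →ₗ[k] L} (h : IsExterior (j := j) ϖ d) :
    ∃ d', IsExterior (j := π.toLinearMap ∘ₗ j) ϖ d' := by
  have h0 : ∀ x, π x = 0 → (π.toLinearMap ∘ₗ d) x = 0 := fun x hx =>
    (hker _).2 (hΔ.d_mem_radical hX hϖ hsurj h ((hker x).1 hx))
  refine ⟨descend π hπ (π.toLinearMap ∘ₗ d), ?_, ?_, ?_⟩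
  · rw [← map_one π, descend_apply hπ h0, LinearMap.comp_apply, h.one, map_zero]
  · intro v x
    obtain ⟨x, rfl⟩ := hπ x
    simp only [LinearMap.comp_apply, AlgHom.toLinearMap_apply]
    rw [← map_mul, descend_apply hπ h0, descend_apply hπ h0, descend_apply hπ h0]
    simp [h.gen_mul]
  · intro a
    have h1 : mcConv ϖ (π.toLinearMap ∘ₗ j) = Conv.post π (mcConv ϖ j) := rfl
    rw [LinearMap.comp_apply, AlgHom.toLinearMap_apply, descend_apply hπ h0, LinearMap.comp_apply,
      h.mc, h1, ← map_mul, map_neg]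
    rfl

end Construction

theorem IsMap.isHom (hX : X.IsCrossedModule) {π : L →ₐ[k] L'} (hπ : IsMap G G' π)
    (hsurj : Function.Surjective ϖ)
    (hΔ : G.IsCoproduct Δ) (hΔ' : G'.IsCoproduct Δ') {d : L →ₗ[k] L} {d' : L' →ₗ[k] L'}
    (h : IsExterior (j := j) ϖ d) (h' : IsExterior (j := j') ϖ d') {S : L →ₗ[k] L}
    {S' : L' →ₗ[k] L'}
    (hl : ∀ x, LinearMap.mul' k L (S.rTensor L (Δ x)) = algebraMap k L (G.ε x))
    (hr' : ∀ x, LinearMap.mul' k L' (S'.lTensor L' (Δ' x)) = algebraMap k L' (G'.ε x)) :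
    (G.data Δ S d).IsHom (G'.data Δ' S' d') π where
  crossed :=
    { act := fun x a => (hπ.β_apply x a).symm
      coact := fun x => hπ.α_apply x }
  comul := hπ.comul_apply hΔ hΔ'
  counit := hπ.ε_apply
  d := hπ.d_apply hsurj h h'
  antipode x := by
    have key : π.toLinearMap ∘ₗ S = S' ∘ₗ π.toLinearMap := by
      refine convolution_inverse_unique (hΔ.coassoc hX) (ε := G.ε.toLinearMap)
        (hΔ.counit_left hX) hΔ.counit_right (f := π.toLinearMap) (fun x => ?_) fun x => ?_
      · have h1 := congr(π $(hl x))
        rw [AlgHom.commutes] at h1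
        rw [AlgHom.toLinearMap_apply, ← h1]
        generalize Δ x = Z
        induction Z with
        | zero => simp
        | tmul z w => simp
        | add s t hs ht => simp only [map_add, hs, ht]
      · have h1 := hr' (π x)
        rw [hπ.ε_apply, hπ.comul_apply hΔ hΔ'] at h1
        rw [AlgHom.toLinearMap_apply, ← h1]
        generalize Δ x = Z
        induction Z with
        | zero => simp
        | tmul z w => simp
        | add s t hs ht => simp only [map_add, hs, ht]
    exact (LinearMap.congr_fun key x).symm

end Generated

end Quotient

/-! ### The tensor algebra -/

section TensorAlg

open WithConv

variable {k : Type u} {A : Type v} [Field k] [Ring A] [HopfAlgebra k A]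
variable {V : Type w} [AddCommGroup V] [Module k V]
variable (X : CrossedData k A V) {ϖ : Aug k A →ₗ[k] V}

theorem adjoin_range_ι : Algebra.adjoin k (Set.range (TensorAlgebra.ι k : V →ₗ[k] _)) = ⊤ :=
  TensorAlgebra.adjoin_range_ι

/-- `v ↦ ((c, w) ↦ (0, c v))`. -/
def degreeOneOp (k : Type u) [Field k] (V : Type w) [AddCommGroup V] [Module k V] :
    V →ₗ[k] Module.End k (k × V) where
  toFun v := LinearMap.inr k k V ∘ₗ LinearMap.toSpanSingleton k V v ∘ₗ LinearMap.fst k k V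
  map_add' v w := by ext <;> simp
  map_smul' c v := by ext <;> simp

@[simp] theorem degreeOneOp_apply (v : V) (z : k × V) : degreeOneOp k V v z = (0, z.1 • v) := rfl

theorem degreeOneOp_mul (v w : V) : degreeOneOp k V v * degreeOneOp k V w = 0 := by
  refine LinearMap.ext fun z => ?_
  simp

/-- `(c, w) ↦ w`, applied to the vector `(1, 0)`. -/
def prOfOp {L : Type*} [Ring L] [Algebra k L] (f : L →ₐ[k] Module.End k (k × V)) : L →ₗ[k] V :=
  LinearMap.snd k k V ∘ₗ LinearMap.applyₗ (1, 0) ∘ₗ f.toLinearMap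

theorem prOfOp_gen_mul {L : Type*} [Ring L] [Algebra k L] {j : V →ₗ[k] L}
    (h : Algebra.adjoin k (Set.range j) = ⊤) {f : L →ₐ[k] Module.End k (k × V)}
    (hf : ∀ v, f (j v) = degreeOneOp k V v) {ε : L →ₐ[k] k} (hε : ∀ v, ε (j v) = 0)
    (v : V) (x : L) :
    prOfOp f (j v * x) = ε x • v := by
  have h1 : LinearMap.fst k k V ∘ₗ LinearMap.applyₗ (1, 0) ∘ₗ f.toLinearMap = ε.toLinearMap := by
    refine linearMap_ext_left h (by simp) fun v x _ => ?_
    simp [hf, hε]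
  have h2 : (f x (1, 0)).1 = ε x := LinearMap.congr_fun h1 x
  simp [prOfOp, hf, h2]

theorem prOfOp_one {L : Type*} [Ring L] [Algebra k L] (f : L →ₐ[k] Module.End k (k × V)) :
    prOfOp f 1 = 0 := by
  simp [prOfOp]

/-- The linear map `v ↦ (a ↦ j (v ◁ a))`. -/
def actConv {R : Type*} [Ring R] [Algebra k R] (j : V →ₗ[k] R) : V →ₗ[k] Conv k A R :=
  (WithConv.linearEquiv k (A →ₗ[k] R)).symm.toLinearMap ∘ₗ LinearMap.compRight k j ∘ₗ
    TensorProduct.curry X.act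

@[simp] theorem actConv_apply {R : Type*} [Ring R] [Algebra k R] (j : V →ₗ[k] R) (v : V) (a : A) :
    actConv X j v a = j (X.act (v ⊗ₜ a)) := rfl

/-- The structures of the tensor algebra. -/
def tensorGenerated : Generated X (TensorAlgebra k V) (TensorAlgebra.ι k) where
  α := TensorAlgebra.lift k ((TensorAlgebra.ι k).rTensor A ∘ₗ X.coact)
  β := TensorAlgebra.lift k (actConv X (TensorAlgebra.ι k))
  P := TensorAlgebra.lift k (-TensorAlgebra.ι k)
  ε := TensorAlgebra.lift k 0
  γ := TensorAlgebra.lift k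
    ((Polynomial.monomial 1).restrictScalars k ∘ₗ TensorAlgebra.ι k)
  pr := prOfOp (TensorAlgebra.lift k (degreeOneOp k V))
  adjoin_eq_top := adjoin_range_ι
  α_gen v := by simp
  β_gen v a := by simp
  P_gen v := by simp
  ε_gen v := by simp
  γ_gen v := by simp
  pr_one := prOfOp_one _
  pr_gen := prOfOp_gen_mul adjoin_range_ι (fun v => by simp) (fun v => by simp)

variable {X} {L : Type x} [Ring L] [Algebra k L]

namespace Generated

variable {j : V →ₗ[k] L} (G : Generated X L j)

/-- `primOp` as a linear map. -/
def primOpₗ : V →ₗ[k] Module.End k (L ⊗[k] L) :=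
  LinearMap.rTensorHom L ∘ₗ LinearMap.mul k L ∘ₗ j +
    LinearMap.mulRight k (G.parityFst L) ∘ₗ Conv.coOpₗ (R := L) G.α.toLinearMap ∘ₗ
      G.β.toLinearMap ∘ₗ j

@[simp] theorem primOpₗ_apply (v : V) : G.primOpₗ v = G.primOp v := rfl

theorem isCoproduct_of_algHom (Φ : L →ₐ[k] Module.End k (L ⊗[k] L))
    (h : ∀ v, Φ (j v) = G.primOp v) :
    G.IsCoproduct (LinearMap.applyₗ (1 ⊗ₜ[k] 1) ∘ₗ Φ.toLinearMap) where
  one := by simp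
  gen_mul v x := by simp [h]

end Generated

theorem exists_isCoproduct_tensor : ∃ Δ, (tensorGenerated X).IsCoproduct Δ :=
  ⟨_, (tensorGenerated X).isCoproduct_of_algHom
    (TensorAlgebra.lift k (tensorGenerated X).primOpₗ) fun v => by simp⟩

/-! ### The algebra with the quadratic relations -/

/-- The algebra maps from `Λ_max`. -/
def LambdaMax.lift (ϖ : Aug k A →ₗ[k] V) {R : Type*} [Ring R] [Algebra k R] (f : V →ₗ[k] R)
    (h : ∀ a : Aug k A, ϖ a = 0 → (mcConv ϖ f * mcConv ϖ f) (a : A) = 0) : LambdaMax ϖ →ₐ[k] R :=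
  RingQuot.liftAlgHom k ⟨TensorAlgebra.lift k f, by
    rintro x y ⟨a, ha⟩
    rw [map_zero, ← h a ha, LinearMap.convMul_apply]
    generalize (Coalgebra.comul (R := k) (a : A)) = s
    induction s with
    | zero => simp
    | tmul a b => simp
    | add s t hs ht => simp only [map_add, hs, ht]⟩

@[simp] theorem LambdaMax.lift_ι (ϖ : Aug k A →ₗ[k] V) {R : Type*} [Ring R] [Algebra k R]
    (f : V →ₗ[k] R) (h : ∀ a : Aug k A, ϖ a = 0 → (mcConv ϖ f * mcConv ϖ f) (a : A) = 0) (v : V) :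
    LambdaMax.lift ϖ f h (LambdaMax.ι ϖ v) = f v := by
  simp [LambdaMax.lift, LambdaMax.ι]

theorem mcConv_sq_one (f : V →ₗ[k] L) : (mcConv ϖ f * mcConv ϖ f) (1 : A) = 0 := by
  simp [LinearMap.convMul_apply, mcForm_one, Algebra.TensorProduct.one_def]

theorem mcConv_sq_piEps (f : V →ₗ[k] L) (a : A) :
    (mcConv ϖ f * mcConv ϖ f) (piEps k A a : A) = (mcConv ϖ f * mcConv ϖ f) a := by
  rw [piEps_apply, map_sub, Algebra.algebraMap_eq_smul_one, map_smul, mcConv_sq_one, smul_zero,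
    sub_zero]

theorem LambdaMax.mcConv_sq (ϖ : Aug k A →ₗ[k] V) (a : Aug k A) (ha : ϖ a = 0) :
    (mcConv ϖ (LambdaMax.ι ϖ) * mcConv ϖ (LambdaMax.ι ϖ)) (a : A) = 0 := by
  have h := RingQuot.mkAlgHom_rel k (MaxRel.of a ha)
  rw [map_zero] at h
  rw [← h, LinearMap.convMul_apply]
  generalize (Coalgebra.comul (R := k) (a : A)) = s
  induction s with
  | zero => simp
  | tmul a b => simp [LambdaMax.ι]
  | add s t hs ht => simp only [map_add, hs, ht]

theorem LambdaMax.adjoin_range_ι (ϖ : Aug k A →ₗ[k] V) :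
    Algebra.adjoin k (Set.range (LambdaMax.ι ϖ)) = ⊤ := by
  have h : (Algebra.adjoin k (Set.range (TensorAlgebra.ι k : V →ₗ[k] _))).map
      (RingQuot.mkAlgHom k (MaxRel ϖ)) = ⊤ := by
    rw [TensorAlgebra.adjoin_range_ι, Algebra.map_top, AlgHom.range_eq_top]
    exact RingQuot.mkAlgHom_surjective k _
  rw [AlgHom.map_adjoin, ← Set.range_comp] at h
  exact h

theorem post_mcConv {R : Type*} [Ring R] [Algebra k R] (π : L →ₐ[k] R) (f : V →ₗ[k] L) :
    Conv.post π (mcConv ϖ f) = mcConv ϖ (π.toLinearMap ∘ₗ f) := rfl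

theorem mcConv_sq_comp {R : Type*} [Ring R] [Algebra k R] (π : L →ₐ[k] R) (f : V →ₗ[k] L) (a : A) :
    (mcConv ϖ (π.toLinearMap ∘ₗ f) * mcConv ϖ (π.toLinearMap ∘ₗ f)) a =
      π ((mcConv ϖ f * mcConv ϖ f) a) := by
  rw [← post_mcConv, ← map_mul]
  rfl

/-- `v ↦ ((x, y) ↦ (v x, δ(v) x - v y))`. -/
def derivOp (j δ : V →ₗ[k] L) : V →ₗ[k] Module.End k (L × L) where
  toFun v := LinearMap.prod (LinearMap.mulLeft k (j v) ∘ₗ LinearMap.fst k L L)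
    (LinearMap.mulLeft k (δ v) ∘ₗ LinearMap.fst k L L -
      LinearMap.mulLeft k (j v) ∘ₗ LinearMap.snd k L L)
  map_add' v w := by
    refine LinearMap.ext fun z => Prod.ext ?_ ?_
    · simp [add_mul]
    · simp [add_mul]; abel
  map_smul' c v := by
    refine LinearMap.ext fun z => Prod.ext ?_ ?_ <;> simp [smul_sub]

@[simp] theorem derivOp_apply (j δ : V →ₗ[k] L) (v : V) (z : L × L) :
    derivOp j δ v z = (j v * z.1, δ v * z.1 - j v * z.2) := rfl

theorem exists_isExterior_of_lift {j : V →ₗ[k] L} (hsurj : Function.Surjective ϖ)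
    (hadj : Algebra.adjoin k (Set.range j) = ⊤)
    (hsq : ∀ a : Aug k A, ϖ a = 0 → (mcConv ϖ j * mcConv ϖ j) (a : A) = 0)
    (hlift : ∀ {R : Type x} [Ring R] [Algebra k R] (f : V →ₗ[k] R), (∀ a : Aug k A, ϖ a = 0 →
      (mcConv ϖ f * mcConv ϖ f) (a : A) = 0) → ∃ Φ : L →ₐ[k] R, ∀ v, Φ (j v) = f v) :
    ∃ d, Generated.IsExterior (j := j) ϖ d := by
  obtain ⟨s, hs⟩ := ϖ.exists_rightInverse_of_surjective (LinearMap.range_eq_top.2 hsurj)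
  let δ : V →ₗ[k] L := -((mcConv ϖ j * mcConv ϖ j).ofConv ∘ₗ (Aug k A).subtype ∘ₗ s)
  have hδ : ∀ a, δ (mcForm ϖ a) = -(mcConv ϖ j * mcConv ϖ j) a := by
    intro a
    have h := hsq (s (mcForm ϖ a) - piEps k A a) (by
      rw [map_sub, ← LinearMap.comp_apply ϖ s, hs, LinearMap.id_apply]
      exact sub_self _)
    rw [Submodule.coe_sub, map_sub, mcConv_sq_piEps, sub_eq_zero] at h
    simp only [δ, LinearMap.neg_apply, LinearMap.comp_apply, Submodule.subtype_apply]
    rw [h]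
  let E : Conv k A (Module.End k (L × L)) :=
    mcConv (L := Module.End k (L × L)) ϖ (derivOp (j) δ)
  have hE : ∀ a, E a = derivOp (j) δ (mcForm ϖ a) := fun a => rfl
  have hrel : ∀ a : Aug k A, ϖ a = 0 → (E * E) (a : A) = 0 := by
    intro a ha
    have h1 : ∀ x y, ((E * E) (a : A)) (x, y) =
      ((mcConv ϖ j * mcConv ϖ j) (a : A) * x,
        -(((mcConv ϖ j * mcConv ϖ j) * mcConv ϖ j) (a : A) * x) +
          ((mcConv ϖ j * (mcConv ϖ j * mcConv ϖ j)) (a : A) * x) +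
          (mcConv ϖ j * mcConv ϖ j) (a : A) * y) := by
      intro x y
      rw [LinearMap.convMul_apply (mcConv ϖ j * mcConv ϖ j),
        LinearMap.convMul_apply (mcConv ϖ j) (mcConv ϖ j * mcConv ϖ j),
        LinearMap.convMul_apply E E, LinearMap.convMul_apply (mcConv ϖ j) (mcConv ϖ j)]
      generalize (Coalgebra.comul (R := k) (a : A)) = s
      induction s with
      | zero => simp [Prod.ext_iff]
      | tmul a b =>
        simp only [TensorProduct.map_tmul, LinearMap.mul'_apply, mcConv_apply, hE,
          Module.End.mul_apply, derivOp_apply, hδ]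
        simp only [mul_assoc, mul_sub, neg_mul, mul_neg]
        refine Prod.ext rfl ?_
        simp only []
        abel
      | add s t hs ht =>
        simp only [map_add, LinearMap.add_apply, hs, ht, add_mul, Prod.mk_add_mk, neg_add]
        refine Prod.ext rfl ?_
        simp only []
        abel
    refine LinearMap.ext fun ⟨x, y⟩ => ?_
    rw [h1, mul_assoc, hsq a ha]
    simp
  obtain ⟨Φ, hΦ⟩ := hlift (R := Module.End k (L × L)) _ hrel
  have hfst : ∀ x, (Φ x (1, 0)).1 = x := by
    have h : LinearMap.fst k _ _ ∘ₗ LinearMap.applyₗ (1, 0) ∘ₗ Φ.toLinearMap = LinearMap.id := by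
      refine linearMap_ext_left (hadj) (by simp) fun v x ih => ?_
      simp only [LinearMap.comp_apply, AlgHom.toLinearMap_apply, LinearMap.applyₗ_apply_apply,
        LinearMap.fst_apply, LinearMap.id_apply] at ih ⊢
      rw [map_mul, hΦ, Module.End.mul_apply, derivOp_apply, ih]
    exact LinearMap.congr_fun h
  have hgen : ∀ v x, (Φ (j v * x) (1, 0)).2 =
      δ v * x - j v * (Φ x (1, 0)).2 := by
    intro v x
    rw [map_mul, hΦ, Module.End.mul_apply, derivOp_apply, hfst]
  refine ⟨LinearMap.snd k _ _ ∘ₗ LinearMap.applyₗ (1, 0) ∘ₗ Φ.toLinearMap, by simp, ?_, ?_⟩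
  · intro v x
    have h := hgen v 1
    rw [mul_one, mul_one, map_one, Module.End.one_apply, mul_zero, sub_zero] at h
    simp only [LinearMap.comp_apply, AlgHom.toLinearMap_apply, LinearMap.applyₗ_apply_apply,
        LinearMap.snd_apply, hgen, h]
  · intro a
    have h := hgen (mcForm ϖ a) 1
    rw [mul_one, mul_one, map_one, Module.End.one_apply, mul_zero, sub_zero, hδ] at h
    exact h

namespace LambdaMax

variable (ϖ)

/-- The projection from the tensor algebra. -/
abbrev mk : TensorAlgebra k V →ₐ[k] LambdaMax ϖ := RingQuot.mkAlgHom k (MaxRel ϖ)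

/-- The form `ϖ π_ε` with values in `Λ_max`. -/
abbrev mc : Conv k A (LambdaMax ϖ) := mcConv ϖ (LambdaMax.ι ϖ)

variable {ϖ}

theorem shift_mc (hϖ : (CrossedData.aug k A).IsMorphism X ϖ) {a : Aug k A} (ha : ϖ a = 0) :
    Conv.shift (mc ϖ) (a : A) = 0 := Conv.ext' fun b => by
  have h0 : Coalgebra.counit (R := k) (a : A) = 0 := a.2
  simp [mcForm_mul hϖ, mcForm_coe, ha, h0]

theorem shift_mc_sq (hϖ : (CrossedData.aug k A).IsMorphism X ϖ) {a : Aug k A} (ha : ϖ a = 0) :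
    Conv.shift (mc ϖ * mc ϖ) (a : A) = 0 := Conv.ext' fun b => by
  have h0 : Coalgebra.counit (R := k) (a : A) = 0 := a.2
  have h1 : ϖ ((CrossedData.aug k A).act (a ⊗ₜ b)) = 0 := by
    rw [hϖ.act, ha]; simp
  exact LambdaMax.mcConv_sq ϖ _ h1

theorem coact_rel (hϖ : (CrossedData.aug k A).IsMorphism X ϖ) (hsurj : Function.Surjective ϖ)
    (a : Aug k A) (ha : ϖ a = 0) : Algebra.TensorProduct.map (mk ϖ) (AlgHom.id k A)
      ((tensorGenerated X).α ((mcConv ϖ (TensorAlgebra.ι k) * mcConv ϖ (TensorAlgebra.ι k))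
        (a : A))) = 0 := by
  rw [(tensorGenerated X).α_mcConv_sq hϖ]
  have h := rTensor_adR_eq_zero hϖ hsurj (f := (mc ϖ * mc ϖ).ofConv)
    (mcConv_sq_one _) (LambdaMax.mcConv_sq ϖ) a ha
  rw [← h]
  generalize (adR k A (a : A)) = t
  induction t with
  | zero => simp
  | tmul x y =>
    have h1 := mcConv_sq_comp (mk ϖ) (TensorAlgebra.ι k) (ϖ := ϖ) x
    rw [LinearMap.rTensor_tmul, LinearMap.rTensor_tmul, Algebra.TensorProduct.map_tmul, ← h1]
    rfl
  | add s t hs ht => simp only [map_add, hs, ht]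

theorem act_rel (hϖ : (CrossedData.aug k A).IsMorphism X ϖ) (a : Aug k A) (ha : ϖ a = 0) :
    Conv.post (mk ϖ) ((tensorGenerated X).β
      ((mcConv ϖ (TensorAlgebra.ι k) * mcConv ϖ (TensorAlgebra.ι k)) (a : A))) = 0 := by
  have h0 : Coalgebra.counit (R := k) (a : A) = 0 := a.2
  have h : ∀ f, Conv.post (mk ϖ) (Conv.shift f (a : A)) = Conv.shift (Conv.post (mk ϖ) f) (a : A) :=
    fun f => rfl
  have h1 : Conv.post (mk ϖ) (mcConv ϖ (TensorAlgebra.ι k)) = mc ϖ := rfl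
  rw [(tensorGenerated X).β_mcConv_sq hϖ, h0, zero_smul, add_zero, map_sub, map_sub, map_mul,
    map_mul, h, h, map_mul, h1, shift_mc hϖ ha, shift_mc_sq hϖ ha]
  simp

/-- The structures of `Λ_max`. -/
def generated (hϖ : (CrossedData.aug k A).IsMorphism X ϖ) (hsurj : Function.Surjective ϖ) :
    Generated X (LambdaMax ϖ) (LambdaMax.ι ϖ) where
  α := LambdaMax.lift ϖ (((Algebra.TensorProduct.map (mk ϖ) (AlgHom.id k A)).comp
      (tensorGenerated X).α).toLinearMap ∘ₗ TensorAlgebra.ι k) fun a ha => by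
    rw [mcConv_sq_comp]
    exact coact_rel hϖ hsurj a ha
  β := LambdaMax.lift ϖ (((Conv.post (mk ϖ)).comp
      (tensorGenerated X).β).toLinearMap ∘ₗ TensorAlgebra.ι k) fun a ha => by
    rw [mcConv_sq_comp]
    exact act_rel hϖ a ha
  P := LambdaMax.lift ϖ (-LambdaMax.ι ϖ) fun a ha => by
    have h : mcConv ϖ (-LambdaMax.ι ϖ) = - mc ϖ := rfl
    rw [h, neg_mul_neg]
    exact LambdaMax.mcConv_sq ϖ a ha
  ε := LambdaMax.lift ϖ 0 fun a ha => by
    have h : mcConv ϖ (0 : V →ₗ[k] k) = 0 := rfl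
    rw [h, zero_mul]
    rfl
  γ := LambdaMax.lift ϖ ((Polynomial.monomial 1).restrictScalars k ∘ₗ LambdaMax.ι ϖ) fun a ha => by
    refine Eq.trans ?_ ((congrArg (Polynomial.monomial 2) (LambdaMax.mcConv_sq ϖ a ha)).trans
      (map_zero _))
    rw [LinearMap.convMul_apply, LinearMap.convMul_apply]
    generalize (Coalgebra.comul (R := k) (a : A)) = s
    induction s with
    | zero => simp
    | tmul a b => simp [Polynomial.monomial_mul_monomial]
    | add s t hs ht => simp only [map_add, hs, ht]
  pr := prOfOp (LambdaMax.lift ϖ (degreeOneOp k V) fun a ha => by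
    rw [LinearMap.convMul_apply]
    generalize (Coalgebra.comul (R := k) (a : A)) = s
    induction s with
    | zero => simp
    | tmul a b =>
      simp only [TensorProduct.map_tmul, LinearMap.mul'_apply, mcConv_apply, degreeOneOp_mul]
    | add s t hs ht => rw [map_add, map_add, hs, ht, add_zero])
  adjoin_eq_top := LambdaMax.adjoin_range_ι ϖ
  α_gen v := by
    rw [LambdaMax.lift_ι, LinearMap.comp_apply, AlgHom.toLinearMap_apply, AlgHom.comp_apply,
      Generated.α_gen, LambdaMax.ι, LinearMap.rTensor_comp_apply]
    rfl
  β_gen v a := by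
    rw [LambdaMax.lift_ι, LinearMap.comp_apply, AlgHom.toLinearMap_apply, AlgHom.comp_apply,
      Conv.post_apply, Generated.β_gen]
    rfl
  P_gen v := by simp
  ε_gen v := by simp
  γ_gen v := by simp
  pr_one := prOfOp_one _
  pr_gen := prOfOp_gen_mul (LambdaMax.adjoin_range_ι ϖ) (fun v => by simp) (fun v => by simp)

theorem isMap_mk (hϖ : (CrossedData.aug k A).IsMorphism X ϖ) (hsurj : Function.Surjective ϖ) :
    Generated.IsMap (tensorGenerated X) (generated hϖ hsurj) (mk ϖ) := ⟨fun _ => rfl⟩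

theorem exists_isCoproduct (hX : X.IsCrossedModule) (hϖ : (CrossedData.aug k A).IsMorphism X ϖ)
    (hsurj : Function.Surjective ϖ) : ∃ Δ, (generated hϖ hsurj).IsCoproduct Δ := by
  let G := generated hϖ hsurj
  have h : mcConv ϖ G.primOpₗ = G.mcPrim ϖ := Conv.ext' fun a => by
    rw [G.mcPrim_apply hϖ, mcConv_apply, Generated.primOpₗ_apply]
  refine ⟨_, G.isCoproduct_of_algHom (LambdaMax.lift ϖ G.primOpₗ fun a ha => ?_) fun v => by simp⟩
  have h0 : Coalgebra.counit (R := k) (a : A) = 0 := a.2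
  have h1 : mc ϖ (a : A) = 0 := by rw [mcConv_apply, mcForm_coe, ha, map_zero]
  have h2 : Generated.lmulFst (LambdaMax ϖ) (0 : LambdaMax ϖ) =
      (0 : Module.End k (LambdaMax ϖ ⊗[k] LambdaMax ϖ)) := by ext; simp
  rw [h, G.mcPrim_mul_mcPrim hX hϖ, h0, shift_mc hϖ ha, shift_mc_sq hϖ ha,
    LambdaMax.mcConv_sq ϖ a ha, h1, h2]
  simp [G.op_zero]

theorem exists_isExterior (hsurj : Function.Surjective ϖ) :
    ∃ d, Generated.IsExterior (j := LambdaMax.ι ϖ) ϖ d :=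
  exists_isExterior_of_lift hsurj (LambdaMax.adjoin_range_ι ϖ) (LambdaMax.mcConv_sq ϖ)
    fun f hf => ⟨LambdaMax.lift ϖ f hf, LambdaMax.lift_ι ϖ f hf⟩

end LambdaMax

end TensorAlg

/-! ### Braided integers -/

section BraidedIntegers

variable {k : Type u} [Field k] {V : Type w} [AddCommGroup V] [Module k V]

theorem consEquiv_induction {n : ℕ} {p : (⨂[k]^(n + 1) V) → Prop}
    (h : ∀ v x, p (consEquiv k V n (v ⊗ₜ x))) (add : ∀ x y, p x → p y → p (x + y)) (x) : p x := by
  obtain ⟨y, rfl⟩ := (consEquiv k V n).surjective x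
  induction y with
  | zero => simpa using h 0 0
  | tmul v y => exact h v y
  | add s t hs ht => rw [map_add]; exact add _ _ hs ht

theorem idTensor_cons (n : ℕ) (f : Module.End k (⨂[k]^n V)) (v : V) (x : ⨂[k]^n V) :
    idTensor n f (consEquiv k V n (v ⊗ₜ x)) = consEquiv k V n (v ⊗ₜ f x) := by
  simp [idTensor]

theorem end_ext_cons {n : ℕ} {M : Type*} [AddCommGroup M] [Module k M]
    {f g : (⨂[k]^(n + 1) V) →ₗ[k] M}
    (h : ∀ v x, f (consEquiv k V n (v ⊗ₜ x)) = g (consEquiv k V n (v ⊗ₜ x))) : f = g := by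
  refine LinearMap.ext fun x => ?_
  induction x using consEquiv_induction with
  | h v x => exact h v x
  | add x y hx hy => rw [map_add, map_add, hx, hy]

theorem idTensor_one (n : ℕ) : idTensor n (1 : Module.End k (⨂[k]^n V)) = 1 :=
  end_ext_cons fun v x => by rw [idTensor_cons]; rfl

theorem idTensor_mul (n : ℕ) (f g : Module.End k (⨂[k]^n V)) :
    idTensor n (f * g) = idTensor n f * idTensor n g :=
  end_ext_cons fun v x => by
    rw [idTensor_cons, Module.End.mul_apply, Module.End.mul_apply, idTensor_cons, idTensor_cons]

theorem idTensor_add (n : ℕ) (f g : Module.End k (⨂[k]^n V)) :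
    idTensor n (f + g) = idTensor n f + idTensor n g :=
  end_ext_cons fun v x => by
    rw [idTensor_cons, LinearMap.add_apply, LinearMap.add_apply, idTensor_cons, idTensor_cons,
      TensorProduct.tmul_add, map_add]

theorem idTensor_smul (n : ℕ) (c : k) (f : Module.End k (⨂[k]^n V)) :
    idTensor n (c • f) = c • idTensor n f :=
  end_ext_cons fun v x => by
    rw [idTensor_cons, LinearMap.smul_apply, LinearMap.smul_apply, idTensor_cons,
      TensorProduct.tmul_smul, map_smul]

/-- `f ↦ id ⊗ f`. -/
def idTensorHom (n : ℕ) : Module.End k (⨂[k]^n V) →ₐ[k] Module.End k (⨂[k]^(n + 1) V) :=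
  AlgHom.ofLinearMap
    { toFun := idTensor n, map_add' := idTensor_add n, map_smul' := idTensor_smul n }
    (idTensor_one n) (idTensor_mul n)

@[simp] theorem idTensorHom_apply (n : ℕ) (f : Module.End k (⨂[k]^n V)) :
    idTensorHom n f = idTensor n f := rfl

theorem braidFirst_cons (Ψ : V ⊗[k] V →ₗ[k] V ⊗[k] V) (n : ℕ) (v w : V) (x : ⨂[k]^n V) :
    braidFirst Ψ n (consEquiv k V (n + 1) (v ⊗ₜ consEquiv k V n (w ⊗ₜ x))) =
      consEquiv k V (n + 1) ((consEquiv k V n).toLinearMap.lTensor V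
        (TensorProduct.assoc k V V _ (Ψ (v ⊗ₜ w) ⊗ₜ x))) := by
  simp [braidFirst, LinearMap.lTensor, TensorProduct.congr, LinearEquiv.refl_toLinearMap]

theorem braidAt_succ_succ (Ψ : V ⊗[k] V →ₗ[k] V ⊗[k] V) (n i : ℕ) :
    braidAt Ψ (n + 2) (i + 1) = idTensor (n + 1) (braidAt Ψ (n + 1) i) := rfl

theorem prod_map_braidAt_succ (Ψ : V ⊗[k] V →ₗ[k] V ⊗[k] V) (n : ℕ) (l : List ℕ) :
    ((l.map (· + 1)).map (braidAt Ψ (n + 2))).prod =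
      idTensor (n + 1) (l.map (braidAt Ψ (n + 1))).prod := by
  rw [← idTensorHom_apply, map_list_prod, List.map_map, List.map_map]
  rfl

theorem braidedInt_succ_succ (Ψ : V ⊗[k] V →ₗ[k] V ⊗[k] V) (n : ℕ) :
    braidedInt Ψ (n + 2) = 1 + braidFirst Ψ n * idTensor (n + 1) (braidedInt Ψ (n + 1)) := by
  rw [braidedInt, Finset.sum_range_succ']
  refine (add_comm _ _).trans ?_
  congr 1
  rw [braidedInt, ← idTensorHom_apply, map_sum, Finset.mul_sum]
  refine Finset.sum_congr rfl fun j _ => ?_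
  rw [idTensorHom_apply, ← prod_map_braidAt_succ, List.range_succ_eq_map, List.map_cons,
    List.prod_cons]
  rfl

theorem braidedInt_one (Ψ : V ⊗[k] V →ₗ[k] V ⊗[k] V) : braidedInt Ψ 1 = 1 := by
  simp [braidedInt]

theorem toTensorAlgebra_cons (n : ℕ) (v : V) (x : ⨂[k]^n V) :
    TensorPower.toTensorAlgebra (consEquiv k V n (v ⊗ₜ x)) =
      TensorAlgebra.ι k v * TensorPower.toTensorAlgebra x := by
  induction x using PiTensorProduct.induction_on with
  | smul_tprod r f =>
    rw [TensorProduct.tmul_smul, map_smul, map_smul, map_smul, mul_smul_comm,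
      consEquiv_tmul_tprod, TensorPower.toTensorAlgebra_tprod, TensorPower.toTensorAlgebra_tprod,
      TensorAlgebra.tprod_apply, TensorAlgebra.tprod_apply, List.ofFn_succ, List.prod_cons]
    simp
  | add x y hx hy => simp only [TensorProduct.tmul_add, map_add, hx, hy, mul_add]

theorem toTensorAlgebra_zero (x : ⨂[k]^0 V) : TensorPower.toTensorAlgebra x =
    algebraMap k (TensorAlgebra k V) (PiTensorProduct.isEmptyEquiv (Fin 0) x) := by
  induction x using PiTensorProduct.induction_on with
  | smul_tprod r f =>
    rw [map_smul, map_smul, TensorPower.toTensorAlgebra_tprod, TensorAlgebra.tprod_apply]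
    simp [Algebra.algebraMap_eq_smul_one]
  | add x y hx hy => simp only [map_add, hx, hy]

end BraidedIntegers

section TensorRadical

open WithConv

variable {k : Type u} {A : Type v} [Field k] [Ring A] [HopfAlgebra k A]
variable {V : Type w} [AddCommGroup V] [Module k V]
variable {X : CrossedData k A V}
variable {Δ : TensorAlgebra k V →ₗ[k] TensorAlgebra k V ⊗[k] TensorAlgebra k V}

open Generated

theorem leftDer_toTensorAlgebra (hX : X.IsCrossedModule) (hΔ : (tensorGenerated X).IsCoproduct Δ)
    (n : ℕ) (x : ⨂[k]^(n + 1) V) :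
    (tensorGenerated X).leftDer Δ (TensorPower.toTensorAlgebra x) =
      TensorPower.toTensorAlgebra.lTensor V
        ((consEquiv k V n).symm (braidedInt (-(X.braiding X)) (n + 1) x)) := by
  induction n with
  | zero =>
    induction x using consEquiv_induction with
    | h v x =>
      rw [toTensorAlgebra_cons, hΔ.leftDer_gen_mul hX, toTensorAlgebra_zero,
        Algebra.algebraMap_eq_smul_one, map_smul, hΔ.leftDer_one, smul_zero, map_zero, sub_zero,
        braidedInt_one, Module.End.one_apply, LinearEquiv.symm_apply_apply, LinearMap.lTensor_tmul,
        toTensorAlgebra_zero, Algebra.algebraMap_eq_smul_one]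
    | add x y hx hy => simp only [map_add, hx, hy]
  | succ n ih =>
    induction x using consEquiv_induction with
    | h v y =>
      rw [toTensorAlgebra_cons, hΔ.leftDer_gen_mul hX, ih, braidedInt_succ_succ,
        LinearMap.add_apply, Module.End.one_apply, Module.End.mul_apply, idTensor_cons, map_add,
        LinearEquiv.symm_apply_apply, map_add, LinearMap.lTensor_tmul, sub_eq_add_neg]
      congr 1
      obtain ⟨Y, hY⟩ := (consEquiv k V n).surjective (braidedInt (-(X.braiding X)) (n + 1) y)
      rw [← hY, LinearEquiv.symm_apply_apply]
      clear hY
      induction Y with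
      | zero => simp
      | tmul w z =>
        rw [LinearMap.lTensor_tmul, Conv.coOpₗ_tmul, braidFirst_cons, LinearEquiv.symm_apply_apply,
          LinearMap.neg_apply, TensorProduct.neg_tmul, map_neg, map_neg, map_neg]
        congr 1
        simp only [CrossedData.braiding, LinearMap.comp_apply, LinearMap.lTensor_tmul,
          LinearEquiv.coe_coe]
        generalize X.coact w = t
        induction t with
        | zero => simp
        | tmul w a => simp [(tensorGenerated X).β_gen, toTensorAlgebra_cons]
        | add s t hs ht => simp only [map_add, hs, ht, TensorProduct.tmul_add,
            TensorProduct.add_tmul]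
      | add s t hs ht =>
        simp only [map_add, TensorProduct.tmul_add, neg_add, hs, ht]
    | add x y hx hy => simp only [map_add, hx, hy]

theorem tensorPart_toTensorAlgebra (hX : X.IsCrossedModule)
    (hΔ : (tensorGenerated X).IsCoproduct Δ) (n : ℕ) (x : ⨂[k]^n V) :
    (tensorGenerated X).tensorPart Δ n (TensorPower.toTensorAlgebra x) =
      braidedFactorial (-(X.braiding X)) n x := by
  induction n with
  | zero =>
    rw [toTensorAlgebra_zero, tensorPart, LinearMap.comp_apply, AlgHom.toLinearMap_apply,
      AlgHom.commutes]
    exact (PiTensorProduct.isEmptyEquiv (Fin 0)).symm_apply_apply x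
  | succ n ih =>
    have h : (tensorGenerated X).tensorPart Δ n ∘ₗ TensorPower.toTensorAlgebra =
      braidedFactorial (-(X.braiding X)) n := LinearMap.ext ih
    rw [tensorPart, LinearMap.comp_apply, LinearMap.comp_apply, leftDer_toTensorAlgebra hX hΔ,
      ← LinearMap.lTensor_comp_apply, h]
    rfl

theorem tensorPart_toTensorAlgebra_of_ne (hX : X.IsCrossedModule)
    (hΔ : (tensorGenerated X).IsCoproduct Δ) {m n : ℕ} (hmn : m ≠ n) (x : ⨂[k]^n V) :
    (tensorGenerated X).tensorPart Δ m (TensorPower.toTensorAlgebra x) = 0 := by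
  induction m generalizing n with
  | zero =>
    obtain ⟨n, rfl⟩ := Nat.exists_eq_succ_of_ne_zero hmn.symm
    rw [tensorPart_zero_eq_zero]
    induction x using consEquiv_induction with
    | h v y => rw [toTensorAlgebra_cons, map_mul, (tensorGenerated X).ε_gen, zero_mul]
    | add x y hx hy => simp only [map_add, hx, hy, add_zero]
  | succ m ih =>
    rw [tensorPart_succ_eq_zero]
    cases n with
    | zero =>
      rw [toTensorAlgebra_zero, Algebra.algebraMap_eq_smul_one, map_smul, hΔ.leftDer_one, smul_zero,
        map_zero]
    | succ n =>
      have h : (tensorGenerated X).tensorPart Δ m ∘ₗ TensorPower.toTensorAlgebra = 0 :=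
        LinearMap.ext (ih fun h => hmn (by rw [h]) : ∀ x : ⨂[k]^n V, _)
      rw [leftDer_toTensorAlgebra hX hΔ, ← LinearMap.lTensor_comp_apply, h]
      simp

theorem ofDirectSum_of (n : ℕ) (x : ⨂[k]^n V) :
    TensorAlgebra.ofDirectSum (DirectSum.of (fun n => ⨂[k]^n V) n x) =
      TensorPower.toTensorAlgebra x :=
  DirectSum.toAddMonoid_of (fun _ => TensorPower.toTensorAlgebra.toAddMonoidHom) _ _

theorem BMinus.mk_toTensorAlgebra (Ψ : V ⊗[k] V →ₗ[k] V ⊗[k] V) (n : ℕ) (x : ⨂[k]^n V)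
    (hx : braidedFactorial (-Ψ) n x = 0) : BMinus.mk Ψ (TensorPower.toTensorAlgebra x) = 0 := by
  have h := RingQuot.mkAlgHom_rel k (ExtRel.of n x hx)
  rwa [map_zero] at h

theorem BMinus.mk_eq_zero (hX : X.IsCrossedModule) (hΔ : (tensorGenerated X).IsCoproduct Δ)
    (x : TensorAlgebra k V) :
    BMinus.mk (X.braiding X) x = 0 ↔ x ∈ (tensorGenerated X).radical Δ := by
  classical
  constructor
  · intro hx
    let I : Ideal (TensorAlgebra k V) :=
      { (tensorGenerated X).radical Δ with
        smul_mem' := fun c x hx => hΔ.mul_mem_radical_left hX hx c }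
    have hI : I.IsTwoSided := ⟨fun b ha => hΔ.mul_mem_radical_right hX ha b⟩
    let f : BMinus (X.braiding X) →ₐ[k] TensorAlgebra k V ⧸ I :=
      RingQuot.liftAlgHom k ⟨Ideal.Quotient.mkₐ k I, by
        rintro x y ⟨n, x, hx⟩
        rw [map_zero]
        refine Ideal.Quotient.eq_zero_iff_mem.2 ?_
        refine Generated.mem_radical.2 fun m => ?_
        by_cases hmn : m = n
        · subst hmn
          rw [tensorPart_toTensorAlgebra hX hΔ, hx]
        · exact tensorPart_toTensorAlgebra_of_ne hX hΔ hmn x⟩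
    have h : f (BMinus.mk (X.braiding X) x) = Ideal.Quotient.mk I x := by
      simp [f, BMinus.mk]
    rw [hx, map_zero] at h
    exact Ideal.Quotient.eq_zero_iff_mem.1 h.symm
  · intro hx
    obtain ⟨y, rfl⟩ : ∃ y, TensorAlgebra.ofDirectSum y = x :=
      (TensorAlgebra.equivDirectSum (R := k) (M := V)).symm.surjective x
    have h : ∀ m, (tensorGenerated X).tensorPart Δ m ∘ₗ TensorAlgebra.ofDirectSum.toLinearMap =
        braidedFactorial (-(X.braiding X)) m ∘ₗ DirectSum.component k ℕ (fun n => ⨂[k]^n V) m := by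
      intro m
      refine DirectSum.linearMap_ext k fun n => LinearMap.ext fun x => ?_
      have h1 := ofDirectSum_of n x
      simp only [LinearMap.comp_apply, DirectSum.lof_eq_of, AlgHom.toLinearMap_apply]
      rw [h1, ← DirectSum.lof_eq_of k]
      by_cases hmn : m = n
      · subst hmn
        rw [tensorPart_toTensorAlgebra hX hΔ, DirectSum.component.lof_self]
      · rw [tensorPart_toTensorAlgebra_of_ne hX hΔ hmn, DirectSum.component.of,
          dif_neg (Ne.symm hmn), map_zero]
    rw [← DirectSum.sum_support_of y, map_sum, map_sum]
    refine Finset.sum_eq_zero fun n _ => ?_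
    rw [ofDirectSum_of]
    refine BMinus.mk_toTensorAlgebra _ n _ ?_
    have h1 := LinearMap.congr_fun (h n) y
    rw [LinearMap.comp_apply, AlgHom.toLinearMap_apply, Generated.mem_radical.1 hx n] at h1
    exact h1.symm

theorem BMinus.mk_toTensorAlgebra_eq_zero (hX : X.IsCrossedModule) (n : ℕ) (x : ⨂[k]^n V) :
    BMinus.mk (X.braiding X) (TensorPower.toTensorAlgebra x) = 0 ↔
      braidedFactorial (-(X.braiding X)) n x = 0 := by
  refine ⟨fun h => ?_, BMinus.mk_toTensorAlgebra _ n x⟩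
  obtain ⟨Δ, hΔ⟩ := exists_isCoproduct_tensor (X := X)
  rw [← tensorPart_toTensorAlgebra hX hΔ]
  exact Generated.mem_radical.1 ((BMinus.mk_eq_zero hX hΔ _).1 h) n

end TensorRadical

/-! ### The quotient map from `Λ_max` to `Λ_min` -/

section MinMax

open WithConv

variable {k : Type u} {A : Type v} [Field k] [Ring A] [HopfAlgebra k A]
variable {V : Type w} [AddCommGroup V] [Module k V]
variable {X : CrossedData k A V} {ϖ : Aug k A →ₗ[k] V}

namespace Generated

variable {L : Type x} [Ring L] [Algebra k L] {j : V →ₗ[k] L} {G : Generated X L j}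
  {Δ : L →ₗ[k] L ⊗[k] L}

theorem IsCoproduct.leftDer_mcConv_sq (hX : X.IsCrossedModule)
    (hϖ : (CrossedData.aug k A).IsMorphism X ϖ) (hΔ : G.IsCoproduct Δ) (a : A) :
    G.leftDer Δ ((mcConv ϖ j * mcConv ϖ j) a) =
      (mcConv ϖ j).ofConv.lTensor V (X.coact (mcForm ϖ a)) := by
  set E := mcConv ϖ j with hE
  have h1 : ∀ c, G.leftDer Δ (E c) = mcForm ϖ c ⊗ₜ 1 := by
    intro c
    have h := hΔ.leftDer_gen_mul hX (mcForm ϖ c) 1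
    rwa [mul_one, hΔ.leftDer_one, map_zero, sub_zero] at h
  have h2 : ∀ (f : Conv k A L) (t : V ⊗[k] A), Conv.fill f 1 t = f.ofConv.lTensor V t := by
    intro f t
    induction t with
    | zero => simp
    | tmul v a => simp
    | add s t hs ht => simp only [map_add, hs, ht]
  have h3 : ∀ b (t : L ⊗[k] A), Conv.fill (Conv.shift E b) 1 (G.pr.rTensor A t) =
      E.ofConv.lTensor V (G.pr.rTensor A (Conv.incl L b * t)) := by
    intro b t
    induction t with
    | zero => simp
    | tmul v a => simp
    | add s t hs ht => simp only [map_add, mul_add, hs, ht]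
  have hα : ∀ c, G.pr.rTensor A (G.α (E c)) = X.coact (mcForm ϖ c) := by
    intro c
    rw [G.pr_α, hE, mcConv_apply]
    have := G.pr_gen (mcForm ϖ c) 1
    rw [mul_one, map_one, one_smul] at this
    rw [this]
  have h4 : ∀ s : A ⊗[k] A, G.leftDer Δ (LinearMap.mul' k L
      (TensorProduct.map E.ofConv E.ofConv s)) =
      TensorProduct.map (mcForm ϖ) E.ofConv s - E.ofConv.lTensor V (G.pr.rTensor A
        (LinearMap.mul' k _ (TensorProduct.map (Conv.incl L).ofConv
          (Conv.post G.α E).ofConv s))) +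
      E.ofConv.lTensor V (X.coact (mcForm ϖ (TensorProduct.lid k A
        ((Coalgebra.counit (R := k) (A := A)).rTensor A s)))) := by
    intro s
    induction s with
    | zero => simp
    | tmul b c =>
      have hb : G.β (j (mcForm ϖ b)) = Conv.shift E b - Coalgebra.counit (R := k) b • E :=
        G.β_mcConv hϖ b
      simp only [TensorProduct.map_tmul, LinearMap.mul'_apply, LinearMap.rTensor_tmul,
        TensorProduct.lid_tmul, map_smul]
      rw [show E b = j (mcForm ϖ b) from rfl, hΔ.leftDer_gen_mul hX, h1, hb, map_sub, map_smul,
        LinearMap.sub_apply, LinearMap.smul_apply, Conv.coOpₗ_tmul, Conv.coOpₗ_tmul, h2 E, ← hα c,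
        h3]
      simp only [Conv.post_apply]
      abel
    | add s t hs ht => simp only [map_add, hs, ht]; abel
  have h5 := h4 (Coalgebra.comul (R := k) a)
  rw [Coalgebra.rTensor_counit_comul, TensorProduct.lid_tmul, one_smul] at h5
  have h6 : LinearMap.mul' k _ (TensorProduct.map (Conv.incl L).ofConv
      (Conv.post G.α E).ofConv (Coalgebra.comul (R := k) a)) =
      (Conv.post Algebra.TensorProduct.includeLeft E * Conv.incl L : Conv k A (L ⊗[k] A)) a := by
    rw [← G.incl_mul_post_α_mcConv hϖ]
    rfl
  rw [h6] at h5
  refine Eq.trans h5 ?_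
  convert zero_add _
  rw [sub_eq_zero, LinearMap.convMul_apply]
  generalize (Coalgebra.comul (R := k) a) = s
  induction s with
  | zero => simp
  | tmul b c =>
    have := G.pr_gen (mcForm ϖ b) 1
    rw [mul_one, map_one, one_smul] at this
    simp [hE, this]
  | add s t hs ht => simp only [map_add, hs, ht]

theorem IsCoproduct.mcConv_sq_mem_radical (hX : X.IsCrossedModule)
    (hϖ : (CrossedData.aug k A).IsMorphism X ϖ) (hΔ : G.IsCoproduct Δ) (a : A)
    (ha : mcForm ϖ a = 0) : (mcConv ϖ j * mcConv ϖ j) a ∈ G.radical Δ := by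
  refine Generated.mem_radical.2 fun n => ?_
  cases n with
  | zero =>
    rw [tensorPart_zero_eq_zero, LinearMap.convMul_apply]
    generalize (Coalgebra.comul (R := k) a) = s
    induction s with
    | zero => simp
    | tmul b c => simp [G.ε_gen]
    | add s t hs ht => simp only [map_add, hs, ht, add_zero]
  | succ n =>
    rw [tensorPart_succ_eq_zero, hΔ.leftDer_mcConv_sq hX hϖ, ha, map_zero, map_zero, map_zero]

end Generated

theorem exists_toMin (hX : X.IsCrossedModule) (hϖ : (CrossedData.aug k A).IsMorphism X ϖ) :
    ∃ q : LambdaMax ϖ →ₐ[k] BMinus (X.braiding X),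
      ∀ v, q (LambdaMax.ι ϖ v) = BMinus.ι (X.braiding X) v := by
  obtain ⟨Δ, hΔ⟩ := exists_isCoproduct_tensor (X := X)
  refine ⟨LambdaMax.lift ϖ (BMinus.ι (X.braiding X)) fun a ha => ?_, fun v => by simp⟩
  have h := mcConv_sq_comp (BMinus.mk (X.braiding X)) (TensorAlgebra.ι k) (ϖ := ϖ) (a : A)
  refine Eq.trans h ?_
  rw [BMinus.mk_eq_zero hX hΔ]
  exact hΔ.mcConv_sq_mem_radical hX hϖ _ ((mcForm_coe ϖ a).trans ha)

/-- The structures on `Λ_max` and `Λ_min`, and the map between them. -/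
theorem exists_structures (hX : X.IsCrossedModule) (hϖ : (CrossedData.aug k A).IsMorphism X ϖ)
    (hsurj : Function.Surjective ϖ) :
    ∃ (G : Generated X (LambdaMax ϖ) (LambdaMax.ι ϖ)) (Δ : _) (d : _)
      (G' : Generated X (BMinus (X.braiding X)) (BMinus.ι (X.braiding X))) (Δ' : _) (d' : _)
      (q : LambdaMax ϖ →ₐ[k] BMinus (X.braiding X)),
      G.IsCoproduct Δ ∧ Generated.IsExterior (j := LambdaMax.ι ϖ) ϖ d ∧
      G'.IsCoproduct Δ' ∧ Generated.IsExterior (j := BMinus.ι (X.braiding X)) ϖ d' ∧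
      Generated.IsMap G G' q := by
  obtain ⟨ΔT, hΔT⟩ := exists_isCoproduct_tensor (X := X)
  obtain ⟨Δ, hΔ⟩ := LambdaMax.exists_isCoproduct hX hϖ hsurj
  obtain ⟨d, hd⟩ := LambdaMax.exists_isExterior hsurj
  obtain ⟨q, hq⟩ := exists_toMin hX hϖ
  have hqm : q.comp (LambdaMax.mk ϖ) = BMinus.mk (X.braiding X) :=
    TensorAlgebra.hom_ext (LinearMap.ext fun v => hq v)
  have hqs : Function.Surjective q := fun y => by
    obtain ⟨x, hx⟩ := RingQuot.mkAlgHom_surjective k _ y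
    exact ⟨LambdaMax.mk ϖ x, (AlgHom.congr_fun hqm x).trans hx⟩
  have hker : ∀ x, q x = 0 ↔ x ∈ (LambdaMax.generated hϖ hsurj).radical Δ := by
    intro x
    obtain ⟨x, rfl⟩ := RingQuot.mkAlgHom_surjective k _ x
    rw [(LambdaMax.isMap_mk hϖ hsurj).mem_radical hΔT hΔ, ← BMinus.mk_eq_zero hX hΔT, ← hqm]
    rfl
  have hj : q.toLinearMap ∘ₗ LambdaMax.ι ϖ = BMinus.ι (X.braiding X) := LinearMap.ext hq
  obtain ⟨Δ', hΔ'⟩ := Generated.exists_isCoproduct_ofRadical q hqs hX hΔ hker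
  obtain ⟨d', hd'⟩ := Generated.exists_isExterior_ofRadical q hqs hX hΔ hker hϖ hsurj hd
  refine ⟨LambdaMax.generated hϖ hsurj, Δ, d, ?_⟩
  rw [← hj]
  exact ⟨Generated.ofRadical q hqs hX hΔ hker, Δ', d', q, hΔ, hd, hΔ', hd',
    Generated.isMap_ofRadical q hqs hX hΔ hker⟩

end MinMax

/-! ### The antisymmetriser is a braided factorial -/

section Antisymmetriser

variable {k : Type u} [Field k] {V : Type w} [AddCommGroup V] [Module k V]

theorem idTensor_neg (n : ℕ) (f : Module.End k (⨂[k]^n V)) : idTensor n (-f) = -idTensor n f :=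
  map_neg (idTensorHom n) f

theorem braidFirst_neg (Ψ : V ⊗[k] V →ₗ[k] V ⊗[k] V) (n : ℕ) :
    braidFirst (-Ψ) n = -braidFirst Ψ n := by
  simp only [braidFirst, LinearMap.rTensor_neg, LinearMap.neg_comp, LinearMap.comp_neg]

theorem braidAt_neg (Ψ : V ⊗[k] V →ₗ[k] V ⊗[k] V) : ∀ (n i : ℕ), i + 1 < n →
    braidAt (-Ψ) n i = -braidAt Ψ n i
  | 0, _, h => absurd h (by omega)
  | 1, _, h => absurd h (by omega)
  | n + 2, 0, _ => braidFirst_neg Ψ n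
  | n + 2, i + 1, h => by
    rw [braidAt_succ_succ, braidAt_succ_succ, braidAt_neg Ψ (n + 1) i (by omega), idTensor_neg]

theorem prod_range_braidAt_neg (Ψ : V ⊗[k] V →ₗ[k] V ⊗[k] V) (n j : ℕ) (h : j ≤ n) :
    ((List.range j).map (braidAt (-Ψ) (n + 1))).prod =
      (-1 : ℤ) ^ j • ((List.range j).map (braidAt Ψ (n + 1))).prod := by
  induction j with
  | zero => simp
  | succ j ih =>
    rw [List.range_succ, List.map_append, List.map_append, List.prod_append, List.prod_append,
      ih (by omega), List.map_singleton, List.map_singleton, List.prod_singleton,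
      List.prod_singleton, braidAt_neg Ψ _ _ (by omega), pow_succ, mul_neg_one, neg_smul,
      smul_mul_assoc]
    refine LinearMap.ext fun x => ?_
    simp

theorem prod_map_succ_braidAt (Ψ : V ⊗[k] V →ₗ[k] V ⊗[k] V) (n : ℕ) (q : Equiv.Perm (Fin n)) :
    (((reducedWord n q).map (· + 1)).map (braidAt Ψ (n + 1))).prod =
      idTensor n ((reducedWord n q).map (braidAt Ψ n)).prod := by
  cases n with
  | zero =>
    have : reducedWord 0 q = [] := by rw [reducedWord]
    rw [this]
    exact (idTensor_one 0).symm
  | succ n => exact prod_map_braidAt_succ Ψ n _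

/-- The permutation sending `j` to `0`, and otherwise given by `q` on the remaining letters. -/
def insertPerm (n : ℕ) (j : Fin (n + 1)) (q : Equiv.Perm (Fin n)) : Equiv.Perm (Fin (n + 1)) :=
  (finSuccEquiv' j).trans ((Equiv.optionCongr q).trans (finSuccEquiv n).symm)

theorem insertPerm_symm_zero (n : ℕ) (j : Fin (n + 1)) (q : Equiv.Perm (Fin n)) :
    (insertPerm n j q).symm 0 = j := by
  rw [Equiv.symm_apply_eq]
  simp [insertPerm]

theorem conj_insertPerm (n : ℕ) (j : Fin (n + 1)) (q : Equiv.Perm (Fin n)) :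
    (finSuccEquiv' j).symm.trans ((insertPerm n j q).trans (finSuccEquiv n)) =
      Equiv.optionCongr q := by
  ext x : 1
  simp [insertPerm]

theorem reducedWord_insertPerm (n : ℕ) (j : Fin (n + 1)) (q : Equiv.Perm (Fin n)) :
    reducedWord (n + 1) (insertPerm n j q) =
      (reducedWord n q).map (· + 1) ++ List.range j := by
  rw [reducedWord, insertPerm_symm_zero, conj_insertPerm, Equiv.removeNone_optionCongr]

theorem insertPerm_bijective (n : ℕ) :
    Function.Bijective (fun z : Equiv.Perm (Fin n) × Fin (n + 1) => insertPerm n z.2 z.1) := by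
  refine (Fintype.bijective_iff_injective_and_card _).2 ⟨?_, ?_⟩
  · rintro ⟨q, j⟩ ⟨q', j'⟩ h
    have h1 : j = j' := by
      rw [← insertPerm_symm_zero n j q, ← insertPerm_symm_zero n j' q']
      exact congrArg (fun p : Equiv.Perm (Fin (n + 1)) => p.symm 0) h
    subst h1
    have h2 := conj_insertPerm n j q
    rw [show insertPerm n j q = insertPerm n j q' from h, conj_insertPerm] at h2
    rw [Equiv.optionCongr_injective h2]
  · rw [Fintype.card_prod, Fintype.card_perm, Fintype.card_perm, Fintype.card_fin,
      Fintype.card_fin, Nat.factorial_succ, mul_comm]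

theorem finSuccEquiv'_trans_symm (n : ℕ) (j : Fin (n + 1)) :
    (finSuccEquiv' j).trans (finSuccEquiv n).symm = Fin.cycleRange j := by
  rw [← Equiv.symm_symm (Fin.cycleRange j), ← Equiv.symm_symm ((finSuccEquiv' j).trans _)]
  congr 1
  ext x : 1
  refine Fin.cases ?_ (fun i => ?_) x
  · simp [Fin.cycleRange_symm_zero]
  · simp [Fin.cycleRange_symm_succ]

theorem sign_insertPerm (n : ℕ) (j : Fin (n + 1)) (q : Equiv.Perm (Fin n)) :
    (Equiv.Perm.sign (insertPerm n j q) : ℤ) = (-1) ^ (j : ℕ) * Equiv.Perm.sign q := by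
  have h : insertPerm n j q = (Fin.cycleRange j).trans
      ((finSuccEquiv n).trans ((Equiv.optionCongr q).trans (finSuccEquiv n).symm)) := by
    rw [← finSuccEquiv'_trans_symm]
    ext x : 1
    simp [insertPerm]
  rw [h, Equiv.Perm.sign_trans, Fin.sign_cycleRange]
  have h2 := Equiv.Perm.sign_symm_trans_trans (Equiv.optionCongr q) (finSuccEquiv n).symm
  rw [Equiv.symm_symm, Equiv.trans_assoc] at h2
  rw [h2, Equiv.optionCongr_sign]
  push_cast
  ring

theorem antisymmetriser_succ (Ψ : V ⊗[k] V →ₗ[k] V ⊗[k] V) (n : ℕ) :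
    antisymmetriser Ψ (n + 1) =
      idTensor n (antisymmetriser Ψ n) * braidedInt (-Ψ) (n + 1) := by
  rw [antisymmetriser, ← Function.Bijective.sum_comp (insertPerm_bijective n)
    (fun p => (Equiv.Perm.sign p : ℤ) •
      ((reducedWord (n + 1) p).map (braidAt Ψ (n + 1))).prod), Fintype.sum_prod_type,
    antisymmetriser, ← idTensorHom_apply, map_sum, Finset.sum_mul, braidedInt]
  refine Finset.sum_congr rfl fun q _ => ?_
  rw [Finset.mul_sum, Finset.sum_range]
  refine Finset.sum_congr rfl fun j _ => ?_
  rw [reducedWord_insertPerm, List.map_append, List.prod_append, prod_map_succ_braidAt,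
    prod_range_braidAt_neg Ψ n j (Nat.lt_succ_iff.1 j.2), sign_insertPerm, map_zsmul,
    idTensorHom_apply, smul_mul_smul_comm, mul_comm]

theorem antisymmetriser_eq_braidedFactorial (Ψ : V ⊗[k] V →ₗ[k] V ⊗[k] V) (n : ℕ) :
    antisymmetriser Ψ n = braidedFactorial (-Ψ) n := by
  induction n with
  | zero =>
    rw [antisymmetriser, Fintype.sum_unique, braidedFactorial, reducedWord]
    simp
  | succ n ih => rw [antisymmetriser_succ, ih, braidedFactorial]

end Antisymmetriser

/-! ### The super-bosonisation -/

section Bosonisation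

open WithConv

variable {k : Type u} {A : Type v} [Field k] [Ring A] [HopfAlgebra k A]
variable {V : Type w} [AddCommGroup V] [Module k V] {X : CrossedData k A V}
variable {L : Type x} [Ring L] [Algebra k L] {j : V →ₗ[k] L}

/-- Left multiplication by `a` on `A ⊗ M`. -/
def lmulA (M : Type*) [AddCommGroup M] [Module k M] (a : A) : Module.End k (A ⊗[k] M) :=
  (LinearMap.mulLeft k a).rTensor M

@[simp] theorem lmulA_tmul {M : Type*} [AddCommGroup M] [Module k M] (a b : A) (m : M) :
    lmulA M a (b ⊗ₜ[k] m) = (a * b) ⊗ₜ m := rfl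

theorem lmulA_mul {M : Type*} [AddCommGroup M] [Module k M] (a b : A) :
    (lmulA M (a * b) : Module.End k (A ⊗[k] M)) = lmulA M a * lmulA M b :=
  TensorProduct.ext' fun c m => by simp [mul_assoc]

theorem lmulA_one {M : Type*} [AddCommGroup M] [Module k M] :
    (lmulA M (1 : A) : Module.End k (A ⊗[k] M)) = 1 :=
  TensorProduct.ext' fun c m => by simp

theorem lmulA_add {M : Type*} [AddCommGroup M] [Module k M] (a b : A) :
    (lmulA M (a + b) : Module.End k (A ⊗[k] M)) = lmulA M a + lmulA M b :=
  TensorProduct.ext' fun c m => by simp [add_mul, TensorProduct.add_tmul]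

theorem lmulA_smul {M : Type*} [AddCommGroup M] [Module k M] (r : k) (a : A) :
    (lmulA M (r • a) : Module.End k (A ⊗[k] M)) = r • lmulA M a :=
  TensorProduct.ext' fun c m => by simp [TensorProduct.smul_tmul']

section Regular

variable {R : Type*} [Ring R] [Algebra k R]

/-- `a ⊗ r ↦ a₁ ⊗ f(a₂) r` on `A ⊗ R`. -/
def regOp (f : Conv k A R) : Module.End k (A ⊗[k] R) := Conv.coOpₗ Coalgebra.comul f

theorem regOp_tmul (f : Conv k A R) (a : A) (r : R) :
    regOp f (a ⊗ₜ r) = Conv.fill f r (Coalgebra.comul (R := k) a) := Conv.coOpₗ_tmul _ f a r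

theorem regOp_mul (f g : Conv k A R) : regOp (f * g) = regOp f * regOp g :=
  Conv.coOpₗ_mul (M := A) Coalgebra.comul Coalgebra.coassoc_apply f g

theorem regOp_one : regOp (1 : Conv k A R) = 1 :=
  Conv.coOpₗ_one _ fun a => Coalgebra.lTensor_counit_comul a

theorem regOp_add (f g : Conv k A R) : regOp (f + g) = regOp f + regOp g := map_add _ _ _

theorem regOp_sub (f g : Conv k A R) : regOp (f - g) = regOp f - regOp g := map_sub _ _ _

theorem regOp_neg (f : Conv k A R) : regOp (-f) = -regOp f := map_neg _ _

theorem regOp_smul (c : k) (f : Conv k A R) : regOp (c • f) = c • regOp f := map_smul _ _ _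

/-- `Σ ℓ(b) f(c ·)` for a tensor `b ⊗ c`. -/
def regPushed (f : Conv k A R) : A ⊗[k] A →ₗ[k] Module.End k (A ⊗[k] R) :=
  TensorProduct.lift (LinearMap.mk₂ k (fun b c => lmulA R b * regOp (Conv.shift f c))
    (fun b b' c => by rw [lmulA_add, add_mul])
    (fun r b c => by rw [lmulA_smul, smul_mul_assoc])
    (fun b c d => by rw [Conv.shift_add, regOp_add, mul_add])
    (fun r b c => by
      rw [← mul_smul_comm, ← regOp_smul]; congr 2; exact Conv.ext' fun a => by simp))

@[simp] theorem regPushed_tmul (f : Conv k A R) (b c : A) :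
    regPushed f (b ⊗ₜ c) = lmulA R b * regOp (Conv.shift f c) := rfl

theorem regOp_mul_lmulA (f : Conv k A R) (b : A) :
    regOp f * lmulA R b = regPushed f (Coalgebra.comul (R := k) b) := by
  refine TensorProduct.ext' fun c r => ?_
  simp only [Module.End.mul_apply, regOp_tmul, lmulA_tmul, Bialgebra.comul_mul]
  generalize Coalgebra.comul (R := k) b = s
  induction s with
  | zero => simp
  | tmul b b' =>
    simp only [regPushed_tmul, Module.End.mul_apply, regOp_tmul]
    generalize Coalgebra.comul (R := k) c = t
    induction t with
    | zero => simp
    | tmul c c' => simp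
    | add s t hs ht => simp only [map_add, hs, ht, mul_add]
  | add s t hs ht => simp only [map_add, hs, ht, add_mul, LinearMap.add_apply]

end Regular

variable (G : Generated X L j)

/-- Left multiplication in the bosonisation: `(a ⊗ x)(b ⊗ y) = a b₁ ⊗ (x ◁ b₂) y`. -/
def bosonOp : A ⊗[k] L →ₗ[k] Module.End k (A ⊗[k] L) :=
  TensorProduct.lift (LinearMap.mk₂ k (fun a x => lmulA L a * regOp (G.β x))
    (fun a b x => by rw [lmulA_add, add_mul])
    (fun r a x => by rw [lmulA_smul, smul_mul_assoc])
    (fun a x y => by rw [map_add, regOp_add, mul_add])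
    (fun r a x => by rw [map_smul, regOp_smul, mul_smul_comm]))

@[simp] theorem bosonOp_tmul (a : A) (x : L) :
    bosonOp G (a ⊗ₜ x) = lmulA L a * regOp (G.β x) := rfl

theorem bosonOp_bosonOp (hX : X.IsCrossedModule) (z w : A ⊗[k] L) :
    bosonOp G (bosonOp G z w) = bosonOp G z * bosonOp G w := by
  induction z with
  | zero => simp
  | tmul a x =>
    induction w with
    | zero => simp
    | tmul b y =>
      rw [bosonOp_tmul, bosonOp_tmul, Module.End.mul_apply, regOp_tmul,
        show lmulA L a * regOp (G.β x) * (lmulA L b * regOp (G.β y)) =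
          lmulA L a * (regOp (G.β x) * lmulA L b) * regOp (G.β y) by simp only [mul_assoc],
        regOp_mul_lmulA]
      generalize Coalgebra.comul (R := k) b = s
      induction s with
      | zero => simp
      | tmul b c =>
        rw [Conv.fill_tmul, lmulA_tmul, bosonOp_tmul, regPushed_tmul, map_mul, lmulA_mul,
          G.shift_β hX, regOp_mul]
        simp only [mul_assoc]
      | add s t hs ht => simp only [map_add, hs, ht, mul_add, add_mul]
    | add s t hs ht => simp only [map_add, hs, ht, mul_add]
  | add s t hs ht => simp only [map_add, hs, ht, add_mul, LinearMap.add_apply]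

/-- The bosonisation `A ⊗ L`, as an algebra. -/
def Boson (_ : Generated X L j) (_ : X.IsCrossedModule) : Type _ := A ⊗[k] L

namespace Boson

variable {G} {hX : X.IsCrossedModule}

instance : AddCommGroup (Boson G hX) := inferInstanceAs (AddCommGroup (A ⊗[k] L))

instance : Module k (Boson G hX) := inferInstanceAs (Module k (A ⊗[k] L))

variable (G hX) in
/-- The underlying vector space of the bosonisation. -/
def equiv : A ⊗[k] L ≃ₗ[k] Boson G hX := LinearEquiv.refl k _

instance : Mul (Boson G hX) :=
  ⟨fun z w => equiv G hX (bosonOp G ((equiv G hX).symm z) ((equiv G hX).symm w))⟩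

instance : One (Boson G hX) := ⟨equiv G hX (1 ⊗ₜ 1)⟩

theorem equiv_mul_equiv (z w : A ⊗[k] L) :
    equiv G hX z * equiv G hX w = equiv G hX (bosonOp G z w) := rfl

theorem one_def : (1 : Boson G hX) = equiv G hX (1 ⊗ₜ 1) := rfl

instance : Ring (Boson G hX) where
  left_distrib a b c := map_add (bosonOp G ((equiv G hX).symm a)) _ _
  right_distrib a b c := congr(equiv G hX ($(map_add (bosonOp G) _ _) ((equiv G hX).symm c)))
  zero_mul a := congr(equiv G hX ($(map_zero (bosonOp G)) ((equiv G hX).symm a)))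
  mul_zero a := map_zero (bosonOp G ((equiv G hX).symm a))
  mul_assoc a b c := by
    obtain ⟨a, rfl⟩ := (equiv G hX).surjective a
    obtain ⟨b, rfl⟩ := (equiv G hX).surjective b
    obtain ⟨c, rfl⟩ := (equiv G hX).surjective c
    rw [equiv_mul_equiv, equiv_mul_equiv, equiv_mul_equiv, equiv_mul_equiv, bosonOp_bosonOp G hX,
      Module.End.mul_apply]
  one_mul a := by
    obtain ⟨a, rfl⟩ := (equiv G hX).surjective a
    rw [one_def, equiv_mul_equiv, bosonOp_tmul, lmulA_one, map_one, regOp_one]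
    rfl
  mul_one a := by
    obtain ⟨a, rfl⟩ := (equiv G hX).surjective a
    rw [one_def, equiv_mul_equiv]
    congr 1
    induction a with
    | zero => simp
    | tmul a x =>
      rw [bosonOp_tmul, Module.End.mul_apply, regOp_tmul, Bialgebra.comul_one,
        Algebra.TensorProduct.one_def, Conv.fill_tmul, lmulA_tmul, G.β_apply_one hX, mul_one,
        mul_one]
    | add s t hs ht => rw [map_add, LinearMap.add_apply, hs, ht]
  zsmul := zsmulRec
  neg_add_cancel := neg_add_cancel

instance : Algebra k (Boson G hX) :=
  Algebra.ofModule (fun r _ b => congr(equiv G hX ($(map_smul (bosonOp G) r _)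
    ((equiv G hX).symm b)))) fun r a _ => map_smul (bosonOp G ((equiv G hX).symm a)) r _

variable (G hX) in
/-- `A` as a subalgebra of the bosonisation. -/
def ofA : A →ₐ[k] Boson G hX :=
  AlgHom.ofLinearMap ((equiv G hX).toLinearMap ∘ₗ (TensorProduct.mk k A L).flip 1) rfl
    fun a b => by
      simp only [LinearMap.comp_apply, LinearMap.flip_apply, TensorProduct.mk_apply,
        LinearEquiv.coe_coe, equiv_mul_equiv, bosonOp_tmul, map_one, regOp_one, mul_one, lmulA_tmul]

variable (G hX) in
/-- `L` as a subalgebra of the bosonisation. -/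
def ofL : L →ₐ[k] Boson G hX :=
  AlgHom.ofLinearMap ((equiv G hX).toLinearMap ∘ₗ TensorProduct.mk k A L 1) rfl
    fun x y => by
      simp only [LinearMap.comp_apply, TensorProduct.mk_apply, LinearEquiv.coe_coe,
        equiv_mul_equiv, bosonOp_tmul, lmulA_one, one_mul, regOp_tmul, Bialgebra.comul_one,
        Algebra.TensorProduct.one_def, Conv.fill_tmul, G.β_apply_one hX]

theorem ofA_apply (a : A) : ofA G hX a = equiv G hX (a ⊗ₜ 1) := rfl

theorem ofL_apply (x : L) : ofL G hX x = equiv G hX (1 ⊗ₜ x) := rfl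

theorem ofA_mul_equiv (a : A) (z : A ⊗[k] L) :
    ofA G hX a * equiv G hX z = equiv G hX (lmulA L a z) := by
  rw [ofA_apply, equiv_mul_equiv, bosonOp_tmul, map_one, regOp_one, mul_one]

theorem ofL_mul_equiv (x : L) (z : A ⊗[k] L) :
    ofL G hX x * equiv G hX z = equiv G hX (regOp (G.β x) z) := by
  rw [ofL_apply, equiv_mul_equiv, bosonOp_tmul, lmulA_one, one_mul]

theorem ofA_mul_ofL (a : A) (x : L) : ofA G hX a * ofL G hX x = equiv G hX (a ⊗ₜ x) := by
  rw [ofL_apply, ofA_mul_equiv, lmulA_tmul, mul_one]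

variable (G hX) in
/-- The inclusion of `A`, as an element of the convolution algebra. -/
def convA : Conv k A (Boson G hX) := toConv (ofA G hX).toLinearMap

@[simp] theorem convA_apply (a : A) : convA G hX a = ofA G hX a := rfl

theorem const_mul_convA (x : L) : Conv.const (ofL G hX x) * convA G hX =
    convA G hX * Conv.post (ofL G hX) (G.β x) := Conv.ext' fun b => by
  rw [Conv.const_mul_apply, LinearMap.convMul_apply, convA_apply, ofA_apply, ofL_mul_equiv,
    regOp_tmul]
  generalize Coalgebra.comul (R := k) b = s
  induction s with
  | zero => simp
  | tmul b c =>
    simp only [Conv.fill_tmul, mul_one, TensorProduct.map_tmul, LinearMap.mul'_apply]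
    exact (ofA_mul_ofL _ _).symm
  | add s t hs ht => simp only [map_add, hs, ht]

/-- Algebra maps out of the bosonisation are pairs of algebra maps `f`, `g` with
`g(x) f(b) = f(b₁) g(x ◁ b₂)`. -/
def lift {R : Type*} [Ring R] [Algebra k R] (f : A →ₐ[k] R) (g : L →ₐ[k] R)
    (h : ∀ x, Conv.const (g x) * toConv f.toLinearMap =
      (toConv f.toLinearMap * Conv.post g (G.β x) : Conv k A R)) : Boson G hX →ₐ[k] R :=
  AlgHom.ofLinearMap ((LinearMap.mul' k R ∘ₗ TensorProduct.map f.toLinearMap g.toLinearMap) ∘ₗ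
      (equiv G hX).symm.toLinearMap)
    (by
      rw [one_def, LinearMap.comp_apply, LinearEquiv.coe_coe, LinearEquiv.symm_apply_apply]
      simp)
    (fun z w => by
      obtain ⟨z, rfl⟩ := (equiv G hX).surjective z
      obtain ⟨w, rfl⟩ := (equiv G hX).surjective w
      rw [equiv_mul_equiv]
      simp only [LinearMap.comp_apply, LinearEquiv.coe_coe, LinearEquiv.symm_apply_apply]
      induction z with
      | zero => simp
      | tmul a x =>
        induction w with
        | zero => simp
        | tmul b y =>
          have h1 := congr($(h x) b)
          rw [Conv.const_mul_apply, LinearMap.convMul_apply] at h1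
          rw [bosonOp_tmul, Module.End.mul_apply, regOp_tmul]
          have h2 : ∀ s : A ⊗[k] A, LinearMap.mul' k R (TensorProduct.map f.toLinearMap
              g.toLinearMap (lmulA L a (Conv.fill (G.β x) y s))) =
              f a * LinearMap.mul' k R (TensorProduct.map f.toLinearMap
                (Conv.post g (G.β x)).ofConv s) * g y := by
            intro s
            induction s with
            | zero => simp
            | tmul b c => simp [mul_assoc]
            | add s t hs ht => simp only [map_add, hs, ht, mul_add, add_mul]
          rw [h2]
          refine (congr(f a * $h1 * g y)).symm.trans ?_
          simp [mul_assoc]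
        | add s t hs ht => simp only [map_add, hs, ht, mul_add]
      | add s t hs ht => simp only [map_add, hs, ht, add_mul, LinearMap.add_apply])

section Lift

variable {R : Type*} [Ring R] [Algebra k R] (f : A →ₐ[k] R) (g : L →ₐ[k] R)
    (h : ∀ x, Conv.const (g x) * toConv f.toLinearMap =
      (toConv f.toLinearMap * Conv.post g (G.β x) : Conv k A R))

theorem lift_equiv_tmul (a : A) (x : L) :
    lift (hX := hX) f g h (equiv G hX (a ⊗ₜ x)) = f a * g x := rfl

@[simp] theorem lift_ofA (a : A) : lift (hX := hX) f g h (ofA G hX a) = f a := by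
  rw [ofA_apply, lift_equiv_tmul, map_one, mul_one]

@[simp] theorem lift_ofL (x : L) : lift (hX := hX) f g h (ofL G hX x) = g x := by
  rw [ofL_apply, lift_equiv_tmul, map_one, one_mul]

end Lift

/-- The condition for an algebra map out of the bosonisation, on the generators. -/
theorem lift_condition {R : Type*} [Ring R] [Algebra k R] (f : Conv k A R) (g : L →ₐ[k] R)
    (h : ∀ v, Conv.const (g (j v)) * f = f * Conv.post g (G.β (j v))) (x : L) :
    Conv.const (g x) * f = f * Conv.post g (G.β x) := by
  induction x using adjoin_induction_left G.adjoin_eq_top with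
  | one => simp
  | add x y hx hy => simp only [map_add, add_mul, mul_add, hx, hy]
  | smul c x hx => simp only [map_smul, smul_mul_assoc, mul_smul_comm, hx]
  | gen_mul v x hx => rw [map_mul, map_mul, map_mul, map_mul, mul_assoc, hx, ← mul_assoc, h,
      mul_assoc]

theorem algHom_ext {R : Type*} [Ring R] [Algebra k R] {f g : Boson G hX →ₐ[k] R}
    (hA : ∀ a, f (ofA G hX a) = g (ofA G hX a))
    (hL : ∀ v, f (ofL G hX (j v)) = g (ofL G hX (j v))) : f = g := by
  have hL' : f.comp (ofL G hX) = g.comp (ofL G hX) := G.algHom_ext hL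
  refine AlgHom.ext fun z => ?_
  obtain ⟨z, rfl⟩ := (equiv G hX).surjective z
  induction z with
  | zero => simp
  | tmul a x =>
    rw [← ofA_mul_ofL, map_mul, map_mul, hA]
    exact congr(_ * $(AlgHom.congr_fun hL' x))
  | add s t hs ht => simp only [map_add, hs, ht]

end Boson

end Bosonisation

/-! ### Coactions on the super-bosonisation and its differential -/

section BosonStructure

open WithConv

variable {k : Type u} {A : Type v} [Field k] [Ring A] [HopfAlgebra k A]
variable {V : Type w} [AddCommGroup V] [Module k V] {X : CrossedData k A V}
variable {L : Type x} [Ring L] [Algebra k L] {j : V →ₗ[k] L}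
variable (G : Generated X L j) (hX : X.IsCrossedModule)

namespace Boson

theorem coactLeft_condition (x : L) :
    Conv.const ((Algebra.TensorProduct.includeRight.comp (ofL G hX)) x) *
        toConv (((Algebra.TensorProduct.map (AlgHom.id k A) (ofA G hX)).comp
          (Bialgebra.comulAlgHom k A)).toLinearMap) =
      (toConv (((Algebra.TensorProduct.map (AlgHom.id k A) (ofA G hX)).comp
          (Bialgebra.comulAlgHom k A)).toLinearMap) *
        Conv.post (Algebra.TensorProduct.includeRight.comp (ofL G hX)) (G.β x) :
        Conv k A (A ⊗[k] Boson G hX)) := by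
  refine Conv.ext' fun b => ?_
  rw [Conv.const_mul_apply, LinearMap.convMul_apply]
  set F := (toConv (((Algebra.TensorProduct.map (AlgHom.id k A) (ofA G hX)).comp
    (Bialgebra.comulAlgHom k A)).toLinearMap) : Conv k A (A ⊗[k] Boson G hX)) with hF
  let Φ : A ⊗[k] (A ⊗[k] A) →ₗ[k] A ⊗[k] Boson G hX :=
    (LinearMap.mul' k _ ∘ₗ TensorProduct.map (convA G hX).ofConv
      (Conv.post (ofL G hX) (G.β x)).ofConv).lTensor A
  have h1 : ∀ s : A ⊗[k] A, LinearMap.mul' k _ (TensorProduct.map F.ofConv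
      (Conv.post (Algebra.TensorProduct.includeRight.comp (ofL G hX)) (G.β x)).ofConv s) =
      Φ (TensorProduct.assoc k A A A ((Coalgebra.comul (R := k) (A := A)).rTensor A s)) := by
    intro s
    induction s with
    | zero => simp
    | tmul b c =>
      simp only [TensorProduct.map_tmul, LinearMap.mul'_apply, LinearMap.rTensor_tmul, hF,
        AlgHom.toLinearMap_apply, AlgHom.comp_apply, Bialgebra.comulAlgHom_apply]
      generalize Coalgebra.comul (R := k) b = t
      induction t with
      | zero => simp
      | tmul b b' => simp [Φ]
      | add s t hs ht => simp only [map_add, hs, ht, add_mul, TensorProduct.add_tmul]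
    | add s t hs ht => simp only [map_add, hs, ht]
  have h2 : ∀ c, ofL G hX x * ofA G hX c = LinearMap.mul' k _ (TensorProduct.map
      (convA G hX).ofConv (Conv.post (ofL G hX) (G.β x)).ofConv (Coalgebra.comul (R := k) c)) :=
    fun c => by
      have := congr($(const_mul_convA (G := G) (hX := hX) x) c)
      rwa [Conv.const_mul_apply, LinearMap.convMul_apply] at this
  have h3 : ∀ s : A ⊗[k] A, (Algebra.TensorProduct.includeRight.comp (ofL G hX)) x *
      (Algebra.TensorProduct.map (AlgHom.id k A) (ofA G hX) s) =
      Φ ((Coalgebra.comul (R := k) (A := A)).lTensor A s) := by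
    intro s
    induction s with
    | zero => simp
    | tmul b c => simp [Φ, h2]
    | add s t hs ht => simp only [map_add, hs, ht, mul_add]
  rw [h1, Coalgebra.coassoc_apply]
  exact h3 _

/-- The left coaction of `A` on the bosonisation. -/
def coactLeft : Boson G hX →ₐ[k] A ⊗[k] Boson G hX :=
  lift ((Algebra.TensorProduct.map (AlgHom.id k A) (ofA G hX)).comp (Bialgebra.comulAlgHom k A))
    (Algebra.TensorProduct.includeRight.comp (ofL G hX)) (coactLeft_condition G hX)

@[simp] theorem coactLeft_ofA (a : A) : coactLeft G hX (ofA G hX a) =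
    (ofA G hX).toLinearMap.lTensor A (Coalgebra.comul (R := k) a) := lift_ofA _ _ _ a

@[simp] theorem coactLeft_ofL (x : L) : coactLeft G hX (ofL G hX x) = 1 ⊗ₜ ofL G hX x :=
  lift_ofL _ _ _ x

theorem coactRight_condition (x : L) :
    Conv.const (((Algebra.TensorProduct.map (ofL G hX) (AlgHom.id k A)).comp G.α) x) *
        toConv (((Algebra.TensorProduct.map (ofA G hX) (AlgHom.id k A)).comp
          (Bialgebra.comulAlgHom k A)).toLinearMap) =
      (toConv (((Algebra.TensorProduct.map (ofA G hX) (AlgHom.id k A)).comp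
          (Bialgebra.comulAlgHom k A)).toLinearMap) *
        Conv.post ((Algebra.TensorProduct.map (ofL G hX) (AlgHom.id k A)).comp G.α) (G.β x) :
        Conv k A (Boson G hX ⊗[k] A)) := by
  set m := Algebra.TensorProduct.map (ofL G hX) (AlgHom.id k A) with hm
  set J : Conv k A (Boson G hX ⊗[k] A) :=
    Conv.post Algebra.TensorProduct.includeLeft (convA G hX) with hJ
  have hF : (toConv (((Algebra.TensorProduct.map (ofA G hX) (AlgHom.id k A)).comp
      (Bialgebra.comulAlgHom k A)).toLinearMap) : Conv k A (Boson G hX ⊗[k] A)) =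
      J * Conv.post m (Conv.incl L) := Conv.ext' fun a => by
    rw [LinearMap.convMul_apply]
    simp only [AlgHom.toLinearMap_apply, AlgHom.comp_apply, Bialgebra.comulAlgHom_apply]
    generalize Coalgebra.comul (R := k) a = s
    induction s with
    | zero => simp
    | tmul a b => simp [hJ, hm]
    | add s t hs ht => simp only [map_add, hs, ht]
  have hcomm : ∀ (f : Conv k A (Boson G hX)) (c : A),
      Conv.post Algebra.TensorProduct.includeLeft f * Conv.const ((1 : Boson G hX) ⊗ₜ[k] c) =
      Conv.const ((1 : Boson G hX) ⊗ₜ[k] c) *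
        Conv.post Algebra.TensorProduct.includeLeft f := fun f c => Conv.ext' fun a => by
    rw [Conv.mul_const_apply, Conv.const_mul_apply]
    simp
  have key : ∀ t : L ⊗[k] A, J * Conv.post m (Generated.actLeft G.β t) =
      Conv.const (m t) * J := by
    intro t
    induction t with
    | zero => simp
    | tmul y c =>
      have h1 : Conv.post m (Generated.actLeft G.β (y ⊗ₜ c)) =
          Conv.post Algebra.TensorProduct.includeLeft (Conv.post (ofL G hX) (G.β y)) *
          Conv.const ((1 : Boson G hX) ⊗ₜ[k] c) := Conv.ext' fun a => by
        rw [Conv.mul_const_apply, Conv.post_apply, Generated.actLeft_tmul]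
        simp [hm]
      have h2 : (Conv.const (m (y ⊗ₜ c)) : Conv k A (Boson G hX ⊗[k] A)) =
          Conv.const ((1 : Boson G hX) ⊗ₜ[k] c) *
          Conv.post Algebra.TensorProduct.includeLeft (Conv.const (ofL G hX y)) :=
        Conv.ext' fun a => by
          rw [Conv.const_mul_apply, Conv.post_apply]
          simp [hm, TensorProduct.smul_tmul']
      rw [h1, h2, ← mul_assoc, ← map_mul, ← const_mul_convA, hcomm, map_mul, ← mul_assoc]
    | add s t hs ht => simp only [map_add, hs, ht, mul_add, add_mul]
  have h4 : Conv.post (m.comp G.α) (G.β x) = Conv.post m (Conv.post G.α (G.β x)) := rfl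
  rw [hF, h4, mul_assoc, ← map_mul, G.incl_mul_post_α_β hX, map_mul, ← mul_assoc, ← mul_assoc,
    key]
  rfl

/-- The right coaction of `A` on the bosonisation. -/
def coactRight : Boson G hX →ₐ[k] Boson G hX ⊗[k] A :=
  lift ((Algebra.TensorProduct.map (ofA G hX) (AlgHom.id k A)).comp (Bialgebra.comulAlgHom k A))
    ((Algebra.TensorProduct.map (ofL G hX) (AlgHom.id k A)).comp G.α) (coactRight_condition G hX)

@[simp] theorem coactRight_ofA (a : A) : coactRight G hX (ofA G hX a) =
    (ofA G hX).toLinearMap.rTensor A (Coalgebra.comul (R := k) a) := lift_ofA _ _ _ a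

@[simp] theorem coactRight_ofL (x : L) : coactRight G hX (ofL G hX x) =
    (ofL G hX).toLinearMap.rTensor A (G.α x) :=
  lift_ofL _ _ _ x

/-- The parity automorphism of the bosonisation. -/
def parity : Boson G hX →ₐ[k] Boson G hX :=
  lift (ofA G hX) ((ofL G hX).comp G.P) fun x => by
    have h : Conv.post ((ofL G hX).comp G.P) (G.β x) = Conv.post (ofL G hX) (G.β (G.P x)) :=
      Conv.ext' fun a => by
        rw [Conv.post_apply, Conv.post_apply, G.β_P]; rfl
    rw [h]
    exact const_mul_convA (G.P x)

@[simp] theorem parity_ofA (a : A) : parity G hX (ofA G hX a) = ofA G hX a := lift_ofA _ _ _ a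

@[simp] theorem parity_ofL (x : L) : parity G hX (ofL G hX x) = ofL G hX (G.P x) :=
  lift_ofL _ _ _ x

/-- The degree `n` part of the bosonisation. -/
def deg (n : ℕ) : Submodule k (Boson G hX) :=
  Submodule.map₂ ((LinearMap.mul k (Boson G hX)).compl₁₂ (ofA G hX).toLinearMap
    (ofL G hX).toLinearMap) ⊤ (gradedPart j n)

variable {G hX}

theorem mem_deg (a : A) {n : ℕ} {x : L} (hx : x ∈ gradedPart j n) :
    ofA G hX a * ofL G hX x ∈ deg G hX n :=
  Submodule.apply_mem_map₂ ((LinearMap.mul k (Boson G hX)).compl₁₂ (ofA G hX).toLinearMap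
    (ofL G hX).toLinearMap) (Submodule.mem_top (x := a)) hx

theorem deg_le {n : ℕ} {p : Submodule k (Boson G hX)}
    (h : ∀ a, ∀ x ∈ gradedPart j n, ofA G hX a * ofL G hX x ∈ p) : deg G hX n ≤ p :=
  Submodule.map₂_le.2 fun a _ x hx => h a x hx

theorem parity_of_mem {n : ℕ} {z : Boson G hX} (hz : z ∈ deg G hX n) :
    parity G hX z = (-1 : k) ^ n • z := by
  have h : deg G hX n ≤ LinearMap.ker ((parity G hX).toLinearMap - (-1 : k) ^ n • LinearMap.id) :=
    deg_le fun a x hx => by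
      rw [LinearMap.mem_ker, LinearMap.sub_apply, AlgHom.toLinearMap_apply, map_mul, parity_ofA,
        parity_ofL, G.P_of_mem n x hx, map_smul, mul_smul_comm]
      exact sub_self _
  exact sub_eq_zero.1 (LinearMap.mem_ker.1 (h hz))

theorem ofA_mul_mem (a : A) {n : ℕ} {z : Boson G hX} (hz : z ∈ deg G hX n) :
    ofA G hX a * z ∈ deg G hX n := by
  have h : deg G hX n ≤ (deg G hX n).comap (LinearMap.mulLeft k (ofA G hX a)) :=
    deg_le fun b x hx => by
      rw [Submodule.mem_comap, LinearMap.mulLeft_apply, ← mul_assoc, ← map_mul]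
      exact mem_deg _ hx
  exact h hz

theorem mul_ofL_mem {m n : ℕ} {z : Boson G hX} (hz : z ∈ deg G hX m) {x : L}
    (hx : x ∈ gradedPart j n) : z * ofL G hX x ∈ deg G hX (m + n) := by
  have h : deg G hX m ≤ (deg G hX (m + n)).comap (LinearMap.mulRight k (ofL G hX x)) :=
    deg_le fun b y hy => by
      rw [Submodule.mem_comap, LinearMap.mulRight_apply, mul_assoc, ← map_mul]
      refine mem_deg _ ?_
      rw [gradedPart, pow_add]
      exact Submodule.mul_mem_mul hy hx
  exact h hz

theorem ofL_mul_ofA_mem {n : ℕ} {x : L} (hx : x ∈ gradedPart j n) (a : A) :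
    ofL G hX x * ofA G hX a ∈ deg G hX n := by
  have h1 := congr($(const_mul_convA (G := G) (hX := hX) x) a)
  rw [Conv.const_mul_apply, LinearMap.convMul_apply] at h1
  rw [← convA_apply, h1]
  generalize Coalgebra.comul (R := k) a = s
  induction s with
  | zero => simp
  | tmul b c => exact mem_deg _ (G.β_mem n x hx c)
  | add s t hs ht => rw [map_add, map_add]; exact add_mem hs ht

theorem mul_mem_deg {m n : ℕ} {z w : Boson G hX} (hz : z ∈ deg G hX m) (hw : w ∈ deg G hX n) :
    z * w ∈ deg G hX (m + n) := by
  have h : deg G hX m ≤ (deg G hX (m + n)).comap (LinearMap.mulRight k w) :=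
    deg_le fun a x hx => by
      rw [Submodule.mem_comap, LinearMap.mulRight_apply, mul_assoc]
      refine ofA_mul_mem a ?_
      have h' : deg G hX n ≤ (deg G hX (m + n)).comap (LinearMap.mulLeft k (ofL G hX x)) :=
        deg_le fun b y hy => by
          rw [Submodule.mem_comap, LinearMap.mulLeft_apply, ← mul_assoc]
          exact mul_ofL_mem (ofL_mul_ofA_mem hx b) hy
      exact h' hw
  exact h hz

section Differential

variable {ϖ : Aug k A →ₗ[k] V} {d : L →ₗ[k] L}

variable (G hX ϖ d) in
/-- The differential of the bosonisation. -/
def diff : Boson G hX →ₗ[k] Boson G hX :=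
  (equiv G hX).toLinearMap ∘ₗ (regOp (mcConv ϖ j) + d.lTensor A) ∘ₗ (equiv G hX).symm.toLinearMap

theorem diff_equiv (z : A ⊗[k] L) : diff G hX ϖ d (equiv G hX z) =
    equiv G hX (regOp (mcConv ϖ j) z + d.lTensor A z) := rfl

theorem diff_ofA (hd : Generated.IsExterior (j := j) ϖ d) (a : A) :
    diff G hX ϖ d (ofA G hX a) =
      equiv G hX ((j ∘ₗ mcForm ϖ).lTensor A (Coalgebra.comul (R := k) a)) := by
  rw [ofA_apply, diff_equiv, LinearMap.lTensor_tmul, hd.one, TensorProduct.tmul_zero, add_zero,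
    regOp_tmul]
  congr 1
  generalize Coalgebra.comul (R := k) a = s
  induction s with
  | zero => simp
  | tmul b c => simp
  | add s t hs ht => rw [map_add, map_add, hs, ht]

theorem diff_ofL (x : L) : diff G hX ϖ d (ofL G hX x) = ofL G hX (d x) := by
  rw [ofL_apply, diff_equiv, regOp_tmul, Bialgebra.comul_one, Algebra.TensorProduct.one_def,
    Conv.fill_tmul, mcConv_apply, mcForm_one]
  simp [ofL_apply]

theorem diff_ofA_mul (hϖ : (CrossedData.aug k A).IsMorphism X ϖ)
    (hd : Generated.IsExterior (j := j) ϖ d) (a : A) (w : Boson G hX) :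
    diff G hX ϖ d (ofA G hX a * w) =
      diff G hX ϖ d (ofA G hX a) * w + ofA G hX a * diff G hX ϖ d w := by
  obtain ⟨w, rfl⟩ := (equiv G hX).surjective w
  have h1 : ∀ s : A ⊗[k] A, bosonOp G ((j ∘ₗ mcForm ϖ).lTensor A s) =
      regPushed (mcConv ϖ j) s - lmulA L (TensorProduct.rid k A
        ((Coalgebra.counit (R := k) (A := A)).lTensor A s)) * regOp (mcConv ϖ j) := by
    intro s
    induction s with
    | zero => refine LinearMap.ext fun z => ?_; simp [lmulA]
    | tmul b c =>
      have h := G.β_mcConv (j := j) hϖ c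
      rw [mcConv_apply] at h
      rw [LinearMap.lTensor_tmul, bosonOp_tmul, LinearMap.comp_apply, h, regOp_sub, mul_sub,
        regPushed_tmul, regOp_smul, LinearMap.lTensor_tmul, TensorProduct.rid_tmul, lmulA_smul,
        smul_mul_assoc, mul_smul_comm]
    | add s t hs ht => rw [map_add, map_add, hs, ht, map_add, map_add, map_add, lmulA_add, add_mul,
        add_sub_add_comm]
  rw [diff_ofA hd, equiv_mul_equiv, h1, Coalgebra.lTensor_counit_comul, ← regOp_mul_lmulA,
    ofA_mul_equiv, diff_equiv, diff_equiv, ofA_mul_equiv, ← map_add]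
  congr 1
  have h2 : d.lTensor A (lmulA L a w) = lmulA L a (d.lTensor A w) := by
    induction w with
    | zero => simp
    | tmul b y => simp
    | add s t hs ht => simp only [map_add, hs, ht]
  rw [h2, map_add, LinearMap.sub_apply, Module.End.mul_apply, Module.End.mul_apply,
    TensorProduct.rid_tmul, one_smul]
  abel

theorem lTensor_mul_regOp (hd : Generated.IsExterior (j := j) ϖ d) (f : Conv k A L) :
    (d.lTensor A : Module.End k (A ⊗[k] L)) * regOp f =
      regOp (Generated.IsExterior.dConv d f) + regOp (Conv.post G.P f) * d.lTensor A := by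
  refine TensorProduct.ext' fun b y => ?_
  simp only [Module.End.mul_apply, LinearMap.add_apply, regOp_tmul, LinearMap.lTensor_tmul]
  generalize Coalgebra.comul (R := k) b = s
  induction s with
  | zero => simp
  | tmul b c => simp [hd.leibniz G, TensorProduct.tmul_add]
  | add s t hs ht => simp only [map_add, hs, ht]; abel

theorem diff_ofL_mul (hϖ : (CrossedData.aug k A).IsMorphism X ϖ)
    (hsurj : Function.Surjective ϖ) (hd : Generated.IsExterior (j := j) ϖ d) (x : L)
    (w : Boson G hX) :
    diff G hX ϖ d (ofL G hX x * w) =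
      ofL G hX (d x) * w + ofL G hX (G.P x) * diff G hX ϖ d w := by
  obtain ⟨w, rfl⟩ := (equiv G hX).surjective w
  have hP : Conv.post G.P (G.β x) = G.β (G.P x) :=
    Conv.ext' fun a => by rw [Conv.post_apply, G.β_P]
  have h1 := congr(regOp $(sub_eq_sub_iff_add_eq_add.1 (hd.d_act G hϖ hsurj x)))
  have h2 := lTensor_mul_regOp (G := G) hd (G.β x)
  rw [hP] at h2
  rw [regOp_add, regOp_add, regOp_mul, regOp_mul] at h1
  rw [ofL_mul_equiv, diff_equiv, diff_equiv, ofL_mul_equiv, ofL_mul_equiv, ← map_add]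
  congr 1
  have h1' := LinearMap.congr_fun h1 w
  have h2' := LinearMap.congr_fun h2 w
  simp only [LinearMap.add_apply, Module.End.mul_apply] at h1' h2'
  rw [h2', map_add, ← add_assoc, ← h1', add_assoc]

theorem diff_mul (hϖ : (CrossedData.aug k A).IsMorphism X ϖ)
    (hsurj : Function.Surjective ϖ) (hd : Generated.IsExterior (j := j) ϖ d) (z w : Boson G hX) :
    diff G hX ϖ d (z * w) = diff G hX ϖ d z * w + parity G hX z * diff G hX ϖ d w := by
  obtain ⟨z, rfl⟩ := (equiv G hX).surjective z
  induction z with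
  | zero => simp
  | tmul a x =>
    rw [← ofA_mul_ofL, mul_assoc, diff_ofA_mul hϖ hd, diff_ofA_mul hϖ hd, diff_ofL_mul hϖ hsurj hd,
      diff_ofL, map_mul, parity_ofA, parity_ofL, add_mul, mul_add, mul_assoc, mul_assoc, mul_assoc,
      add_assoc]
  | add s t hs ht => simp only [map_add, add_mul, hs, ht]; abel

theorem diff_diff (hsurj : Function.Surjective ϖ) (hd : Generated.IsExterior (j := j) ϖ d)
    (z : Boson G hX) : diff G hX ϖ d (diff G hX ϖ d z) = 0 := by
  obtain ⟨z, rfl⟩ := (equiv G hX).surjective z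
  rw [diff_equiv, diff_equiv]
  have hP : Conv.post G.P (mcConv ϖ j) = -mcConv ϖ j := Conv.ext' fun a => by
    rw [Conv.post_apply, mcConv_apply, G.P_gen]; rfl
  have h2 := LinearMap.congr_fun (lTensor_mul_regOp (G := G) hd (mcConv ϖ j)) z
  have h3 := LinearMap.congr_fun (regOp_mul (mcConv ϖ j) (mcConv ϖ j)) z
  have h4 : d.lTensor A (d.lTensor A z) = 0 := by
    clear h2 h3
    induction z with
    | zero => simp
    | tmul a x => simp [hd.d_d G hsurj]
    | add s t hs ht => simp only [map_add, hs, ht, add_zero]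
  rw [hd.dConv_mcConv, hP, regOp_neg, regOp_neg] at h2
  simp only [LinearMap.add_apply, Module.End.mul_apply, LinearMap.neg_apply] at h2 h3
  rw [map_add (regOp (mcConv ϖ j)), map_add (d.lTensor A), h2, h4, h3, ← map_zero (equiv G hX)]
  congr 1
  abel

theorem diff_mem_deg (hsurj : Function.Surjective ϖ) (hd : Generated.IsExterior (j := j) ϖ d)
    (hϖ : (CrossedData.aug k A).IsMorphism X ϖ) {n : ℕ}
    {z : Boson G hX} (hz : z ∈ deg G hX n) : diff G hX ϖ d z ∈ deg G hX (n + 1) := by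
  have h : deg G hX n ≤ (deg G hX (n + 1)).comap (diff G hX ϖ d) := deg_le fun a x hx => by
    rw [Submodule.mem_comap, diff_ofA_mul hϖ hd, diff_ofL]
    refine add_mem ?_ (mem_deg a (hd.degree hsurj n x hx))
    rw [diff_ofA hd]
    generalize Coalgebra.comul (R := k) a = s
    induction s with
    | zero => simp
    | tmul b c =>
      rw [LinearMap.lTensor_tmul, ← ofA_mul_ofL, mul_assoc, ← map_mul]
      refine mem_deg b ?_
      rw [gradedPart, pow_succ']
      exact Submodule.mul_mem_mul ⟨_, rfl⟩ hx
    | add s t hs ht => rw [map_add, map_add, add_mul]; exact add_mem hs ht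
  exact h hz

end Differential

end Boson

namespace Generated

variable {G} {Δ : L →ₗ[k] L ⊗[k] L} (S d : L →ₗ[k] L)

theorem bosonMul_eq (z w : A ⊗[k] L) : (G.data Δ S d).bosonMul (z ⊗ₜ w) = bosonOp G z w := by
  induction z with
  | zero => simp
  | tmul a x =>
    induction w with
    | zero => simp
    | tmul b y =>
      rw [bosonOp_tmul, Module.End.mul_apply, regOp_tmul]
      simp only [SuperBraidedData.bosonMul, LinearMap.comp_apply, LinearMap.lTensor_tmul,
        LinearMap.rTensor_tmul]
      generalize Coalgebra.comul (R := k) b = s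
      induction s with
      | zero => simp
      | tmul b c => simp [data]
      | add s t hs ht => simp only [map_add, hs, ht, TensorProduct.add_tmul, TensorProduct.tmul_add]
    | add s t hs ht => simp only [map_add, hs, ht, TensorProduct.tmul_add]
  | add s t hs ht => simp only [map_add, hs, ht, TensorProduct.add_tmul, LinearMap.add_apply]

theorem bosonD_eq (ϖ : Aug k A →ₗ[k] V) (z : A ⊗[k] L) :
    (G.data Δ S d).bosonD ϖ j z = regOp (mcConv ϖ j) z + d.lTensor A z := rfl

theorem IsCoproduct.bosonCoactLeft_eq {G : Generated X L j} (hX : X.IsCrossedModule)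
    (h : G.IsCoproduct Δ) (S d : L →ₗ[k] L) (z : A ⊗[k] L) :
    Boson.coactLeft G hX (Boson.equiv G hX z) =
      (Boson.equiv G hX).toLinearMap.lTensor A ((G.data Δ S d).bosonCoactLeft z) := by
  induction z with
  | zero => simp
  | tmul a x =>
    let Φ : (A ⊗[k] A) →ₗ[k] L →ₗ[k] A ⊗[k] (A ⊗[k] L) :=
      TensorProduct.curry (TensorProduct.assoc k A A L).toLinearMap
    have h1 : ∀ (π : A ⊗[k] L →ₗ[k] A) (_ : ∀ a y, π (a ⊗ₜ y) = G.ε y • a) (s : A ⊗[k] A)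
        (Z : L ⊗[k] L), π.rTensor (A ⊗[k] L) (((LinearMap.mul' k A).rTensor L ∘ₗ
          (TensorProduct.assoc k A A L).symm.toLinearMap).lTensor (A ⊗[k] L)
          (TensorProduct.tensorTensorTensorComm k A A L (A ⊗[k] L) (s ⊗ₜ
            TensorProduct.assoc k L A L (G.α.toLinearMap.rTensor L Z)))) =
        Φ s (TensorProduct.lid k L (G.ε.toLinearMap.rTensor L Z)) := by
      intro π hπ s Z
      induction Z with
      | zero => simp
      | tmul y z =>
        have h2 : ∀ t : L ⊗[k] A,
            π.rTensor (A ⊗[k] L) (((LinearMap.mul' k A).rTensor L ∘ₗ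
              (TensorProduct.assoc k A A L).symm.toLinearMap).lTensor (A ⊗[k] L)
              (TensorProduct.tensorTensorTensorComm k A A L (A ⊗[k] L) (s ⊗ₜ
                TensorProduct.assoc k L A L (t ⊗ₜ z)))) =
            (TensorProduct.assoc k A A L) ((LinearMap.mulRight k (TensorProduct.lid k A
              (G.ε.toLinearMap.rTensor A t))).lTensor A s ⊗ₜ z) := by
          intro t
          induction t with
          | zero => simp
          | tmul y c =>
            induction s with
            | zero => simp
            | tmul a b =>
              simp only [TensorProduct.assoc_tmul, TensorProduct.tensorTensorTensorComm_tmul,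
                LinearMap.lTensor_tmul, LinearMap.rTensor_tmul, LinearMap.comp_apply,
                LinearEquiv.coe_coe, TensorProduct.assoc_symm_tmul, LinearMap.mul'_apply, hπ,
                TensorProduct.lid_tmul, LinearMap.mulRight_apply, AlgHom.toLinearMap_apply,
                mul_smul_comm, TensorProduct.smul_tmul]
              rw [TensorProduct.tmul_smul, TensorProduct.tmul_smul, TensorProduct.tmul_smul]
            | add s t hs ht => simp only [map_add, hs, ht, TensorProduct.add_tmul]
          | add t t' hs ht =>
            have h3 : ∀ a b : A, (LinearMap.mulRight k (a + b)).lTensor A s =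
              (LinearMap.mulRight k a).lTensor A s + (LinearMap.mulRight k b).lTensor A s := by
              intro a b
              rw [← LinearMap.add_apply, ← LinearMap.lTensor_add]
              congr 2
              ext; simp [mul_add]
            simp only [map_add, hs, ht, TensorProduct.add_tmul, TensorProduct.tmul_add, h3]
        rw [LinearMap.rTensor_tmul, AlgHom.toLinearMap_apply, h2, G.ε_α]
        clear h2
        induction s with
        | zero => simp
        | tmul a b => simp [Φ, ← TensorProduct.smul_tmul']
        | add s t hs ht =>
          simp only [map_add, hs, ht, TensorProduct.add_tmul, LinearMap.add_apply]
      | add Z Z' hs ht => simp only [map_add, hs, ht, TensorProduct.tmul_add]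
    have h4 : (G.data Δ S d).bosonCoactLeft (a ⊗ₜ x) = Φ (Coalgebra.comul (R := k) a) x := by
      refine (h1 _ (fun a y => by simp [data, SuperBraidedData.bosonProj])
        (Coalgebra.comul (R := k) a) (Δ x)).trans ?_
      rw [h.counit_left hX]
      simp
    rw [h4, ← Boson.ofA_mul_ofL, map_mul, Boson.coactLeft_ofA, Boson.coactLeft_ofL]
    generalize Coalgebra.comul (R := k) a = s
    induction s with
    | zero => simp
    | tmul a b => simp [Φ, Boson.ofA_mul_ofL]
    | add s t hs ht => simp only [map_add, hs, ht, add_mul, LinearMap.add_apply]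
  | add s t hs ht => simp only [map_add, hs, ht]

theorem IsCoproduct.bosonCoactRight_eq {G : Generated X L j} (hX : X.IsCrossedModule)
    (h : G.IsCoproduct Δ) (S d : L →ₗ[k] L) (z : A ⊗[k] L) :
    Boson.coactRight G hX (Boson.equiv G hX z) =
      (Boson.equiv G hX).toLinearMap.rTensor A ((G.data Δ S d).bosonCoactRight z) := by
  induction z with
  | zero => simp
  | tmul a x =>
    let Φ : (A ⊗[k] A) ⊗[k] (L ⊗[k] A) →ₗ[k] (A ⊗[k] L) ⊗[k] A :=
      (LinearMap.mul' k A).lTensor (A ⊗[k] L) ∘ₗ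
        (TensorProduct.tensorTensorTensorComm k A A L A).toLinearMap
    have h1 : ∀ (π : A ⊗[k] L →ₗ[k] A) (_ : ∀ a y, π (a ⊗ₜ y) = G.ε y • a) (s : A ⊗[k] A)
        (Z : L ⊗[k] L), π.lTensor (A ⊗[k] L) (((LinearMap.mul' k A).rTensor L ∘ₗ
          (TensorProduct.assoc k A A L).symm.toLinearMap).lTensor (A ⊗[k] L)
          (TensorProduct.tensorTensorTensorComm k A A L (A ⊗[k] L) (s ⊗ₜ
            TensorProduct.assoc k L A L (G.α.toLinearMap.rTensor L Z)))) =
        Φ (s ⊗ₜ G.α (TensorProduct.rid k L (G.ε.toLinearMap.lTensor L Z))) := by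
      intro π hπ s Z
      induction Z with
      | zero => simp
      | tmul y z =>
        simp only [LinearMap.rTensor_tmul, LinearMap.lTensor_tmul, AlgHom.toLinearMap_apply,
          TensorProduct.rid_tmul, map_smul]
        generalize G.α y = t
        induction t with
        | zero => simp
        | tmul y c =>
          induction s with
          | zero => simp
          | tmul a b =>
            simp only [Φ, TensorProduct.assoc_tmul, TensorProduct.tensorTensorTensorComm_tmul,
              LinearMap.lTensor_tmul, LinearMap.rTensor_tmul, LinearMap.comp_apply,
              LinearEquiv.coe_coe, TensorProduct.assoc_symm_tmul, LinearMap.mul'_apply, hπ,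
              TensorProduct.tmul_smul, map_smul]
          | add s t hs ht => simp only [map_add, hs, ht, TensorProduct.add_tmul]
        | add s t hs ht =>
          simp only [map_add, hs, ht, TensorProduct.add_tmul, TensorProduct.tmul_add, smul_add]
      | add Z Z' hs ht => simp only [map_add, hs, ht, TensorProduct.tmul_add]
    have h4 : (G.data Δ S d).bosonCoactRight (a ⊗ₜ x) =
        Φ (Coalgebra.comul (R := k) a ⊗ₜ G.α x) := by
      refine (h1 _ (fun a y => by simp [data, SuperBraidedData.bosonProj])
        (Coalgebra.comul (R := k) a) (Δ x)).trans ?_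
      rw [h.counit_right]
      simp
    rw [h4, ← Boson.ofA_mul_ofL, map_mul, Boson.coactRight_ofA, Boson.coactRight_ofL]
    generalize Coalgebra.comul (R := k) a = s
    generalize G.α x = t
    induction s with
    | zero => simp
    | tmul a b =>
      induction t with
      | zero => simp
      | tmul y c => simp [Φ, Boson.ofA_mul_ofL]
      | add s t hs ht => simp only [map_add, hs, ht, mul_add, TensorProduct.tmul_add]
    | add s t hs ht => simp only [map_add, hs, ht, add_mul, TensorProduct.add_tmul]
  | add s t hs ht => simp only [map_add, hs, ht]

end Generated

end BosonStructure

/-! ### Bicovariant calculi inside algebras with coactions -/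

section Embedding

variable {k : Type u} {A : Type v} [Field k] [Ring A] [HopfAlgebra k A]
variable {Γ : Type w} [AddCommGroup Γ] [Module k Γ] {B : Type x} [Ring B] [Algebra k B]

/-- The structure maps of a calculus on `Γ` are those of an algebra `B` with coactions of `A`
which contains `A` and `Γ`. -/
structure CalculusData.IsEmbedding (C : CalculusData k A Γ) (oA : A →ₐ[k] B) (i : Γ →ₗ[k] B)
    (cL : B →ₐ[k] A ⊗[k] B) (cR : B →ₐ[k] B ⊗[k] A) : Prop where
  injective : Function.Injective i
  lact : ∀ a γ, i (C.lact (a ⊗ₜ γ)) = oA a * i γ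
  ract : ∀ γ a, i (C.ract (γ ⊗ₜ a)) = i γ * oA a
  coL : ∀ γ, i.lTensor A (C.coL γ) = cL (i γ)
  coR : ∀ γ, i.rTensor A (C.coR γ) = cR (i γ)
  cL_oA : ∀ a, cL (oA a) = oA.toLinearMap.lTensor A (Coalgebra.comul (R := k) a)
  cR_oA : ∀ a, cR (oA a) = oA.toLinearMap.rTensor A (Coalgebra.comul (R := k) a)
  cL_coassoc : ∀ b, TensorProduct.assoc k A A B
    ((Coalgebra.comul (R := k) (A := A)).rTensor B (cL b)) = cL.toLinearMap.lTensor A (cL b)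
  cL_counit : ∀ b, (Coalgebra.counit (R := k) (A := A)).rTensor B (cL b) = 1 ⊗ₜ b
  cR_coassoc : ∀ b, TensorProduct.assoc k B A A (cR.toLinearMap.rTensor A (cR b)) =
    (Coalgebra.comul (R := k) (A := A)).lTensor B (cR b)
  cR_counit : ∀ b, (Coalgebra.counit (R := k) (A := A)).lTensor B (cR b) = b ⊗ₜ 1
  cL_cR : ∀ b, TensorProduct.assoc k A B A (cL.toLinearMap.rTensor A (cR b)) =
    cR.toLinearMap.lTensor A (cL b)
  leibniz : ∀ a b, i (C.d (a * b)) = i (C.d a) * oA b + oA a * i (C.d b)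
  span : LinearMap.range (C.lact ∘ₗ C.d.lTensor A) = ⊤
  cL_d : ∀ a, cL (i (C.d a)) = (i ∘ₗ C.d).lTensor A (Coalgebra.comul (R := k) a)
  cR_d : ∀ a, cR (i (C.d a)) = (i ∘ₗ C.d).rTensor A (Coalgebra.comul (R := k) a)

namespace CalculusData.IsEmbedding

variable {C : CalculusData k A Γ} {oA : A →ₐ[k] B} {i : Γ →ₗ[k] B}
    {cL : B →ₐ[k] A ⊗[k] B} {cR : B →ₐ[k] B ⊗[k] A}

theorem lTensor_injective (h : C.IsEmbedding oA i cL cR) (M : Type*) [AddCommGroup M]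
    [Module k M] : Function.Injective (i.lTensor M) :=
  Module.Flat.lTensor_preserves_injective_linearMap i h.injective

theorem rTensor_injective (h : C.IsEmbedding oA i cL cR) (M : Type*) [AddCommGroup M]
    [Module k M] : Function.Injective (i.rTensor M) :=
  Module.Flat.rTensor_preserves_injective_linearMap i h.injective

theorem coL_coassoc (h : C.IsEmbedding oA i cL cR) (γ : Γ) : TensorProduct.assoc k A A Γ
    ((Coalgebra.comul (R := k) (A := A)).rTensor Γ (C.coL γ)) = C.coL.lTensor A (C.coL γ) := by
  apply Module.Flat.lTensor_preserves_injective_linearMap (M := A) _ (h.lTensor_injective A)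
  have h1 : ∀ t : A ⊗[k] Γ, (i.lTensor A).lTensor A (TensorProduct.assoc k A A Γ
      ((Coalgebra.comul (R := k) (A := A)).rTensor Γ t)) = TensorProduct.assoc k A A B
      ((Coalgebra.comul (R := k) (A := A)).rTensor B (i.lTensor A t)) := by
    intro t
    induction t with
    | zero => simp
    | tmul a γ =>
      simp only [LinearMap.rTensor_tmul, LinearMap.lTensor_tmul]
      generalize Coalgebra.comul (R := k) a = s
      induction s with
      | zero => simp
      | tmul a b => simp
      | add s t hs ht => simp only [map_add, hs, ht, TensorProduct.add_tmul]
    | add s t hs ht => simp only [map_add, hs, ht]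
  have h2 : ∀ t : A ⊗[k] Γ, (i.lTensor A).lTensor A (C.coL.lTensor A t) =
      cL.toLinearMap.lTensor A (i.lTensor A t) := by
    intro t
    rw [← LinearMap.lTensor_comp_apply, ← LinearMap.lTensor_comp_apply]
    congr 2
    exact LinearMap.ext h.coL
  rw [h1, h2, h.coL, h.cL_coassoc]

theorem coL_counit (h : C.IsEmbedding oA i cL cR) (γ : Γ) :
    (Coalgebra.counit (R := k) (A := A)).rTensor Γ (C.coL γ) = 1 ⊗ₜ γ := by
  apply h.lTensor_injective k
  rw [← LinearMap.comp_apply, LinearMap.lTensor_comp_rTensor, ← LinearMap.rTensor_comp_lTensor,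
    LinearMap.comp_apply, h.coL, h.cL_counit, LinearMap.lTensor_tmul]

theorem coR_counit (h : C.IsEmbedding oA i cL cR) (γ : Γ) :
    (Coalgebra.counit (R := k) (A := A)).lTensor Γ (C.coR γ) = γ ⊗ₜ 1 := by
  apply h.rTensor_injective k
  rw [← LinearMap.comp_apply, LinearMap.rTensor_comp_lTensor, ← LinearMap.lTensor_comp_rTensor,
    LinearMap.comp_apply, h.coR, h.cR_counit, LinearMap.rTensor_tmul]

theorem coR_coassoc (h : C.IsEmbedding oA i cL cR) (γ : Γ) :
    TensorProduct.assoc k Γ A A (C.coR.rTensor A (C.coR γ)) =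
      (Coalgebra.comul (R := k) (A := A)).lTensor Γ (C.coR γ) := by
  apply h.rTensor_injective (A ⊗[k] A)
  have h1 : ∀ t : (Γ ⊗[k] A) ⊗[k] A, i.rTensor (A ⊗[k] A) (TensorProduct.assoc k Γ A A t) =
      TensorProduct.assoc k B A A ((i.rTensor A).rTensor A t) := by
    have : i.rTensor (A ⊗[k] A) ∘ₗ (TensorProduct.assoc k Γ A A).toLinearMap =
        (TensorProduct.assoc k B A A).toLinearMap ∘ₗ (i.rTensor A).rTensor A := by
      ext; simp
    exact fun t => LinearMap.congr_fun this t
  have h2 : ∀ t : Γ ⊗[k] A, (i.rTensor A).rTensor A (C.coR.rTensor A t) =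
      cR.toLinearMap.rTensor A (i.rTensor A t) := by
    intro t
    rw [← LinearMap.rTensor_comp_apply, ← LinearMap.rTensor_comp_apply]
    congr 2
    exact LinearMap.ext h.coR
  rw [h1, h2, h.coR, h.cR_coassoc, ← h.coR]
  exact LinearMap.congr_fun ((LinearMap.lTensor_comp_rTensor ..).trans
    (LinearMap.rTensor_comp_lTensor ..).symm) (C.coR γ)

theorem coL_coR (h : C.IsEmbedding oA i cL cR) (γ : Γ) :
    TensorProduct.assoc k A Γ A (C.coL.rTensor A (C.coR γ)) = C.coR.lTensor A (C.coL γ) := by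
  apply Module.Flat.lTensor_preserves_injective_linearMap (M := A) _ (h.rTensor_injective A)
  have h1 : ∀ t : (A ⊗[k] Γ) ⊗[k] A, (i.rTensor A).lTensor A (TensorProduct.assoc k A Γ A t) =
      TensorProduct.assoc k A B A ((i.lTensor A).rTensor A t) := by
    have : (i.rTensor A).lTensor A ∘ₗ (TensorProduct.assoc k A Γ A).toLinearMap =
        (TensorProduct.assoc k A B A).toLinearMap ∘ₗ (i.lTensor A).rTensor A := by
      ext; simp
    exact fun t => LinearMap.congr_fun this t
  have h2 : ∀ t : Γ ⊗[k] A, (i.lTensor A).rTensor A (C.coL.rTensor A t) =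
      cL.toLinearMap.rTensor A (i.rTensor A t) := by
    intro t
    rw [← LinearMap.rTensor_comp_apply, ← LinearMap.rTensor_comp_apply]
    congr 2
    exact LinearMap.ext h.coL
  have h3 : ∀ t : A ⊗[k] Γ, (i.rTensor A).lTensor A (C.coR.lTensor A t) =
      cR.toLinearMap.lTensor A (i.lTensor A t) := by
    intro t
    rw [← LinearMap.lTensor_comp_apply, ← LinearMap.lTensor_comp_apply]
    congr 2
    exact LinearMap.ext h.coR
  rw [h1, h2, h3, h.coR, h.coL, h.cL_cR]

theorem coL_lact (h : C.IsEmbedding oA i cL cR) (a : A) (γ : Γ) : C.coL (C.lact (a ⊗ₜ γ)) =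
    TensorProduct.map (LinearMap.mul' k A) C.lact
      (TensorProduct.tensorTensorTensorComm k A A A Γ (Coalgebra.comul (R := k) a ⊗ₜ C.coL γ)) := by
  apply h.lTensor_injective A
  rw [h.coL, h.lact, map_mul, h.cL_oA, ← h.coL]
  generalize Coalgebra.comul (R := k) a = s
  generalize C.coL γ = t
  induction s with
  | zero => simp
  | tmul a b =>
    induction t with
    | zero => simp
    | tmul c γ => simp [h.lact]
    | add s t hs ht => simp only [map_add, hs, ht, mul_add, TensorProduct.tmul_add]
  | add s t hs ht => simp only [map_add, hs, ht, add_mul, TensorProduct.add_tmul]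

theorem coL_ract (h : C.IsEmbedding oA i cL cR) (γ : Γ) (a : A) : C.coL (C.ract (γ ⊗ₜ a)) =
    TensorProduct.map (LinearMap.mul' k A) C.ract
      (TensorProduct.tensorTensorTensorComm k A Γ A A (C.coL γ ⊗ₜ Coalgebra.comul (R := k) a)) := by
  apply h.lTensor_injective A
  rw [h.coL, h.ract, map_mul, h.cL_oA, ← h.coL]
  generalize Coalgebra.comul (R := k) a = s
  generalize C.coL γ = t
  induction s with
  | zero => simp
  | tmul a b =>
    induction t with
    | zero => simp
    | tmul c γ => simp [h.ract]
    | add s t hs ht => simp only [map_add, hs, ht, add_mul, TensorProduct.add_tmul]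
  | add s t hs ht => simp only [map_add, hs, ht, mul_add, TensorProduct.tmul_add]

theorem coR_lact (h : C.IsEmbedding oA i cL cR) (a : A) (γ : Γ) : C.coR (C.lact (a ⊗ₜ γ)) =
    TensorProduct.map C.lact (LinearMap.mul' k A)
      (TensorProduct.tensorTensorTensorComm k A A Γ A (Coalgebra.comul (R := k) a ⊗ₜ C.coR γ)) := by
  apply h.rTensor_injective A
  rw [h.coR, h.lact, map_mul, h.cR_oA, ← h.coR]
  generalize Coalgebra.comul (R := k) a = s
  generalize C.coR γ = t
  induction s with
  | zero => simp
  | tmul a b =>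
    induction t with
    | zero => simp
    | tmul γ c => simp [h.lact]
    | add s t hs ht => simp only [map_add, hs, ht, mul_add, TensorProduct.tmul_add]
  | add s t hs ht => simp only [map_add, hs, ht, add_mul, TensorProduct.add_tmul]

theorem coR_ract (h : C.IsEmbedding oA i cL cR) (γ : Γ) (a : A) : C.coR (C.ract (γ ⊗ₜ a)) =
    TensorProduct.map C.ract (LinearMap.mul' k A)
      (TensorProduct.tensorTensorTensorComm k Γ A A A (C.coR γ ⊗ₜ Coalgebra.comul (R := k) a)) := by
  apply h.rTensor_injective A
  rw [h.coR, h.ract, map_mul, h.cR_oA, ← h.coR]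
  generalize Coalgebra.comul (R := k) a = s
  generalize C.coR γ = t
  induction s with
  | zero => simp
  | tmul a b =>
    induction t with
    | zero => simp
    | tmul γ c => simp [h.ract]
    | add s t hs ht => simp only [map_add, hs, ht, add_mul, TensorProduct.add_tmul]
  | add s t hs ht => simp only [map_add, hs, ht, mul_add, TensorProduct.tmul_add]

theorem isBicovariant (h : C.IsEmbedding oA i cL cR) : C.IsBicovariant where
  one_lact γ := h.injective (by rw [h.lact, map_one, one_mul])
  mul_lact a b γ := h.injective (by rw [h.lact, h.lact, h.lact, map_mul, mul_assoc])
  ract_one γ := h.injective (by rw [h.ract, map_one, mul_one])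
  ract_mul γ a b := h.injective (by rw [h.ract, h.ract, h.ract, map_mul, mul_assoc])
  lact_ract a γ b := h.injective (by rw [h.ract, h.lact, h.lact, h.ract, mul_assoc])
  leibniz a b := h.injective (by rw [h.leibniz, map_add, h.ract, h.lact])
  span := h.span
  coL_coassoc := h.coL_coassoc
  coL_counit := h.coL_counit
  coR_coassoc := h.coR_coassoc
  coR_counit := h.coR_counit
  coL_coR := h.coL_coR
  coL_lact := h.coL_lact
  coL_ract := h.coL_ract
  coR_lact := h.coR_lact
  coR_ract := h.coR_ract
  coL_d a := h.lTensor_injective A (by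
    rw [h.coL, h.cL_d, LinearMap.lTensor_comp_apply])
  coR_d a := h.rTensor_injective A (by
    rw [h.coR, h.cR_d, LinearMap.rTensor_comp_apply])

end CalculusData.IsEmbedding

end Embedding

/-! ### The bicovariant calculus inside the super-bosonisation -/

section BosonCoactions

open WithConv

variable {k : Type u} {A : Type v} [Field k] [Ring A] [HopfAlgebra k A]
variable {V : Type w} [AddCommGroup V] [Module k V] {X : CrossedData k A V}
variable {L : Type x} [Ring L] [Algebra k L] {j : V →ₗ[k] L}
variable {G : Generated X L j} {hX : X.IsCrossedModule}

namespace Boson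

theorem coactLeft_coassoc (z : Boson G hX) : TensorProduct.assoc k A A _
    ((Coalgebra.comul (R := k) (A := A)).rTensor _ (coactLeft G hX z)) =
      (coactLeft G hX).toLinearMap.lTensor A (coactLeft G hX z) := by
  have h : ((Algebra.TensorProduct.assoc k k k A A (Boson G hX)).toAlgHom.comp
      (Algebra.TensorProduct.map (Bialgebra.comulAlgHom k A) (AlgHom.id k _))).comp
        (coactLeft G hX) =
      (Algebra.TensorProduct.map (AlgHom.id k A) (coactLeft G hX)).comp (coactLeft G hX) := by
    refine algHom_ext (fun a => ?_) fun v => ?_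
    · simp only [AlgHom.comp_apply, coactLeft_ofA]
      have h1 : ∀ s : A ⊗[k] A, (Algebra.TensorProduct.assoc k k k A A (Boson G hX)).toAlgHom
          (Algebra.TensorProduct.map (Bialgebra.comulAlgHom k A) (AlgHom.id k _)
            ((ofA G hX).toLinearMap.lTensor A s)) =
          ((ofA G hX).toLinearMap.lTensor A).lTensor A (TensorProduct.assoc k A A A
            ((Coalgebra.comul (R := k) (A := A)).rTensor A s)) := by
        intro s
        induction s with
        | zero => simp
        | tmul a b =>
          simp only [LinearMap.lTensor_tmul, LinearMap.rTensor_tmul, Algebra.TensorProduct.map_tmul,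
            Bialgebra.comulAlgHom_apply]
          generalize Coalgebra.comul (R := k) a = t
          induction t with
          | zero => simp
          | tmul a b => simp
          | add s t hs ht => simp only [map_add, hs, ht, TensorProduct.add_tmul]
        | add s t hs ht => simp only [map_add, hs, ht]
      have h2 : ∀ s : A ⊗[k] A, Algebra.TensorProduct.map (AlgHom.id k A) (coactLeft G hX)
          ((ofA G hX).toLinearMap.lTensor A s) =
          ((ofA G hX).toLinearMap.lTensor A).lTensor A
            ((Coalgebra.comul (R := k) (A := A)).lTensor A s) := by
        intro s
        induction s with
        | zero => simp
        | tmul a b => simp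
        | add s t hs ht => simp only [map_add, hs, ht]
      rw [h1, h2, Coalgebra.coassoc_apply]
    · simp [Algebra.TensorProduct.one_def]
  exact AlgHom.congr_fun h z

theorem coactLeft_counit (z : Boson G hX) :
    (Coalgebra.counit (R := k) (A := A)).rTensor _ (coactLeft G hX z) = 1 ⊗ₜ z := by
  have h : (Algebra.TensorProduct.map (Bialgebra.counitAlgHom k A) (AlgHom.id k _)).comp
      (coactLeft G hX) = Algebra.TensorProduct.includeRight := by
    refine algHom_ext (fun a => ?_) fun v => ?_
    · simp only [AlgHom.comp_apply, coactLeft_ofA]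
      have h1 : ∀ s : A ⊗[k] A, Algebra.TensorProduct.map (Bialgebra.counitAlgHom k A)
          (AlgHom.id k _) ((ofA G hX).toLinearMap.lTensor A s) =
          (ofA G hX).toLinearMap.lTensor k
            ((Coalgebra.counit (R := k) (A := A)).rTensor A s) := by
        intro s
        induction s with
        | zero => simp
        | tmul a b => simp
        | add s t hs ht => simp only [map_add, hs, ht]
      rw [h1, Coalgebra.rTensor_counit_comul]
      simp
    · simp
  exact AlgHom.congr_fun h z

theorem coactRight_coassoc (z : Boson G hX) : TensorProduct.assoc k _ A A
    ((coactRight G hX).toLinearMap.rTensor A (coactRight G hX z)) =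
      (Coalgebra.comul (R := k) (A := A)).lTensor _ (coactRight G hX z) := by
  have h : ((Algebra.TensorProduct.assoc k k k (Boson G hX) A A).toAlgHom.comp
      (Algebra.TensorProduct.map (coactRight G hX) (AlgHom.id k _))).comp (coactRight G hX) =
      (Algebra.TensorProduct.map (AlgHom.id k _) (Bialgebra.comulAlgHom k A)).comp
        (coactRight G hX) := by
    refine algHom_ext (fun a => ?_) fun v => ?_
    · simp only [AlgHom.comp_apply, coactRight_ofA]
      have h1 : ∀ s : A ⊗[k] A, (Algebra.TensorProduct.assoc k k k (Boson G hX) A A).toAlgHom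
          (Algebra.TensorProduct.map (coactRight G hX) (AlgHom.id k _)
            ((ofA G hX).toLinearMap.rTensor A s)) =
          (ofA G hX).toLinearMap.rTensor (A ⊗[k] A) (TensorProduct.assoc k A A A
            ((Coalgebra.comul (R := k) (A := A)).rTensor A s)) := by
        intro s
        induction s with
        | zero => simp
        | tmul a b =>
          simp only [LinearMap.rTensor_tmul, Algebra.TensorProduct.map_tmul,
            AlgHom.toLinearMap_apply, coactRight_ofA]
          generalize Coalgebra.comul (R := k) a = t
          induction t with
          | zero => simp
          | tmul a b => simp
          | add s t hs ht => simp only [map_add, hs, ht, TensorProduct.add_tmul]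
        | add s t hs ht => simp only [map_add, hs, ht]
      have h2 : ∀ s : A ⊗[k] A, Algebra.TensorProduct.map (AlgHom.id k _)
          (Bialgebra.comulAlgHom k A) ((ofA G hX).toLinearMap.rTensor A s) =
          (ofA G hX).toLinearMap.rTensor (A ⊗[k] A)
            ((Coalgebra.comul (R := k) (A := A)).lTensor A s) := by
        intro s
        induction s with
        | zero => simp
        | tmul a b => simp
        | add s t hs ht => simp only [map_add, hs, ht]
      rw [h1, h2, Coalgebra.coassoc_apply]
    · simp only [AlgHom.comp_apply, coactRight_ofL]
      have h1 : ∀ s : L ⊗[k] A, (Algebra.TensorProduct.assoc k k k (Boson G hX) A A).toAlgHom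
          (Algebra.TensorProduct.map (coactRight G hX) (AlgHom.id k _)
            ((ofL G hX).toLinearMap.rTensor A s)) =
          (ofL G hX).toLinearMap.rTensor (A ⊗[k] A) (TensorProduct.assoc k L A A
            (G.α.toLinearMap.rTensor A s)) := by
        intro s
        induction s with
        | zero => simp
        | tmul x b =>
          simp only [LinearMap.rTensor_tmul, Algebra.TensorProduct.map_tmul,
            AlgHom.toLinearMap_apply, coactRight_ofL]
          generalize G.α x = t
          induction t with
          | zero => simp
          | tmul a b => simp
          | add s t hs ht => simp only [map_add, hs, ht, TensorProduct.add_tmul]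
        | add s t hs ht => simp only [map_add, hs, ht]
      have h2 : ∀ s : L ⊗[k] A, Algebra.TensorProduct.map (AlgHom.id k _)
          (Bialgebra.comulAlgHom k A) ((ofL G hX).toLinearMap.rTensor A s) =
          (ofL G hX).toLinearMap.rTensor (A ⊗[k] A)
            ((Coalgebra.comul (R := k) (A := A)).lTensor L s) := by
        intro s
        induction s with
        | zero => simp
        | tmul a b => simp
        | add s t hs ht => simp only [map_add, hs, ht]
      rw [h1, h2, G.α_coassoc hX]
  exact AlgHom.congr_fun h z

theorem coactRight_counit (z : Boson G hX) :
    (Coalgebra.counit (R := k) (A := A)).lTensor _ (coactRight G hX z) = z ⊗ₜ 1 := by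
  have h : (Algebra.TensorProduct.map (AlgHom.id k _) (Bialgebra.counitAlgHom k A)).comp
      (coactRight G hX) = Algebra.TensorProduct.includeLeft := by
    have h1 : ∀ (M : Type _) [Ring M] [Algebra k M] (f : M →ₐ[k] Boson G hX) (s : M ⊗[k] A),
        Algebra.TensorProduct.map (AlgHom.id k _) (Bialgebra.counitAlgHom k A)
          (f.toLinearMap.rTensor A s) =
        f.toLinearMap.rTensor k ((Coalgebra.counit (R := k) (A := A)).lTensor M s) := by
      intro M _ _ f s
      induction s with
      | zero => simp
      | tmul a b => simp
      | add s t hs ht => simp only [map_add, hs, ht]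
    refine algHom_ext (fun a => ?_) fun v => ?_
    · simp only [AlgHom.comp_apply, coactRight_ofA]
      have h2 := congr((ofA G hX).toLinearMap.rTensor k
        $(Coalgebra.lTensor_counit_comul (R := k) a))
      refine Eq.trans ?_ h2
      generalize Coalgebra.comul (R := k) a = s
      induction s with
      | zero => simp
      | tmul a b => simp
      | add s t hs ht => simp only [map_add, hs, ht]
    · simp only [AlgHom.comp_apply, coactRight_ofL]
      rw [h1, G.α_counit hX]
      simp
  exact AlgHom.congr_fun h z

theorem coactLeft_coactRight (z : Boson G hX) : TensorProduct.assoc k A _ A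
    ((coactLeft G hX).toLinearMap.rTensor A (coactRight G hX z)) =
      (coactRight G hX).toLinearMap.lTensor A (coactLeft G hX z) := by
  have h : ((Algebra.TensorProduct.assoc k k k A (Boson G hX) A).toAlgHom.comp
      (Algebra.TensorProduct.map (coactLeft G hX) (AlgHom.id k _))).comp (coactRight G hX) =
      (Algebra.TensorProduct.map (AlgHom.id k _) (coactRight G hX)).comp
        (coactLeft G hX) := by
    refine algHom_ext (fun a => ?_) fun v => ?_
    · simp only [AlgHom.comp_apply, coactRight_ofA, coactLeft_ofA]
      have h1 : ∀ s : A ⊗[k] A, (Algebra.TensorProduct.assoc k k k A (Boson G hX) A).toAlgHom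
          (Algebra.TensorProduct.map (coactLeft G hX) (AlgHom.id k _)
            ((ofA G hX).toLinearMap.rTensor A s)) =
          ((ofA G hX).toLinearMap.rTensor A).lTensor A (TensorProduct.assoc k A A A
            ((Coalgebra.comul (R := k) (A := A)).rTensor A s)) := by
        intro s
        induction s with
        | zero => simp
        | tmul a b =>
          simp only [LinearMap.rTensor_tmul, Algebra.TensorProduct.map_tmul,
            AlgHom.toLinearMap_apply, coactLeft_ofA]
          generalize Coalgebra.comul (R := k) a = t
          induction t with
          | zero => simp
          | tmul a b => simp
          | add s t hs ht => simp only [map_add, hs, ht, TensorProduct.add_tmul]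
        | add s t hs ht => simp only [map_add, hs, ht]
      have h2 : ∀ s : A ⊗[k] A, Algebra.TensorProduct.map (AlgHom.id k _)
          (coactRight G hX) ((ofA G hX).toLinearMap.lTensor A s) =
          ((ofA G hX).toLinearMap.rTensor A).lTensor A
            ((Coalgebra.comul (R := k) (A := A)).lTensor A s) := by
        intro s
        induction s with
        | zero => simp
        | tmul a b => simp
        | add s t hs ht => simp only [map_add, hs, ht]
      rw [h1, h2, Coalgebra.coassoc_apply]
    · simp only [AlgHom.comp_apply, coactRight_ofL, coactLeft_ofL, Algebra.TensorProduct.map_tmul]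
      generalize G.α (j v) = s
      induction s with
      | zero => simp
      | tmul a b => simp
      | add s t hs ht => simp only [map_add, hs, ht, TensorProduct.tmul_add]
  exact AlgHom.congr_fun h z

variable {ϖ : Aug k A →ₗ[k] V} {d : L →ₗ[k] L}

/-- The form `a₁ ⊗ ϖ π_ε a₂` which represents `da`. -/
theorem diff_ofA_eq (hd : Generated.IsExterior (j := j) ϖ d) (a : A) :
    diff G hX ϖ d (ofA G hX a) =
      (convA G hX * Conv.post (ofL G hX) (mcConv ϖ j) : Conv k A (Boson G hX)) a := by
  rw [diff_ofA hd, LinearMap.convMul_apply]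
  generalize Coalgebra.comul (R := k) a = s
  induction s with
  | zero => simp
  | tmul a b => simp [ofA_mul_ofL]
  | add s t hs ht => simp only [map_add, hs, ht]

theorem coactLeft_diff (hd : Generated.IsExterior (j := j) ϖ d) (a : A) :
    coactLeft G hX (diff G hX ϖ d (ofA G hX a)) =
      (diff G hX ϖ d ∘ₗ (ofA G hX).toLinearMap).lTensor A (Coalgebra.comul (R := k) a) := by
  let Φ : A ⊗[k] (A ⊗[k] A) →ₗ[k] A ⊗[k] Boson G hX :=
    ((equiv G hX).toLinearMap ∘ₗ (j ∘ₗ mcForm ϖ).lTensor A).lTensor A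
  have h1 : ∀ s : A ⊗[k] A, coactLeft G hX (equiv G hX ((j ∘ₗ mcForm ϖ).lTensor A s)) =
      Φ (TensorProduct.assoc k A A A ((Coalgebra.comul (R := k) (A := A)).rTensor A s)) := by
    intro s
    induction s with
    | zero => simp
    | tmul a b =>
      rw [LinearMap.lTensor_tmul, ← ofA_mul_ofL, map_mul, coactLeft_ofA, coactLeft_ofL,
        LinearMap.rTensor_tmul]
      generalize Coalgebra.comul (R := k) a = t
      induction t with
      | zero => simp
      | tmul a b => simp [Φ, ofA_mul_ofL]
      | add s t hs ht => simp only [map_add, hs, ht, TensorProduct.add_tmul, add_mul]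
    | add s t hs ht => simp only [map_add, hs, ht]
  have h2 : ∀ s : A ⊗[k] A, (diff G hX ϖ d ∘ₗ (ofA G hX).toLinearMap).lTensor A s =
      Φ ((Coalgebra.comul (R := k) (A := A)).lTensor A s) := by
    intro s
    induction s with
    | zero => simp
    | tmul a b => simp [Φ, diff_ofA hd]
    | add s t hs ht => simp only [map_add, hs, ht]
  rw [h2, diff_ofA hd, h1, Coalgebra.coassoc_apply]

theorem coactRight_diff (hϖ : (CrossedData.aug k A).IsMorphism X ϖ)
    (hd : Generated.IsExterior (j := j) ϖ d) (a : A) :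
    coactRight G hX (diff G hX ϖ d (ofA G hX a)) =
      (diff G hX ϖ d ∘ₗ (ofA G hX).toLinearMap).rTensor A (Coalgebra.comul (R := k) a) := by
  set m := Algebra.TensorProduct.map (ofL G hX) (AlgHom.id k A) with hm
  set J : Conv k A (Boson G hX ⊗[k] A) :=
    Conv.post Algebra.TensorProduct.includeLeft (convA G hX) with hJ
  set I : Conv k A (Boson G hX ⊗[k] A) := Conv.incl _ with hI
  have hA : Conv.post (coactRight G hX) (convA G hX) = J * I := Conv.ext' fun a => by
    rw [LinearMap.convMul_apply, Conv.post_apply, convA_apply, coactRight_ofA]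
    generalize Coalgebra.comul (R := k) a = s
    induction s with
    | zero => simp
    | tmul a b => simp [hJ, hI]
    | add s t hs ht => simp only [map_add, hs, ht]
  have hL : Conv.post (coactRight G hX) (Conv.post (ofL G hX) (mcConv ϖ j)) =
      Conv.post m (Conv.post G.α (mcConv ϖ j)) := Conv.ext' fun a => by
    rw [Conv.post_apply, Conv.post_apply, coactRight_ofL]
    rfl
  have hI' : I = Conv.post m (Conv.incl L) := Conv.ext' fun a => by simp [hI, hm]
  have hE : Conv.post m (Conv.post Algebra.TensorProduct.includeLeft (mcConv ϖ j)) =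
      Conv.post Algebra.TensorProduct.includeLeft (Conv.post (ofL G hX) (mcConv ϖ j)) :=
    Conv.ext' fun a => by simp [hm]
  have key : Conv.post (coactRight G hX) (convA G hX * Conv.post (ofL G hX) (mcConv ϖ j)) =
      Conv.post Algebra.TensorProduct.includeLeft
        (convA G hX * Conv.post (ofL G hX) (mcConv ϖ j)) * I := by
    rw [map_mul, hA, hL, mul_assoc, hI', ← map_mul, G.incl_mul_post_α_mcConv hϖ, map_mul, hE,
      map_mul, mul_assoc]
  have hW := diff_ofA_eq (G := G) (hX := hX) hd
  generalize convA G hX * Conv.post (ofL G hX) (mcConv ϖ j) = W at key hW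
  rw [hW, ← Conv.post_apply, key, LinearMap.convMul_apply]
  generalize Coalgebra.comul (R := k) a = s
  induction s with
  | zero => simp
  | tmul a b => simp [hI, hW]
  | add s t hs ht => simp only [map_add, hs, ht]

end Boson

end BosonCoactions

section ModelCalculus

variable {k : Type u} {A : Type v} [Field k] [Ring A] [HopfAlgebra k A]
variable {V : Type w} [AddCommGroup V] [Module k V] (X : CrossedData k A V) (ϖ : Aug k A →ₗ[k] V)
variable {Γ : Type*} [AddCommGroup Γ] [Module k Γ] (ρ : Γ ≃ₗ[k] A ⊗[k] V)

/-- The calculus on `Γ ≅ A ⊗ V` with free left module structure and `da = a₁ ⊗ ϖ π_ε a₂`. -/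
def modelCalculus : CalculusData k A Γ where
  lact := ρ.symm.toLinearMap ∘ₗ (LinearMap.mul' k A).rTensor V ∘ₗ
    (TensorProduct.assoc k A A V).symm.toLinearMap ∘ₗ ρ.toLinearMap.lTensor A
  ract := ρ.symm.toLinearMap ∘ₗ TensorProduct.map (LinearMap.mul' k A) X.act ∘ₗ
    (TensorProduct.tensorTensorTensorComm k A V A A).toLinearMap ∘ₗ
    TensorProduct.map ρ.toLinearMap Coalgebra.comul
  coL := ρ.symm.toLinearMap.lTensor A ∘ₗ (TensorProduct.assoc k A A V).toLinearMap ∘ₗ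
    (Coalgebra.comul (R := k) (A := A)).rTensor V ∘ₗ ρ.toLinearMap
  coR := ρ.symm.toLinearMap.rTensor A ∘ₗ (LinearMap.mul' k A).lTensor (A ⊗[k] V) ∘ₗ
    (TensorProduct.tensorTensorTensorComm k A A V A).toLinearMap ∘ₗ
    TensorProduct.map Coalgebra.comul X.coact ∘ₗ ρ.toLinearMap
  d := ρ.symm.toLinearMap ∘ₗ (mcForm ϖ).lTensor A ∘ₗ Coalgebra.comul

theorem modelCalculus_lact (a b : A) (v : V) :
    (modelCalculus X ϖ ρ).lact (a ⊗ₜ ρ.symm (b ⊗ₜ v)) = ρ.symm ((a * b) ⊗ₜ v) := by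
  simp [modelCalculus]

theorem modelCalculus_d (a : A) : (modelCalculus X ϖ ρ).d a =
    ρ.symm ((mcForm ϖ).lTensor A (Coalgebra.comul (R := k) a)) := rfl

theorem modelCalculus_span (hsurj : Function.Surjective ϖ) :
    LinearMap.range ((modelCalculus X ϖ ρ).lact ∘ₗ (modelCalculus X ϖ ρ).d.lTensor A) = ⊤ := by
  rw [eq_top_iff]
  rintro γ -
  obtain ⟨z, rfl⟩ := ρ.symm.surjective γ
  induction z with
  | zero => rw [map_zero]; exact Submodule.zero_mem _
  | add s t hs ht => rw [map_add]; exact add_mem hs ht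
  | tmul b v =>
    obtain ⟨a, rfl⟩ := mcForm_surjective hsurj v
    let Φ : A ⊗[k] (A ⊗[k] A) →ₗ[k] Γ := ρ.symm.toLinearMap ∘ₗ
      TensorProduct.map (LinearMap.mulLeft k b ∘ₗ LinearMap.mul' k A ∘ₗ
        (HopfAlgebra.antipode k).rTensor A) (mcForm ϖ) ∘ₗ
        (TensorProduct.assoc k A A A).symm.toLinearMap
    refine ⟨(LinearMap.mulLeft k b ∘ₗ HopfAlgebra.antipode k).rTensor A
      (Coalgebra.comul (R := k) a), ?_⟩
    have h1 : ∀ s : A ⊗[k] A, ((modelCalculus X ϖ ρ).lact ∘ₗ (modelCalculus X ϖ ρ).d.lTensor A)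
        ((LinearMap.mulLeft k b ∘ₗ HopfAlgebra.antipode k).rTensor A s) =
        Φ ((Coalgebra.comul (R := k) (A := A)).lTensor A s) := by
      intro s
      induction s with
      | zero => simp
      | tmul a c =>
        simp only [LinearMap.rTensor_tmul, LinearMap.lTensor_tmul, LinearMap.comp_apply,
          modelCalculus_d]
        generalize Coalgebra.comul (R := k) c = t
        induction t with
        | zero => simp
        | tmul c c' => simp [modelCalculus_lact, Φ, mul_assoc]
        | add s t hs ht => simp only [map_add, hs, ht, TensorProduct.tmul_add]
      | add s t hs ht => simp only [map_add, hs, ht]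
    have h2 : ∀ s : A ⊗[k] A, Φ (TensorProduct.assoc k A A A
        ((Coalgebra.comul (R := k) (A := A)).rTensor A s)) =
        ρ.symm (b ⊗ₜ mcForm ϖ (TensorProduct.lid k A
          ((Coalgebra.counit (R := k) (A := A)).rTensor A s))) := by
      intro s
      induction s with
      | zero => simp
      | tmul a c =>
        simp [Φ, HopfAlgebra.mul_antipode_rTensor_comul_apply, Algebra.algebraMap_eq_smul_one,
          TensorProduct.smul_tmul]
      | add s t hs ht => simp only [map_add, hs, ht, TensorProduct.tmul_add]
    rw [h1, ← Coalgebra.coassoc_apply, h2, Coalgebra.rTensor_counit_comul]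
    simp

variable {L : Type x} [Ring L] [Algebra k L] {j : V →ₗ[k] L}
variable (G : Generated X L j) (hX : X.IsCrossedModule)

/-- The embedding of `Γ ≅ A ⊗ V` into the bosonisation. -/
def toBoson : Γ →ₗ[k] Boson G hX :=
  (Boson.equiv G hX).toLinearMap ∘ₗ j.lTensor A ∘ₗ ρ.toLinearMap

theorem toBoson_symm (a : A) (v : V) : toBoson X ρ G hX (ρ.symm (a ⊗ₜ v)) =
    Boson.ofA G hX a * Boson.ofL G hX (j v) := by
  simp [toBoson, Boson.ofA_mul_ofL]

theorem toBoson_injective : Function.Injective (toBoson X ρ G hX) :=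
  (Boson.equiv G hX).injective.comp
    ((Module.Flat.lTensor_preserves_injective_linearMap j G.generators_injective).comp ρ.injective)

theorem toBoson_lact (a : A) (γ : Γ) : toBoson X ρ G hX ((modelCalculus X ϖ ρ).lact (a ⊗ₜ γ)) =
    Boson.ofA G hX a * toBoson X ρ G hX γ := by
  obtain ⟨z, rfl⟩ := ρ.symm.surjective γ
  induction z with
  | zero => simp
  | tmul b v => rw [modelCalculus_lact, toBoson_symm, toBoson_symm, map_mul, mul_assoc]
  | add s t hs ht => simp only [map_add, TensorProduct.tmul_add, mul_add, hs, ht]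

theorem toBoson_ract (γ : Γ) (a : A) : toBoson X ρ G hX ((modelCalculus X ϖ ρ).ract (γ ⊗ₜ a)) =
    toBoson X ρ G hX γ * Boson.ofA G hX a := by
  obtain ⟨z, rfl⟩ := ρ.symm.surjective γ
  induction z with
  | zero => simp
  | tmul b v =>
    have h1 := congr($(Boson.const_mul_convA (G := G) (hX := hX) (j v)) a)
    rw [Conv.const_mul_apply, LinearMap.convMul_apply, Boson.convA_apply] at h1
    rw [toBoson_symm, mul_assoc, h1]
    simp only [modelCalculus, LinearMap.comp_apply, TensorProduct.map_tmul, LinearEquiv.coe_coe,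
      LinearEquiv.apply_symm_apply]
    generalize Coalgebra.comul (R := k) a = s
    induction s with
    | zero => simp
    | tmul a c => simp [toBoson_symm, G.β_gen, mul_assoc]
    | add s t hs ht => simp only [map_add, TensorProduct.tmul_add, mul_add, hs, ht]
  | add s t hs ht => simp only [map_add, TensorProduct.add_tmul, add_mul, hs, ht]

theorem toBoson_coL (γ : Γ) : (toBoson X ρ G hX).lTensor A ((modelCalculus X ϖ ρ).coL γ) =
    Boson.coactLeft G hX (toBoson X ρ G hX γ) := by
  obtain ⟨z, rfl⟩ := ρ.symm.surjective γ
  induction z with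
  | zero => simp
  | tmul b v =>
    rw [toBoson_symm, map_mul, Boson.coactLeft_ofA, Boson.coactLeft_ofL]
    simp only [modelCalculus, LinearMap.comp_apply, LinearMap.rTensor_tmul, LinearEquiv.coe_coe,
      LinearEquiv.apply_symm_apply]
    generalize Coalgebra.comul (R := k) b = s
    induction s with
    | zero => simp
    | tmul a c => simp [toBoson_symm]
    | add s t hs ht => simp only [map_add, TensorProduct.add_tmul, add_mul, hs, ht]
  | add s t hs ht => simp only [map_add, hs, ht]

theorem toBoson_coR (γ : Γ) : (toBoson X ρ G hX).rTensor A ((modelCalculus X ϖ ρ).coR γ) =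
    Boson.coactRight G hX (toBoson X ρ G hX γ) := by
  obtain ⟨z, rfl⟩ := ρ.symm.surjective γ
  induction z with
  | zero => simp
  | tmul b v =>
    rw [toBoson_symm, map_mul, Boson.coactRight_ofA, Boson.coactRight_ofL, G.α_gen]
    simp only [modelCalculus, LinearMap.comp_apply, TensorProduct.map_tmul, LinearEquiv.coe_coe,
      LinearEquiv.apply_symm_apply]
    generalize Coalgebra.comul (R := k) b = s
    generalize X.coact v = t
    induction s with
    | zero => simp
    | tmul a c =>
      induction t with
      | zero => simp
      | tmul v b => simp [toBoson_symm]
      | add s t hs ht => simp only [map_add, TensorProduct.tmul_add, mul_add, hs, ht]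
    | add s t hs ht => simp only [map_add, TensorProduct.add_tmul, add_mul, hs, ht]
  | add s t hs ht => simp only [map_add, hs, ht]

variable {G hX ϖ}

theorem toBoson_d {d : L →ₗ[k] L} (hd : Generated.IsExterior (j := j) ϖ d) (a : A) :
    toBoson X ρ G hX ((modelCalculus X ϖ ρ).d a) =
      Boson.diff G hX ϖ d (Boson.ofA G hX a) := by
  rw [Boson.diff_ofA hd, modelCalculus_d, toBoson, LinearMap.comp_apply, LinearMap.comp_apply,
    LinearEquiv.coe_coe, LinearEquiv.coe_coe, LinearEquiv.apply_symm_apply,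
    LinearMap.lTensor_comp_apply]

theorem modelCalculus_isEmbedding (hϖ : (CrossedData.aug k A).IsMorphism X ϖ)
    (hsurj : Function.Surjective ϖ) {d : L →ₗ[k] L}
    (hd : Generated.IsExterior (j := j) ϖ d) :
    (modelCalculus X ϖ ρ).IsEmbedding (Boson.ofA G hX) (toBoson X ρ G hX)
      (Boson.coactLeft G hX) (Boson.coactRight G hX) where
  injective := toBoson_injective X ρ G hX
  lact := toBoson_lact X ϖ ρ G hX
  ract := toBoson_ract X ϖ ρ G hX
  coL := toBoson_coL X ϖ ρ G hX
  coR := toBoson_coR X ϖ ρ G hX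
  cL_oA := Boson.coactLeft_ofA G hX
  cR_oA := Boson.coactRight_ofA G hX
  cL_coassoc := Boson.coactLeft_coassoc
  cL_counit := Boson.coactLeft_counit
  cR_coassoc := Boson.coactRight_coassoc
  cR_counit := Boson.coactRight_counit
  cL_cR := Boson.coactLeft_coactRight
  leibniz a b := by
    rw [toBoson_d X ρ hd, toBoson_d X ρ hd, toBoson_d X ρ hd, map_mul, Boson.diff_ofA_mul hϖ hd]
  span := modelCalculus_span X ϖ ρ hsurj
  cL_d a := by
    rw [toBoson_d X ρ hd, Boson.coactLeft_diff hd]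
    congr 2
    exact LinearMap.ext fun a => (toBoson_d X ρ hd a).symm
  cR_d a := by
    rw [toBoson_d X ρ hd, Boson.coactRight_diff hϖ hd]
    congr 2
    exact LinearMap.ext fun a => (toBoson_d X ρ hd a).symm

end ModelCalculus

/-! ### The first order calculus of Woronowicz -/

section FirstOrder

variable {k : Type u} {A : Type v} [Field k] [Ring A] [HopfAlgebra k A]
variable {V : Type w} [AddCommGroup V] [Module k V]

variable (k A) in
/-- `r(a ⊗ b) = a b₁ ⊗ b₂`. -/
def galois : A ⊗[k] A →ₗ[k] A ⊗[k] A :=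
  (LinearMap.mul' k A).rTensor A ∘ₗ (TensorProduct.assoc k A A A).symm.toLinearMap ∘ₗ
    (Coalgebra.comul (R := k) (A := A)).lTensor A

theorem galois_tmul (a b : A) :
    galois k A (a ⊗ₜ b) = lmulA A a (Coalgebra.comul (R := k) b) := by
  simp only [galois, LinearMap.comp_apply, LinearMap.lTensor_tmul]
  generalize Coalgebra.comul (R := k) b = s
  induction s with
  | zero => simp
  | tmul b c => simp
  | add s t hs ht => simp only [map_add, TensorProduct.tmul_add, hs, ht]

theorem counit_galois (z : A ⊗[k] A) : (Coalgebra.counit (R := k) (A := A)).lTensor A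
    (galois k A z) = LinearMap.mul' k A z ⊗ₜ 1 := by
  induction z with
  | zero => simp
  | tmul a b =>
    have h : ∀ s : A ⊗[k] A, (Coalgebra.counit (R := k) (A := A)).lTensor A (lmulA A a s) =
        lmulA k a ((Coalgebra.counit (R := k) (A := A)).lTensor A s) := by
      intro s
      induction s with
      | zero => simp
      | tmul b c => simp
      | add s t hs ht => simp only [map_add, hs, ht]
    rw [galois_tmul, h, Coalgebra.lTensor_counit_comul, lmulA_tmul, LinearMap.mul'_apply]
  | add s t hs ht => simp only [map_add, TensorProduct.add_tmul, hs, ht]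

theorem piEps_galois {z : A ⊗[k] A} (hz : LinearMap.mul' k A z = 0) :
    (Aug k A).subtype.lTensor A ((piEps k A).lTensor A (galois k A z)) = galois k A z := by
  have h : ∀ s : A ⊗[k] A, (Aug k A).subtype.lTensor A ((piEps k A).lTensor A s) =
      s - (Algebra.linearMap k A).lTensor A ((Coalgebra.counit (R := k) (A := A)).lTensor A s) := by
    intro s
    induction s with
    | zero => simp
    | tmul b c => simp [piEps_apply, TensorProduct.tmul_sub]
    | add s t hs ht => simp only [map_add, hs, ht]; abel
  rw [h, counit_galois, hz]
  simp

variable (ϖ : Aug k A →ₗ[k] V)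

/-- The map `a ⊗ b ↦ a b₁ ⊗ ϖ π_ε b₂`. -/
def formOf : A ⊗[k] A →ₗ[k] A ⊗[k] V := (mcForm ϖ).lTensor A ∘ₗ galois k A

theorem formOf_lmul (a : A) (z : A ⊗[k] A) :
    formOf ϖ ((a ⊗ₜ[k] (1 : A)) * z) = lmulA V a (formOf ϖ z) := by
  induction z with
  | zero => simp
  | tmul b c =>
    simp only [formOf, LinearMap.comp_apply, Algebra.TensorProduct.tmul_mul_tmul, one_mul,
      galois_tmul, lmulA_mul, Module.End.mul_apply]
    generalize lmulA A b (Coalgebra.comul (R := k) c) = s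
    induction s with
    | zero => simp
    | tmul b c => simp
    | add s t hs ht => simp only [map_add, hs, ht]
  | add s t hs ht => simp only [map_add, mul_add, hs, ht]

theorem formOf_rmul {X : CrossedData k A V} (hϖ : (CrossedData.aug k A).IsMorphism X ϖ)
    (c : A) (z : A ⊗[k] A) : formOf ϖ (z * ((1 : A) ⊗ₜ[k] c)) =
      TensorProduct.map (LinearMap.mul' k A) X.act
        (TensorProduct.tensorTensorTensorComm k A V A A
          (formOf ϖ z ⊗ₜ Coalgebra.comul (R := k) c)) +
      lmulA V (LinearMap.mul' k A z) ((mcForm ϖ).lTensor A (Coalgebra.comul (R := k) c)) := by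
  induction z with
  | zero => simp [lmulA]
  | tmul a b =>
    have h : ∀ s t : A ⊗[k] A, (mcForm ϖ).lTensor A (lmulA A a (s * t)) =
        TensorProduct.map (LinearMap.mul' k A) X.act
          (TensorProduct.tensorTensorTensorComm k A V A A
            ((mcForm ϖ).lTensor A (lmulA A a s) ⊗ₜ t)) +
        lmulA V (a * TensorProduct.rid k A ((Coalgebra.counit (R := k) (A := A)).lTensor A s))
          ((mcForm ϖ).lTensor A t) := by
      intro s t
      induction s with
      | zero => simp [lmulA]
      | tmul b c =>
        induction t with
        | zero => simp
        | tmul b' c' =>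
          simp [mcForm_mul hϖ, TensorProduct.tmul_add, mul_assoc, ← TensorProduct.smul_tmul']
        | add s t hs ht =>
          simp only [map_add, mul_add, TensorProduct.tmul_add, hs, ht]
          abel
      | add s s' hs ht =>
        simp only [map_add, mul_add, add_mul, TensorProduct.add_tmul, hs, ht, lmulA_add,
          LinearMap.add_apply]
        abel
    rw [formOf, Algebra.TensorProduct.tmul_mul_tmul, mul_one, LinearMap.comp_apply,
      LinearMap.comp_apply, galois_tmul, galois_tmul, Bialgebra.comul_mul, h,
      Coalgebra.lTensor_counit_comul, TensorProduct.rid_tmul, one_smul, LinearMap.mul'_apply]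
  | add s t hs ht =>
    simp only [map_add, add_mul, TensorProduct.add_tmul, hs, ht, lmulA_add, LinearMap.add_apply]
    abel

theorem formOf_surjective (hsurj : Function.Surjective ϖ) :
    Function.Surjective (formOf ϖ ∘ₗ (UniversalForms k A).subtype) := by
  intro z
  induction z with
  | zero => exact ⟨0, map_zero _⟩
  | add s t hs ht =>
    obtain ⟨y, rfl⟩ := hs
    obtain ⟨z, rfl⟩ := ht
    exact ⟨y + z, map_add _ _ _⟩
  | tmul b v =>
    obtain ⟨a, rfl⟩ := hsurj v
    let z : A ⊗[k] A := (LinearMap.mulLeft k b ∘ₗ HopfAlgebra.antipode k).rTensor A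
      (Coalgebra.comul (R := k) (a : A))
    have h1 : ∀ s : A ⊗[k] A, LinearMap.mul' k A
        ((LinearMap.mulLeft k b ∘ₗ HopfAlgebra.antipode k).rTensor A s) =
        b * LinearMap.mul' k A ((HopfAlgebra.antipode k).rTensor A s) := by
      intro s
      induction s with
      | zero => simp
      | tmul b c => simp [mul_assoc]
      | add s t hs ht => simp only [map_add, mul_add, hs, ht]
    have hz : LinearMap.mul' k A z = 0 := by
      rw [h1, HopfAlgebra.mul_antipode_rTensor_comul_apply, LinearMap.mem_ker.1 a.2, map_zero,
        mul_zero]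
    refine ⟨⟨z, hz⟩, ?_⟩
    let Φ : A ⊗[k] (A ⊗[k] A) →ₗ[k] A ⊗[k] V :=
      TensorProduct.map (LinearMap.mulLeft k b ∘ₗ LinearMap.mul' k A ∘ₗ
        (HopfAlgebra.antipode k).rTensor A) (mcForm ϖ) ∘ₗ
        (TensorProduct.assoc k A A A).symm.toLinearMap
    have h2 : ∀ s : A ⊗[k] A, formOf ϖ
        ((LinearMap.mulLeft k b ∘ₗ HopfAlgebra.antipode k).rTensor A s) =
        Φ ((Coalgebra.comul (R := k) (A := A)).lTensor A s) := by
      intro s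
      induction s with
      | zero => simp
      | tmul a c =>
        simp only [LinearMap.rTensor_tmul, LinearMap.lTensor_tmul, LinearMap.comp_apply, formOf,
          galois_tmul]
        generalize Coalgebra.comul (R := k) c = t
        induction t with
        | zero => simp
        | tmul c c' => simp [Φ, mul_assoc]
        | add s t hs ht => simp only [map_add, hs, ht, TensorProduct.tmul_add]
      | add s t hs ht => simp only [map_add, hs, ht]
    have h3 : ∀ s : A ⊗[k] A, Φ (TensorProduct.assoc k A A A
        ((Coalgebra.comul (R := k) (A := A)).rTensor A s)) =
        b ⊗ₜ mcForm ϖ (TensorProduct.lid k A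
          ((Coalgebra.counit (R := k) (A := A)).rTensor A s)) := by
      intro s
      induction s with
      | zero => simp
      | tmul a c =>
        simp [Φ, HopfAlgebra.mul_antipode_rTensor_comul_apply, Algebra.algebraMap_eq_smul_one,
          TensorProduct.smul_tmul]
      | add s t hs ht => simp only [map_add, hs, ht, TensorProduct.tmul_add]
    rw [LinearMap.comp_apply, Submodule.subtype_apply, h2, ← Coalgebra.coassoc_apply, h3,
      Coalgebra.rTensor_counit_comul, TensorProduct.lid_tmul, one_smul, mcForm_coe]

theorem ker_formOf (hsurj : Function.Surjective ϖ) :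
    LinearMap.ker (formOf ϖ ∘ₗ (UniversalForms k A).subtype) =
      (worSub ϖ).comap (UniversalForms k A).subtype := by
  ext ⟨z, hz⟩
  have hz' := piEps_galois (LinearMap.mem_ker.1 hz)
  rw [LinearMap.mem_ker, LinearMap.comp_apply, Submodule.subtype_apply, Submodule.mem_comap,
    Submodule.subtype_apply, worSub, Submodule.mem_comap]
  change (mcForm ϖ).lTensor A (galois k A z) = 0 ↔
    galois k A z ∈ LinearMap.range ((kerIdeal ϖ).subtype.lTensor A)
  constructor
  · intro h
    rw [mcForm, LinearMap.lTensor_comp_apply] at h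
    have hex := lTensor_exact (M := LinearMap.ker ϖ) (N := Aug k A) (P := V)
      (f := (LinearMap.ker ϖ).subtype) (g := ϖ) A (fun x => by simp) hsurj
    obtain ⟨y, hy⟩ := (hex _).1 h
    refine ⟨((Aug k A).subtype.restrict (p := LinearMap.ker ϖ) (q := kerIdeal ϖ)
      fun x hx => Submodule.mem_map_of_mem hx).lTensor A y, ?_⟩
    rw [← hz', ← hy, ← LinearMap.lTensor_comp_apply, ← LinearMap.lTensor_comp_apply]
    rfl
  · rintro ⟨y, hy⟩
    rw [← hy, ← LinearMap.lTensor_comp_apply]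
    have h : mcForm ϖ ∘ₗ (kerIdeal ϖ).subtype = 0 := by
      refine LinearMap.ext ?_
      rintro ⟨_, ⟨a, ha, rfl⟩⟩
      simp only [LinearMap.comp_apply, Submodule.subtype_apply, mcForm_coe]
      exact ha
    rw [h, LinearMap.lTensor_zero, LinearMap.zero_apply]

/-- The isomorphism of the first order forms with `A ⊗ V`. -/
def worEquiv (hsurj : Function.Surjective ϖ) : WorForms ϖ ≃ₗ[k] A ⊗[k] V :=
  (Submodule.quotEquivOfEq _ _ (ker_formOf ϖ hsurj).symm).trans
    (LinearMap.quotKerEquivOfSurjective _ (formOf_surjective ϖ hsurj))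

theorem worEquiv_mk (hsurj : Function.Surjective ϖ) (z : UniversalForms k A) :
    worEquiv ϖ hsurj (WorForms.mk ϖ z) = formOf ϖ z := rfl

theorem isWoronowiczCalculus {X : CrossedData k A V}
    (hϖ : (CrossedData.aug k A).IsMorphism X ϖ) (hsurj : Function.Surjective ϖ)
    (h : (modelCalculus X ϖ (worEquiv ϖ hsurj)).IsBicovariant) :
    IsWoronowiczCalculus ϖ (modelCalculus X ϖ (worEquiv ϖ hsurj)) where
  lact a z := by
    apply (worEquiv ϖ hsurj).injective
    rw [worEquiv_mk, formOf_lmul, ← worEquiv_mk ϖ hsurj z]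
    simp only [modelCalculus, LinearMap.comp_apply, LinearEquiv.coe_coe,
      LinearEquiv.apply_symm_apply, LinearMap.lTensor_tmul]
    generalize worEquiv ϖ hsurj (WorForms.mk ϖ z) = s
    induction s with
    | zero => simp
    | tmul b v => simp
    | add s t hs ht => simp only [map_add, TensorProduct.tmul_add, hs, ht]
  ract z a := by
    apply (worEquiv ϖ hsurj).injective
    rw [worEquiv_mk, formOf_rmul ϖ hϖ, LinearMap.mem_ker.1 z.2, ← worEquiv_mk ϖ hsurj z]
    simp [modelCalculus, lmulA]
  d a := by
    apply (worEquiv ϖ hsurj).injective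
    rw [worEquiv_mk, modelCalculus_d, LinearEquiv.apply_symm_apply, formOf]
    simp only [universalD, map_sub, LinearMap.comp_apply, galois_tmul, Bialgebra.comul_one]
    simp [lmulA_one, Algebra.TensorProduct.one_def, mcForm_one]
  isBicovariant := h

end FirstOrder

/-! ### Balanced tensors -/

section Balanced

variable {k : Type u} {A : Type v} [Field k] [Ring A] [HopfAlgebra k A]
variable {Γ : Type w} [AddCommGroup Γ] [Module k Γ] {C : CalculusData k A Γ}

theorem tprod_eq_cons {n : ℕ} (f : Fin (n + 1) → Γ) : PiTensorProduct.tprod k f =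
    consEquiv k Γ n (f 0 ⊗ₜ PiTensorProduct.tprod k (Fin.tail f)) := by
  rw [consEquiv_tmul_tprod, Fin.cons_self_tail]

theorem cons_mem_balanced {n : ℕ} (γ : Γ) {x : ⨂[k]^n Γ} (hx : x ∈ C.balanced n) :
    consEquiv k Γ n (γ ⊗ₜ x) ∈ C.balanced (n + 1) := by
  rw [CalculusData.balanced] at hx
  induction hx using Submodule.span_induction with
  | zero => simp
  | add x y _ _ hx hy => rw [TensorProduct.tmul_add, map_add]; exact add_mem hx hy
  | smul c x _ hx => rw [TensorProduct.tmul_smul, map_smul]; exact Submodule.smul_mem _ _ hx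
  | mem x hx =>
    obtain ⟨f, i, i', a, hi, rfl⟩ := hx
    refine Submodule.subset_span ⟨Fin.cons γ f, i.succ, i'.succ, a, by simp [hi], ?_⟩
    rw [TensorProduct.tmul_sub, map_sub, consEquiv_tmul_tprod, consEquiv_tmul_tprod,
      Fin.cons_update, Fin.cons_update, Fin.cons_succ, Fin.cons_succ]

theorem cons_cons_mem_balanced {n : ℕ} (γ γ' : Γ) (a : A) (y : ⨂[k]^n Γ) :
    consEquiv k Γ (n + 1) (C.ract (γ ⊗ₜ a) ⊗ₜ consEquiv k Γ n (γ' ⊗ₜ y)) -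
      consEquiv k Γ (n + 1) (γ ⊗ₜ consEquiv k Γ n (C.lact (a ⊗ₜ γ') ⊗ₜ y)) ∈
      C.balanced (n + 2) := by
  induction y using PiTensorProduct.induction_on with
  | smul_tprod r f =>
    simp only [TensorProduct.tmul_smul, map_smul, ← smul_sub]
    refine Submodule.smul_mem _ _ (Submodule.subset_span
      ⟨Fin.cons γ (Fin.cons γ' f), 0, 1, a, by simp, ?_⟩)
    rw [consEquiv_tmul_tprod, consEquiv_tmul_tprod, consEquiv_tmul_tprod, consEquiv_tmul_tprod,
      Fin.update_cons_zero, ← Fin.succ_zero_eq_one, ← Fin.cons_update, Fin.update_cons_zero,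
      Fin.cons_zero, Fin.cons_succ, Fin.cons_zero]
  | add x y hx hy =>
    simp only [TensorProduct.tmul_add, map_add, add_sub_add_comm]
    exact add_mem hx hy

theorem balanced_le {p : ∀ n, Submodule k (⨂[k]^n Γ)}
    (h₁ : ∀ (n : ℕ) (γ : Γ), ∀ x ∈ p n, consEquiv k Γ n (γ ⊗ₜ x) ∈ p (n + 1))
    (h₂ : ∀ (n : ℕ) (γ γ' : Γ) (a : A) (y : ⨂[k]^n Γ),
      consEquiv k Γ (n + 1) (C.ract (γ ⊗ₜ a) ⊗ₜ consEquiv k Γ n (γ' ⊗ₜ y)) -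
      consEquiv k Γ (n + 1) (γ ⊗ₜ consEquiv k Γ n (C.lact (a ⊗ₜ γ') ⊗ₜ y)) ∈ p (n + 2))
    (n : ℕ) : C.balanced n ≤ p n := by
  refine Submodule.span_le.2 ?_
  rintro _ ⟨f, i, i', a, hi, rfl⟩
  induction n with
  | zero => exact i.elim0
  | succ n ih =>
    obtain ⟨l, rfl⟩ := Fin.exists_succ_eq.2 (show i' ≠ 0 from fun h => by simp [h] at hi)
    induction i using Fin.cases with
    | zero =>
      cases n with
      | zero => exact l.elim0
      | succ n =>
        obtain rfl : l = 0 := by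
          ext
          simpa using hi
        rw [SetLike.mem_coe]
        convert h₂ n (f 0) (f 1) a (PiTensorProduct.tprod k (Fin.tail (Fin.tail f))) using 2
        · rw [tprod_eq_cons, Function.update_self, Fin.tail_update_zero, tprod_eq_cons]
          rfl
        · rw [tprod_eq_cons, Fin.tail_update_succ, tprod_eq_cons, Function.update_self,
            Fin.tail_update_zero, Function.update_of_ne (Fin.succ_ne_zero _).symm]
          rfl
    | succ i =>
      have h := h₁ n (f 0) _ (ih (Fin.tail f) i l (by simpa using hi))
      rw [TensorProduct.tmul_sub, map_sub] at h
      rw [SetLike.mem_coe]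
      convert h using 2
      · rw [tprod_eq_cons, Fin.tail_update_succ, Function.update_of_ne (Fin.succ_ne_zero _).symm]
        rfl
      · rw [tprod_eq_cons, Fin.tail_update_succ, Function.update_of_ne (Fin.succ_ne_zero _).symm]
        rfl

end Balanced

section Straighten

variable {k : Type u} {A : Type v} [Field k] [Ring A] [HopfAlgebra k A]
variable {V : Type w} [AddCommGroup V] [Module k V] (X : CrossedData k A V) (ϖ : Aug k A →ₗ[k] V)
variable {Γ : Type*} [AddCommGroup Γ] [Module k Γ] (ρ : Γ ≃ₗ[k] A ⊗[k] V)

/-- `(a ⊗ v) ⊗ (b ⊗ y) ↦ a b₁ ⊗ (v ◁ b₂) ⊗ y`, for `Γ ≅ A ⊗ V`. -/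
def straightenMul (n : ℕ) : Γ ⊗[k] (A ⊗[k] (⨂[k]^n V)) →ₗ[k] A ⊗[k] (⨂[k]^(n + 1) V) :=
  TensorProduct.map (LinearMap.mul' k A) ((consEquiv k V n).toLinearMap ∘ₗ X.act.rTensor _ ∘ₗ
      (TensorProduct.assoc k V A _).symm.toLinearMap) ∘ₗ
    (TensorProduct.tensorTensorTensorComm k A V A (A ⊗[k] (⨂[k]^n V))).toLinearMap ∘ₗ
    TensorProduct.map ρ.toLinearMap ((TensorProduct.assoc k A A _).toLinearMap ∘ₗ
      (Coalgebra.comul (R := k) (A := A)).rTensor _)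

/-- `v ◁ b ⊗ y`, as a function of `b`. -/
def consAct {n : ℕ} (v : V) (y : ⨂[k]^n V) : A →ₗ[k] ⨂[k]^(n + 1) V :=
  (consEquiv k V n).toLinearMap ∘ₗ (TensorProduct.mk k V _).flip y ∘ₗ TensorProduct.curry X.act v

@[simp] theorem consAct_apply {n : ℕ} (v : V) (y : ⨂[k]^n V) (b : A) :
    consAct X v y b = consEquiv k V n (X.act (v ⊗ₜ b) ⊗ₜ y) := rfl

theorem straightenMul_tmul (n : ℕ) (a : A) (v : V) (b : A) (y : ⨂[k]^n V) :
    straightenMul X ρ n (ρ.symm (a ⊗ₜ v) ⊗ₜ (b ⊗ₜ y)) =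
      lmulA _ a ((consAct X v y).lTensor A (Coalgebra.comul (R := k) b)) := by
  simp only [straightenMul, LinearMap.comp_apply, TensorProduct.map_tmul, LinearEquiv.coe_coe,
    LinearEquiv.apply_symm_apply, LinearMap.rTensor_tmul]
  generalize Coalgebra.comul (R := k) b = s
  induction s with
  | zero => simp
  | tmul b c => simp
  | add s t hs ht => simp only [map_add, TensorProduct.add_tmul, TensorProduct.tmul_add, hs, ht]

/-- The identification of `Γ ⊗_A ⋯ ⊗_A Γ` with `A ⊗ V ⊗ ⋯ ⊗ V`, as a map on `Γ ⊗ ⋯ ⊗ Γ`. -/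
def straighten : (n : ℕ) → (⨂[k]^n Γ) →ₗ[k] A ⊗[k] (⨂[k]^n V)
  | 0 => TensorProduct.mk k A _ 1 ∘ₗ ((PiTensorProduct.isEmptyEquiv (Fin 0)).trans
      (PiTensorProduct.isEmptyEquiv (Fin 0)).symm).toLinearMap
  | n + 1 => straightenMul X ρ n ∘ₗ (straighten n).lTensor Γ ∘ₗ (consEquiv k Γ n).symm.toLinearMap

theorem straighten_cons (n : ℕ) (γ : Γ) (x : ⨂[k]^n Γ) :
    straighten X ρ (n + 1) (consEquiv k Γ n (γ ⊗ₜ x)) =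
      straightenMul X ρ n (γ ⊗ₜ straighten X ρ n x) := by
  simp [straighten]

theorem idTensor_straightenMul (n : ℕ) (f : Module.End k (⨂[k]^n V)) (γ : Γ)
    (z : A ⊗[k] (⨂[k]^n V)) : straightenMul X ρ n (γ ⊗ₜ f.lTensor A z) =
      (idTensor n f).lTensor A (straightenMul X ρ n (γ ⊗ₜ z)) := by
  obtain ⟨γ, rfl⟩ := ρ.symm.surjective γ
  induction γ with
  | zero => simp
  | tmul a v =>
    induction z with
    | zero => simp
    | tmul b y =>
      rw [LinearMap.lTensor_tmul, straightenMul_tmul, straightenMul_tmul]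
      generalize Coalgebra.comul (R := k) b = s
      induction s with
      | zero => simp
      | tmul b c => simp [idTensor_cons]
      | add s t hs ht => simp only [map_add, hs, ht]
    | add s t hs ht => simp only [map_add, TensorProduct.tmul_add, hs, ht]
  | add s t hs ht => simp only [map_add, TensorProduct.add_tmul, hs, ht]

/-- `a ⊗ v₁ ⊗ ⋯ ⊗ vₙ ↦ a v₁ ⊗ v₂ ⊗ ⋯ ⊗ vₙ`, a section of `straighten`. -/
def straightenSection (n : ℕ) : A ⊗[k] (⨂[k]^(n + 1) V) →ₗ[k] ⨂[k]^(n + 1) Γ :=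
  (consEquiv k Γ n).toLinearMap ∘ₗ TensorProduct.map ρ.symm.toLinearMap
      (PiTensorProduct.map fun _ : Fin n => ρ.symm.toLinearMap ∘ₗ TensorProduct.mk k A V 1) ∘ₗ
    (TensorProduct.assoc k A V _).symm.toLinearMap ∘ₗ
      (consEquiv k V n).symm.toLinearMap.lTensor A

theorem straightenSection_tmul (n : ℕ) (a : A) (v : V) (y : ⨂[k]^n V) :
    straightenSection ρ n (a ⊗ₜ consEquiv k V n (v ⊗ₜ y)) = consEquiv k Γ n (ρ.symm (a ⊗ₜ v) ⊗ₜ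
      PiTensorProduct.map (fun _ : Fin n => ρ.symm.toLinearMap ∘ₗ TensorProduct.mk k A V 1) y) := by
  simp [straightenSection]

theorem map_cons (n : ℕ) (f : V →ₗ[k] Γ) (v : V) (y : ⨂[k]^n V) :
    PiTensorProduct.map (fun _ : Fin (n + 1) => f) (consEquiv k V n (v ⊗ₜ y)) =
      consEquiv k Γ n (f v ⊗ₜ PiTensorProduct.map (fun _ : Fin n => f) y) := by
  induction y using PiTensorProduct.induction_on with
  | smul_tprod r g =>
    simp only [TensorProduct.tmul_smul, map_smul, consEquiv_tmul_tprod,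
      PiTensorProduct.map_tprod]
    congr 2
    funext i
    refine Fin.cases rfl (fun i => rfl) i
  | add x y hx hy => simp only [TensorProduct.tmul_add, map_add, hx, hy]

theorem modelCalculus_ract_symm (a b : A) (v : V) :
    (modelCalculus X ϖ ρ).ract (ρ.symm (a ⊗ₜ v) ⊗ₜ b) =
      ρ.symm (lmulA V a ((TensorProduct.curry X.act v).lTensor A
        (Coalgebra.comul (R := k) b))) := by
  simp only [modelCalculus, LinearMap.comp_apply, TensorProduct.map_tmul, LinearEquiv.coe_coe,
    LinearEquiv.apply_symm_apply]
  congr 1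
  generalize Coalgebra.comul (R := k) b = s
  induction s with
  | zero => simp
  | tmul b c => simp
  | add s t hs ht => simp only [map_add, TensorProduct.tmul_add, hs, ht]

theorem straightenSection_straightenMul (n : ℕ) (γ : Γ) (z : A ⊗[k] (⨂[k]^(n + 1) V)) :
    consEquiv k Γ (n + 1) (γ ⊗ₜ straightenSection ρ n z) -
      straightenSection ρ (n + 1) (straightenMul X ρ (n + 1) (γ ⊗ₜ z)) ∈
      (modelCalculus X ϖ ρ).balanced (n + 2) := by
  obtain ⟨γ, rfl⟩ := ρ.symm.surjective γ
  induction γ with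
  | zero => simp
  | tmul a v =>
    induction z with
    | zero => simp
    | tmul b y =>
      induction y using consEquiv_induction with
      | h w y =>
        set Y := PiTensorProduct.map
          (fun _ : Fin n => ρ.symm.toLinearMap ∘ₗ TensorProduct.mk k A V 1) y with hY
        have h := neg_mem (cons_cons_mem_balanced (C := modelCalculus X ϖ ρ) (ρ.symm (a ⊗ₜ v))
          (ρ.symm (1 ⊗ₜ w)) b Y)
        rw [neg_sub, modelCalculus_lact, mul_one] at h
        convert h using 2
        · rw [straightenSection_tmul]
        · rw [straightenMul_tmul, modelCalculus_ract_symm]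
          generalize Coalgebra.comul (R := k) b = s
          induction s with
          | zero => simp
          | tmul b c => simp [straightenSection_tmul, map_cons, hY]
          | add s t hs ht => simp only [map_add, TensorProduct.add_tmul, hs, ht]
      | add x y hx hy =>
        simp only [map_add, TensorProduct.tmul_add, add_sub_add_comm]
        exact add_mem hx hy
    | add s t hs ht =>
      simp only [map_add, TensorProduct.tmul_add, add_sub_add_comm]
      exact add_mem hs ht
  | add s t hs ht =>
    simp only [map_add, TensorProduct.add_tmul, add_sub_add_comm]
    exact add_mem hs ht

theorem sub_straightenSection_mem (hX : X.IsCrossedModule) (n : ℕ) (x : ⨂[k]^(n + 1) Γ) :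
    x - straightenSection ρ n (straighten X ρ (n + 1) x) ∈
      (modelCalculus X ϖ ρ).balanced (n + 1) := by
  induction n with
  | zero =>
    have : x - straightenSection ρ 0 (straighten X ρ 1 x) = 0 := by
      rw [sub_eq_zero]
      induction x using consEquiv_induction with
      | h γ x =>
        obtain ⟨γ, rfl⟩ := ρ.symm.surjective γ
        obtain ⟨r, rfl⟩ := (PiTensorProduct.isEmptyEquiv (R := k) (s := fun _ => Γ)
          (Fin 0)).symm.surjective x
        rw [straighten_cons]
        induction γ with
        | zero => simp
        | tmul a v =>
          rw [straighten, LinearMap.comp_apply, LinearEquiv.coe_coe, LinearEquiv.trans_apply,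
            LinearEquiv.apply_symm_apply, TensorProduct.mk_apply, straightenMul_tmul,
            Bialgebra.comul_one, Algebra.TensorProduct.one_def, LinearMap.lTensor_tmul,
            lmulA_tmul, mul_one, consAct_apply, hX.act_one, straightenSection_tmul]
          congr 2
          simp only [PiTensorProduct.isEmptyEquiv, LinearEquiv.coe_symm_mk', map_smul,
            PiTensorProduct.map_tprod]
          exact congr(r • PiTensorProduct.tprod k $(Subsingleton.elim _ _))
        | add s t hs ht => simp only [map_add, TensorProduct.add_tmul, ← hs, ← ht]
      | add x y hx hy => rw [map_add, map_add, ← hx, ← hy]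
    rw [this]
    exact Submodule.zero_mem _
  | succ n ih =>
    induction x using consEquiv_induction with
    | h γ x =>
      rw [straighten_cons]
      have h := add_mem (cons_mem_balanced γ (ih x)) (straightenSection_straightenMul X ϖ ρ n γ
        (straighten X ρ (n + 1) x))
      rwa [TensorProduct.tmul_sub, map_sub, sub_add_sub_cancel] at h
    | add x y hx hy =>
      rw [map_add, map_add, add_sub_add_comm]
      exact add_mem hx hy

theorem ker_straighten_le (hX : X.IsCrossedModule) (n : ℕ) :
    LinearMap.ker (straighten X ρ n) ≤ (modelCalculus X ϖ ρ).balanced n := by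
  intro x hx
  cases n with
  | zero =>
    have h := congr((TensorProduct.lid k _) ((Coalgebra.counit (R := k) (A := A)).rTensor _
      $(LinearMap.mem_ker.1 hx)))
    simp only [straighten, LinearMap.comp_apply, TensorProduct.mk_apply, LinearMap.rTensor_tmul,
      Bialgebra.counit_one, TensorProduct.lid_tmul, one_smul, map_zero, LinearEquiv.coe_coe,
      LinearEquiv.map_eq_zero_iff] at h
    rw [h]
    exact Submodule.zero_mem _
  | succ n =>
    have h := sub_straightenSection_mem X ϖ ρ hX n x
    rwa [LinearMap.mem_ker.1 hx, map_zero, sub_zero] at h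

end Straighten

/-! ### The braiding of Woronowicz in terms of the braiding of crossed modules -/

section TensorProducts

variable {k : Type u} [Field k] {M : Type v} [AddCommGroup M] [Module k M]
variable {B : Type w} [Ring B] [Algebra k B]

/-- `x₁ ⊗ ⋯ ⊗ xₙ ↦ f(x₁) ⋯ f(xₙ)`. -/
def tensorProd (f : M →ₗ[k] B) (n : ℕ) : (⨂[k]^n M) →ₗ[k] B :=
  (TensorAlgebra.lift k f).toLinearMap ∘ₗ TensorPower.toTensorAlgebra

theorem tensorProd_cons (f : M →ₗ[k] B) (n : ℕ) (m : M) (x : ⨂[k]^n M) :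
    tensorProd f (n + 1) (consEquiv k M n (m ⊗ₜ x)) = f m * tensorProd f n x := by
  simp [tensorProd, toTensorAlgebra_cons]

theorem tensorProd_zero (f : M →ₗ[k] B) (x : ⨂[k]^0 M) :
    tensorProd f 0 x = algebraMap k B (PiTensorProduct.isEmptyEquiv (Fin 0) x) := by
  simp [tensorProd, toTensorAlgebra_zero]

theorem tensorProd_ι_injective (n : ℕ) :
    Function.Injective (tensorProd (TensorAlgebra.ι k (M := M)) n) := by
  classical
  intro x y h
  have h1 : ∀ x : ⨂[k]^n M, TensorAlgebra.toDirectSum (tensorProd (TensorAlgebra.ι k) n x) =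
      DirectSum.of (fun n => ⨂[k]^n M) n x := fun x => by
    have h2 : TensorAlgebra.lift k (TensorAlgebra.ι k (M := M)) = AlgHom.id k _ :=
      TensorAlgebra.hom_ext (by ext; simp)
    rw [tensorProd, h2, ← TensorAlgebra.toDirectSum_ofDirectSum
      (DirectSum.of (fun n => ⨂[k]^n M) n x), ofDirectSum_of]
    rfl
  exact DirectSum.of_injective n ((h1 x).symm.trans ((congrArg _ h).trans (h1 y)))

end TensorProducts

section Cross

open WithConv

variable {k : Type u} {A : Type v} [Field k] [Ring A] [HopfAlgebra k A]
variable {V : Type w} [AddCommGroup V] [Module k V] {X : CrossedData k A V}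
variable {L : Type x} [Ring L] [Algebra k L] {j : V →ₗ[k] L}
variable (G : Generated X L j) (hX : X.IsCrossedModule)

namespace Boson

/-- `v ⊗ (y ⊗ b) ↦ y (v ◁ b)`. -/
def cross : V ⊗[k] (L ⊗[k] A) →ₗ[k] Boson G hX :=
  LinearMap.mul' k _ ∘ₗ TensorProduct.map (ofL G hX).toLinearMap
    ((ofL G hX).toLinearMap ∘ₗ j ∘ₗ X.act) ∘ₗ (TensorProduct.leftComm k V L A).toLinearMap

@[simp] theorem cross_tmul (v : V) (y : L) (b : A) : cross G hX (v ⊗ₜ (y ⊗ₜ b)) =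
    ofL G hX y * ofL G hX (j (X.act (v ⊗ₜ b))) := rfl

theorem cross_act (v : V) (c : A) (t : L ⊗[k] A) :
    cross G hX (v ⊗ₜ ((1 ⊗ₜ c) * t)) = cross G hX (X.act (v ⊗ₜ c) ⊗ₜ t) := by
  induction t with
  | zero => simp
  | tmul y b => simp [hX.act_mul]
  | add s t hs ht => simp only [mul_add, TensorProduct.tmul_add, map_add, hs, ht]

theorem cross_mul_ofA (v : V) (t : L ⊗[k] A) (c : A) : cross G hX (v ⊗ₜ t) * ofA G hX c =
    (convA G hX * toConv (cross G hX ∘ₗ TensorProduct.mk k V _ v ∘ₗ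
      (Generated.actLeft G.β t * Conv.incl L).ofConv) : Conv k A (Boson G hX)) c := by
  induction t with
  | zero => simp
  | tmul y b =>
    have h : toConv (cross G hX ∘ₗ TensorProduct.mk k V _ v ∘ₗ
        (Generated.actLeft G.β (y ⊗ₜ b) * Conv.incl L).ofConv) =
        (Conv.post (ofL G hX) (G.β y) * Conv.post (ofL G hX) (G.β (j (X.act (v ⊗ₜ b)))) :
          Conv k A (Boson G hX)) := Conv.ext' fun c => by
      rw [LinearMap.convMul_apply]
      simp only [LinearMap.comp_apply, LinearMap.convMul_apply]
      generalize Coalgebra.comul (R := k) c = s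
      induction s with
      | zero => simp
      | tmul a c => simp [Generated.actLeft_tmul, G.β_gen, hX.act_mul]
      | add s t hs ht => simp only [map_add, hs, ht]
    rw [h, ← mul_assoc, ← const_mul_convA, mul_assoc, ← const_mul_convA, Conv.const_mul_apply,
      Conv.const_mul_apply, cross_tmul, convA_apply, mul_assoc]
  | add s t hs ht =>
    rw [TensorProduct.tmul_add, map_add, add_mul, hs, ht, ← LinearMap.add_apply, ← ofConv_add,
      ← mul_add]
    congr 3
    rw [map_add, add_mul, ofConv_add, LinearMap.comp_add, LinearMap.comp_add, toConv_add]

/-- `c ⊗ x ↦ c₁ x₀ ((v ◁ c₂) ◁ x₁)`. -/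
def crossAct (v : V) : A ⊗[k] L →ₗ[k] Boson G hX :=
  (LinearMap.mul' k _ ∘ₗ TensorProduct.map (ofA G hX).toLinearMap
    (cross G hX ∘ₗ TensorProduct.map (TensorProduct.curry X.act v) G.α.toLinearMap)) ∘ₗ
    (TensorProduct.assoc k A A L).toLinearMap ∘ₗ (Coalgebra.comul (R := k) (A := A)).rTensor L

/-- `crossAct` as a function of the coproduct of its first argument. -/
def crossSum (v : V) (x : L) : A ⊗[k] A →ₗ[k] Boson G hX :=
  LinearMap.mul' k _ ∘ₗ TensorProduct.map (ofA G hX).toLinearMap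
    (cross G hX ∘ₗ (TensorProduct.mk k V _).flip (G.α x) ∘ₗ TensorProduct.curry X.act v)

@[simp] theorem crossSum_tmul (v : V) (x : L) (b c : A) : crossSum G hX v x (b ⊗ₜ c) =
    ofA G hX b * cross G hX (X.act (v ⊗ₜ c) ⊗ₜ G.α x) := rfl

theorem crossAct_tmul (v : V) (c : A) (x : L) :
    crossAct G hX v (c ⊗ₜ x) = crossSum G hX v x (Coalgebra.comul (R := k) c) := by
  simp only [crossAct, LinearMap.comp_apply, LinearMap.rTensor_tmul]
  generalize Coalgebra.comul (R := k) c = s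
  induction s with
  | zero => simp
  | tmul a c => simp
  | add s t hs ht => simp only [map_add, TensorProduct.add_tmul, hs, ht]

theorem cross_α_mul_ofA (v : V) (x : L) (c : A) : cross G hX (v ⊗ₜ G.α x) * ofA G hX c =
    crossAct G hX v ((G.β x).ofConv.lTensor A (Coalgebra.comul (R := k) c)) := by
  rw [cross_mul_ofA, ← G.incl_mul_post_α_β hX, LinearMap.convMul_apply]
  let Φ : A ⊗[k] (A ⊗[k] A) →ₗ[k] Boson G hX :=
    LinearMap.mul' k _ ∘ₗ TensorProduct.map (ofA G hX).toLinearMap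
      (cross G hX ∘ₗ TensorProduct.map (TensorProduct.curry X.act v)
        (G.α.toLinearMap ∘ₗ (G.β x).ofConv))
  have h1 : ∀ s : A ⊗[k] A, crossAct G hX v ((G.β x).ofConv.lTensor A s) =
      Φ (TensorProduct.assoc k A A A ((Coalgebra.comul (R := k) (A := A)).rTensor A s)) := by
    intro s
    induction s with
    | zero => simp
    | tmul b c =>
      rw [LinearMap.lTensor_tmul, crossAct_tmul, LinearMap.rTensor_tmul]
      generalize Coalgebra.comul (R := k) b = t
      induction t with
      | zero => simp
      | tmul a c => simp [Φ]
      | add s t hs ht => simp only [map_add, TensorProduct.add_tmul, hs, ht]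
    | add s t hs ht => simp only [map_add, hs, ht]
  rw [h1, Coalgebra.coassoc_apply]
  generalize Coalgebra.comul (R := k) c = s
  induction s with
  | zero => simp
  | tmul b c =>
    simp only [TensorProduct.map_tmul, LinearMap.mul'_apply, convA_apply,
      LinearMap.comp_apply, LinearMap.convMul_apply, LinearMap.lTensor_tmul]
    generalize Coalgebra.comul (R := k) c = t
    induction t with
    | zero => simp
    | tmul a c => simp [Φ, cross_act]
    | add s t hs ht => simp only [map_add, mul_add, TensorProduct.tmul_add, hs, ht]
  | add s t hs ht => simp only [map_add, hs, ht]

theorem crossAct_mul_ofA (v : V) (x : L) (b c : A) :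
    crossAct G hX v (b ⊗ₜ x) * ofA G hX c =
      crossAct G hX v (lmulA L b ((G.β x).ofConv.lTensor A (Coalgebra.comul (R := k) c))) := by
  have h1 : ∀ (s : A ⊗[k] A), crossSum G hX v x s * ofA G hX c = LinearMap.mul' k _
      (TensorProduct.map (ofA G hX).toLinearMap
        (LinearMap.mulRight k (ofA G hX c) ∘ₗ cross G hX ∘ₗ
          (TensorProduct.mk k V _).flip (G.α x) ∘ₗ TensorProduct.curry X.act v) s) := by
    intro s
    induction s with
    | zero => simp
    | tmul b c => simp [mul_assoc]
    | add s t hs ht => simp only [map_add, add_mul, hs, ht]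
  obtain ⟨W, hW⟩ : ∃ W : A ⊗[k] L →ₗ[k] A →ₗ[k] Boson G hX,
      ∀ t c, W t c = crossAct G hX (X.act (v ⊗ₜ c)) t :=
    ⟨LinearMap.mk₂ k (fun t c => crossAct G hX (X.act (v ⊗ₜ c)) t)
      (fun t t' c => map_add _ _ _) (fun r t c => map_smul _ _ _)
      (fun t c c' => by simp [crossAct, TensorProduct.map_add_left, TensorProduct.tmul_add,
        LinearMap.comp_add, TensorProduct.map_add_right, LinearMap.add_comp])
      (fun r t c => by simp [crossAct, TensorProduct.map_smul_left, LinearMap.comp_smul,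
        TensorProduct.map_smul_right, LinearMap.smul_comp]), fun _ _ => rfl⟩
  have h2 : ∀ (t : A ⊗[k] L), crossAct G hX v (lmulA L b t) = LinearMap.mul' k _
      (TensorProduct.map (ofA G hX).toLinearMap (W t) (Coalgebra.comul (R := k) b)) := by
    intro t
    induction t with
    | zero => simp
    | tmul c y =>
      rw [lmulA_tmul, crossAct_tmul, Bialgebra.comul_mul]
      generalize Coalgebra.comul (R := k) b = s
      induction s with
      | zero => simp
      | tmul b b' =>
        simp only [TensorProduct.map_tmul, LinearMap.mul'_apply, hW, crossAct_tmul]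
        generalize Coalgebra.comul (R := k) c = t
        induction t with
        | zero => simp
        | tmul c c' => simp [hX.act_mul, mul_assoc]
        | add s t hs ht => simp only [map_add, mul_add, hs, ht]
      | add s t hs ht => simp only [map_add, add_mul, hs, ht]
    | add s t hs ht =>
      simp only [map_add, hs, ht]
      rw [TensorProduct.map_add_right]
      simp
  rw [crossAct_tmul, h1, h2]
  refine congrArg (fun f => LinearMap.mul' k _ (TensorProduct.map _ f _))
    (LinearMap.ext fun a => ?_)
  simp [cross_α_mul_ofA, hW]

end Boson

section Products

variable (ϖ : Aug k A →ₗ[k] V)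
variable {Γ : Type*} [AddCommGroup Γ] [Module k Γ] (ρ : Γ ≃ₗ[k] A ⊗[k] V)

theorem equiv_straightenMul (n : ℕ) (γ : Γ) (z : A ⊗[k] (⨂[k]^n V)) :
    Boson.equiv G hX ((tensorProd j (n + 1)).lTensor A (straightenMul X ρ n (γ ⊗ₜ z))) =
      toBoson X ρ G hX γ * Boson.equiv G hX ((tensorProd j n).lTensor A z) := by
  obtain ⟨γ, rfl⟩ := ρ.symm.surjective γ
  induction γ with
  | zero => simp
  | tmul a v =>
    induction z with
    | zero => simp
    | tmul b y =>
      have h1 := congr($(Boson.const_mul_convA (G := G) (hX := hX) (j v)) b)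
      rw [Conv.const_mul_apply, LinearMap.convMul_apply, Boson.convA_apply] at h1
      rw [straightenMul_tmul, toBoson_symm, LinearMap.lTensor_tmul, ← Boson.ofA_mul_ofL,
        ← mul_assoc, mul_assoc _ _ (Boson.ofA G hX b), h1]
      generalize Coalgebra.comul (R := k) b = s
      induction s with
      | zero => simp
      | tmul b c => simp [tensorProd_cons, ← Boson.ofA_mul_ofL, G.β_gen, mul_assoc]
      | add s t hs ht => simp only [map_add, mul_add, add_mul, hs, ht]
    | add s t hs ht => simp only [map_add, TensorProduct.tmul_add, mul_add, hs, ht]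
  | add s t hs ht => simp only [map_add, TensorProduct.add_tmul, add_mul, hs, ht]

theorem tensorProd_toBoson (n : ℕ) (x : ⨂[k]^n Γ) : tensorProd (toBoson X ρ G hX) n x =
    Boson.equiv G hX ((tensorProd j n).lTensor A (straighten X ρ n x)) := by
  induction n with
  | zero =>
    rw [tensorProd_zero, straighten, LinearMap.comp_apply, TensorProduct.mk_apply,
      LinearMap.lTensor_tmul, tensorProd_zero, ← Boson.ofL_apply, AlgHom.commutes]
    simp
  | succ n ih =>
    induction x using consEquiv_induction with
    | h γ x => rw [tensorProd_cons, straighten_cons, equiv_straightenMul, ih]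
    | add x y hx hy => simp only [map_add, hx, hy]

theorem toBoson_projL (a : A) (v : V) : toBoson X ρ G hX
    ((modelCalculus X ϖ ρ).projL (ρ.symm (a ⊗ₜ v))) =
      Coalgebra.counit (R := k) a • Boson.ofL G hX (j v) := by
  have h := HopfAlgebra.mul_antipode_rTensor_comul_apply (R := k) a
  have h1 : ∀ s : A ⊗[k] A, toBoson X ρ G hX ((modelCalculus X ϖ ρ).lact
      ((HopfAlgebra.antipode k).rTensor Γ (ρ.symm.toLinearMap.lTensor A
        (TensorProduct.assoc k A A V (s ⊗ₜ v))))) =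
      Boson.ofA G hX (LinearMap.mul' k A ((HopfAlgebra.antipode k).rTensor A s)) *
        Boson.ofL G hX (j v) := by
    intro s
    induction s with
    | zero => simp
    | tmul b c => simp [toBoson_lact, toBoson_symm, mul_assoc]
    | add s t hs ht => simp only [map_add, TensorProduct.add_tmul, add_mul, hs, ht]
  have h2 := h1 (Coalgebra.comul (R := k) a)
  rw [h, AlgHom.commutes, ← Algebra.smul_def] at h2
  rw [← h2]
  simp [CalculusData.projL, modelCalculus]

theorem toBoson_projR (hC : (modelCalculus X ϖ ρ).IsBicovariant) (f : Conv k A (Boson G hX))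
    (γ : Γ) : LinearMap.mul' k _ (TensorProduct.map
      (toBoson X ρ G hX ∘ₗ (modelCalculus X ϖ ρ).projR) (Boson.convA G hX * f).ofConv
        ((modelCalculus X ϖ ρ).coR γ)) =
      LinearMap.mul' k _ (TensorProduct.map (toBoson X ρ G hX) f.ofConv
        ((modelCalculus X ϖ ρ).coR γ)) := by
  set i := toBoson X ρ G hX with hi
  set c := (modelCalculus X ϖ ρ).coR with hc
  let m : Γ ⊗[k] Boson G hX →ₗ[k] Boson G hX := LinearMap.mul' k _ ∘ₗ i.rTensor _
  let g : Conv k A (Boson G hX) := toConv ((Boson.ofA G hX).toLinearMap ∘ₗ HopfAlgebra.antipode k)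
  have hg : g * Boson.convA G hX = 1 := Conv.ext' fun a => by
    have h := congr(Boson.ofA G hX $(HopfAlgebra.mul_antipode_rTensor_comul_apply (R := k) a))
    rw [AlgHom.commutes] at h
    rw [LinearMap.convMul_apply]
    refine Eq.trans ?_ h
    generalize Coalgebra.comul (R := k) a = s
    induction s with
    | zero => simp
    | tmul b c => simp [g]
    | add s t hs ht => simp only [map_add, hs, ht]
  have h1 : ∀ (f : Conv k A (Boson G hX)) (γ : Γ) (b : Boson G hX),
      m (Conv.coOpₗ c f (γ ⊗ₜ b)) =
        LinearMap.mul' k _ (TensorProduct.map i f.ofConv (c γ)) * b := by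
    intro f γ b
    rw [Conv.coOpₗ_tmul]
    generalize c γ = s
    induction s with
    | zero => simp
    | tmul b c => simp [m, mul_assoc]
    | add s t hs ht => simp only [map_add, add_mul, hs, ht]
  have h2 : ∀ γ, i ((modelCalculus X ϖ ρ).projR γ) =
      LinearMap.mul' k _ (TensorProduct.map i g.ofConv (c γ)) := by
    intro γ
    simp only [CalculusData.projR, LinearMap.comp_apply, ← hc]
    generalize c γ = s
    induction s with
    | zero => simp
    | tmul b c => simp [g, toBoson_ract, hi]
    | add s t hs ht => simp only [map_add, hs, ht]
  have h3 : ∀ t : Γ ⊗[k] A, LinearMap.mul' k _ (TensorProduct.map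
      (i ∘ₗ (modelCalculus X ϖ ρ).projR) (Boson.convA G hX * f).ofConv t) =
      m (Conv.coOpₗ c g (Conv.fill (Boson.convA G hX * f) 1 t)) := by
    intro t
    induction t with
    | zero => simp
    | tmul γ a =>
      rw [Conv.fill_tmul, h1, mul_one, ← h2]
      rfl
    | add s t hs ht => simp only [map_add, hs, ht]
  rw [h3, ← Conv.coOpₗ_tmul, ← Module.End.mul_apply, ← Conv.coOpₗ_mul c hC.coR_coassoc,
    ← mul_assoc, hg, one_mul, h1, mul_one]

theorem toBoson_braiding (hC : (modelCalculus X ϖ ρ).IsBicovariant) (a b : A) (v w : V) :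
    LinearMap.mul' k _ (TensorProduct.map (toBoson X ρ G hX) (toBoson X ρ G hX)
      ((modelCalculus X ϖ ρ).braiding (ρ.symm (a ⊗ₜ v) ⊗ₜ ρ.symm (b ⊗ₜ w)))) =
      Boson.ofA G hX a * Boson.crossAct G hX v (b ⊗ₜ j w) := by
  set i := toBoson X ρ G hX with hi
  set C := modelCalculus X ϖ ρ with hCdef
  have h1 : ∀ (t : Γ ⊗[k] A), LinearMap.mul' k _ (TensorProduct.map i i
      (TensorProduct.map (C.lact ∘ₗ C.projR.lTensor A) (C.ract ∘ₗ C.projL.rTensor A)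
        (TensorProduct.tensorTensorTensorComm k A Γ Γ A (C.coL (ρ.symm (a ⊗ₜ v)) ⊗ₜ t)))) =
      Boson.ofA G hX a * LinearMap.mul' k _ (TensorProduct.map (i ∘ₗ C.projR)
        (Boson.convA G hX * Conv.post (Boson.ofL G hX) (G.β (j v))).ofConv t) := by
    intro t
    have h2 : C.coL (ρ.symm (a ⊗ₜ v)) = ρ.symm.toLinearMap.lTensor A
        (TensorProduct.assoc k A A V (Coalgebra.comul (R := k) a ⊗ₜ v)) := by
      simp [hCdef, modelCalculus]
    induction t with
    | zero => simp
    | tmul γ c =>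
      have h3 : ∀ s : A ⊗[k] A, LinearMap.mul' k _ (TensorProduct.map i i
          (TensorProduct.map (C.lact ∘ₗ C.projR.lTensor A) (C.ract ∘ₗ C.projL.rTensor A)
            (TensorProduct.tensorTensorTensorComm k A Γ Γ A (ρ.symm.toLinearMap.lTensor A
              (TensorProduct.assoc k A A V (s ⊗ₜ v)) ⊗ₜ (γ ⊗ₜ c))))) =
          Boson.ofA G hX (TensorProduct.rid k A
            ((Coalgebra.counit (R := k) (A := A)).lTensor A s)) *
          (i (C.projR γ) * (Boson.ofL G hX (j v) * Boson.ofA G hX c)) := by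
        intro s
        induction s with
        | zero => simp
        | tmul b b' => simp [hCdef, hi, toBoson_lact, toBoson_ract, toBoson_projL, mul_assoc]
        | add s t hs ht => simp only [map_add, TensorProduct.add_tmul, add_mul, hs, ht]
      have h4 := congr($(Boson.const_mul_convA (G := G) (hX := hX) (j v)) c)
      rw [Conv.const_mul_apply, Boson.convA_apply] at h4
      rw [h2, h3, Coalgebra.lTensor_counit_comul, h4]
      simp
    | add s t hs ht => simp only [map_add, TensorProduct.tmul_add, mul_add, hs, ht]
  rw [CalculusData.braiding, LinearMap.comp_apply, LinearMap.comp_apply, TensorProduct.map_tmul,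
    LinearEquiv.coe_coe, h1, toBoson_projR G hX ϖ ρ hC]
  congr 1
  rw [Boson.crossAct_tmul]
  have h5 : C.coR (ρ.symm (b ⊗ₜ w)) = ρ.symm.toLinearMap.rTensor A
      ((LinearMap.mul' k A).lTensor (A ⊗[k] V) (TensorProduct.tensorTensorTensorComm k A A V A
        (Coalgebra.comul (R := k) b ⊗ₜ X.coact w))) := by
    simp [hCdef, modelCalculus]
  rw [h5]
  generalize Coalgebra.comul (R := k) b = s
  induction s with
  | zero => simp
  | tmul b c =>
    rw [Boson.crossSum_tmul, G.α_gen]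
    generalize X.coact w = t
    induction t with
    | zero => simp
    | tmul w a => simp [toBoson_symm, G.β_gen, hX.act_mul, mul_assoc]
    | add s t hs ht => simp only [map_add, TensorProduct.tmul_add, mul_add, hs, ht]
  | add s t hs ht => simp only [map_add, TensorProduct.add_tmul, hs, ht]

theorem cross_braiding (v w : V) : Boson.cross G hX (v ⊗ₜ G.α (j w)) =
    LinearMap.mul' k _ (TensorProduct.map ((Boson.ofL G hX).toLinearMap ∘ₗ j)
      ((Boson.ofL G hX).toLinearMap ∘ₗ j) (X.braiding X (v ⊗ₜ w))) := by
  rw [G.α_gen]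
  simp only [CrossedData.braiding, LinearMap.comp_apply, LinearMap.lTensor_tmul]
  generalize X.coact w = t
  induction t with
  | zero => simp
  | tmul w a => simp
  | add s t hs ht => simp only [map_add, TensorProduct.tmul_add, hs, ht]

theorem tensorProd_braidFirst {M : Type*} [AddCommGroup M] [Module k M] {B : Type*} [Ring B]
    [Algebra k B] (f : M →ₗ[k] B) (Ψ : M ⊗[k] M →ₗ[k] M ⊗[k] M) (n : ℕ) (v w : M)
    (y : ⨂[k]^n M) : tensorProd f (n + 2) (braidFirst Ψ n
      (consEquiv k M (n + 1) (v ⊗ₜ consEquiv k M n (w ⊗ₜ y)))) =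
      LinearMap.mul' k B (TensorProduct.map f f (Ψ (v ⊗ₜ w))) * tensorProd f n y := by
  rw [braidFirst_cons]
  generalize Ψ (v ⊗ₜ w) = s
  induction s with
  | zero => simp
  | tmul v w => simp [tensorProd_cons, mul_assoc]
  | add s t hs ht => simp only [map_add, TensorProduct.add_tmul, add_mul, hs, ht]

theorem equiv_braidFirst_straightenMul (n : ℕ) (a : A) (v : V) (z : A ⊗[k] V) (y : ⨂[k]^n V) :
    Boson.equiv G hX ((tensorProd j (n + 2)).lTensor A ((braidFirst (X.braiding X) n).lTensor A
      (straightenMul X ρ (n + 1) (ρ.symm (a ⊗ₜ v) ⊗ₜ ((consEquiv k V n).toLinearMap ∘ₗ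
        (TensorProduct.mk k V _).flip y).lTensor A z)))) =
      Boson.ofA G hX a * Boson.crossAct G hX v (j.lTensor A z) *
        Boson.ofL G hX (tensorProd j n y) := by
  induction z with
  | zero => simp
  | tmul b w =>
    rw [LinearMap.lTensor_tmul, straightenMul_tmul, LinearMap.lTensor_tmul, Boson.crossAct_tmul]
    generalize Coalgebra.comul (R := k) b = s
    induction s with
    | zero => simp
    | tmul b c =>
      rw [LinearMap.lTensor_tmul, lmulA_tmul, LinearMap.lTensor_tmul, LinearMap.lTensor_tmul,
        consAct_apply, LinearMap.comp_apply, LinearMap.flip_apply, TensorProduct.mk_apply,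
        LinearEquiv.coe_coe, tensorProd_braidFirst, ← Boson.ofA_mul_ofL, Boson.crossSum_tmul,
        cross_braiding, map_mul, map_mul]
      have h : ∀ s : V ⊗[k] V, Boson.ofL G hX (LinearMap.mul' k L (TensorProduct.map j j s)) =
          LinearMap.mul' k _ (TensorProduct.map ((Boson.ofL G hX).toLinearMap ∘ₗ j)
            ((Boson.ofL G hX).toLinearMap ∘ₗ j) s) := by
        intro s
        induction s with
        | zero => simp
        | tmul v w => simp
        | add s t hs ht => simp only [map_add, hs, ht]
      rw [h]
      simp only [mul_assoc]
    | add s t hs ht => simp only [map_add, mul_add, add_mul, hs, ht]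
  | add s t hs ht => simp only [map_add, TensorProduct.tmul_add, mul_add, add_mul, hs, ht]

theorem tensorProd_toBoson_braidFirst (hC : (modelCalculus X ϖ ρ).IsBicovariant) (n : ℕ)
    (x : ⨂[k]^(n + 2) Γ) :
    tensorProd (toBoson X ρ G hX) (n + 2) (braidFirst (modelCalculus X ϖ ρ).braiding n x) =
      Boson.equiv G hX ((tensorProd j (n + 2)).lTensor A ((braidFirst (X.braiding X) n).lTensor A
        (straighten X ρ (n + 2) x))) := by
  induction x using consEquiv_induction with
  | h γ x =>
    induction x using consEquiv_induction with
    | h γ' x =>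
      rw [tensorProd_braidFirst, straighten_cons, straighten_cons, tensorProd_toBoson]
      generalize straighten X ρ n x = z
      obtain ⟨γ, rfl⟩ := ρ.symm.surjective γ
      obtain ⟨γ', rfl⟩ := ρ.symm.surjective γ'
      induction γ with
      | zero => simp
      | tmul a v =>
        induction γ' with
        | zero => simp
        | tmul b w =>
          induction z with
          | zero => simp
          | tmul c y =>
            have h1 : lmulA _ b ((consAct X w y).lTensor A (Coalgebra.comul (R := k) c)) =
                ((consEquiv k V n).toLinearMap ∘ₗ (TensorProduct.mk k V _).flip y).lTensor A
                  (lmulA V b ((TensorProduct.curry X.act w).lTensor A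
                    (Coalgebra.comul (R := k) c))) := by
              generalize Coalgebra.comul (R := k) c = s
              induction s with
              | zero => simp
              | tmul b c => simp
              | add s t hs ht => simp only [map_add, hs, ht]
            have h2 : j.lTensor A (lmulA V b ((TensorProduct.curry X.act w).lTensor A
                (Coalgebra.comul (R := k) c))) =
                lmulA L b ((G.β (j w)).ofConv.lTensor A (Coalgebra.comul (R := k) c)) := by
              generalize Coalgebra.comul (R := k) c = s
              induction s with
              | zero => simp
              | tmul b c => simp [G.β_gen]
              | add s t hs ht => simp only [map_add, hs, ht]
            rw [toBoson_braiding G hX ϖ ρ hC, straightenMul_tmul, h1,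
              equiv_braidFirst_straightenMul G hX ρ n a v, h2, ← Boson.crossAct_mul_ofA,
              LinearMap.lTensor_tmul, ← Boson.ofA_mul_ofL]
            simp only [mul_assoc]
          | add s t hs ht => simp only [map_add, TensorProduct.tmul_add, mul_add, hs, ht]
        | add s t hs ht =>
          simp only [map_add, TensorProduct.tmul_add, TensorProduct.add_tmul, add_mul, hs, ht]
      | add s t hs ht => simp only [map_add, TensorProduct.add_tmul, add_mul, hs, ht]
    | add x y hx hy => simp only [map_add, TensorProduct.tmul_add, hx, hy]
  | add x y hx hy => simp only [map_add, hx, hy]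

end Products

end Cross

/-! ### Antisymmetrisers and braided factorials -/

section Braid

variable {k : Type u} {A : Type v} [Field k] [Ring A] [HopfAlgebra k A]
variable {V : Type w} [AddCommGroup V] [Module k V] {X : CrossedData k A V}
variable (ϖ : Aug k A →ₗ[k] V)
variable {Γ : Type*} [AddCommGroup Γ] [Module k Γ] (ρ : Γ ≃ₗ[k] A ⊗[k] V)

theorem straighten_eq_iff (hX : X.IsCrossedModule) {n : ℕ} {x : ⨂[k]^n Γ} {z : A ⊗[k] (⨂[k]^n V)} :
    straighten X ρ n x = z ↔ tensorProd (toBoson X ρ (tensorGenerated X) hX) n x =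
      Boson.equiv (tensorGenerated X) hX ((tensorProd (TensorAlgebra.ι k) n).lTensor A z) := by
  rw [tensorProd_toBoson, EmbeddingLike.apply_eq_iff_eq]
  exact (Module.Flat.lTensor_preserves_injective_linearMap _
    (tensorProd_ι_injective n)).eq_iff.symm

theorem straighten_braidAt (hX : X.IsCrossedModule) (hC : (modelCalculus X ϖ ρ).IsBicovariant) :
    ∀ (n i : ℕ) (x : ⨂[k]^n Γ), straighten X ρ n (braidAt (modelCalculus X ϖ ρ).braiding n i x) =
      (braidAt (X.braiding X) n i).lTensor A (straighten X ρ n x)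
  | 0, _, x => congr($((LinearMap.lTensor_id A (⨂[k]^0 V)).symm) (straighten X ρ 0 x))
  | 1, _, x => congr($((LinearMap.lTensor_id A (⨂[k]^1 V)).symm) (straighten X ρ 1 x))
  | n + 2, 0, x =>
    (straighten_eq_iff ρ hX).2 (tensorProd_toBoson_braidFirst (tensorGenerated X) hX ϖ ρ hC n x)
  | n + 2, i + 1, x => by
    induction x using consEquiv_induction with
    | h γ x =>
      rw [braidAt_succ_succ, braidAt_succ_succ, idTensor_cons, straighten_cons, straighten_cons,
        straighten_braidAt hX hC (n + 1) i x, idTensor_straightenMul]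
    | add x y hx hy => simp only [map_add, hx, hy]

theorem straighten_antisymmetriser (hX : X.IsCrossedModule)
    (hC : (modelCalculus X ϖ ρ).IsBicovariant) (n : ℕ) (x : ⨂[k]^n Γ) :
    straighten X ρ n (antisymmetriser (modelCalculus X ϖ ρ).braiding n x) =
      (braidedFactorial (-(X.braiding X)) n).lTensor A (straighten X ρ n x) := by
  have h : ∀ (l : List ℕ) (x : ⨂[k]^n Γ),
      straighten X ρ n ((l.map (braidAt (modelCalculus X ϖ ρ).braiding n)).prod x) =
        ((l.map (braidAt (X.braiding X) n)).prod).lTensor A (straighten X ρ n x) := by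
    intro l
    induction l with
    | nil => exact fun x => congr($((LinearMap.lTensor_id A _).symm) (straighten X ρ n x))
    | cons i l ih =>
      intro x
      rw [List.map_cons, List.prod_cons, Module.End.mul_apply, straighten_braidAt ϖ ρ hX hC, ih,
        List.map_cons, List.prod_cons, Module.End.mul_eq_comp, LinearMap.lTensor_comp,
        LinearMap.comp_apply]
  rw [← antisymmetriser_eq_braidedFactorial, antisymmetriser, antisymmetriser,
    ← LinearMap.coe_lTensorHom, LinearMap.sum_apply, map_sum, map_sum, LinearMap.sum_apply]
  refine Finset.sum_congr rfl fun p _ => ?_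
  refine (map_zsmul (straighten X ρ n) _ _).trans ?_
  rw [h, map_zsmul]
  rfl

theorem mem_balanced_iff (hX : X.IsCrossedModule) {n : ℕ} {x : ⨂[k]^n Γ} :
    x ∈ (modelCalculus X ϖ ρ).balanced n ↔ straighten X ρ n x = 0 := by
  refine ⟨fun hx => ?_, fun hx => ker_straighten_le X ϖ ρ hX n hx⟩
  refine balanced_le (p := fun n => LinearMap.ker (straighten X ρ n)) ?_ ?_ n hx
  · intro n γ x hx
    rw [LinearMap.mem_ker] at hx ⊢
    rw [straighten_cons, hx, TensorProduct.tmul_zero, map_zero]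
  · intro n γ γ' a y
    rw [LinearMap.mem_ker, straighten_eq_iff ρ hX, map_zero, map_zero, map_sub, sub_eq_zero]
    simp only [tensorProd_cons, toBoson_ract, toBoson_lact, mul_assoc]

theorem braidAt_mem_balanced (hX : X.IsCrossedModule)
    (hC : (modelCalculus X ϖ ρ).IsBicovariant) (n i : ℕ) :
    (modelCalculus X ϖ ρ).balanced n ≤
      ((modelCalculus X ϖ ρ).balanced n).comap (braidAt (modelCalculus X ϖ ρ).braiding n i) := by
  intro x hx
  rw [mem_balanced_iff ϖ ρ hX] at hx
  rw [Submodule.mem_comap, mem_balanced_iff ϖ ρ hX, straighten_braidAt ϖ ρ hX hC, hx, map_zero]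

theorem tensorProd_BMinus_eq_zero_iff (hX : X.IsCrossedModule) (n : ℕ) (x : ⨂[k]^n V) :
    tensorProd (BMinus.ι (X.braiding X)) n x = 0 ↔
      braidedFactorial (-(X.braiding X)) n x = 0 := by
  rw [← BMinus.mk_toTensorAlgebra_eq_zero hX n x]
  have h : TensorAlgebra.lift k (BMinus.ι (X.braiding X)) = BMinus.mk (X.braiding X) :=
    TensorAlgebra.hom_ext (by ext; simp [BMinus.ι])
  rw [tensorProd, h]
  rfl

theorem antisymmetriser_mem_balanced_iff (hX : X.IsCrossedModule)
    (hC : (modelCalculus X ϖ ρ).IsBicovariant)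
    (G : Generated X (BMinus (X.braiding X)) (BMinus.ι (X.braiding X))) (n : ℕ) (x : ⨂[k]^n Γ) :
    antisymmetriser (modelCalculus X ϖ ρ).braiding n x ∈ (modelCalculus X ϖ ρ).balanced n ↔
      tensorProd (toBoson X ρ G hX) n x = 0 := by
  rw [mem_balanced_iff ϖ ρ hX, straighten_antisymmetriser ϖ ρ hX hC, tensorProd_toBoson,
    (Boson.equiv G hX).map_eq_zero_iff]
  constructor <;> intro h
  · exact lTensor_eq_zero_of_family (f := fun _ : Unit => braidedFactorial (-(X.braiding X)) n)
      (fun x hx => (tensorProd_BMinus_eq_zero_iff hX n x).2 (hx ())) fun _ => h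
  · exact lTensor_eq_zero_of_family (f := fun _ : Unit => tensorProd (BMinus.ι (X.braiding X)) n)
      (fun x hx => (tensorProd_BMinus_eq_zero_iff hX n x).1 (hx ())) fun _ => h

end Braid

/-! ### The exterior algebra of Woronowicz as a bosonisation -/

section TensorProducts

variable {k : Type u} [Field k] {M : Type v} [AddCommGroup M] [Module k M]
variable {B : Type w} [Ring B] [Algebra k B]

theorem map_tensorProd {B' : Type*} [Ring B'] [Algebra k B'] (g : B →ₐ[k] B') (f : M →ₗ[k] B)
    (n : ℕ) (x : ⨂[k]^n M) : g (tensorProd f n x) = tensorProd (g.toLinearMap ∘ₗ f) n x := by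
  have h : g.comp (TensorAlgebra.lift k f) = TensorAlgebra.lift k (g.toLinearMap ∘ₗ f) :=
    TensorAlgebra.hom_ext (by ext; simp)
  exact congr($h _)

theorem tensorProd_map {N : Type*} [AddCommGroup N] [Module k N] (f : M →ₗ[k] B) (g : N →ₗ[k] M)
    (n : ℕ) (x : ⨂[k]^n N) : tensorProd f n (PiTensorProduct.map (fun _ => g) x) =
      tensorProd (f ∘ₗ g) n x := by
  induction x using PiTensorProduct.induction_on with
  | smul_tprod r y => simp [tensorProd, TensorPower.toTensorAlgebra_tprod,
      TensorAlgebra.tprod_apply, map_list_prod, List.map_ofFn, Function.comp_def]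
  | add x y hx hy => simp only [map_add, hx, hy]

end TensorProducts

namespace CalculusData.Ext

variable {k : Type u} {A : Type v} [Field k] [Ring A] [HopfAlgebra k A]
variable {Γ : Type w} [AddCommGroup Γ] [Module k Γ] (C : CalculusData k A Γ)

theorem ofA_one : ofA C 1 = 1 := (RingQuot.mkAlgHom_rel k ExtRel.one).trans (map_one _)

theorem ofA_mul (a b : A) : ofA C (a * b) = ofA C a * ofA C b :=
  (RingQuot.mkAlgHom_rel k (ExtRel.mul a b)).symm.trans (map_mul _ _ _)

theorem ofΓ_lact (a : A) (γ : Γ) : ofΓ C (C.lact (a ⊗ₜ γ)) = ofA C a * ofΓ C γ :=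
  (RingQuot.mkAlgHom_rel k (ExtRel.lact a γ)).symm.trans (map_mul _ _ _)

theorem ofΓ_ract (γ : Γ) (a : A) : ofΓ C (C.ract (γ ⊗ₜ a)) = ofΓ C γ * ofA C a :=
  (RingQuot.mkAlgHom_rel k (ExtRel.ract γ a)).symm.trans (map_mul _ _ _)

/-- `A → Γ^∧` as an algebra map. -/
def algOfA : A →ₐ[k] C.Ext := AlgHom.ofLinearMap (ofA C) (ofA_one C) (ofA_mul C)

theorem ofTensors_eq (n : ℕ) (x : ⨂[k]^n Γ) : ofTensors C n x = tensorProd (ofΓ C) n x := by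
  have h : TensorAlgebra.lift k (TensorAlgebra.ι k (M := A × Γ)) = AlgHom.id k _ :=
    TensorAlgebra.hom_ext (by ext <;> simp)
  have h1 : ofTensors C n x = RingQuot.mkAlgHom k C.ExtRel
      (tensorProd (TensorAlgebra.ι k) n
        (PiTensorProduct.map (fun _ => LinearMap.inr k A Γ) x)) := by
    rw [tensorProd, h]
    rfl
  rw [h1, tensorProd_map, map_tensorProd]
  rfl

variable {C} in
theorem algHom_ext {R : Type*} [Ring R] [Algebra k R] {f g : C.Ext →ₐ[k] R}
    (hA : ∀ a, f (ofA C a) = g (ofA C a)) (hΓ : ∀ γ, f (ofΓ C γ) = g (ofΓ C γ)) : f = g :=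
  RingQuot.ringQuot_ext' k _ _ (TensorAlgebra.hom_ext
    (LinearMap.prod_ext (LinearMap.ext hA) (LinearMap.ext hΓ)))

variable {C} in
theorem induction {p : Submodule k C.Ext} (one : 1 ∈ p) (hA : ∀ a, ∀ x ∈ p, ofA C a * x ∈ p)
    (hΓ : ∀ γ, ∀ x ∈ p, ofΓ C γ * x ∈ p) (x : C.Ext) : x ∈ p := by
  obtain ⟨x, rfl⟩ := RingQuot.mkAlgHom_surjective k C.ExtRel x
  suffices h : ∀ y ∈ p, RingQuot.mkAlgHom k C.ExtRel x * y ∈ p by simpa using h 1 one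
  induction x using TensorAlgebra.induction with
  | algebraMap r =>
    intro y hy
    rw [AlgHom.commutes, ← Algebra.smul_def]
    exact p.smul_mem r hy
  | ι z =>
    intro y hy
    have h : RingQuot.mkAlgHom k C.ExtRel (TensorAlgebra.ι k z) = ofA C z.1 + ofΓ C z.2 := by
      rw [ofA, ofΓ, LinearMap.comp_apply, LinearMap.comp_apply, LinearMap.comp_apply,
        LinearMap.comp_apply, ← map_add, ← map_add]
      simp
    rw [h, add_mul]
    exact p.add_mem (hA _ _ hy) (hΓ _ _ hy)
  | mul x z hx hz => exact fun y hy => by rw [map_mul, mul_assoc]; exact hx _ (hz _ hy)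
  | add x z hx hz => exact fun y hy => by rw [map_add, add_mul]; exact p.add_mem (hx _ hy) (hz _ hy)

theorem ofA_mem_deg (a : A) : ofA C a ∈ deg C 0 := by
  rw [deg, pow_zero, mul_one]
  exact ⟨a, rfl⟩

theorem ofΓ_mem_deg (γ : Γ) : ofΓ C γ ∈ deg C 1 := by
  rw [deg, pow_one, ← one_mul (ofΓ C γ), ← ofA_one]
  exact Submodule.mul_mem_mul ⟨1, rfl⟩ ⟨γ, rfl⟩

variable {C} in
theorem exteriorDerivative_unique (hC : C.IsBicovariant) {δ δ' : C.Ext →ₗ[k] C.Ext}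
    (h : C.IsExteriorDerivative δ) (h' : C.IsExteriorDerivative δ') : δ' = δ := by
  have hΓ : ∀ γ, δ' (ofΓ C γ) = δ (ofΓ C γ) := by
    intro γ
    obtain ⟨z, rfl⟩ : γ ∈ LinearMap.range (C.lact ∘ₗ C.d.lTensor A) := by
      rw [hC.span]
      trivial
    induction z with
    | zero => simp
    | tmul a b =>
      rw [LinearMap.comp_apply, LinearMap.lTensor_tmul, ofΓ_lact, h.leibniz 0 _ (ofA_mem_deg C a),
        h'.leibniz 0 _ (ofA_mem_deg C a), h.ofA, h'.ofA, ← h.ofA b, h.sq, h.ofA, ← h'.ofA b, h'.sq]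
    | add s t hs ht => simp only [map_add, hs, ht]
  refine LinearMap.ext fun x => LinearMap.mem_eqLocus.1
    (induction (p := LinearMap.eqLocus δ' δ) ?_ (fun a x hx => ?_) (fun γ x hx => ?_) x)
  · rw [LinearMap.mem_eqLocus, ← ofA_one, h.ofA, h'.ofA]
  · rw [LinearMap.mem_eqLocus] at hx ⊢
    rw [h.leibniz 0 _ (ofA_mem_deg C a), h'.leibniz 0 _ (ofA_mem_deg C a), h.ofA, h'.ofA, hx]
  · rw [LinearMap.mem_eqLocus] at hx ⊢
    rw [h.leibniz 1 _ (ofΓ_mem_deg C γ), h'.leibniz 1 _ (ofΓ_mem_deg C γ), hΓ, hx]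

end CalculusData.Ext

section Comparison

open WithConv CalculusData

variable {k : Type u} {A : Type v} [Field k] [Ring A] [HopfAlgebra k A]
variable {V : Type w} [AddCommGroup V] [Module k V] {X : CrossedData k A V}
variable {ϖ : Aug k A →ₗ[k] V} {Γ : Type x} [AddCommGroup Γ] [Module k Γ]
variable (ρ : Γ ≃ₗ[k] A ⊗[k] V) (hX : X.IsCrossedModule)
variable (G : Generated X (BMinus (X.braiding X)) (BMinus.ι (X.braiding X)))
variable (hC : (modelCalculus X ϖ ρ).IsBicovariant)

/-- The map from the exterior algebra to the bosonisation. -/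
def extToBoson : (modelCalculus X ϖ ρ).Ext →ₐ[k] Boson G hX :=
  RingQuot.liftAlgHom k ⟨TensorAlgebra.lift k
    ((Boson.ofA G hX).toLinearMap.coprod (toBoson X ρ G hX)), fun x y h => by
      cases h with
      | one => simp
      | mul a b => simp
      | lact a γ => simp [toBoson_lact]
      | ract γ a => simp [toBoson_ract]
      | antisymm n x hx =>
        rw [antisymmetriser_mem_balanced_iff ϖ ρ hX hC G] at hx
        have h := tensorProd_map ((Boson.ofA G hX).toLinearMap.coprod (toBoson X ρ G hX))
          (LinearMap.inr k A Γ) n x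
        rw [LinearMap.coprod_inr, hx] at h
        exact h.trans (map_zero _).symm⟩

theorem extToBoson_ofA (a : A) : extToBoson ρ hX G hC (Ext.ofA _ a) = Boson.ofA G hX a := by
  simp [extToBoson, Ext.ofA]

theorem extToBoson_ofΓ (γ : Γ) : extToBoson ρ hX G hC (Ext.ofΓ _ γ) = toBoson X ρ G hX γ := by
  simp [extToBoson, Ext.ofΓ]

theorem ofTensors_eq_zero_iff_tensorProd (hC : (modelCalculus X ϖ ρ).IsBicovariant) (n : ℕ)
    (x : ⨂[k]^n Γ) :
    Ext.ofTensors (modelCalculus X ϖ ρ) n x = 0 ↔ tensorProd (toBoson X ρ G hX) n x = 0 := by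
  refine ⟨fun h => ?_, fun h => ?_⟩
  · have h1 : (extToBoson ρ hX G hC).toLinearMap ∘ₗ Ext.ofΓ _ = toBoson X ρ G hX :=
      LinearMap.ext (extToBoson_ofΓ ρ hX G hC)
    rw [← h1, ← map_tensorProd, ← Ext.ofTensors_eq, h, map_zero]
  · exact (RingQuot.mkAlgHom_rel k (ExtRel.antisymm n x
      ((antisymmetriser_mem_balanced_iff ϖ ρ hX hC G n x).2 h))).trans (map_zero _)

/-- The left-invariant forms. -/
def invariantForms : BMinus (X.braiding X) →ₐ[k] (modelCalculus X ϖ ρ).Ext :=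
  RingQuot.liftAlgHom k ⟨TensorAlgebra.lift k
    (Ext.ofΓ _ ∘ₗ ρ.symm.toLinearMap ∘ₗ TensorProduct.mk k A V 1), fun x y h => by
      obtain ⟨n, x, hx⟩ := h
      refine Eq.trans ?_ (map_zero _).symm
      refine (tensorProd_map (Ext.ofΓ _) _ n x).symm.trans ?_
      rw [← Ext.ofTensors_eq, ofTensors_eq_zero_iff_tensorProd ρ hX G hC, tensorProd_map]
      have h1 : toBoson X ρ G hX ∘ₗ ρ.symm.toLinearMap ∘ₗ TensorProduct.mk k A V 1 =
          (Boson.ofL G hX).toLinearMap ∘ₗ BMinus.ι (X.braiding X) :=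
        LinearMap.ext fun v => by simp [toBoson_symm]
      rw [h1, ← map_tensorProd, (tensorProd_BMinus_eq_zero_iff hX n x).2 hx, map_zero]⟩

theorem invariantForms_ι (v : V) : invariantForms ρ hX G hC (BMinus.ι _ v) =
    Ext.ofΓ _ (ρ.symm (1 ⊗ₜ v)) := by
  simp [invariantForms, BMinus.ι, BMinus.mk]

/-- The map from the bosonisation to the exterior algebra. -/
def bosonToExt : Boson G hX →ₐ[k] (modelCalculus X ϖ ρ).Ext :=
  Boson.lift (Ext.algOfA _) (invariantForms ρ hX G hC) <|
    Boson.lift_condition _ _ fun v => Conv.ext' fun b => by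
      have h := Ext.ofΓ_ract (modelCalculus X ϖ ρ) (ρ.symm (1 ⊗ₜ v)) b
      rw [modelCalculus_ract_symm] at h
      rw [Conv.const_mul_apply, invariantForms_ι]
      refine h.symm.trans ?_
      rw [LinearMap.convMul_apply]
      generalize Coalgebra.comul (R := k) b = s
      induction s with
      | zero => simp
      | tmul b c =>
        have h1 := Ext.ofΓ_lact (modelCalculus X ϖ ρ) b (ρ.symm (1 ⊗ₜ X.act (v ⊗ₜ c)))
        rw [modelCalculus_lact, mul_one] at h1
        simp [G.β_gen, invariantForms_ι, h1, Ext.algOfA]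
      | add s t hs ht => simp only [map_add, hs, ht]

theorem bosonToExt_mul (a : A) (x : BMinus (X.braiding X)) :
    bosonToExt ρ hX G hC (Boson.ofA G hX a * Boson.ofL G hX x) =
      Ext.ofA _ a * invariantForms ρ hX G hC x := by
  rw [Boson.ofA_mul_ofL]
  exact Boson.lift_equiv_tmul _ _ _ a x

theorem bosonToExt_toBoson (γ : Γ) : bosonToExt ρ hX G hC (toBoson X ρ G hX γ) = Ext.ofΓ _ γ := by
  obtain ⟨γ, rfl⟩ := ρ.symm.surjective γ
  induction γ with
  | zero => simp
  | tmul a v =>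
    rw [toBoson_symm, bosonToExt_mul, invariantForms_ι, ← Ext.ofΓ_lact, modelCalculus_lact, mul_one]
  | add s t hs ht => simp only [map_add, hs, ht]

/-- The exterior algebra is the bosonisation. -/
def extEquiv : (modelCalculus X ϖ ρ).Ext ≃ₐ[k] Boson G hX :=
  AlgEquiv.ofAlgHom (extToBoson ρ hX G hC) (bosonToExt ρ hX G hC)
    (Boson.algHom_ext
      (fun a => by
        have h := bosonToExt_mul ρ hX G hC a 1
        rw [map_one, map_one, mul_one, mul_one] at h
        rw [AlgHom.comp_apply, h, extToBoson_ofA, AlgHom.id_apply])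
      fun v => by
        have h := bosonToExt_mul ρ hX G hC 1 (BMinus.ι _ v)
        rw [map_one, Ext.ofA_one, one_mul, one_mul] at h
        rw [AlgHom.comp_apply, h, invariantForms_ι, extToBoson_ofΓ, toBoson_symm, map_one, one_mul,
          AlgHom.id_apply])
    (Ext.algHom_ext
      (fun a => by
        have h := bosonToExt_mul ρ hX G hC a 1
        rw [map_one, map_one, mul_one, mul_one] at h
        rw [AlgHom.comp_apply, extToBoson_ofA, h, AlgHom.id_apply])
      fun γ => by
        rw [AlgHom.comp_apply, extToBoson_ofΓ, bosonToExt_toBoson, AlgHom.id_apply])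

theorem extEquiv_ofA (a : A) : extEquiv ρ hX G hC (Ext.ofA _ a) = Boson.ofA G hX a :=
  extToBoson_ofA ρ hX G hC a

theorem extEquiv_ofΓ (γ : Γ) : extEquiv ρ hX G hC (Ext.ofΓ _ γ) = toBoson X ρ G hX γ :=
  extToBoson_ofΓ ρ hX G hC γ

theorem extEquiv_symm_mem {n : ℕ} {z : Boson G hX} (hz : z ∈ Boson.deg G hX n) :
    (extEquiv ρ hX G hC).symm z ∈ Ext.deg (modelCalculus X ϖ ρ) n := by
  have h : gradedPart (BMinus.ι (X.braiding X)) n ≤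
      (LinearMap.range (Ext.ofΓ (modelCalculus X ϖ ρ)) ^ n).comap
        (invariantForms ρ hX G hC).toLinearMap := by
    rw [← Submodule.map_le_iff_le_comap, gradedPart, Submodule.map_pow]
    refine pow_le_pow_left' ?_ n
    rintro _ ⟨_, ⟨v, rfl⟩, rfl⟩
    exact ⟨_, (invariantForms_ι ρ hX G hC v).symm⟩
  have h' : Boson.deg G hX n ≤ (Ext.deg (modelCalculus X ϖ ρ) n).comap
      (bosonToExt ρ hX G hC).toLinearMap := Boson.deg_le fun a x hx => by
    rw [Submodule.mem_comap, AlgHom.toLinearMap_apply, bosonToExt_mul]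
    exact Submodule.mul_mem_mul ⟨a, rfl⟩ (h hx)
  exact h' hz

theorem extEquiv_mem {n : ℕ} {x : (modelCalculus X ϖ ρ).Ext} (hx : x ∈ Ext.deg _ n) :
    extEquiv ρ hX G hC x ∈ Boson.deg G hX n := by
  have hA : ∀ a, Boson.ofA G hX a ∈ Boson.deg G hX 0 := fun a => by
    simpa using Boson.mem_deg (G := G) (hX := hX) a (n := 0) (x := 1)
      (by rw [gradedPart, pow_zero]; exact Submodule.one_le.1 le_rfl)
  have hΓ : ∀ γ, toBoson X ρ G hX γ ∈ Boson.deg G hX 1 := by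
    intro γ
    obtain ⟨γ, rfl⟩ := ρ.symm.surjective γ
    induction γ with
    | zero => simp
    | tmul a v =>
      rw [toBoson_symm]
      exact Boson.mem_deg a (by rw [gradedPart, pow_one]; exact ⟨v, rfl⟩)
    | add s t hs ht => rw [map_add, map_add]; exact Submodule.add_mem _ hs ht
  have h : LinearMap.range (Ext.ofΓ (modelCalculus X ϖ ρ)) ^ n ≤
      (Boson.deg G hX n).comap (extEquiv ρ hX G hC).toLinearMap := by
    clear hx
    induction n with
    | zero =>
      rw [pow_zero, Submodule.one_le]
      simpa using hA 1
    | succ n ih =>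
      rw [pow_succ, Submodule.mul_le]
      rintro y hy _ ⟨γ, rfl⟩
      have h1 := Boson.mul_mem_deg (ih hy) (hΓ γ)
      rw [← extEquiv_ofΓ ρ hX G hC] at h1
      simpa using h1
  have h' : Ext.deg _ n ≤ (Boson.deg G hX n).comap (extEquiv ρ hX G hC).toLinearMap := by
    refine Submodule.mul_le.2 ?_
    rintro _ ⟨a, rfl⟩ y hy
    have h1 := Boson.ofA_mul_mem a (h hy)
    rw [← extEquiv_ofA ρ hX G hC] at h1
    simpa using h1
  exact h' hx

theorem isExteriorDerivative (hϖ : (CrossedData.aug k A).IsMorphism X ϖ)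
    (hsurj : Function.Surjective ϖ) {d : BMinus (X.braiding X) →ₗ[k] BMinus (X.braiding X)}
    (hd : Generated.IsExterior (j := BMinus.ι (X.braiding X)) ϖ d) :
    (modelCalculus X ϖ ρ).IsExteriorDerivative
      ((extEquiv ρ hX G hC).symm.toLinearMap ∘ₗ Boson.diff G hX ϖ d ∘ₗ
        (extEquiv ρ hX G hC).toLinearMap) where
  degree n x hx :=
    extEquiv_symm_mem ρ hX G hC (Boson.diff_mem_deg hsurj hd hϖ (extEquiv_mem ρ hX G hC hx))
  ofA a := (extEquiv ρ hX G hC).symm_apply_eq.2 <| by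
    rw [LinearMap.comp_apply, AlgEquiv.toLinearMap_apply, extEquiv_ofA, extEquiv_ofΓ,
      toBoson_d X ρ hd]
  leibniz n x hx y := by
    simp only [LinearMap.comp_apply, AlgEquiv.toLinearMap_apply, map_mul,
      Boson.diff_mul hϖ hsurj hd, map_add, AlgEquiv.symm_apply_apply,
      Boson.parity_of_mem (extEquiv_mem ρ hX G hC hx), map_smul, smul_mul_assoc]
  sq x := by
    simp [Boson.diff_diff hsurj hd]

/-- The left coaction on the exterior algebra. -/
def extCoactLeft : (modelCalculus X ϖ ρ).Ext →ₐ[k] A ⊗[k] (modelCalculus X ϖ ρ).Ext :=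
  ((Algebra.TensorProduct.map (AlgHom.id k A) (extEquiv ρ hX G hC).symm.toAlgHom).comp
    (Boson.coactLeft G hX)).comp (extEquiv ρ hX G hC).toAlgHom

/-- The right coaction on the exterior algebra. -/
def extCoactRight : (modelCalculus X ϖ ρ).Ext →ₐ[k] (modelCalculus X ϖ ρ).Ext ⊗[k] A :=
  ((Algebra.TensorProduct.map (extEquiv ρ hX G hC).symm.toAlgHom (AlgHom.id k A)).comp
    (Boson.coactRight G hX)).comp (extEquiv ρ hX G hC).toAlgHom

theorem extCoactLeft_apply (x : (modelCalculus X ϖ ρ).Ext) : extCoactLeft ρ hX G hC x =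
    (extEquiv ρ hX G hC).symm.toLinearMap.lTensor A
      (Boson.coactLeft G hX (extEquiv ρ hX G hC x)) := rfl

theorem extCoactRight_apply (x : (modelCalculus X ϖ ρ).Ext) : extCoactRight ρ hX G hC x =
    (extEquiv ρ hX G hC).symm.toLinearMap.rTensor A
      (Boson.coactRight G hX (extEquiv ρ hX G hC x)) := rfl

theorem isLeftCoaction : (modelCalculus X ϖ ρ).IsLeftCoaction (extCoactLeft ρ hX G hC) where
  ofA a := by
    rw [extCoactLeft_apply, extEquiv_ofA, Boson.coactLeft_ofA]
    generalize Coalgebra.comul (R := k) a = s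
    induction s with
    | zero => simp
    | tmul a b => simp [← extEquiv_ofA ρ hX G hC]
    | add s t hs ht => simp only [map_add, hs, ht]
  ofΓ γ := by
    rw [extCoactLeft_apply, extEquiv_ofΓ, ← toBoson_coL X ϖ]
    generalize (modelCalculus X ϖ ρ).coL γ = s
    induction s with
    | zero => simp
    | tmul a b => simp [← extEquiv_ofΓ ρ hX G hC]
    | add s t hs ht => simp only [map_add, hs, ht]

theorem isRightCoaction : (modelCalculus X ϖ ρ).IsRightCoaction (extCoactRight ρ hX G hC) where
  ofA a := by
    rw [extCoactRight_apply, extEquiv_ofA, Boson.coactRight_ofA]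
    generalize Coalgebra.comul (R := k) a = s
    induction s with
    | zero => simp
    | tmul a b => simp [← extEquiv_ofA ρ hX G hC]
    | add s t hs ht => simp only [map_add, hs, ht]
  ofΓ γ := by
    rw [extCoactRight_apply, extEquiv_ofΓ, ← toBoson_coR X ϖ]
    generalize (modelCalculus X ϖ ρ).coR γ = s
    induction s with
    | zero => simp
    | tmul a b => simp [← extEquiv_ofΓ ρ hX G hC]
    | add s t hs ht => simp only [map_add, hs, ht]

/-- The isomorphism of the bosonisation with the exterior algebra. -/
def extIso : A ⊗[k] BMinus (X.braiding X) ≃ₗ[k] (modelCalculus X ϖ ρ).Ext :=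
  (Boson.equiv G hX).trans (extEquiv ρ hX G hC).symm.toLinearEquiv

theorem extIso_apply (z : A ⊗[k] BMinus (X.braiding X)) :
    extIso ρ hX G hC z = (extEquiv ρ hX G hC).symm (Boson.equiv G hX z) := rfl

variable {Δ : BMinus (X.braiding X) →ₗ[k] BMinus (X.braiding X) ⊗[k] BMinus (X.braiding X)}
variable (S d : BMinus (X.braiding X) →ₗ[k] BMinus (X.braiding X))

theorem extIso_bosonMul (z w : A ⊗[k] BMinus (X.braiding X)) :
    extIso ρ hX G hC ((G.data Δ S d).bosonMul (z ⊗ₜ w)) =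
      extIso ρ hX G hC z * extIso ρ hX G hC w := by
  rw [Generated.bosonMul_eq, extIso_apply, ← Boson.equiv_mul_equiv, map_mul]
  rfl

theorem extIso_mem_deg (n : ℕ) (a : A) {η : BMinus (X.braiding X)}
    (hη : η ∈ gradedPart (BMinus.ι (X.braiding X)) n) :
    extIso ρ hX G hC (a ⊗ₜ η) ∈ Ext.deg (modelCalculus X ϖ ρ) n := by
  rw [extIso_apply, ← Boson.ofA_mul_ofL]
  exact extEquiv_symm_mem ρ hX G hC (Boson.mem_deg a hη)

theorem extIso_bosonD (z : A ⊗[k] BMinus (X.braiding X)) :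
    extIso ρ hX G hC ((G.data Δ S d).bosonD ϖ (BMinus.ι (X.braiding X)) z) =
      ((extEquiv ρ hX G hC).symm.toLinearMap ∘ₗ Boson.diff G hX ϖ d ∘ₗ
        (extEquiv ρ hX G hC).toLinearMap) (extIso ρ hX G hC z) := by
  rw [Generated.bosonD_eq, LinearMap.comp_apply, LinearMap.comp_apply, extIso_apply, extIso_apply,
    AlgEquiv.toLinearMap_apply, AlgEquiv.toLinearMap_apply, AlgEquiv.apply_symm_apply,
    Boson.diff_equiv]

theorem extCoactLeft_extIso (h : G.IsCoproduct Δ) (z : A ⊗[k] BMinus (X.braiding X)) :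
    extCoactLeft ρ hX G hC (extIso ρ hX G hC z) =
      (extIso ρ hX G hC).toLinearMap.lTensor A ((G.data Δ S d).bosonCoactLeft z) := by
  rw [extCoactLeft_apply, extIso_apply, AlgEquiv.apply_symm_apply, h.bosonCoactLeft_eq hX S d,
    ← LinearMap.lTensor_comp_apply]
  rfl

theorem extCoactRight_extIso (h : G.IsCoproduct Δ) (z : A ⊗[k] BMinus (X.braiding X)) :
    extCoactRight ρ hX G hC (extIso ρ hX G hC z) =
      (extIso ρ hX G hC).toLinearMap.rTensor A ((G.data Δ S d).bosonCoactRight z) := by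
  rw [extCoactRight_apply, extIso_apply, AlgEquiv.apply_symm_apply, h.bosonCoactRight_eq hX S d,
    ← LinearMap.rTensor_comp_apply]
  rfl

end Comparison

end BraidedExterior

end

open BraidedExterior in
theorem proposition2p6 {k : Type*} {A : Type*} {V : Type*} [Field k] [Ring A] [HopfAlgebra k A]
    (hS : Function.Bijective (HopfAlgebra.antipode k (A := A)))
    [AddCommGroup V] [Module k V]
    (X : CrossedData k A V) (hX : X.IsCrossedModule)
    (ϖ : Aug k A →ₗ[k] V) (hϖ : (CrossedData.aug k A).IsMorphism X ϖ)
    (hsurj : Function.Surjective ϖ) :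
    -- in each degree the relations of `Λ_min = B₋(V)` are the kernel of the braided factorial
    (∀ (n : ℕ) (x : ⨂[k]^n V),
      BMinus.mk (X.braiding X) (TensorPower.toTensorAlgebra x) = 0 ↔
        braidedFactorial (-(X.braiding X)) n x = 0) ∧
    -- the structures on `Λ_max` and on `Λ_min`
    ∃ (Dmax : SuperBraidedData k A (LambdaMax ϖ))
      (Dmin : SuperBraidedData k A (BMinus (X.braiding X))),
      Dmax.IsSuperBraidedHopf X (LambdaMax.ι ϖ) ∧
      Dmax.IsDifferential ϖ (LambdaMax.ι ϖ) ∧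
      Dmin.IsSuperBraidedHopf X (BMinus.ι (X.braiding X)) ∧
      Dmin.IsDifferential ϖ (BMinus.ι (X.braiding X)) ∧
      -- `Λ_min` is a quotient of `Λ_max` with the inherited structures
      (∃ q : LambdaMax ϖ →ₐ[k] BMinus (X.braiding X), Function.Surjective q ∧
        (∀ v, q (LambdaMax.ι ϖ v) = BMinus.ι (X.braiding X) v) ∧ Dmax.IsHom Dmin q) ∧
      -- the super-bosonisation of `Λ_min` is Woronowicz's bicovariant exterior algebra
      ∃ C : CalculusData k A (WorForms ϖ), IsWoronowiczCalculus ϖ C ∧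
        (∀ n i : ℕ, C.balanced n ≤ (C.balanced n).comap (braidAt C.braiding n i)) ∧
        (∀ (n : ℕ) (x : ⨂[k]^n (WorForms ϖ)), CalculusData.Ext.ofTensors C n x = 0 ↔
          antisymmetriser C.braiding n x ∈ C.balanced n) ∧
        ∃ (δ : C.Ext →ₗ[k] C.Ext) (ΦL : C.Ext →ₐ[k] A ⊗[k] C.Ext)
          (ΦR : C.Ext →ₐ[k] C.Ext ⊗[k] A),
          C.IsExteriorDerivative δ ∧ (∀ δ', C.IsExteriorDerivative δ' → δ' = δ) ∧
          C.IsLeftCoaction ΦL ∧ C.IsRightCoaction ΦR ∧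
          ∃ Θ : A ⊗[k] BMinus (X.braiding X) ≃ₗ[k] C.Ext,
            (∀ x y, Θ (Dmin.bosonMul (x ⊗ₜ y)) = Θ x * Θ y) ∧
            (∀ a, Θ (a ⊗ₜ 1) = CalculusData.Ext.ofA C a) ∧
            (∀ (n : ℕ) (a : A), ∀ η ∈ gradedPart (BMinus.ι (X.braiding X)) n,
              Θ (a ⊗ₜ η) ∈ CalculusData.Ext.deg C n) ∧
            (∀ x, Θ (Dmin.bosonD ϖ (BMinus.ι (X.braiding X)) x) = δ (Θ x)) ∧
            (∀ x, ΦL (Θ x) = Θ.toLinearMap.lTensor A (Dmin.bosonCoactLeft x)) ∧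
            (∀ x, ΦR (Θ x) = Θ.toLinearMap.rTensor A (Dmin.bosonCoactRight x)) := by
  obtain ⟨G, Δ, d, G', Δ', d', q, h, hd, h', hd', hq⟩ := exists_structures hX hϖ hsurj
  refine (h.exists_antipode hX).elim fun S hS => ?_
  refine (h'.exists_antipode hX).elim fun S' hS' => ?_
  let ρ := worEquiv ϖ hsurj
  have hC : (modelCalculus X ϖ ρ).IsBicovariant :=
    (modelCalculus_isEmbedding (G := G') (hX := hX) X ρ hϖ hsurj hd').isBicovariant
  have hδ := isExteriorDerivative ρ hX G' hC hϖ hsurj hd'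
  refine ⟨BMinus.mk_toTensorAlgebra_eq_zero hX, G.data Δ S d, G'.data Δ' S' d', ?_⟩
  refine ⟨h.isSuperBraidedHopf hX hS.1 hS.2 d, ?_⟩
  refine ⟨h.isDifferential hX hϖ hsurj hd S, ?_⟩
  refine ⟨h'.isSuperBraidedHopf hX hS'.1 hS'.2 d', ?_⟩
  refine ⟨h'.isDifferential hX hϖ hsurj hd' S', ?_⟩
  refine ⟨⟨q, hq.surjective, hq.gen, ?_⟩, ?_⟩
  · exact hq.isHom hX hsurj h h' hd hd' hS.1 hS'.2
  refine ⟨modelCalculus X ϖ ρ, isWoronowiczCalculus ϖ hϖ hsurj hC, ?_⟩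
  refine ⟨braidAt_mem_balanced ϖ ρ hX hC, ?_⟩
  refine ⟨fun n x => (ofTensors_eq_zero_iff_tensorProd ρ hX G' hC n x).trans
      (antisymmetriser_mem_balanced_iff ϖ ρ hX hC G' n x).symm, ?_⟩
  refine ⟨_, extCoactLeft ρ hX G' hC, extCoactRight ρ hX G' hC, hδ,
    fun δ' h => CalculusData.Ext.exteriorDerivative_unique hC hδ h,
    isLeftCoaction ρ hX G' hC, isRightCoaction ρ hX G' hC,
    extIso ρ hX G' hC, extIso_bosonMul ρ hX G' hC S' d',
    fun a => (extEquiv ρ hX G' hC).symm_apply_eq.2 (extEquiv_ofA ρ hX G' hC a).symm,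
    fun n a η hη => extIso_mem_deg ρ hX G' hC n a hη, extIso_bosonD ρ hX G' hC S' d',
    extCoactLeft_extIso ρ hX G' hC S' d' h', extCoactRight_extIso ρ hX G' hC S' d' h'⟩
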